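/- **Setting.** A network is a directed graph $G(V,E)$ with $N$ nodes and $M$ links (parallel links allowed); each link $e$ has a positive integer weight $w_e$ and a failure probability $p_e\in(0,1)$. Paths are simple, and the weight of a path is the sum of its link weights. Let $s\ne t$ be nodes such that $t$ is reachable from $s$, and let $B\ge 1$ be an integer. Running time is the number of steps on a random access machine with arrays of natural and of real numbers, where memory accesses, constants, additions, subtractions, comparisons and (for reals) logarithms cost one step each. **The CT-QAMSC algorithm.** *Stage 0:* find a weight-shortest path $\pi_{\min}$ from $s$ to $t$ by a shortest-path subroutine; let $k$ be its number of links. *Stage 1:* build a transformed network on the $k+1$ nodes of $\pi_{\min}$: for each link $e:u\to v$ of $\pi_{\min}$ a simple link $u\to v$ with length $-\ln(1-p_e)$ and time $2w_e$; and for each ordered pair $u\ne v$ of nodes of $\pi_{\min}$, call a subroutine for the Edge-Disjoint Shortest Pair (EDSP) problem (two edge-disjoint $u$–$v$ paths in $G$ of minimum total weight) and, if such a pair exists, add a disjoint link $u\to v$ with length $0$ and time the total weight of the pair found. *Stage 2:* by a subroutine for the Restricted Shortest Path (RSP) problem, find in the transformed network a path from $s$ to $t$ of minimum length among those of total time at most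 $B$; fail if there is none. *Stage 3:* expand the links of this path into two link sequences $(\pi_1,\pi_2)$: a simple link contributes its original link to both, a disjoint link contributes one path of its pair to each. Here a subroutine is any program that solves the problem correctly. $SP(N,M)$ and $D(N,M)$ bound the running times of the shortest-path and of the EDSP subroutine on networks with $N$ nodes and $M$ links, and $R(N,M,T)$ bounds that of the RSP subroutine on all instances (nonnegative real lengths, positive integer times, distinct end nodes, at least one link) with at most $N$ nodes, at most $M$ links and constraint $T\ge1$; in all three, the delivery of the output is charged at one step per link of the returned paths. **Theorem.** (1) There is an absolute constant $C>0$ such that, for all subroutines and all such bounds $SP,D,R$, on every input as above CT-QAMSC halts after at most $$C\,\bigl(SP(N,M)+k^2\,D(N,M)+R(k+1,\;k^2+2k,\;B)\bigr)$$ steps. Moreover, for every $L$ with $R(2a,3b,c)\le L\,R(a,b,c)$ for all integers $a,b,c\ge1$, it halts after at most $C\,(SP(N,M)+k^2 D(N,M)+L\,R(k,k^2,B))$ steps; that is, the time is $O(SP(N,M)+k^2 D(N,M)+R(k,k^2))$. (2) There are a shortest-path subroutine and an EDSP subroutine with running times $O(M+N\log N)$ and an RSP subroutine with running time $O(M\cdot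 N\cdot T)$ (that is, with respective bounds $C(M+N\log N)$, $C(M+N\log N)$ and $CMNT$ for a constant $C>0$), and with them CT-QAMSC runs in time $$O\bigl(k^2\,(M+N\log N)+k^3 B\bigr),$$ with a constant independent of the input. -/

import Mathlib

namespace CTQAMSC

/-! ### Networks and paths -/

/-- A walk from `u` to `v`, given by its list of links, in the directed (multi)graph whose links
`Fin M` have tails `src` and heads `dst`. -/
def IsWalk {N M : ℕ} (src dst : Fin M → Fin N) : Fin N → Fin N → List (Fin M) → Prop
  | u, v, [] => u = v
  | u, v, e :: π => src e = u ∧ IsWalk src dst (dst e) v π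

/-- A simple path: a walk all of whose nodes are distinct. -/
def IsSimplePath {N M : ℕ} (src dst : Fin M → Fin N) (u v : Fin N) (π : List (Fin M)) : Prop :=
  IsWalk src dst u v π ∧ (u :: π.map dst).Nodup

/-- A network: a directed graph with `N` nodes and `M` links (parallel links are allowed), each
link having a positive integer weight and a failure probability strictly between `0` and `1`. -/
structure Network where
  N : ℕ
  M : ℕ
  src : Fin M → Fin N
  dst : Fin M → Fin N
  w : Fin M → ℕ
  p : Fin M → ℝ
  w_pos : ∀ e, 0 < w e
  p_pos : ∀ e, 0 < p e
  p_lt_one : ∀ e, p e < 1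

namespace Network

/-- `P^(u,v)`. -/
def IsPath (G : Network) (u v : Fin G.N) (π : List (Fin G.M)) : Prop :=
  IsSimplePath G.src G.dst u v π

def weight (G : Network) (π : List (Fin G.M)) : ℕ := (π.map G.w).sum

/-- A weight-shortest path from `u` to `v`. -/
def IsWeightShortest (G : Network) (u v : Fin G.N) (π : List (Fin G.M)) : Prop :=
  G.IsPath u v π ∧ ∀ π', G.IsPath u v π' → G.weight π ≤ G.weight π'

/-- A pair of edge-disjoint paths from `u` to `v`. -/
def IsDisjointPair (G : Network) (u v : Fin G.N) (π₁ π₂ : List (Fin G.M)) : Prop :=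
  G.IsPath u v π₁ ∧ G.IsPath u v π₂ ∧ List.Disjoint π₁ π₂

/-- An edge-disjoint shortest pair of paths from `u` to `v`: the sum of the weights is minimum. -/
def IsShortestDisjointPair (G : Network) (u v : Fin G.N) (π₁ π₂ : List (Fin G.M)) : Prop :=
  G.IsDisjointPair u v π₁ π₂ ∧
    ∀ π₁' π₂', G.IsDisjointPair u v π₁' π₂' →
      G.weight π₁ + G.weight π₂ ≤ G.weight π₁' + G.weight π₂'

end Network

/-- An instance of the Restricted Shortest Path problem: a directed (multi)graph with link lengths
(the objective) and positive integer link times (the constraint), two distinct nodes `s` and `t`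
and a positive integer bound `T`. -/
structure RSPInstance where
  N : ℕ
  M : ℕ
  src : Fin M → Fin N
  dst : Fin M → Fin N
  len : Fin M → ℝ
  time : Fin M → ℕ
  s : Fin N
  t : Fin N
  T : ℕ
  len_nonneg : ∀ e, 0 ≤ len e
  time_pos : ∀ e, 0 < time e
  s_ne_t : s ≠ t
  M_pos : 0 < M
  T_pos : 0 < T

namespace RSPInstance

def IsFeasible (I : RSPInstance) (π : List (Fin I.M)) : Prop :=
  IsSimplePath I.src I.dst I.s I.t π ∧ (π.map I.time).sum ≤ I.T

def IsSolution (I : RSPInstance) (π : List (Fin I.M)) : Prop :=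
  I.IsFeasible π ∧ ∀ π', I.IsFeasible π' → (π.map I.len).sum ≤ (π'.map I.len).sum

end RSPInstance

/-! ### The machine: a random access machine with a step count

The memory consists of arrays of natural numbers and arrays of real numbers; cell `0` of an array
also serves as a scalar variable. Programs are finite pieces of syntax. Every operator, constant
and memory access in an expression and every command costs one step. There is no multiplication,
and real numbers cannot be converted into natural numbers. -/

structure State where
  nat : ℕ → ℕ → ℕ
  real : ℕ → ℕ → ℝ

def State.setNat (σ : State) (a i x : ℕ) : State :=
  { σ with nat := Function.update σ.nat a (Function.update (σ.nat a) i x) }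

def State.setReal (σ : State) (a i : ℕ) (x : ℝ) : State :=
  { σ with real := Function.update σ.real a (Function.update (σ.real a) i x) }

/-- Expressions with natural number values; `get a i` reads cell `i` of array `a`. -/
inductive NExp where
  | const (n : ℕ)
  | get (a : ℕ) (i : NExp)
  | plus (x y : NExp)
  | minus (x y : NExp)

def NExp.eval (σ : State) : NExp → ℕ
  | const n => n
  | get a i => σ.nat a (i.eval σ)
  | plus x y => x.eval σ + y.eval σ
  | minus x y => x.eval σ - y.eval σ

def NExp.cost : NExp → ℕ
  | const _ => 1
  | get _ i => i.cost + 1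
  | plus x y => x.cost + y.cost + 1
  | minus x y => x.cost + y.cost + 1

/-- Expressions with real values. -/
inductive RExp where
  | const (q : ℚ)
  | get (a : ℕ) (i : NExp)
  | plus (x y : RExp)
  | minus (x y : RExp)
  | ln (x : RExp)

noncomputable def RExp.eval (σ : State) : RExp → ℝ
  | const q => (q : ℝ)
  | get a i => σ.real a (i.eval σ)
  | plus x y => x.eval σ + y.eval σ
  | minus x y => x.eval σ - y.eval σ
  | ln x => Real.log (x.eval σ)

def RExp.cost : RExp → ℕ
  | const _ => 1
  | get _ i => i.cost + 1
  | plus x y => x.cost + y.cost + 1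
  | minus x y => x.cost + y.cost + 1
  | ln x => x.cost + 1

/-- Tests. -/
inductive BExp where
  | natEq (x y : NExp)
  | natLe (x y : NExp)
  | natLt (x y : NExp)
  | realLe (x y : RExp)
  | not (b : BExp)
  | and (b c : BExp)

def BExp.Holds (σ : State) : BExp → Prop
  | natEq x y => x.eval σ = y.eval σ
  | natLe x y => x.eval σ ≤ y.eval σ
  | natLt x y => x.eval σ < y.eval σ
  | realLe x y => x.eval σ ≤ y.eval σ
  | not b => ¬ b.Holds σ
  | and b c => b.Holds σ ∧ c.Holds σ

def BExp.cost : BExp → ℕ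
  | natEq x y => x.cost + y.cost + 1
  | natLe x y => x.cost + y.cost + 1
  | natLt x y => x.cost + y.cost + 1
  | realLe x y => x.cost + y.cost + 1
  | not b => b.cost + 1
  | and b c => b.cost + c.cost + 1

/-- Programs. `setNat a i x` and `setReal a i x` write the value of `x` to cell `i` of array `a`;
`loop b c` repeats `c` while `b` holds. -/
inductive Cmd where
  | skip
  | setNat (a : ℕ) (i x : NExp)
  | setReal (a : ℕ) (i : NExp) (x : RExp)
  | seq (c d : Cmd)
  | ite (b : BExp) (c d : Cmd)
  | loop (b : BExp) (c : Cmd)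

/-- `Exec c σ τ n`: started in state `σ`, the program `c` halts in state `τ` after exactly `n`
steps. -/
inductive Exec : Cmd → State → State → ℕ → Prop where
  | skip (σ : State) : Exec .skip σ σ 1
  | setNat (σ : State) (a : ℕ) (i x : NExp) :
      Exec (.setNat a i x) σ (σ.setNat a (i.eval σ) (x.eval σ)) (i.cost + x.cost + 1)
  | setReal (σ : State) (a : ℕ) (i : NExp) (x : RExp) :
      Exec (.setReal a i x) σ (σ.setReal a (i.eval σ) (x.eval σ)) (i.cost + x.cost + 1)
  | seq {c d : Cmd} {σ σ' τ : State} {m n : ℕ} :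
      Exec c σ σ' m → Exec d σ' τ n → Exec (.seq c d) σ τ (m + n)
  | ite_true {b : BExp} {c d : Cmd} {σ τ : State} {n : ℕ} :
      b.Holds σ → Exec c σ τ n → Exec (.ite b c d) σ τ (b.cost + n + 1)
  | ite_false {b : BExp} {c d : Cmd} {σ τ : State} {n : ℕ} :
      ¬ b.Holds σ → Exec d σ τ n → Exec (.ite b c d) σ τ (b.cost + n + 1)
  | loop_stop {b : BExp} {c : Cmd} {σ : State} :
      ¬ b.Holds σ → Exec (.loop b c) σ σ (b.cost + 1)
  | loop_step {b : BExp} {c : Cmd} {σ σ' τ : State} {m n : ℕ} :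
      b.Holds σ → Exec c σ σ' m → Exec (.loop b c) σ' τ n →
      Exec (.loop b c) σ τ (b.cost + m + n + 1)

/-- The scalar variable `a`. -/
def var (a : ℕ) : NExp := .get a (.const 0)

/-- Assignment to the scalar variable `a`. -/
def assign (a : ℕ) (x : NExp) : Cmd := .setNat a (.const 0) x

/-- `a := a + 1`. -/
def incr (a : ℕ) : Cmd := assign a (.plus (var a) (.const 1))

/-- Sequential execution of a list of commands. -/
def block : List Cmd → Cmd
  | [] => .skip
  | c :: cs => .seq c (block cs)

/-! ### Names of the variables and arrays

The names below `reserved` belong to the interface of the subroutines and to the main program; all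
other names can be used freely as working memory by the subroutines. -/

def reserved : ℕ := 100

/-- Input: numbers of nodes and links, tails, heads, weights, source, destination, bound. -/
def inN : ℕ := 0
def inM : ℕ := 1
def inSrc : ℕ := 2
def inDst : ℕ := 3
def inW : ℕ := 4
def inS : ℕ := 5
def inT : ℕ := 6
def inB : ℕ := 7
/-- Input (array of reals): failure probabilities. -/
def inP : ℕ := 0
/-- Output of the shortest-path subroutine: success flag, number of links, links. -/
def spFound : ℕ := 8
def spLen : ℕ := 9
def spPath : ℕ := 10
/-- Arguments and output of the EDSP subroutine: end nodes, success flag, the two paths. -/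
def edU : ℕ := 11
def edV : ℕ := 12
def edFound : ℕ := 13
def edLen₁ : ℕ := 14
def edPath₁ : ℕ := 15
def edLen₂ : ℕ := 16
def edPath₂ : ℕ := 17
/-- Arguments of the RSP subroutine: the transformed network, source, destination, bound. -/
def rN : ℕ := 18
def rM : ℕ := 19
def rSrc : ℕ := 20
def rDst : ℕ := 21
def rTime : ℕ := 22
def rS : ℕ := 23
def rT : ℕ := 24
def rBound : ℕ := 25
/-- Argument of the RSP subroutine (array of reals): lengths of the links. -/
def rLen : ℕ := 1
/-- Output of the RSP subroutine: success flag, number of links, links. -/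
def rFound : ℕ := 26
def rPathLen : ℕ := 27
def rPath : ℕ := 28
/-- Output of the main program: failure flag and the two paths of the connection. -/
def outFail : ℕ := 29
def outLen₁ : ℕ := 30
def outPath₁ : ℕ := 31
def outLen₂ : ℕ := 32
def outPath₂ : ℕ := 33
/-- Working memory of the main program: counters, the nodes of the shortest path, and for every
link of the transformed network its kind (`0` simple, `1` disjoint), the original link (if it is
simple), and the places of its two paths in the array `pool` (if it is disjoint). -/
def ci : ℕ := 34
def cj : ℕ := 35
def ch : ℕ := 36
def cq : ℕ := 37
def node : ℕ := 38
def kind : ℕ := 39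
def orig : ℕ := 40
def off₁ : ℕ := 41
def cnt₁ : ℕ := 42
def off₂ : ℕ := 43
def cnt₂ : ℕ := 44
def pool : ℕ := 45
def poolEnd : ℕ := 46
def wsum : ℕ := 47

/-- All reserved memory outside the arrays `outs` (of natural numbers) is the same in both
states. -/
def Preserves (outs : List ℕ) (σ τ : State) : Prop :=
  (∀ a < reserved, a ∉ outs → τ.nat a = σ.nat a) ∧ (∀ a < reserved, τ.real a = σ.real a)

/-- Scalar `len` and array `arr` hold the number of links and the links of `π`. -/
def PathAt {M : ℕ} (σ : State) (len arr : ℕ) (π : List (Fin M)) : Prop :=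
  σ.nat len 0 = π.length ∧ ∀ (i : ℕ) (h : i < π.length), σ.nat arr i = (π[i] : ℕ)

/-- The memory holds the network `G`, the source `s` and the destination `t`. -/
def NetworkAt (G : Network) (s t : Fin G.N) (σ : State) : Prop :=
  σ.nat inN 0 = G.N ∧ σ.nat inM 0 = G.M ∧ σ.nat inS 0 = s ∧ σ.nat inT 0 = t ∧
    ∀ e : Fin G.M, σ.nat inSrc e = G.src e ∧ σ.nat inDst e = G.dst e ∧
      σ.nat inW e = G.w e ∧ σ.real inP e = G.p e

/-- The memory holds the RSP instance `I`. -/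
def RSPAt (I : RSPInstance) (σ : State) : Prop :=
  σ.nat rN 0 = I.N ∧ σ.nat rM 0 = I.M ∧ σ.nat rS 0 = I.s ∧ σ.nat rT 0 = I.t ∧
    σ.nat rBound 0 = I.T ∧
    ∀ e : Fin I.M, σ.nat rSrc e = I.src e ∧ σ.nat rDst e = I.dst e ∧
      σ.nat rTime e = I.time e ∧ σ.real rLen e = I.len e

/-! ### What the three subroutines have to do

The delivery of the output is charged at one step per link of the paths that are returned. The
initial contents of the memory outside the input are arbitrary. -/

/-- `c` is a weight-shortest path algorithm with running time `SP(N, M)`. -/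
def IsSPAlgorithm (c : Cmd) (SP : ℕ → ℕ → ℝ) : Prop :=
  ∀ (G : Network) (s t : Fin G.N) (σ : State), s ≠ t → NetworkAt G s t σ →
    ∃ (τ : State) (n : ℕ), Exec c σ τ n ∧ Preserves [spFound, spLen, spPath] σ τ ∧
      ((τ.nat spFound 0 = 1 ∧ ∃ π, G.IsWeightShortest s t π ∧ PathAt τ spLen spPath π ∧
          (n + π.length : ℝ) ≤ SP G.N G.M) ∨
        (τ.nat spFound 0 = 0 ∧ (¬ ∃ π, G.IsPath s t π) ∧ (n : ℝ) ≤ SP G.N G.M))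

/-- `c` is an algorithm with running time `D(N, M)` for the Edge-Disjoint Shortest Pair problem. -/
def IsEDSPAlgorithm (c : Cmd) (D : ℕ → ℕ → ℝ) : Prop :=
  ∀ (G : Network) (s t u v : Fin G.N) (σ : State), u ≠ v → NetworkAt G s t σ →
    σ.nat edU 0 = u → σ.nat edV 0 = v →
    ∃ (τ : State) (n : ℕ), Exec c σ τ n ∧
      Preserves [edFound, edLen₁, edPath₁, edLen₂, edPath₂] σ τ ∧
      ((τ.nat edFound 0 = 1 ∧ ∃ π₁ π₂, G.IsShortestDisjointPair u v π₁ π₂ ∧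
          PathAt τ edLen₁ edPath₁ π₁ ∧ PathAt τ edLen₂ edPath₂ π₂ ∧
          (n + π₁.length + π₂.length : ℝ) ≤ D G.N G.M) ∨
        (τ.nat edFound 0 = 0 ∧ (¬ ∃ π₁ π₂, G.IsDisjointPair u v π₁ π₂) ∧
          (n : ℝ) ≤ D G.N G.M))

/-- `c` is an algorithm for the Restricted Shortest Path problem whose running time on all instances
with at most `N` nodes, at most `M` links and bound `T` is at most `R(N, M, T)`. -/
def IsRSPAlgorithm (c : Cmd) (R : ℕ → ℕ → ℕ → ℝ) : Prop :=
  ∀ (I : RSPInstance) (N M : ℕ) (σ : State), I.N ≤ N → I.M ≤ M → RSPAt I σ →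
    ∃ (τ : State) (n : ℕ), Exec c σ τ n ∧ Preserves [rFound, rPathLen, rPath] σ τ ∧
      ((τ.nat rFound 0 = 1 ∧ ∃ π, I.IsSolution π ∧ PathAt τ rPathLen rPath π ∧
          (n + π.length : ℝ) ≤ R N M I.T) ∨
        (τ.nat rFound 0 = 0 ∧ (¬ ∃ π, I.IsFeasible π) ∧ (n : ℝ) ≤ R N M I.T))

/-! ### The CT-QAMSC algorithm -/

/-- Append the path stored in `(len, arr)` to `pool`, adding the weights of its links to `wsum`. -/
def storePath (len arr : ℕ) : Cmd :=
  block [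
    assign ch (.const 0),
    .loop (.natLt (var ch) (var len)) (block [
      assign wsum (.plus (var wsum) (.get inW (.get arr (var ch)))),
      .setNat pool (var poolEnd) (.get arr (var ch)),
      incr poolEnd,
      incr ch])]

/-- Append to the output path `(len, arr)` the first (second) path of the disjoint link `cq`, whose
place in `pool` is given by `off` and `cnt`. -/
def appendPath (off cnt len arr : ℕ) : Cmd :=
  block [
    assign ch (.const 0),
    .loop (.natLt (var ch) (.get cnt (var cq))) (block [
      .setNat arr (var len) (.get pool (.plus (.get off (var cq)) (var ch))),
      incr len,
      incr ch])]

/-- Step 1.1: the nodes of the transformed network are the positions `0, …, k` on the path found in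
Stage 0; `node` lists the corresponding original nodes. -/
def step11 : Cmd :=
  block [
    .setNat node (.const 0) (var inS),
    assign ci (.const 0),
    .loop (.natLt (var ci) (var spLen)) (block [
      .setNat node (.plus (var ci) (.const 1)) (.get inDst (.get spPath (var ci))),
      incr ci]),
    assign rN (.plus (var spLen) (.const 1)),
    assign rM (.const 0),
    assign poolEnd (.const 0)]

/-- Step 1.2: a simple link for every link `e` of the path, with time `2 w_e` and length
`-ln (1 - p_e)`. -/
def step12 : Cmd :=
  block [
    assign ci (.const 0),
    .loop (.natLt (var ci) (var spLen)) (block [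
      assign cq (.get spPath (var ci)),
      .setNat rSrc (var rM) (var ci),
      .setNat rDst (var rM) (.plus (var ci) (.const 1)),
      .setNat rTime (var rM) (.plus (.get inW (var cq)) (.get inW (var cq))),
      .setReal rLen (var rM)
        (.minus (.const 0) (.ln (.minus (.const 1) (.get inP (var cq))))),
      .setNat kind (var rM) (.const 0),
      .setNat orig (var rM) (var cq),
      incr rM,
      incr ci])]

/-- Step 1.3: for every ordered pair of distinct nodes of the path, a disjoint link if the two nodes
are joined by a pair of edge-disjoint paths; its time is the weight of a shortest such pair and its
length is `0`. -/
def step13 (edsp : Cmd) : Cmd :=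
  block [
    assign ci (.const 0),
    .loop (.natLe (var ci) (var spLen)) (block [
      assign cj (.const 0),
      .loop (.natLe (var cj) (var spLen)) (block [
        .ite (.natEq (var ci) (var cj)) .skip (block [
          assign edU (.get node (var ci)),
          assign edV (.get node (var cj)),
          edsp,
          .ite (.natEq (var edFound) (.const 1)) (block [
            .setNat rSrc (var rM) (var ci),
            .setNat rDst (var rM) (var cj),
            .setReal rLen (var rM) (.const 0),
            .setNat kind (var rM) (.const 1),
            assign wsum (.const 0),
            .setNat off₁ (var rM) (var poolEnd),
            .setNat cnt₁ (var rM) (var edLen₁),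
            storePath edLen₁ edPath₁,
            .setNat off₂ (var rM) (var poolEnd),
            .setNat cnt₂ (var rM) (var edLen₂),
            storePath edLen₂ edPath₂,
            .setNat rTime (var rM) (var wsum),
            incr rM]) .skip]),
        incr cj]),
      incr ci])]

/-- Stage 3: expand the links of the RSP solution into the two paths of the connection. -/
def stage3 : Cmd :=
  block [
    assign outLen₁ (.const 0),
    assign outLen₂ (.const 0),
    assign ci (.const 0),
    .loop (.natLt (var ci) (var rPathLen)) (block [
      assign cq (.get rPath (var ci)),
      .ite (.natEq (.get kind (var cq)) (.const 0))
        (block [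
          .setNat outPath₁ (var outLen₁) (.get orig (var cq)),
          incr outLen₁,
          .setNat outPath₂ (var outLen₂) (.get orig (var cq)),
          incr outLen₂])
        (block [
          appendPath off₁ cnt₁ outLen₁ outPath₁,
          appendPath off₂ cnt₂ outLen₂ outPath₂]),
      incr ci])]

/-- The CT-QAMSC algorithm, which employs the subroutines `sp` (Stage 0), `edsp` (Stage 1) and `rsp`
(Stage 2). -/
def ctqamsc (sp edsp rsp : Cmd) : Cmd :=
  block [
    assign outFail (.const 0),
    sp,
    .ite (.natEq (var spFound) (.const 1))
      (block [
        step11,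
        step12,
        step13 edsp,
        assign rS (.const 0),
        assign rT (var spLen),
        assign rBound (var inB),
        rsp,
        .ite (.natEq (var rFound) (.const 1)) stage3 (assign outFail (.const 1))])
      (assign outFail (.const 1))]

/-- The input of CT-QAMSC is in memory: the network, the end nodes, and the weight constraint. -/
def InputAt (G : Network) (s t : Fin G.N) (B : ℕ) (σ : State) : Prop :=
  NetworkAt G s t σ ∧ σ.nat inB 0 = B

end CTQAMSC

open CTQAMSC

set_option linter.unusedSimpArgs false
set_option linter.unnecessarySeqFocus false

namespace CTQAMSC

attribute [local simp] inN inM inSrc inDst inW inS inT inB inP spFound spLen spPath edU edV edFound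
  edLen₁ edPath₁ edLen₂ edPath₂ rN rM rSrc rDst rTime rS rT rBound rLen rFound rPathLen rPath
  outFail outLen₁ outPath₁ outLen₂ outPath₂ ci cj ch cq node kind orig off₁ cnt₁ off₂ cnt₂ pool
  poolEnd wsum

/-! ### Determinism and frames -/

/-! The theorem has two layers: a cost analysis of the main program for arbitrary subroutines, and
three concrete subroutines with proofs of correctness and of running time. Both use a calculus of
time credits: `Runs c σ k Q` says that `k` credits suffice to run `c`, and `Q` sees the credits that
remain. Straight-line code is evaluated by `Cmd.run`; loops are handled by `Runs.loop`, whose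
invariant may mention the credits, so that amortized arguments fit in.

Part (1). Stage 0 costs `SP`. Stage 1 calls EDSP for `k(k+1)` ordered pairs; a call and the delivery
of its pair cost at most `D`, so the pair has at most `D` links and storing it costs `O(D)`. The
transformed network has `k+1` nodes and at most `k + k(k+1) = k² + 2k` links, which gives the term
in `R`. The RSP solution is simple, hence has at most `k` links, each expanding to at most `D` links
in total or to one link on either side, so Stage 3 costs `O(kD)`. As `k ≥ 1` and `D ≥ 1`, all
overheads are absorbed by `k²D` (`ctqamsc_exec`). The form with `L` follows from `k+1 ≤ 2k` and
`k²+2k ≤ 3k²` (`ctqamsc_bounds`).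

Part (2), RSP. A dynamic program over the time budgets `0, …, T` relaxes every link once per budget.
`table_opt` gives optimality, and `table_path` shows that tracing back yields a simple path although
lengths may be zero.

Part (2), shortest paths. Dijkstra's algorithm is run with a hollow heap. Decreasing a key creates a
new node and leaves the old one hollow with its two first children; two children of consecutive top
ranks are enough for tree sizes exponential in the rank (`Forest.two_pow_le`). A potential pays for
all restructuring (`hpStep_run`), so an insertion or a decrease costs `O(1)` (`RootHeap.push`) and a
deletion `O(log M)` amortized (`runs_hpMin`, `RootHeap.extract`). Since `N log M` is at most `N log
N` plus a term linear in `M` (`size_bound`), the total is `O(M + N log N)`.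

Part (2), EDSP. Suurballe's method: after one run of Dijkstra's algorithm the shortest path is
reversed and the weights are reduced by the distances; a second run in this residual graph gives a
path, and the symmetric difference of both link sets is decomposed into two walks. Optimality is
weak duality with the sum of both distance functions as dual solution (`add_sub_le_sum_of_disjoint`,
`two_mul_dist_add_le`). Since weights are positive, walks of minimum total weight are automatically
simple paths. -/

theorem Exec.det {c : Cmd} {σ τ : State} {n : ℕ} (h : Exec c σ τ n) :
    ∀ {τ' : State} {n' : ℕ}, Exec c σ τ' n' → τ = τ' ∧ n = n' := by
  induction h with
  | skip => intro _ _ h'; cases h'; exact ⟨rfl, rfl⟩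
  | setNat => intro _ _ h'; cases h'; exact ⟨rfl, rfl⟩
  | setReal => intro _ _ h'; cases h'; exact ⟨rfl, rfl⟩
  | seq _ _ ih₁ ih₂ =>
    intro _ _ h'
    cases h' with
    | seq h₁ h₂ =>
      obtain ⟨rfl, rfl⟩ := ih₁ h₁
      obtain ⟨rfl, rfl⟩ := ih₂ h₂
      exact ⟨rfl, rfl⟩
  | ite_true hb _ ih =>
    intro _ _ h'
    cases h' with
    | ite_true _ h => obtain ⟨rfl, rfl⟩ := ih h; exact ⟨rfl, rfl⟩
    | ite_false hb' _ => exact absurd hb hb'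
  | ite_false hb _ ih =>
    intro _ _ h'
    cases h' with
    | ite_true hb' _ => exact absurd hb' hb
    | ite_false _ h => obtain ⟨rfl, rfl⟩ := ih h; exact ⟨rfl, rfl⟩
  | loop_stop hb =>
    intro _ _ h'
    cases h' with
    | loop_stop _ => exact ⟨rfl, rfl⟩
    | loop_step hb' _ _ => exact absurd hb' hb
  | loop_step hb _ _ ih₁ ih₂ =>
    intro _ _ h'
    cases h' with
    | loop_stop hb' => exact absurd hb hb'
    | loop_step _ h₁ h₂ =>
      obtain ⟨rfl, rfl⟩ := ih₁ h₁
      obtain ⟨rfl, rfl⟩ := ih₂ h₂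
      exact ⟨rfl, rfl⟩

/-- The arrays of natural numbers that a program may write. -/
def Cmd.writes : Cmd → List ℕ
  | .skip => []
  | .setNat a _ _ => [a]
  | .setReal _ _ _ => []
  | .seq c d => c.writes ++ d.writes
  | .ite _ c d => c.writes ++ d.writes
  | .loop _ c => c.writes

/-- The arrays of real numbers that a program may write. -/
def Cmd.realWrites : Cmd → List ℕ
  | .skip => []
  | .setNat _ _ _ => []
  | .setReal a _ _ => [a]
  | .seq c d => c.realWrites ++ d.realWrites
  | .ite _ c d => c.realWrites ++ d.realWrites
  | .loop _ c => c.realWrites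

/-- The two states agree outside the memory written by `c`. -/
def Agree (c : Cmd) (σ τ : State) : Prop :=
  (∀ a, a ∉ c.writes → τ.nat a = σ.nat a) ∧ (∀ a, a ∉ c.realWrites → τ.real a = σ.real a)

/-- The frame rule, read off from the syntax alone. That a given array survives a given program
thereby becomes a membership question about a concrete list, usually settled by `decide`. -/
theorem Exec.agree {c : Cmd} {σ τ : State} {n : ℕ} (h : Exec c σ τ n) : Agree c σ τ := by
  induction h with
  | skip => exact ⟨fun _ _ => rfl, fun _ _ => rfl⟩
  | setNat σ a i x =>
    refine ⟨fun b hb => ?_, fun _ _ => rfl⟩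
    have : b ≠ a := by simpa [Cmd.writes] using hb
    simp [State.setNat, Function.update_of_ne this]
  | setReal σ a i x =>
    refine ⟨fun _ _ => rfl, fun b hb => ?_⟩
    have : b ≠ a := by simpa [Cmd.realWrites] using hb
    simp [State.setReal, Function.update_of_ne this]
  | seq _ _ ih₁ ih₂ =>
    constructor
    · intro a ha
      simp only [Cmd.writes, List.mem_append, not_or] at ha
      rw [ih₂.1 a ha.2, ih₁.1 a ha.1]
    · intro a ha
      simp only [Cmd.realWrites, List.mem_append, not_or] at ha
      rw [ih₂.2 a ha.2, ih₁.2 a ha.1]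
  | ite_true _ _ ih =>
    constructor
    · intro a ha
      simp only [Cmd.writes, List.mem_append, not_or] at ha
      exact ih.1 a ha.1
    · intro a ha
      simp only [Cmd.realWrites, List.mem_append, not_or] at ha
      exact ih.2 a ha.1
  | ite_false _ _ ih =>
    constructor
    · intro a ha
      simp only [Cmd.writes, List.mem_append, not_or] at ha
      exact ih.1 a ha.2
    · intro a ha
      simp only [Cmd.realWrites, List.mem_append, not_or] at ha
      exact ih.2 a ha.2
  | loop_stop => exact ⟨fun _ _ => rfl, fun _ _ => rfl⟩
  | loop_step _ _ _ ih₁ ih₂ =>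
    exact ⟨fun a ha => (ih₂.1 a ha).trans (ih₁.1 a ha),
      fun a ha => (ih₂.2 a ha).trans (ih₁.2 a ha)⟩

theorem Agree.preserves {c : Cmd} {σ τ : State} (h : Agree c σ τ) (outs : List ℕ)
    (h₁ : ∀ a ∈ c.writes, a ∈ outs ∨ reserved ≤ a) (h₂ : ∀ a ∈ c.realWrites, reserved ≤ a) :
    Preserves outs σ τ :=
  ⟨fun a ha hao => h.1 a fun hw => (h₁ a hw).elim hao fun h' => absurd ha (not_lt.2 h'),
    fun a ha => h.2 a fun hw => absurd ha (not_lt.2 (h₂ a hw))⟩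

/-! ### Reading and writing the memory -/

@[simp] theorem setNat_nat_self (σ : State) (a i x : ℕ) :
    (σ.setNat a i x).nat a = Function.update (σ.nat a) i x := by simp [State.setNat]

@[simp] theorem setNat_nat_of_ne (σ : State) {a b : ℕ} (i x : ℕ) (h : b ≠ a) :
    (σ.setNat a i x).nat b = σ.nat b := by simp [State.setNat, Function.update_of_ne h]

@[simp] theorem setNat_real (σ : State) (a i x : ℕ) : (σ.setNat a i x).real = σ.real := rfl

@[simp] theorem setReal_real_self (σ : State) (a i : ℕ) (x : ℝ) :
    (σ.setReal a i x).real a = Function.update (σ.real a) i x := by simp [State.setReal]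

@[simp] theorem setReal_real_of_ne (σ : State) {a b : ℕ} (i : ℕ) (x : ℝ) (h : b ≠ a) :
    (σ.setReal a i x).real b = σ.real b := by simp [State.setReal, Function.update_of_ne h]

@[simp] theorem setReal_nat (σ : State) (a i : ℕ) (x : ℝ) : (σ.setReal a i x).nat = σ.nat := rfl

attribute [simp] NExp.eval RExp.eval BExp.Holds var assign incr

/-! ### Programs without loops -/

def Cmd.LoopFree : Cmd → Bool
  | .skip => true
  | .setNat _ _ _ => true
  | .setReal _ _ _ => true
  | .seq c d => c.LoopFree && d.LoopFree
  | .ite _ c d => c.LoopFree && d.LoopFree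
  | .loop _ _ => false

/-- The maximal number of steps of a program without loops. -/
def Cmd.bound : Cmd → ℕ
  | .skip => 1
  | .setNat _ i x => i.cost + x.cost + 1
  | .setReal _ i x => i.cost + x.cost + 1
  | .seq c d => c.bound + d.bound
  | .ite b c d => b.cost + max c.bound d.bound + 1
  | .loop _ _ => 0

open Classical in
/-- The result of a program without loops. -/
noncomputable def Cmd.run : Cmd → State → State
  | .skip, σ => σ
  | .setNat a i x, σ => σ.setNat a (i.eval σ) (x.eval σ)
  | .setReal a i x, σ => σ.setReal a (i.eval σ) (x.eval σ)
  | .seq c d, σ => d.run (c.run σ)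
  | .ite b c d, σ => if b.Holds σ then c.run σ else d.run σ
  | .loop _ _, σ => σ

/-- Reduces loop-free code to computation: `simp` evaluates the final state and `decide` checks the
cost, so that only loops need invariants. -/
theorem Cmd.exec_run (c : Cmd) (hc : c.LoopFree = true) (σ : State) :
    ∃ n ≤ c.bound, Exec c σ (c.run σ) n := by
  induction c generalizing σ with
  | skip => exact ⟨1, le_rfl, .skip σ⟩
  | setNat a i x => exact ⟨_, le_rfl, .setNat σ a i x⟩
  | setReal a i x => exact ⟨_, le_rfl, .setReal σ a i x⟩
  | seq c d ihc ihd =>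
    simp only [Cmd.LoopFree, Bool.and_eq_true] at hc
    obtain ⟨m, hm, h₁⟩ := ihc hc.1 σ
    obtain ⟨n, hn, h₂⟩ := ihd hc.2 (c.run σ)
    exact ⟨m + n, Nat.add_le_add hm hn, .seq h₁ h₂⟩
  | ite b c d ihc ihd =>
    simp only [Cmd.LoopFree, Bool.and_eq_true] at hc
    by_cases hb : b.Holds σ
    · obtain ⟨m, hm, h⟩ := ihc hc.1 σ
      refine ⟨_, ?_, by simpa [Cmd.run, hb] using Exec.ite_true hb h⟩
      simp only [Cmd.bound]; omega
    · obtain ⟨m, hm, h⟩ := ihd hc.2 σ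
      refine ⟨_, ?_, by simpa [Cmd.run, hb] using Exec.ite_false hb h⟩
      simp only [Cmd.bound]; omega
  | loop => simp [Cmd.LoopFree] at hc

/-! ### Time credits -/

/-- Started in `σ` with `k` time credits, `c` halts with a state and a number of remaining credits
that satisfy `Q`. -/
def Runs (c : Cmd) (σ : State) (k : ℕ) (Q : State → ℕ → Prop) : Prop :=
  ∃ τ n k', Exec c σ τ n ∧ n + k' ≤ k ∧ Q τ k'

theorem Runs.mono {c : Cmd} {σ : State} {k k₂ : ℕ} {Q Q₂ : State → ℕ → Prop} (h : Runs c σ k Q)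
    (hk : k ≤ k₂) (hQ : ∀ τ k', Q τ k' → Q₂ τ k') : Runs c σ k₂ Q₂ := by
  obtain ⟨τ, n, k', h₁, h₂, h₃⟩ := h
  exact ⟨τ, n, k', h₁, h₂.trans hk, hQ _ _ h₃⟩

theorem Runs.frame {c : Cmd} {σ : State} {k : ℕ} {Q : State → ℕ → Prop} (h : Runs c σ k Q) :
    Runs c σ k (fun τ k' => Q τ k' ∧ Agree c σ τ) := by
  obtain ⟨τ, n, k', h₁, h₂, h₃⟩ := h
  exact ⟨τ, n, k', h₁, h₂, h₃, h₁.agree⟩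

/-- Credits that are not needed can be carried along. -/
theorem Runs.add {c : Cmd} {σ : State} {k : ℕ} {Q : State → ℕ → Prop} (m : ℕ) (h : Runs c σ k Q) :
    Runs c σ (k + m) (fun τ k' => ∃ j, Q τ j ∧ k' = j + m) := by
  obtain ⟨τ, n, k', h₁, h₂, h₃⟩ := h
  exact ⟨τ, n, k' + m, h₁, by omega, k', h₃, rfl⟩

theorem Runs.seq {c d : Cmd} {σ : State} {k : ℕ} {Q : State → ℕ → Prop}
    (h : Runs c σ k (fun τ k' => Runs d τ k' Q)) : Runs (.seq c d) σ k Q := by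
  obtain ⟨τ, n, k', h₁, h₂, τ', n', k'', h₃, h₄, h₅⟩ := h
  exact ⟨τ', n + n', k'', .seq h₁ h₃, by omega, h₅⟩

theorem Runs.of_run {c : Cmd} {σ : State} {k : ℕ} {Q : State → ℕ → Prop} (B : ℕ)
    (hc : c.LoopFree = true) (hB : c.bound ≤ B) (hk : B ≤ k) (hQ : Q (c.run σ) (k - B)) :
    Runs c σ k Q := by
  obtain ⟨n, hn, h⟩ := c.exec_run hc σ
  exact ⟨_, n, k - B, h, by omega, hQ⟩

theorem Runs.ite {b : BExp} {c d : Cmd} {σ : State} {k : ℕ} {Q : State → ℕ → Prop}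
    (hk : b.cost + 1 ≤ k) (h₁ : b.Holds σ → Runs c σ (k - (b.cost + 1)) Q)
    (h₂ : ¬ b.Holds σ → Runs d σ (k - (b.cost + 1)) Q) : Runs (.ite b c d) σ k Q := by
  by_cases hb : b.Holds σ
  · obtain ⟨τ, n, k', h, hn, hQ⟩ := h₁ hb
    exact ⟨τ, _, k', .ite_true hb h, by omega, hQ⟩
  · obtain ⟨τ, n, k', h, hn, hQ⟩ := h₂ hb
    exact ⟨τ, _, k', .ite_false hb h, by omega, hQ⟩

theorem Runs.weaken {c : Cmd} {σ : State} {k : ℕ} {Q Q₂ : State → ℕ → Prop} (h : Runs c σ k Q)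
    (hQ : ∀ τ k', Q τ k' → ∃ k'' ≤ k', Q₂ τ k'') : Runs c σ k Q₂ := by
  obtain ⟨τ, n, k', h₁, h₂, h₃⟩ := h
  obtain ⟨k'', h₄, h₅⟩ := hQ _ _ h₃
  exact ⟨τ, n, k'', h₁, by omega, h₅⟩

theorem Runs.skip {σ : State} {k : ℕ} {Q : State → ℕ → Prop} (hk : 1 ≤ k) (hQ : Q σ (k - 1)) :
    Runs .skip σ k Q := ⟨σ, 1, k - 1, .skip σ, by omega, hQ⟩

/-- No separate variant is needed. Every round pays at least one credit for its test, so the number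
of credits itself decreases and strong induction on it proves termination. The invariant ranges over
pairs of a state and a balance, which admits potentials. -/
theorem Runs.loop {b : BExp} {c : Cmd} {σ : State} {k : ℕ} {Q : State → ℕ → Prop}
    (I : State → ℕ → Prop) (h0 : I σ k)
    (hs : ∀ τ k, Agree c σ τ → I τ k → b.Holds τ → ∃ k', b.cost + 1 + k' ≤ k ∧ Runs c τ k' I)
    (he : ∀ τ k, Agree c σ τ → I τ k → ¬ b.Holds τ → ∃ k', b.cost + 1 + k' ≤ k ∧ Q τ k') :
    Runs (.loop b c) σ k Q := by
  have key : ∀ k τ, Agree c σ τ → I τ k → Runs (.loop b c) τ k Q := by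
    intro k
    induction k using Nat.strong_induction_on with
    | _ k ih =>
      intro τ hτ hI
      by_cases hb : b.Holds τ
      · obtain ⟨k₁, hk, τ', n, k', h₁, h₂, h₃⟩ := hs τ k hτ hI hb
        have ha := h₁.agree
        obtain ⟨τ'', n', k'', h₄, h₅, h₆⟩ := ih k' (by omega) τ'
          ⟨fun a h => (ha.1 a h).trans (hτ.1 a h), fun a h => (ha.2 a h).trans (hτ.2 a h)⟩ h₃
        exact ⟨τ'', _, k'', .loop_step hb h₁ h₄, by omega, h₆⟩
      · obtain ⟨k', hk, hQ⟩ := he τ k hτ hI hb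
        exact ⟨τ, _, _, Exec.loop_stop hb, hk, hQ⟩
  exact key k σ ⟨fun _ _ => rfl, fun _ _ => rfl⟩ h0

/-- A loop whose body, which takes at most `B` steps, is executed `m` times. -/
theorem Runs.count {b : BExp} {c : Cmd} {σ : State} {k : ℕ} {Q : State → ℕ → Prop}
    (m B : ℕ) (I : ℕ → State → Prop) (h0 : I 0 σ)
    (hk : m * (B + b.cost + 1) + b.cost + 1 ≤ k)
    (hb : ∀ j τ, j ≤ m → Agree c σ τ → I j τ → (b.Holds τ ↔ j < m))
    (hs : ∀ j τ, j < m → Agree c σ τ → I j τ → Runs c τ B (fun τ' _ => I (j + 1) τ'))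
    (he : ∀ τ, Agree c σ τ → I m τ → Q τ (k - (m * (B + b.cost + 1) + b.cost + 1))) :
    Runs (.loop b c) σ k Q := by
  -- The balance is kept exact as a function of the number `j` of rounds; credits that a round does
  -- not use are discarded by `Runs.weaken`.
  refine Runs.loop (fun τ k' => ∃ j ≤ m, I j τ ∧ k' + j * (B + b.cost + 1) = k) ?_ ?_ ?_
  · exact ⟨0, Nat.zero_le _, h0, by simp⟩
  · rintro τ k' hτ ⟨j, hj, hI, hk'⟩ hbτ
    have hj' : j < m := (hb j τ hj hτ hI).1 hbτ
    have e := Nat.mul_le_mul_right (B + b.cost + 1) hj'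
    rw [Nat.succ_mul] at e
    refine ⟨k' - (b.cost + 1), by omega, ?_⟩
    have := (hs j τ hj' hτ hI).add (k' - (b.cost + 1) - B)
    refine (this.mono (by omega) fun _ _ h => h).weaken ?_
    rintro τ' k'' ⟨i, hI', rfl⟩
    exact ⟨k' - (b.cost + 1) - B, by omega, j + 1, hj', hI', by rw [Nat.succ_mul]; omega⟩
  · rintro τ k' hτ ⟨j, hj, hI, hk'⟩ hbτ
    have : j = m := by
      by_contra hne
      exact hbτ ((hb j τ hj hτ hI).2 (by omega))
    subst this
    refine ⟨_, ?_, he τ hτ hI⟩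
    omega


end CTQAMSC

namespace CTQAMSC

attribute [local simp] inN inM inSrc inDst inW inS inT inB inP spFound spLen spPath edU edV edFound
  edLen₁ edPath₁ edLen₂ edPath₂ rN rM rSrc rDst rTime rS rT rBound rLen rFound rPathLen rPath
  outFail outLen₁ outPath₁ outLen₂ outPath₂ ci cj ch cq node kind orig off₁ cnt₁ off₂ cnt₂ pool
  poolEnd wsum

/-! ### The main program -/

/-- The memory that Stage 1 only reads. -/
def Same (σ τ : State) : Prop :=
  (∀ a ∈ [0, 1, 2, 3, 4, 5, 6, 7, 9, 10, 18, 38], τ.nat a = σ.nat a) ∧ τ.real 0 = σ.real 0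

theorem Same.trans {σ τ υ : State} (h : Same σ τ) (h' : Same τ υ) : Same σ υ :=
  ⟨fun a ha => (h'.1 a ha).trans (h.1 a ha), h'.2.trans h.2⟩

theorem Same.networkAt {G : Network} {s t : Fin G.N} {σ τ : State} (h : Same σ τ)
    (hσ : NetworkAt G s t σ) : NetworkAt G s t τ := by
  simp only [NetworkAt, inN, inM, inSrc, inDst, inW, inS, inT, inP] at *
  rw [h.1 0 (by decide), h.1 1 (by decide), h.1 2 (by decide), h.1 3 (by decide),
    h.1 4 (by decide), h.1 5 (by decide), h.1 6 (by decide), h.2]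
  exact hσ

/-- The links of the transformed network built so far are admissible, and every stored pair of
paths has at most `D` links. -/
def Links (k D : ℕ) (τ : State) : Prop :=
  ∀ m < τ.nat rM 0, τ.nat rSrc m ≤ k ∧ τ.nat rDst m ≤ k ∧ 0 < τ.nat rTime m ∧
    0 ≤ τ.real rLen m ∧ (τ.nat kind m ≠ 0 → τ.nat cnt₁ m + τ.nat cnt₂ m ≤ D)

/-- The last conclusion serves the positivity of the times in the RSP instance: a path between
distinct nodes has a first link, whose positive weight enters the sum. -/
theorem runs_storePath {len arr l : ℕ} {σ : State} (hlen : len ∉ [36, 45, 46, 47])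
    (harr : arr ∉ [36, 45, 46, 47]) (hl : σ.nat len 0 = l) :
    Runs (storePath len arr) σ (50 * (l + 1)) (fun τ _ => σ.nat wsum 0 ≤ τ.nat wsum 0 ∧
      (0 < l → 0 < σ.nat inW (σ.nat arr 0) → 0 < τ.nat wsum 0)) := by
  simp only [List.mem_cons, not_or, List.not_mem_nil, not_false_eq_true, and_true] at hlen harr
  obtain ⟨hlen1, hlen2, hlen3, hlen4⟩ := hlen
  obtain ⟨harr1, harr2, harr3, harr4⟩ := harr
  refine Runs.seq (Runs.of_run 3 rfl (by decide) (by omega) ?_)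
  refine Runs.seq (Runs.count l 39 (fun j τ => τ.nat ch 0 = j ∧ σ.nat wsum 0 ≤ τ.nat wsum 0 ∧
      (0 < j → 0 < σ.nat inW (σ.nat arr 0) → 0 < τ.nat wsum 0)) ?_ ?_ ?_ ?_ ?_)
  · simp [Cmd.run]
  · simp [BExp.cost, NExp.cost]; omega
  · intro j τ hj hτ hI
    have := hτ.1 len (by simp [Cmd.writes, block, *])
    simp [Cmd.run, hlen1] at this hI ⊢
    rw [this, hI.1, hl]
  · intro j τ hj hτ hI
    have h1 := hτ.1 arr (by simp [Cmd.writes, block, *])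
    have h2 := hτ.1 4 (by simp [Cmd.writes, block])
    simp [Cmd.run, harr1] at h1 h2 hI
    obtain ⟨hI1, hI2, hI3⟩ := hI
    refine Runs.of_run 39 rfl (Nat.le_of_ble_eq_true rfl) le_rfl ?_
    simp [Cmd.run, block, hI1, h1, h2, harr4]
    refine ⟨by omega, fun h => ?_⟩
    rcases Nat.eq_zero_or_pos j with rfl | hj
    · right; exact h
    · left; exact hI3 hj h
  · intro τ hτ hI
    refine Runs.skip ?_ hI.2
    simp [BExp.cost, NExp.cost]; omega

theorem storePath_writes (len arr : ℕ) : (storePath len arr).writes = [36, 47, 45, 46, 36] := rfl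
theorem storePath_realWrites (len arr : ℕ) : (storePath len arr).realWrites = [] := rfl

/-- The body of the inner loop of Step 1.3 without the increment. -/
def pairStep (edsp : Cmd) : Cmd :=
  .ite (.natEq (var ci) (var cj)) .skip (block [
    assign edU (.get node (var ci)),
    assign edV (.get node (var cj)),
    edsp,
    .ite (.natEq (var edFound) (.const 1)) (block [
      .setNat rSrc (var rM) (var ci),
      .setNat rDst (var rM) (var cj),
      .setReal rLen (var rM) (.const 0),
      .setNat kind (var rM) (.const 1),
      assign wsum (.const 0),
      .setNat off₁ (var rM) (var poolEnd),
      .setNat cnt₁ (var rM) (var edLen₁),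
      storePath edLen₁ edPath₁,
      .setNat off₂ (var rM) (var poolEnd),
      .setNat cnt₂ (var rM) (var edLen₂),
      storePath edLen₂ edPath₂,
      .setNat rTime (var rM) (var wsum),
      incr rM]) .skip])

theorem IsWalk.ne_nil {N M : ℕ} {src dst : Fin M → Fin N} {u v : Fin N} {π : List (Fin M)}
    (h : IsWalk src dst u v π) (huv : u ≠ v) : π ≠ [] := by
  rintro rfl; exact huv h

/-- The bound on an EDSP call includes the delivery, so the pair found has at most `⌊D⌋` links in
all. Copying it therefore costs `O(D + 1)`, and the new link satisfies the last clause of `Links`.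
The call is legitimate because distinct positions on a simple path are distinct nodes (`hinj`). -/
theorem runs_pairStep {edsp : Cmd} {D : ℕ → ℕ → ℝ} (hed : IsEDSPAlgorithm edsp D) {G : Network}
    {s t : Fin G.N} {σ₀ σ : State} {k i j : ℕ} {nd : ℕ → Fin G.N} (h₀ : NetworkAt G s t σ₀)
    (hnd : ∀ i ≤ k, σ₀.nat node i = nd i) (hinj : ∀ i ≤ k, ∀ j ≤ k, nd i = nd j → i = j)
    (hσ : Same σ₀ σ) (hi : i ≤ k) (hj : j ≤ k) (hci : σ.nat ci 0 = i) (hcj : σ.nat cj 0 = j)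
    (hL : Links k ⌊D G.N G.M⌋₊ σ) :
    Runs (pairStep edsp) σ (250 * (⌊D G.N G.M⌋₊ + 1)) (fun τ _ => Same σ₀ τ ∧
      Links k ⌊D G.N G.M⌋₊ τ ∧ τ.nat ci 0 = i ∧ τ.nat cj 0 = j ∧ σ.nat rM 0 ≤ τ.nat rM 0 ∧
      τ.nat rM 0 ≤ σ.nat rM 0 + if i = j then 0 else 1) := by
  set Dn := ⌊D G.N G.M⌋₊ with hDn
  refine Runs.ite (by simp [BExp.cost, NExp.cost]; omega) (fun hb => ?_) (fun hb => ?_)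
  · refine Runs.skip (by simp [BExp.cost, NExp.cost]; omega) ⟨hσ, hL, hci, hcj, le_rfl, ?_⟩
    omega
  have hij : i ≠ j := by
    intro h; exact hb (by change σ.nat ci 0 = σ.nat cj 0; omega)
  refine Runs.seq (Runs.of_run 5 rfl (by decide) (by simp [BExp.cost, NExp.cost]; omega) ?_)
  refine Runs.seq (Runs.of_run 5 rfl (by decide) (by simp [BExp.cost, NExp.cost]; omega) ?_)
  have h38 := hσ.1 38 (by decide)
  simp only [node] at hnd
  set σ₁ := (assign edV (.get node (var cj))).run ((assign edU (.get node (var ci))).run σ) with hσ₁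
  have e1 : ∀ a, a ≠ 11 → a ≠ 12 → σ₁.nat a = σ.nat a := by
    intro a h1 h2; simp [hσ₁, Cmd.run, h1, h2]
  have e2 : σ₁.real = σ.real := by simp [hσ₁, Cmd.run]
  have e3 : σ₁.nat 11 0 = nd i := by
    simp at hci; simp [hσ₁, Cmd.run, hci, h38, hnd i hi]
  have e4 : σ₁.nat 12 0 = nd j := by
    simp at hcj; simp [hσ₁, Cmd.run, hcj, h38, hnd j hj]
  have hσ1 : Same σ₀ σ₁ := by
    refine hσ.trans ⟨fun a ha => e1 a ?_ ?_, by rw [e2]⟩ <;> · rintro rfl; revert ha; decide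
  obtain ⟨σ₂, n, hx, hp, hres⟩ := hed G s t (nd i) (nd j) σ₁
    (fun h => hij (hinj i hi j hj h)) (hσ1.networkAt h₀) e3 e4
  have hσ2 : Same σ₀ σ₂ := by
    refine hσ1.trans ⟨fun a ha => hp.1 a ?_ ?_, hp.2 _ (by decide)⟩ <;>
      · revert a; decide
  have e5 : ∀ a < 100, a ∉ [11, 12, 13, 14, 15, 16, 17] → σ₂.nat a = σ.nat a := by
    intro a ha h
    simp only [List.mem_cons, not_or] at h
    rw [hp.1 a ha (by simp; tauto), e1 a (by tauto) (by tauto)]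
  have e6 : σ₂.real 1 = σ.real 1 := by rw [hp.2 1 (by decide), e2]
  simp only [ci, cj] at hci hcj
  rcases hres with ⟨hf, π₁, π₂, hsp, hπ₁, hπ₂, hcost⟩ | ⟨hf, -, hcost⟩
  · have hcost' : n + π₁.length + π₂.length ≤ Dn := by
      rw [hDn]; apply Nat.le_floor; push_cast; exact hcost
    refine Runs.seq ⟨σ₂, n, 250 * (Dn + 1) - 20 - n, hx,
      by simp [BExp.cost, NExp.cost]; omega, ?_⟩
    refine Runs.seq (Runs.ite (by simp [BExp.cost, NExp.cost]; omega) (fun _ => ?_)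
      (fun h => absurd hf h))
    have hE : (BExp.natEq (var edFound) (.const 1)).cost = 4 := rfl
    rw [hE]
    refine Runs.seq (Runs.of_run 6 rfl (by decide) (by omega) ?_)
    refine Runs.seq (Runs.of_run 6 rfl (by decide) (by omega) ?_)
    refine Runs.seq (Runs.of_run 6 rfl (by decide) (by omega) ?_)
    refine Runs.seq (Runs.of_run 6 rfl (by decide) (by omega) ?_)
    refine Runs.seq (Runs.of_run 6 rfl (by decide) (by omega) ?_)
    refine Runs.seq (Runs.of_run 6 rfl (by decide) (by omega) ?_)
    refine Runs.seq (Runs.of_run 6 rfl (by decide) (by omega) ?_)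
    simp only [Cmd.run, var, assign, NExp.eval, RExp.eval]
    obtain ⟨hl1, ha1⟩ := hπ₁
    obtain ⟨hl2, ha2⟩ := hπ₂
    have hne : π₁ ≠ [] := hsp.1.1.1.ne_nil (fun h => hij (hinj i hi j hj h))
    have hpos : 0 < π₁.length := List.length_pos_iff.2 hne
    have hw : 0 < σ₂.nat 4 (σ₂.nat 15 0) := by
      have := ha1 0 hpos
      simp only [edPath₁] at this
      rw [this]
      have := ((hσ2.networkAt h₀).2.2.2.2 π₁[0]).2.2.1
      simp only [inW] at this
      rw [this]
      exact G.w_pos _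
    simp only [edLen₁, edLen₂, edPath₁, edPath₂] at hl1 hl2 ha1 ha2
    refine Runs.seq (((runs_storePath (l := π₁.length) (by decide) (by decide)
      (by simp [hl1])).frame.add (250 * (Dn + 1) - 70 - n - 50 * (π₁.length + 1))).mono
        (by omega) ?_)
    rintro σ₃ _ ⟨_, ⟨⟨hw1, hw2⟩, ag⟩, rfl⟩
    simp [storePath_writes, storePath_realWrites, Agree] at ag hw1 hw2
    obtain ⟨ag1, ag2⟩ := ag
    replace hw2 := hw2 hpos hw
    refine Runs.seq (Runs.of_run 6 rfl (by decide) (by omega) ?_)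
    refine Runs.seq (Runs.of_run 6 rfl (by decide) (by omega) ?_)
    simp only [Cmd.run, NExp.eval]
    refine Runs.seq (((runs_storePath (l := π₂.length) (by decide) (by decide)
      (by simp [hl2, ag1])).frame.add (250 * (Dn + 1) - 90 - n - 50 * (π₁.length + 1)
        - 50 * (π₂.length + 1))).mono (by omega) ?_)
    rintro σ₄ _ ⟨_, ⟨⟨hw3, -⟩, ag'⟩, rfl⟩
    simp [storePath_writes, storePath_realWrites, Agree] at ag' hw3
    obtain ⟨ag3, ag4⟩ := ag'
    refine Runs.seq (Runs.of_run 6 rfl (by decide) (by omega) ?_)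
    refine Runs.seq (Runs.of_run 7 rfl (by decide) (by omega) ?_)
    refine Runs.skip (by omega) (Runs.skip (by omega) ?_)
    simp only [Cmd.run, var, assign, incr, NExp.eval]
    refine ⟨⟨fun a ha => ?_, ?_⟩, ?_, ?_, ?_, ?_, ?_⟩
    · rw [← hσ2.1 a ha]
      simp only [List.mem_cons, List.not_mem_nil, or_false] at ha
      rcases ha with rfl | rfl | rfl | rfl | rfl | rfl | rfl | rfl | rfl | rfl | rfl | rfl <;>
        simp [ag3, ag1]
    · simp [ag4, ag2, hσ2.2]
    · intro m hm
      simp [ag3, ag1, e5] at hm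
      simp [ag3, ag1, ag2, ag4, e5, e6, Function.update_apply]
      have hL' := hL m
      simp at hL'
      -- The written cell is the one with the old value of `rM` as index, that is, the new link; all
      -- others are covered by `hL`.
      split_ifs with h
      · refine ⟨by omega, by omega, by omega, le_rfl, fun _ => by omega⟩
      · exact hL' (by omega)
    · simp [ag3, ag1, e5, hci]
    · simp [ag3, ag1, e5, hcj]
    · simp [ag3, ag1, e5]
    · simp [ag3, ag1, e5, hij]
  · have hcost' : n ≤ Dn := by
      rw [hDn]; apply Nat.le_floor; exact hcost
    refine Runs.seq ⟨σ₂, n, 250 * (Dn + 1) - 20 - n, hx,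
      by simp [BExp.cost, NExp.cost]; omega, ?_⟩
    refine Runs.seq (Runs.ite (by simp [BExp.cost, NExp.cost]; omega)
      (fun h => by simp at h hf; omega) (fun h => ?_))
    have hE : (BExp.natEq (var edFound) (.const 1)).cost = 4 := rfl
    rw [hE]
    refine Runs.skip (by omega) (Runs.skip (by omega) ⟨hσ2, ?_, ?_, ?_, ?_, ?_⟩)
    · intro m hm
      have hL' := hL m
      simp [e5, e6] at hm hL' ⊢
      exact hL' hm
    · simp [e5, hci]
    · simp [e5, hcj]
    · simp [e5]
    · simp [e5]

/-- There are `k + 1` rows with at most `k` new links each, on top of the `k` simple links: `k + (k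
+ 1) k = k² + 2k`. -/
theorem runs_step13 {edsp : Cmd} {D : ℕ → ℕ → ℝ} (hed : IsEDSPAlgorithm edsp D) {G : Network}
    {s t : Fin G.N} {σ₀ σ : State} {k b : ℕ} {nd : ℕ → Fin G.N} (h₀ : NetworkAt G s t σ₀)
    (hnd : ∀ i ≤ k, σ₀.nat node i = nd i) (hinj : ∀ i ≤ k, ∀ j ≤ k, nd i = nd j → i = j)
    (hk : σ₀.nat spLen 0 = k) (hσ : Same σ₀ σ) (hL : Links k ⌊D G.N G.M⌋₊ σ)
    (hM : σ.nat rM 0 = k)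
    (hb : (k + 1) * ((k + 1) * (250 * (⌊D G.N G.M⌋₊ + 1) + 20) + 40) + 20 ≤ b) :
    Runs (step13 edsp) σ b (fun τ _ => Same σ₀ τ ∧
      Links k ⌊D G.N G.M⌋₊ τ ∧ k ≤ τ.nat rM 0 ∧ τ.nat rM 0 ≤ k ^ 2 + 2 * k) := by
  set Dn := ⌊D G.N G.M⌋₊ with hDn
  have e9 : ∀ {τ}, Same σ₀ τ → τ.nat 9 0 = k := fun h => by rw [h.1 9 (by decide)]; exact hk
  change Runs (block [assign ci (.const 0), .loop (.natLe (var ci) (var spLen))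
    (block [assign cj (.const 0), .loop (.natLe (var cj) (var spLen))
      (block [pairStep edsp, incr cj]), incr ci])]) σ b _
  refine Runs.seq (Runs.of_run 3 rfl (by decide) (by omega) ?_)
  refine Runs.seq (Runs.count (k + 1) ((k + 1) * (250 * (Dn + 1) + 20) + 30)
    (fun i τ => Same σ₀ τ ∧ Links k Dn τ ∧ τ.nat ci 0 = i ∧ k ≤ τ.nat rM 0 ∧
      τ.nat rM 0 ≤ k + i * k) ?_ ?_ ?_ ?_ ?_)
  · refine ⟨hσ.trans ⟨fun a ha => ?_, rfl⟩, ?_, by simp [Cmd.run], ?_, ?_⟩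
    · simp only [List.mem_cons, List.not_mem_nil, or_false] at ha
      rcases ha with rfl | rfl | rfl | rfl | rfl | rfl | rfl | rfl | rfl | rfl | rfl | rfl <;>
        simp [Cmd.run]
    · simpa [Links, Cmd.run] using hL
    · simp at hM; simp [Cmd.run, hM]
    · simp at hM; simp [Cmd.run, hM]
  · simp only [BExp.cost, NExp.cost, var]; ring_nf at hb ⊢; omega
  · rintro i τ hi - ⟨h1, -, h2, -⟩
    simp at h2
    simp [h2, e9 h1]
  · rintro i τ hi - ⟨h1, h2, h3, h3', h4⟩
    simp at h3 h3' h4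
    refine Runs.seq (Runs.of_run 3 rfl (by decide) (by omega) ?_)
    -- The pair `(i, i)` adds no link. Hence the row has contributed at most `j` links while `j ≤
    -- i`, and at most `j - 1` afterwards.
    refine Runs.seq (Runs.count (k + 1) (250 * (Dn + 1) + 7)
      (fun j τ => Same σ₀ τ ∧ Links k Dn τ ∧ τ.nat ci 0 = i ∧ τ.nat cj 0 = j ∧
        k ≤ τ.nat rM 0 ∧ τ.nat rM 0 ≤ k + i * k + if i < j then j - 1 else j) ?_ ?_ ?_ ?_ ?_)
    · refine ⟨h1.trans ⟨fun a ha => ?_, rfl⟩, ?_, by simp [Cmd.run, h3], by simp [Cmd.run],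
        by simp [Cmd.run, h3'], ?_⟩
      · simp only [List.mem_cons, List.not_mem_nil, or_false] at ha
        rcases ha with rfl | rfl | rfl | rfl | rfl | rfl | rfl | rfl | rfl | rfl | rfl | rfl <;>
          simp [Cmd.run]
      · simpa [Links, Cmd.run] using h2
      · simp [Cmd.run, h4]
    · simp only [BExp.cost, NExp.cost, var]; ring_nf; omega
    · rintro j υ hj - ⟨h5, -, -, h6, -⟩
      simp at h6
      simp [h6, e9 h5]
    · rintro j υ hj - ⟨h5, h6, h7, h8, h8', h9⟩
      refine Runs.seq (((runs_pairStep hed h₀ hnd hinj h5 (by omega) (by omega) h7 h8 h6).add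
        7).mono le_rfl ?_)
      rintro φ _ ⟨_, ⟨g1, g2, g3, g4, g4', g5⟩, rfl⟩
      refine Runs.seq (Runs.of_run 6 rfl (by decide) (by omega) (Runs.skip (by omega) ?_))
      simp at g3 g4 g4' g5 h8' h9
      refine ⟨g1.trans ⟨fun a ha => ?_, rfl⟩, ?_, by simp [Cmd.run, g3], by simp [Cmd.run, g4],
        by simp [Cmd.run]; omega, ?_⟩
      · simp only [List.mem_cons, List.not_mem_nil, or_false] at ha
        rcases ha with rfl | rfl | rfl | rfl | rfl | rfl | rfl | rfl | rfl | rfl | rfl | rfl <;>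
          simp [Cmd.run]
      · simpa [Links, Cmd.run] using g2
      · simp [Cmd.run]
        split_ifs at g5 h9 ⊢ <;> omega
    · rintro υ - ⟨h5, h6, h7, -, h8, h9⟩
      simp only [BExp.cost, NExp.cost, var]
      refine Runs.seq (Runs.of_run 6 rfl (by decide) (by ring_nf; omega)
        (Runs.skip (by ring_nf; omega) ?_))
      simp at h7 h8 h9
      refine ⟨h5.trans ⟨fun a ha => ?_, rfl⟩, ?_, by simp [Cmd.run, h7],
        by simp [Cmd.run, h8], ?_⟩
      · simp only [List.mem_cons, List.not_mem_nil, or_false] at ha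
        rcases ha with rfl | rfl | rfl | rfl | rfl | rfl | rfl | rfl | rfl | rfl | rfl | rfl <;>
          simp [Cmd.run]
      · simpa [Links, Cmd.run] using h6
      · simp [Cmd.run]
        rw [if_pos (by omega)] at h9
        rw [Nat.succ_mul]; omega
  · rintro τ - ⟨h1, h2, -, h3, h4⟩
    refine Runs.skip ?_ ⟨h1, h2, h3, h4.trans (le_of_eq (by ring))⟩
    simp only [BExp.cost, NExp.cost, var]; ring_nf at hb ⊢; omega

theorem runs_step11 {G : Network} {s t : Fin G.N} {σ : State} {b : ℕ} {π : List (Fin G.M)}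
    (h₀ : NetworkAt G s t σ) (hπ : PathAt σ spLen spPath π) (hb : 30 * (π.length + 2) ≤ b) :
    Runs step11 σ b (fun τ k' => b ≤ k' + 30 * (π.length + 2) ∧ NetworkAt G s t τ ∧
      PathAt τ spLen spPath π ∧ τ.nat inB = σ.nat inB ∧
      (∀ i (h : i < (s :: π.map G.dst).length), τ.nat node i = (s :: π.map G.dst)[i]) ∧
      τ.nat rN 0 = π.length + 1 ∧ τ.nat rM 0 = 0) := by
  obtain ⟨hl, ha⟩ := hπ
  have h5 := h₀.2.2.1
  have h3 : ∀ e : Fin G.M, σ.nat 3 e = G.dst e := fun e => (h₀.2.2.2.2 e).2.1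
  simp only [spLen, spPath, inS] at hl ha h5
  refine Runs.seq (Runs.of_run 4 rfl (by decide) (by omega) ?_)
  refine Runs.seq (Runs.of_run 3 rfl (by decide) (by omega) ?_)
  refine Runs.seq (Runs.count π.length 20 (fun j τ => τ.nat ci 0 = j ∧
      (∀ i (h : i < (s :: π.map G.dst).length), i ≤ j → τ.nat node i = (s :: π.map G.dst)[i]))
      ?_ ?_ ?_ ?_ ?_)
  · refine ⟨by simp [Cmd.run], fun i h hi => ?_⟩
    obtain rfl : i = 0 := by omega
    simp [Cmd.run, h5]
  · simp [BExp.cost, NExp.cost]; omega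
  · rintro j τ hj hτ ⟨h1, h2⟩
    have := hτ.1 9 (by decide)
    simp [Cmd.run] at h1 this
    simp [h1, this, hl]
  · rintro j τ hj hτ ⟨h1, h2⟩
    have e1 := hτ.1 10 (by decide)
    have e2 := hτ.1 3 (by decide)
    simp [Cmd.run] at h1 e1 e2
    refine Runs.of_run 20 rfl (by decide) le_rfl ⟨by simp [Cmd.run, block, h1], fun i h hi => ?_⟩
    have := ha j hj
    rcases Nat.lt_or_ge j i with hji | hji
    · obtain rfl : i = j + 1 := by omega
      simp [Cmd.run, block, h1, e1, e2, this, h3]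
    · have h2' := h2 i h hji
      simp [Cmd.run, block, h1] at h2' ⊢
      rw [Function.update_of_ne (by omega), h2']
  · rintro τ hτ ⟨h1, h2⟩
    simp only [BExp.cost, NExp.cost, var]
    refine Runs.seq (Runs.of_run 6 rfl (by decide) (by omega) ?_)
    refine Runs.seq (Runs.of_run 3 rfl (by decide) (by omega) ?_)
    refine Runs.seq (Runs.of_run 3 rfl (by decide) (by omega) (Runs.skip (by omega) ?_))
    have e : ∀ a < 34, τ.nat a = σ.nat a := by
      intro a ha
      rw [hτ.1 a (by simp [Cmd.writes, block]; omega)]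
      simp [Cmd.run, show a ≠ 34 by omega, show a ≠ 38 by omega]
    have e' : τ.real = σ.real := by
      funext a
      rw [hτ.2 a (by simp [Cmd.realWrites, block])]
      simp [Cmd.run]
    refine ⟨by omega, ?_, ?_, ?_, ?_, ?_, ?_⟩
    · simpa [NetworkAt, Cmd.run, e, e'] using h₀
    · simp [PathAt, Cmd.run, e, hl]
      exact ha
    · simp [Cmd.run, e]
    · intro i h
      simp at h h2
      simp [Cmd.run]
      exact h2 i h
    · simp [Cmd.run, e, hl]
    · simp [Cmd.run]

theorem runs_step12 {G : Network} {s t : Fin G.N} {σ : State} {b D : ℕ} {π : List (Fin G.M)}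
    (h₀ : NetworkAt G s t σ) (hπ : PathAt σ spLen spPath π) (hM : σ.nat rM 0 = 0)
    (hb : 100 * (π.length + 1) ≤ b) :
    Runs step12 σ b (fun τ k' => b ≤ k' + 100 * (π.length + 1) ∧ Same σ τ ∧
      τ.nat inB = σ.nat inB ∧ τ.nat rN = σ.nat rN ∧ Links π.length D τ ∧
      τ.nat rM 0 = π.length) := by
  obtain ⟨hl, ha⟩ := hπ
  have hw : ∀ e : Fin G.M, σ.nat 4 e = G.w e := fun e => (h₀.2.2.2.2 e).2.2.1
  have hp : ∀ e : Fin G.M, σ.real 0 e = G.p e := fun e => (h₀.2.2.2.2 e).2.2.2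
  simp only [spLen, spPath, rM] at hl ha hM
  refine Runs.seq (Runs.of_run 3 rfl (by decide) (by omega) ?_)
  refine Runs.seq (Runs.count π.length 70 (fun j τ => τ.nat ci 0 = j ∧ τ.nat rM 0 = j ∧
      Links π.length D τ) ?_ ?_ ?_ ?_ ?_)
  · refine ⟨by simp [Cmd.run], by simp [Cmd.run, hM], fun m hm => ?_⟩
    simp [Cmd.run, hM] at hm
  · simp [BExp.cost, NExp.cost]; omega
  · rintro j τ hj hτ ⟨h1, h2⟩
    have := hτ.1 9 (by decide)
    simp [Cmd.run] at h1 this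
    simp [h1, this, hl]
  · rintro j τ hj hτ ⟨h1, h2, h3⟩
    have e1 := hτ.1 10 (by decide)
    have e2 := hτ.1 4 (by decide)
    have e3 := hτ.2 0 (by decide)
    simp [Cmd.run] at h1 h2 e1 e2 e3
    have hj' := ha j hj
    refine Runs.of_run 70 rfl (by decide) le_rfl ⟨by simp [Cmd.run, block, h1],
      by simp [Cmd.run, block, h2], fun m hm => ?_⟩
    simp [Cmd.run, block, h1, h2, e1, e2, e3, hj', hw, hp] at hm ⊢
    have h3' := h3 m
    simp [h2] at h3'
    simp only [Function.update_apply]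
    split_ifs with h
    · refine ⟨by omega, by omega, Nat.add_pos_left (G.w_pos _) _, ?_, by simp⟩
      have := G.p_pos π[j]
      have := G.p_lt_one π[j]
      exact neg_nonneg.2 (Real.log_nonpos (by linarith) (by linarith))
    · exact h3' (by omega)
  · rintro τ hτ ⟨h1, h2, h3⟩
    simp only [BExp.cost, NExp.cost, var]
    refine Runs.skip (by omega) ⟨by omega, ⟨fun a ha => ?_, ?_⟩, ?_, ?_, h3, h2⟩
    · rw [hτ.1 a (by revert a; decide)]
      simp only [List.mem_cons, List.not_mem_nil, or_false] at ha
      rcases ha with rfl | rfl | rfl | rfl | rfl | rfl | rfl | rfl | rfl | rfl | rfl | rfl <;>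
        simp [Cmd.run]
    · rw [hτ.2 0 (by decide)]; simp [Cmd.run]
    · rw [hτ.1 _ (by decide)]; simp [Cmd.run]
    · rw [hτ.1 _ (by decide)]; simp [Cmd.run]

theorem runs_appendPath {off cnt len arr : ℕ} {σ : State} {b : ℕ}
    (hcnt : cnt ∉ [ch, len, arr]) (hcq : cq ∉ [len, arr]) (hch : ch ∉ [len, arr])
    (hb : 30 * (σ.nat cnt (σ.nat cq 0) + 1) ≤ b) :
    Runs (appendPath off cnt len arr) σ b (fun _ k' =>
      b ≤ k' + 30 * (σ.nat cnt (σ.nat cq 0) + 1)) := by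
  simp at hcnt hcq hch hb ⊢
  refine Runs.seq (Runs.of_run 3 rfl (by decide) (by omega) ?_)
  refine Runs.seq (Runs.count (σ.nat cnt (σ.nat 37 0)) 23 (fun j τ => τ.nat ch 0 = j)
      ?_ ?_ ?_ ?_ ?_)
  · simp [Cmd.run]
  · simp [BExp.cost, NExp.cost]; omega
  · rintro j τ hj hτ h1
    have e1 := hτ.1 cnt (by simp [Cmd.writes, block, hcnt])
    have e2 := hτ.1 37 (by simp [Cmd.writes, block, hcq])
    simp [Cmd.run, hcnt] at h1 e1 e2
    simp [h1, e1, e2]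
  · rintro j τ hj hτ h1
    simp at h1
    refine Runs.of_run 23 rfl (Nat.le_of_ble_eq_true rfl) le_rfl ?_
    simp [Cmd.run, block, h1, hch]
  · rintro τ hτ h1
    simp only [BExp.cost, NExp.cost, var]
    exact Runs.skip (by omega) (by omega)

/-- Expanding a simple link takes constant time, and expanding a disjoint link takes time
proportional to the stored lengths `cnt₁ + cnt₂`, which `Links` bounds by `D`. The hypothesis `hm`
says that the path refers to links that exist. -/
theorem runs_stage3 {σ : State} {k D l : ℕ} (hL : Links k D σ) (hl : σ.nat rPathLen 0 = l)
    (hm : ∀ i < l, σ.nat rPath i < σ.nat rM 0) :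
    Runs stage3 σ (100 * (l * (D + 2) + 1)) (fun _ _ => True) := by
  simp at hl hm
  refine Runs.seq (Runs.of_run 3 rfl (by decide) (by omega) ?_)
  refine Runs.seq (Runs.of_run 3 rfl (by decide) (by omega) ?_)
  refine Runs.seq (Runs.of_run 3 rfl (by decide) (by omega) ?_)
  refine Runs.seq (Runs.count l (90 * (D + 2)) (fun j τ => τ.nat ci 0 = j) ?_ ?_ ?_ ?_ ?_)
  · simp [Cmd.run]
  · simp only [BExp.cost, NExp.cost, var]; ring_nf; omega
  · rintro j τ hj hτ h1
    have e1 := hτ.1 27 (by decide)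
    simp [Cmd.run] at h1 e1
    simp [h1, e1, hl]
  · rintro j τ hj hτ h1
    have e1 := hτ.1 28 (by decide)
    have e2 := hτ.1 39 (by decide)
    have e3 := hτ.1 42 (by decide)
    have e4 := hτ.1 44 (by decide)
    simp [Cmd.run] at h1 e1 e2 e3 e4
    have hL' := (hL _ (hm j hj)).2.2.2.2
    simp at hL'
    refine Runs.seq (Runs.of_run 5 rfl (by decide) (by omega) ?_)
    refine Runs.seq (Runs.ite (by simp [BExp.cost, NExp.cost]; omega) (fun h => ?_) (fun h => ?_))
    · refine Runs.of_run 30 rfl (by decide) (by simp [BExp.cost, NExp.cost]; omega) ?_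
      simp only [BExp.cost, NExp.cost, var]
      refine Runs.seq (Runs.of_run 6 rfl (by decide) (by omega) (Runs.skip (by omega) ?_))
      simp [Cmd.run, block, h1]
    · simp [Cmd.run, h1, e1, e2] at h
      have hc := hL' h
      simp only [BExp.cost, NExp.cost, var]
      refine Runs.seq ((runs_appendPath (by decide) (by decide) (by decide) ?_).frame.mono
        le_rfl ?_)
      · simp [Cmd.run, h1, e1, e3]; omega
      rintro υ k' ⟨hk', ag⟩
      have f1 := ag.1 44 (by decide)
      have f2 := ag.1 37 (by decide)
      have f3 := ag.1 34 (by decide)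
      simp [Cmd.run, h1, e1, e3, e4] at hk' f1 f2 f3
      refine Runs.seq ((runs_appendPath (by decide) (by decide) (by decide) ?_).frame.mono
        le_rfl ?_)
      · simp [f1, f2]; omega
      rintro φ k'' ⟨hk'', ag'⟩
      have f4 := ag'.1 34 (by decide)
      simp [f1, f2] at hk''
      refine Runs.skip (by omega) ?_
      refine Runs.seq (Runs.of_run 6 rfl (by decide) (by omega) (Runs.skip (by omega) ?_))
      simp [Cmd.run, f4, f3, h1]
  · rintro τ hτ h1
    refine Runs.skip ?_ trivial
    simp only [BExp.cost, NExp.cost, var]; ring_nf; omega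


/-! ### Total running time with arbitrary subroutines -/

theorem Exec.pos {c : Cmd} {σ τ : State} {n : ℕ} (h : Exec c σ τ n) : 1 ≤ n := by
  induction h <;> omega

/-- A call for the pair `(s, t)` takes at least one step, so the bound is at least one. This lets
`k² D` absorb the overheads of order `k²`, `k` and `1`. -/
theorem IsEDSPAlgorithm.one_le_floor {edsp : Cmd} {D : ℕ → ℕ → ℝ} (hed : IsEDSPAlgorithm edsp D)
    {G : Network} {s t : Fin G.N} {σ : State} (hst : s ≠ t) (h₀ : NetworkAt G s t σ) :
    1 ≤ ⌊D G.N G.M⌋₊ := by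
  obtain ⟨τ, n, hx, -, h⟩ := hed G s t s t ((σ.setNat 11 0 s).setNat 12 0 t) hst
    (by simpa [NetworkAt] using h₀) (by simp) (by simp)
  have := hx.pos
  apply Nat.le_floor
  have h1 : (1 : ℝ) ≤ n := by exact_mod_cast this
  rcases h with ⟨-, π₁, π₂, -, -, -, h⟩ | ⟨-, -, h⟩
  · have : (0 : ℝ) ≤ π₁.length := by positivity
    have : (0 : ℝ) ≤ π₂.length := by positivity
    push_cast; linarith
  · push_cast; linarith

/-- The transformed network in memory as an instance of the Restricted Shortest Path problem. -/
def instanceAt (τ : State) (k D B : ℕ) (hL : Links k D τ) (hk : 0 < k) (hM : 0 < τ.nat rM 0)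
    (hB : 0 < B) : RSPInstance where
  N := k + 1
  M := τ.nat rM 0
  src e := ⟨τ.nat rSrc e, Nat.lt_succ_of_le (hL e e.2).1⟩
  dst e := ⟨τ.nat rDst e, Nat.lt_succ_of_le (hL e e.2).2.1⟩
  len e := τ.real rLen e
  time e := τ.nat rTime e
  s := 0
  t := Fin.last k
  T := B
  len_nonneg e := (hL e e.2).2.2.2.1
  time_pos e := (hL e e.2).2.2.1
  s_ne_t := by
    intro h
    have := congrArg Fin.val h
    simp at this
    omega
  M_pos := hM
  T_pos := hB

theorem IsSimplePath.length_lt {N M : ℕ} {src dst : Fin M → Fin N} {u v : Fin N}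
    {π : List (Fin M)} (h : IsSimplePath src dst u v π) : π.length < N := by
  have := h.2.length_le_card
  simpa [Nat.succ_le_iff] using this

/-- The specification provides one run for every pair `N`, `M`. By determinism these are the same
run, so its cost `r`, delivery included, is a single number below `R N M I.T` for all admissible `N`
and `M` simultaneously. -/
theorem IsRSPAlgorithm.exec {rsp : Cmd} {R : ℕ → ℕ → ℕ → ℝ} (hr : IsRSPAlgorithm rsp R)
    (I : RSPInstance) (σ : State) (hI : RSPAt I σ) :
    ∃ (τ : State) (n r : ℕ), Exec rsp σ τ n ∧ Preserves [rFound, rPathLen, rPath] σ τ ∧ n ≤ r ∧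
      (τ.nat rFound 0 = 1 → ∃ π, I.IsSolution π ∧ PathAt τ rPathLen rPath π ∧ n + π.length ≤ r) ∧
      ∀ N M, I.N ≤ N → I.M ≤ M → (r : ℝ) ≤ R N M I.T := by
  obtain ⟨τ, n, hx, hp, h⟩ := hr I I.N I.M σ le_rfl le_rfl hI
  rcases h with ⟨hf, π, hs, hπ, hn⟩ | ⟨hf, hno, hn⟩
  · refine ⟨τ, n, n + π.length, hx, hp, by omega, fun _ => ⟨π, hs, hπ, le_rfl⟩, ?_⟩
    intro N M hN hM
    obtain ⟨τ', n', hx', -, h⟩ := hr I N M σ hN hM hI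
    obtain ⟨rfl, rfl⟩ := hx.det hx'
    rcases h with ⟨-, π', -, hπ', hn'⟩ | ⟨hf', -⟩
    · have : π'.length = π.length := hπ'.1.symm.trans hπ.1
      rw [this] at hn'
      exact_mod_cast hn'
    · omega
  · refine ⟨τ, n, n, hx, hp, le_rfl, fun h => by omega, ?_⟩
    intro N M hN hM
    obtain ⟨τ', n', hx', -, h⟩ := hr I N M σ hN hM hI
    obtain ⟨rfl, rfl⟩ := hx.det hx'
    rcases h with ⟨hf', -⟩ | ⟨-, -, hn'⟩
    · omega
    · exact hn'

/-- The actual cost `r` of the RSP call is kept apart from `R`, because the two bounds of the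
theorem evaluate `R` at different arguments. The solution is a simple path on `k + 1` nodes, so
Stage 3 has at most `k` links to expand. -/
theorem runs_stage12 {edsp rsp : Cmd} {D : ℕ → ℕ → ℝ} {R : ℕ → ℕ → ℕ → ℝ}
    (hed : IsEDSPAlgorithm edsp D) (hr : IsRSPAlgorithm rsp R) {G : Network} {s t : Fin G.N}
    (hst : s ≠ t) {B : ℕ} (hB : 1 ≤ B) {σ : State} {π : List (Fin G.M)} (h₀ : NetworkAt G s t σ)
    (hBσ : σ.nat inB 0 = B) (hpath : G.IsPath s t π) (hπ : PathAt σ spLen spPath π) :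
    ∃ r : ℕ, 1 ≤ r ∧ (∀ N M, π.length + 1 ≤ N → π.length ^ 2 + 2 * π.length ≤ M →
        (r : ℝ) ≤ R N M B) ∧
      Runs (block [step11, step12, step13 edsp, assign rS (.const 0), assign rT (var spLen),
        assign rBound (var inB), rsp,
        .ite (.natEq (var rFound) (.const 1)) stage3 (assign outFail (.const 1))]) σ
        (30 * (π.length + 2) + 100 * (π.length + 1) +
          ((π.length + 1) * ((π.length + 1) * (250 * (⌊D G.N G.M⌋₊ + 1) + 20) + 40) + 20) + 40 +
          r + 100 * (π.length * (⌊D G.N G.M⌋₊ + 2) + 1))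
        (fun τ _ => PathAt τ spLen spPath π) := by
  set k := π.length with hk
  set Dn := ⌊D G.N G.M⌋₊ with hDn
  have hkpos : 0 < k := List.length_pos_iff.2 (hpath.1.ne_nil hst)
  -- states up to the call of the last subroutine
  obtain ⟨σ₁, n₁, k₁, hx₁, hn₁, hk₁, h₁, hπ₁, hB₁, hnode, hN₁, hM₁⟩ :=
    runs_step11 h₀ hπ (b := 30 * (k + 2)) le_rfl
  obtain ⟨σ₂, n₂, k₂, hx₂, hn₂, ⟨hk₂, hs₂, hB₂, hN₂, hL₂, hM₂⟩⟩ :=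
    runs_step12 (D := Dn) h₁ hπ₁ hM₁ (b := 100 * (k + 1)) le_rfl
  have hnd : ∀ i ≤ k, σ₁.nat node i =
      ((fun i => if h : i < (s :: π.map G.dst).length then (s :: π.map G.dst)[i] else s) i :
        Fin G.N) := by
    intro i hi
    have h : i < (s :: π.map G.dst).length := by simp; omega
    rw [hnode i h]
    simp only [dif_pos h]
  have hinj : ∀ i ≤ k, ∀ j ≤ k,
      (fun i => if h : i < (s :: π.map G.dst).length then (s :: π.map G.dst)[i] else s) i =
      (fun i => if h : i < (s :: π.map G.dst).length then (s :: π.map G.dst)[i] else s) j →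
      i = j := by
    intro i hi j hj
    have h : i < (s :: π.map G.dst).length := by simp; omega
    have h' : j < (s :: π.map G.dst).length := by simp; omega
    simp only [dif_pos h, dif_pos h']
    exact fun e => (hpath.2.getElem_inj_iff).1 e
  obtain ⟨σ₃, n₃, k₃, hx₃, hn₃, hs₃, hL₃, hkM, hM₃⟩ :=
    runs_step13 (b := (k + 1) * ((k + 1) * (250 * (Dn + 1) + 20) + 40) + 20) hed h₁ hnd hinj hπ₁.1
      hs₂ hL₂ hM₂ le_rfl
  have hMpos : 0 < σ₃.nat rM 0 := by omega
  obtain ⟨σ₄, hσ₄⟩ : ∃ σ₄, σ₄ = (assign rBound (var inB)).run ((assign rT (var spLen)).run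
    ((assign rS (.const 0)).run σ₃)) := ⟨_, rfl⟩
  have e : ∀ a, a ≠ 23 → a ≠ 24 → a ≠ 25 → σ₄.nat a = σ₃.nat a := by
    intro a h1 h2 h3; simp [hσ₄, Cmd.run, h1, h2, h3]
  have e' : σ₄.real = σ₃.real := by simp [hσ₄, Cmd.run]
  have hL₄ : Links k Dn σ₄ := by simpa [Links, e, e'] using hL₃
  have hM₄ : 0 < σ₄.nat rM 0 := by simp [e]; exact hMpos
  have hat : RSPAt (instanceAt σ₄ k Dn B hL₄ hkpos hM₄ hB) σ₄ := by
    have f1 := hs₃.1 18 (by decide)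
    have f2 := hs₃.1 9 (by decide)
    have f3 := hs₃.1 7 (by decide)
    have f4 := hπ₁.1
    simp at f4 hN₁ hB₁ hBσ
    refine ⟨?_, rfl, ?_, ?_, ?_, fun m => ⟨rfl, rfl, rfl, rfl⟩⟩
    · simp [e, f1, hN₁, instanceAt, hk]
    · simp [hσ₄, Cmd.run, instanceAt]
    · simp [hσ₄, Cmd.run, instanceAt, f2, f4, hk]
    · simp [hσ₄, Cmd.run, instanceAt, f3, hB₁, hBσ]
  obtain ⟨σ₅, n₅, r, hx₅, hp₅, hnr, hfound, hR⟩ := hr.exec _ _ hat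
  have h1r := hx₅.pos
  have hout : PathAt σ₅ spLen spPath π := by
    have f1 := hs₃.1 9 (by decide)
    have f2 := hs₃.1 10 (by decide)
    have f3 := hp₅.1 9 (by decide) (by decide)
    have f4 := hp₅.1 10 (by decide) (by decide)
    rw [e 9 (by decide) (by decide) (by decide), f1] at f3
    rw [e 10 (by decide) (by decide) (by decide), f2] at f4
    simp only [PathAt, spLen, spPath] at hπ₁ ⊢
    rw [f3, f4]
    exact hπ₁
  refine ⟨r, by omega, ?_, ?_⟩
  · intro N M hN hM
    refine hR N M hN (le_trans ?_ hM)
    change σ₄.nat rM 0 ≤ _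
    simpa [e] using hM₃
  refine Runs.seq ⟨σ₁, n₁, _, hx₁, (Nat.add_sub_cancel' (by omega)).le, ?_⟩
  refine Runs.seq ⟨σ₂, n₂, _, hx₂, (Nat.add_sub_cancel' (by omega)).le, ?_⟩
  refine Runs.seq ⟨σ₃, n₃, _, hx₃, (Nat.add_sub_cancel' (by omega)).le, ?_⟩
  refine Runs.seq (Runs.of_run 3 rfl (by decide) (by omega) ?_)
  refine Runs.seq (Runs.of_run 4 rfl (by decide) (by omega) ?_)
  refine Runs.seq (Runs.of_run 4 rfl (by decide) (by omega) ?_)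
  rw [← hσ₄]
  have hb : (BExp.natEq (var rFound) (.const 1)).cost = 4 := rfl
  by_cases hf : σ₅.nat rFound 0 = 1
  · obtain ⟨ρ, hρ, hρat, hnρ⟩ := hfound hf
    have hlen : ρ.length ≤ k := Nat.lt_succ_iff.1 hρ.1.1.length_lt
    -- Credits reserved after the RSP call: 5 for the test, then Stage 3, then 1 for the `skip` that
    -- ends a `block`.
    refine Runs.seq ⟨σ₅, n₅, 5 + (100 * (k * (Dn + 2) + 1)) + 1, hx₅, by omega, ?_⟩
    refine Runs.seq (Runs.ite (by omega) (fun _ => ?_) (fun h => absurd hf h))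
    rw [hb]
    have hle := Nat.mul_le_mul_right (Dn + 2) hlen
    have g : ∀ a ∈ [19, 20, 21, 22, 39, 42, 44], σ₅.nat a = σ₄.nat a := by
      intro a ha; refine hp₅.1 a ?_ ?_ <;> · revert a; decide
    refine ((((runs_stage3 (k := k) (D := Dn) (l := ρ.length) ?_ hρat.1 ?_).frame).add
      (1 + (5 + (100 * (k * (Dn + 2) + 1)) + 1 - (4 + 1) -
      (100 * (ρ.length * (Dn + 2) + 1)) - 1))).mono (by omega) ?_)
    · intro m hm
      have g' := hp₅.2 1 (by decide)
      simp [g, g'] at hm ⊢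
      exact hL₄ m hm
    · intro i hi
      simp only [rM]
      rw [g 19 (by decide), hρat.2 i hi]
      exact ρ[i].2
    · rintro τ _ ⟨j, ⟨-, ag⟩, rfl⟩
      refine Runs.skip (by omega) ?_
      have g1 := ag.1 9 (by decide)
      have g2 := ag.1 10 (by decide)
      simp only [PathAt, spLen, spPath] at hout ⊢
      rw [g1, g2]
      exact hout
  · refine Runs.seq ⟨σ₅, n₅, 5 + (100 * (k * (Dn + 2) + 1)) + 1, hx₅, by omega, ?_⟩
    refine Runs.seq (Runs.ite (by omega) (fun h => absurd h hf) (fun _ => ?_))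
    rw [hb]
    refine Runs.of_run 3 rfl (by decide) (by omega) (Runs.skip (by omega) ?_)
    simpa [PathAt, Cmd.run] using hout

/-- The running time of CT-QAMSC in terms of the running times of its subroutines. -/
theorem ctqamsc_exec {sp edsp rsp : Cmd} {SP D : ℕ → ℕ → ℝ} {R : ℕ → ℕ → ℕ → ℝ}
    (hsp : IsSPAlgorithm sp SP) (hed : IsEDSPAlgorithm edsp D) (hr : IsRSPAlgorithm rsp R)
    {G : Network} {s t : Fin G.N} {B : ℕ} {σ : State} (hst : s ≠ t) (hreach : ∃ π, G.IsPath s t π)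
    (hB : 1 ≤ B) (hσ : InputAt G s t B σ) :
    ∃ (π : List (Fin G.M)) (τ : State) (n r : ℕ),
      Exec (ctqamsc sp edsp rsp) σ τ n ∧ G.IsWeightShortest s t π ∧ PathAt τ spLen spPath π ∧
      1 ≤ π.length ∧ 1 ≤ SP G.N G.M ∧ 1 ≤ D G.N G.M ∧
      (∀ N M, π.length + 1 ≤ N → π.length ^ 2 + 2 * π.length ≤ M → (r : ℝ) ≤ R N M B) ∧
      (n : ℝ) ≤ 5000 * (SP G.N G.M + (π.length : ℝ) ^ 2 * D G.N G.M + r) := by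
  obtain ⟨h₀, hBσ⟩ := hσ
  have hσ₁ : NetworkAt G s t ((assign outFail (.const 0)).run σ) := by
    simpa [NetworkAt, Cmd.run] using h₀
  obtain ⟨σ₂, n₂, hx₂, hp₂, hres⟩ := hsp G s t _ hst hσ₁
  have h1 := hx₂.pos
  have h1' : (1 : ℝ) ≤ n₂ := by exact_mod_cast h1
  rcases hres with ⟨hf, π, hshort, hπ, hcost⟩ | ⟨-, hno, -⟩
  swap; · exact absurd hreach hno
  have hk : 1 ≤ π.length := List.length_pos_iff.2 (hshort.1.1.ne_nil hst)
  have h₂ : NetworkAt G s t σ₂ := by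
    have g : ∀ a < 8, σ₂.nat a = ((assign outFail (.const 0)).run σ).nat a := by
      intro a ha; refine hp₂.1 a (by simp [reserved]; omega) ?_
      simp; omega
    have g' := hp₂.2 0 (by decide)
    simp [NetworkAt] at hσ₁ ⊢
    simp [g, g']
    exact hσ₁
  have hB₂ : σ₂.nat inB 0 = B := by
    rw [hp₂.1 inB (by decide) (by decide)]; simpa [Cmd.run] using hBσ
  have hD1 := hed.one_le_floor hst h₂
  obtain ⟨r, hr1, hR, τ, n, k', hx, hn, hout⟩ := runs_stage12 hed hr hst hB h₂ hB₂ hshort.1 hπ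
  set k := π.length with hkdef
  set Dn := ⌊D G.N G.M⌋₊ with hDn
  obtain ⟨m₀, hm₀, hx₀⟩ := (assign outFail (.const 0)).exec_run rfl σ
  have hx' := Exec.seq hx₀ (Exec.seq hx₂ (Exec.seq (Exec.ite_true (b := .natEq (var spFound)
    (.const 1)) (d := assign outFail (.const 1)) hf hx) (.skip _)))
  have hDle : (Dn : ℝ) ≤ D G.N G.M := Nat.floor_le
    (zero_le_one.trans (Nat.floor_pos.1 hD1))
  refine ⟨π, τ, _, r, hx', hshort, hout, hk, ?_, ?_, hR, ?_⟩
  · have : (0 : ℝ) ≤ k := by positivity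
    linarith
  · have : (1 : ℝ) ≤ Dn := by exact_mod_cast hD1
    linarith
  · have e1 : (assign outFail (.const 0)).bound = 3 := rfl
    have e2 : (BExp.natEq (var spFound) (.const 1)).cost = 4 := rfl
    have hnat : m₀ + (n₂ + (4 + n + 1 + 1)) ≤ 5000 * (n₂ + k ^ 2 * Dn + r) := by
      rw [e1] at hm₀
      -- With `k = 1 + a` and `D = 1 + d` the claim compares polynomials in natural numbers. The
      -- dominating term is `250 (k+1)² (D+1)`, at most `2000 k² D`; the constant 5000 leaves room
      -- for the rest.
      obtain ⟨a, ha⟩ := Nat.exists_eq_add_of_le hk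
      obtain ⟨d, hd⟩ := Nat.exists_eq_add_of_le hD1
      rw [ha, hd] at hn ⊢
      nlinarith [Nat.zero_le (a * d), Nat.zero_le (a * a * d), Nat.zero_le (a * a)]
    have hcast : ((m₀ + (n₂ + (4 + n + 1 + 1)) : ℕ) : ℝ) ≤ 5000 * (n₂ + k ^ 2 * Dn + r) := by
      exact_mod_cast hnat
    rw [e2]
    refine hcast.trans ?_
    have h2 : (k : ℝ) ^ 2 * Dn ≤ (k : ℝ) ^ 2 * D G.N G.M :=
      mul_le_mul_of_nonneg_left hDle (by positivity)
    have : (0 : ℝ) ≤ k := by positivity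
    linarith

/-- The bound with `R(k, k²)`. -/
theorem ctqamsc_bounds {sp edsp rsp : Cmd} {SP D : ℕ → ℕ → ℝ} {R : ℕ → ℕ → ℕ → ℝ}
    (hsp : IsSPAlgorithm sp SP) (hed : IsEDSPAlgorithm edsp D) (hr : IsRSPAlgorithm rsp R)
    {G : Network} {s t : Fin G.N} {B : ℕ} {σ : State} (hst : s ≠ t) (hreach : ∃ π, G.IsPath s t π)
    (hB : 1 ≤ B) (hσ : InputAt G s t B σ) :
    ∃ (π : List (Fin G.M)) (τ : State) (n : ℕ),
      Exec (ctqamsc sp edsp rsp) σ τ n ∧ G.IsWeightShortest s t π ∧ PathAt τ spLen spPath π ∧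
      1 ≤ π.length ∧
      (n : ℝ) ≤ 5000 * (SP G.N G.M + (π.length : ℝ) ^ 2 * D G.N G.M +
        R (π.length + 1) (π.length ^ 2 + 2 * π.length) B) ∧
      ∀ L : ℝ, (∀ a b c : ℕ, 1 ≤ a → 1 ≤ b → 1 ≤ c → R (2 * a) (3 * b) c ≤ L * R a b c) →
        (n : ℝ) ≤ 5000 * (SP G.N G.M + (π.length : ℝ) ^ 2 * D G.N G.M +
          L * R π.length (π.length ^ 2) B) := by
  obtain ⟨π, τ, n, r, hx, hshort, hπ, hk, -, -, hR, hn⟩ := ctqamsc_exec hsp hed hr hst hreach hB hσ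
  refine ⟨π, τ, n, hx, hshort, hπ, hk, ?_, fun L hL => ?_⟩
  · have := hR _ _ le_rfl le_rfl
    linarith
  -- As `k ≥ 1`, `k + 1 ≤ 2k` and `k² + 2k ≤ 3k²`; this is the origin of the factors 2 and 3 in the
  -- condition on `L`.
  · have h1 := hR (2 * π.length) (3 * π.length ^ 2) (by omega) (by nlinarith)
    have h2 := hL π.length (π.length ^ 2) B hk (Nat.one_le_pow _ _ hk) hB
    linarith

end CTQAMSC

namespace CTQAMSC

attribute [local simp] inN inM inSrc inDst inW inS inT inB inP spFound spLen spPath edU edV edFound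
  edLen₁ edPath₁ edLen₂ edPath₂ rN rM rSrc rDst rTime rS rT rBound rLen rFound rPathLen rPath
  outFail outLen₁ outPath₁ outLen₂ outPath₂ ci cj ch cq node kind orig off₁ cnt₁ off₂ cnt₂ pool
  poolEnd wsum

/-! ### Walks -/

theorem isWalk_append {N M : ℕ} {src dst : Fin M → Fin N} {π₁ π₂ : List (Fin M)} {u v : Fin N} :
    IsWalk src dst u v (π₁ ++ π₂) ↔ ∃ x, IsWalk src dst u x π₁ ∧ IsWalk src dst x v π₂ := by
  induction π₁ generalizing u with
  | nil => simp [IsWalk]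
  | cons e π₁ ih => simp [IsWalk, ih, and_assoc]

theorem isWalk_concat {N M : ℕ} {src dst : Fin M → Fin N} {π : List (Fin M)} {e : Fin M}
    {u v : Fin N} :
    IsWalk src dst u v (π ++ [e]) ↔ IsWalk src dst u (src e) π ∧ dst e = v := by
  rw [isWalk_append]
  constructor
  · rintro ⟨x, h₁, h₂, h₃⟩
    subst h₂; exact ⟨h₁, h₃⟩
  · rintro ⟨h₁, h₂⟩
    exact ⟨_, h₁, rfl, h₂⟩

theorem isSimplePath_concat {N M : ℕ} {src dst : Fin M → Fin N} {π : List (Fin M)} {e : Fin M}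
    {u v : Fin N} (h : IsSimplePath src dst u (src e) π) (he : dst e = v)
    (hv : v ∉ u :: π.map dst) : IsSimplePath src dst u v (π ++ [e]) := by
  refine ⟨isWalk_concat.2 ⟨h.1, he⟩, ?_⟩
  have h2 := h.2
  rw [List.map_append, ← List.cons_append, List.nodup_append]
  refine ⟨h2, by simp, ?_⟩
  rintro a ha b hb rfl
  simp only [List.map_cons, List.map_nil, List.mem_singleton] at hb
  exact hv (by rw [← he, ← hb]; exact ha)

/-! ### The dynamic program for the Restricted Shortest Path problem

Entry `(b, v)` of the table describes a path of minimum length from `s` to `v` with time at most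
`b`: whether there is one (`fl b v = 1`), its length `dv b v`, and its last link `pa b v - 1`, or
`pa b v = 0` if the entry agrees with entry `(b - 1, v)`. -/

/-- This describes row `b + 1` when the links with index below `j` have been relaxed. The strict
inequality that closes `step`, namely that a last link is recorded only if it improves on the
previous row, is what makes traced paths simple even when links have length zero. -/
structure TableRow (I : RSPInstance) (fl : ℕ → ℕ → ℕ) (dv : ℕ → ℕ → ℝ) (pa : ℕ → ℕ → ℕ) (j b : ℕ) :
    Prop where
  mono : ∀ v : Fin I.N, fl b v = 1 → fl (b + 1) v = 1 ∧ dv (b + 1) v ≤ dv b v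
  relax : ∀ e : Fin I.M, e < j → I.time e ≤ b + 1 → fl (b + 1 - I.time e) (I.src e) = 1 →
    fl (b + 1) (I.dst e) = 1 ∧
      dv (b + 1) (I.dst e) ≤ dv (b + 1 - I.time e) (I.src e) + I.len e
  copy : ∀ v : Fin I.N, pa (b + 1) v = 0 → fl (b + 1) v = 1 →
    fl b v = 1 ∧ dv (b + 1) v = dv b v
  step : ∀ v : Fin I.N, pa (b + 1) v ≠ 0 → fl (b + 1) v = 1 → ∃ e : Fin I.M,
    pa (b + 1) v = e + 1 ∧ I.dst e = v ∧ I.time e ≤ b + 1 ∧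
    fl (b + 1 - I.time e) (I.src e) = 1 ∧
    dv (b + 1) v = dv (b + 1 - I.time e) (I.src e) + I.len e ∧
    (fl b v = 1 → dv (b + 1) v < dv b v)

structure TableBase (I : RSPInstance) (fl : ℕ → ℕ → ℕ) (dv : ℕ → ℕ → ℝ) : Prop where
  start : fl 0 I.s = 1 ∧ dv 0 I.s = 0
  other : ∀ v : Fin I.N, fl 0 v = 1 → v = I.s

/-- `π` is the path obtained by tracing back entry `(b, v)`. -/
inductive Trace (I : RSPInstance) (pa : ℕ → ℕ → ℕ) : ℕ → Fin I.N → List (Fin I.M) → Prop where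
  | nil (b : ℕ) : Trace I pa b I.s []
  | copy {b : ℕ} {v : Fin I.N} {π : List (Fin I.M)} : v ≠ I.s → pa (b + 1) v = 0 →
      Trace I pa b v π → Trace I pa (b + 1) v π
  | step {b : ℕ} {v : Fin I.N} {π : List (Fin I.M)} {e : Fin I.M} : v ≠ I.s →
      pa (b + 1) v = e + 1 → I.dst e = v → I.time e ≤ b + 1 →
      Trace I pa (b + 1 - I.time e) (I.src e) π → Trace I pa (b + 1) v (π ++ [e])

section Table

variable {I : RSPInstance} {fl : ℕ → ℕ → ℕ} {dv : ℕ → ℕ → ℝ} {pa : ℕ → ℕ → ℕ} {T : ℕ}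

theorem table_mono (hr : ∀ b < T, TableRow I fl dv pa I.M b) {v : Fin I.N} {b c : ℕ} (hbc : b ≤ c)
    (hc : c ≤ T) (h : fl b v = 1) : fl c v = 1 ∧ dv c v ≤ dv b v := by
  induction c, hbc using Nat.le_induction with
  | base => exact ⟨h, le_rfl⟩
  | succ c hbc ih =>
    obtain ⟨h₁, h₂⟩ := ih (by omega)
    obtain ⟨h₃, h₄⟩ := (hr c (by omega)).mono v h₁
    exact ⟨h₃, h₄.trans h₂⟩

theorem table_nonneg (h0 : TableBase I fl dv) (hr : ∀ b < T, TableRow I fl dv pa I.M b) {b : ℕ}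
    (hb : b ≤ T) : ∀ v : Fin I.N, fl b v = 1 → 0 ≤ dv b v := by
  induction b using Nat.strong_induction_on with
  | _ b ih =>
    intro v hv
    cases b with
    | zero => obtain rfl := h0.other v hv; exact h0.start.2.ge
    | succ b =>
      have R := hr b (by omega)
      by_cases hp : pa (b + 1) v = 0
      · obtain ⟨h₁, h₂⟩ := R.copy v hp hv
        rw [h₂]; exact ih b (by omega) (by omega) v h₁
      · obtain ⟨e, -, -, ht, hf, hd, -⟩ := R.step v hp hv
        rw [hd]
        have := I.time_pos e
        exact add_nonneg (ih _ (by omega) (by omega) _ hf) (I.len_nonneg e)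

/-- Simplicity rests on the last clause: every node `y` of the path has an entry at some budget `c ≤
b` that is no longer than the whole path. If `v` occurred on the path to the tail of its last link,
then by monotonicity entry `(b, v)` would be at most the new value, against the strict improvement.
Positive times make the recursion go to smaller budgets. -/
theorem table_path (h0 : TableBase I fl dv) (hr : ∀ b < T, TableRow I fl dv pa I.M b) {b : ℕ}
    (hb : b ≤ T) : ∀ v : Fin I.N, fl b v = 1 → ∃ π, Trace I pa b v π ∧
      IsSimplePath I.src I.dst I.s v π ∧ (π.map I.time).sum ≤ b ∧ (π.map I.len).sum = dv b v ∧
      ∀ y ∈ I.s :: π.map I.dst, ∃ c ≤ b, fl c y = 1 ∧ dv c y ≤ dv b v := by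
  induction b using Nat.strong_induction_on with
  | _ b ih =>
    intro v hv
    by_cases hs : v = I.s
    · subst hs
      -- The trace stops at the source for every budget, so the entry there must have length 0: it
      -- is nonnegative, and at most the entry for budget 0.
      have h₁ := table_nonneg h0 hr hb _ hv
      have h₂ := (table_mono hr (Nat.zero_le b) hb h0.start.1).2
      rw [h0.start.2] at h₂
      refine ⟨[], .nil b, ⟨rfl, by simp⟩, by simp, by simp; linarith, ?_⟩
      intro y hy
      obtain rfl : y = I.s := by simpa using hy
      exact ⟨b, le_rfl, hv, le_rfl⟩
    cases b with
    | zero => exact absurd (h0.other v hv) hs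
    | succ b =>
      have R := hr b (by omega)
      by_cases hp : pa (b + 1) v = 0
      · obtain ⟨h₁, h₂⟩ := R.copy v hp hv
        obtain ⟨π, t₁, t₂, t₃, t₄, t₅⟩ := ih b (by omega) (by omega) v h₁
        refine ⟨π, .copy hs hp t₁, t₂, by omega, by rw [h₂, t₄], fun y hy => ?_⟩
        obtain ⟨c, hc, h⟩ := t₅ y hy
        exact ⟨c, by omega, by rwa [h₂]⟩
      · obtain ⟨e, hpe, hde, ht, hf, hd, hlt⟩ := R.step v hp hv
        have htp := I.time_pos e
        have hle := I.len_nonneg e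
        obtain ⟨π, t₁, t₂, t₃, t₄, t₅⟩ := ih _ (by omega) (by omega) _ hf
        refine ⟨π ++ [e], .step hs hpe hde ht t₁, isSimplePath_concat t₂ hde ?_, ?_, ?_, ?_⟩
        · intro hmem
          obtain ⟨c, hc, h₁, h₂⟩ := t₅ v hmem
          obtain ⟨h₃, h₄⟩ := table_mono hr (show c ≤ b by omega) (by omega) h₁
          have := hlt h₃
          linarith
        · simp; omega
        · simp [t₄, hd]
        · intro y hy
          rw [List.map_append, ← List.cons_append, List.mem_append] at hy
          rcases hy with hy | hy
          · obtain ⟨c, hc, h₁, h₂⟩ := t₅ y hy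
            exact ⟨c, by omega, h₁, by linarith⟩
          · obtain rfl : y = I.dst e := by simpa using hy
            exact ⟨b + 1, le_rfl, by rwa [hde], by rw [hde]⟩

/-- Induction on the last link, with the budget lowered by its time. Walks with repeated nodes are
admitted, so simplicity plays no role in the lower bound. -/
theorem table_opt (h0 : TableBase I fl dv) (hr : ∀ b < T, TableRow I fl dv pa I.M b)
    (π : List (Fin I.M)) : ∀ (b : ℕ) (v : Fin I.N), b ≤ T → IsWalk I.src I.dst I.s v π →
      (π.map I.time).sum ≤ b → fl b v = 1 ∧ dv b v ≤ (π.map I.len).sum := by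
  induction π using List.reverseRecOn with
  | nil =>
    rintro b v hb rfl -
    have := table_mono hr (Nat.zero_le b) hb h0.start.1
    rw [h0.start.2] at this
    simpa using this
  | append_singleton π e ih =>
    intro b v hb hw ht
    obtain ⟨h₁, rfl⟩ := isWalk_concat.1 hw
    simp only [List.map_append, List.map_cons, List.map_nil, List.sum_append, List.sum_cons,
      List.sum_nil] at ht ⊢
    have htp := I.time_pos e
    obtain ⟨h₂, h₃⟩ := ih (b - I.time e) _ (by omega) h₁ (by omega)
    obtain ⟨b, rfl⟩ : ∃ c, b = c + 1 := ⟨b - 1, by omega⟩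
    obtain ⟨h₄, h₅⟩ := (hr b (by omega)).relax e e.2 (by omega) h₂
    exact ⟨h₄, by linarith⟩

end Table

/-! ### The program -/

/-- Relaxation of the link in variable `101` for the time bound in variable `100`. -/
def rspRelax : Cmd :=
  block [
    .ite (.natLe (.get rTime (var 101)) (var 100))
      (block [
        assign 105 (.plus (.get 104 (.minus (var 100) (.get rTime (var 101)))) (.get rSrc (var 101))),
        assign 106 (.plus (.get 104 (var 100)) (.get rDst (var 101))),
        .ite (.and (.natEq (.get 102 (var 105)) (.const 1))
            (.not (.and (.natEq (.get 102 (var 106)) (.const 1))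
              (.realLe (.get 100 (var 106)) (.plus (.get 100 (var 105)) (.get rLen (var 101)))))))
          (block [
            .setNat 102 (var 106) (.const 1),
            .setReal 100 (var 106) (.plus (.get 100 (var 105)) (.get rLen (var 101))),
            .setNat 103 (var 106) (.plus (var 101) (.const 1))])
          .skip]) .skip,
    incr 101]

def rspCopy : Cmd :=
  block [
    assign 105 (.plus (.get 104 (.minus (var 100) (.const 1))) (var 101)),
    assign 106 (.plus (.get 104 (var 100)) (var 101)),
    .setNat 102 (var 106) (.get 102 (var 105)),
    .setReal 100 (var 106) (.get 100 (var 105)),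
    .setNat 103 (var 106) (.const 0),
    incr 101]

/-- The machine cannot multiply, so array `104` tabulates the offsets `b * N` of the rows by
repeated addition. -/
def rspRow : Cmd :=
  block [
    .setNat 104 (var 100) (.plus (.get 104 (.minus (var 100) (.const 1))) (var rN)),
    assign 101 (.const 0),
    .loop (.natLt (var 101) (var rN)) rspCopy,
    assign 101 (.const 0),
    .loop (.natLt (var 101) (var rM)) rspRelax,
    incr 100]

def rspTable : Cmd :=
  block [
    .setNat 104 (.const 0) (.const 0),
    assign 101 (.const 0),
    .loop (.natLt (var 101) (var rN)) (block [.setNat 102 (var 101) (.const 0), incr 101]),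
    .setNat 102 (var rS) (.const 1),
    .setReal 100 (var rS) (.const 0),
    assign 100 (.const 1),
    .loop (.natLe (var 100) (var rBound)) rspRow]

/-- One step of the traceback; `105` is the node, `100` the time bound, `106` the length so far. -/
def rspBack : Cmd :=
  block [
    assign 107 (.get 103 (.plus (.get 104 (var 100)) (var 105))),
    .ite (.natEq (var 107) (.const 0))
      (assign 100 (.minus (var 100) (.const 1)))
      (block [
        assign 107 (.minus (var 107) (.const 1)),
        .setNat 108 (var 106) (var 107),
        incr 106,
        assign 105 (.get rSrc (var 107)),
        assign 100 (.minus (var 100) (.get rTime (var 107)))])]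

def rspMain : Cmd :=
  block [
    rspTable,
    .ite (.natEq (.get 102 (.plus (.get 104 (var rBound)) (var rT))) (.const 1))
      (block [
        assign 105 (var rT),
        assign 100 (var rBound),
        assign 106 (.const 0),
        .loop (.not (.natEq (var 105) (var rS))) rspBack,
        assign rPathLen (var 106),
        assign 101 (.const 0),
        .loop (.natLt (var 101) (var rPathLen)) (block [
          .setNat rPath (var 101) (.get 108 (.minus (.minus (var rPathLen) (.const 1)) (var 101))),
          incr 101]),
        assign rFound (.const 1)])
      (assign rFound (.const 0))]

/-- The table in memory. -/
def flAt (N : ℕ) (τ : State) (b v : ℕ) : ℕ := τ.nat 102 (b * N + v)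
def dvAt (N : ℕ) (τ : State) (b v : ℕ) : ℝ := τ.real 100 (b * N + v)
def paAt (N : ℕ) (τ : State) (b v : ℕ) : ℕ := τ.nat 103 (b * N + v)

@[simp] theorem flAt_setNat {N a i x : ℕ} (τ : State) (h : 102 ≠ a) :
    flAt N (τ.setNat a i x) = flAt N τ := by funext b v; simp [flAt, h]
@[simp] theorem dvAt_setNat {N a i x : ℕ} (τ : State) :
    dvAt N (τ.setNat a i x) = dvAt N τ := rfl
@[simp] theorem paAt_setNat {N a i x : ℕ} (τ : State) (h : 103 ≠ a) :
    paAt N (τ.setNat a i x) = paAt N τ := by funext b v; simp [paAt, h]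

theorem index_inj {N b c v w : ℕ} (hv : v < N) (hw : w < N) :
    b * N + v = c * N + w ↔ b = c ∧ v = w := by
  constructor
  · intro h
    have h₁ := congrArg (· / N) h
    have h₂ := congrArg (· % N) h
    have hN : 0 < N := by omega
    simp only [Nat.mul_add_mod', Nat.mod_eq_of_lt hv, Nat.mod_eq_of_lt hw] at h₂
    simp only [mul_comm _ N, Nat.mul_add_div hN, Nat.div_eq_of_lt hv, Nat.div_eq_of_lt hw] at h₁
    omega
  · rintro ⟨rfl, rfl⟩; rfl

theorem RSPAt.congr {I : RSPInstance} {σ τ : State} (h : RSPAt I σ)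
    (h₁ : ∀ a ∈ [18, 19, 20, 21, 22, 23, 24, 25], τ.nat a = σ.nat a) (h₂ : τ.real 1 = σ.real 1) :
    RSPAt I τ := by
  simp only [RSPAt, rN, rM, rSrc, rDst, rTime, rS, rT, rBound, rLen] at h ⊢
  rw [h₁ 18 (by decide), h₁ 19 (by decide), h₁ 20 (by decide), h₁ 21 (by decide),
    h₁ 22 (by decide), h₁ 23 (by decide), h₁ 24 (by decide), h₁ 25 (by decide), h₂]
  exact h

theorem TableRow.succ_skip {I : RSPInstance} {fl : ℕ → ℕ → ℕ} {dv : ℕ → ℕ → ℝ} {pa : ℕ → ℕ → ℕ}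
    {b : ℕ} {e : Fin I.M} (h : TableRow I fl dv pa e b)
    (he : I.time e ≤ b + 1 → fl (b + 1 - I.time e) (I.src e) = 1 → fl (b + 1) (I.dst e) = 1 ∧
      dv (b + 1) (I.dst e) ≤ dv (b + 1 - I.time e) (I.src e) + I.len e) :
    TableRow I fl dv pa (e + 1) b := by
  refine ⟨h.mono, fun e' he' ht hf => ?_, h.copy, h.step⟩
  rcases Nat.lt_succ_iff_lt_or_eq.1 he' with h' | h'
  · exact h.relax e' h' ht hf
  · obtain rfl := Fin.ext h'
    exact he ht hf

/-- Times are positive, so relaxations for row `b + 1` read rows up to `b` only, and overwriting an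
entry of row `b + 1` does not disturb what they read (`ot`). The entry becomes smaller, which
preserves earlier relaxations; being below its old value, it is also strictly below the entry of row
`b`, as `step` demands. -/
theorem TableRow.succ_update {I : RSPInstance} {fl fl' : ℕ → ℕ → ℕ} {dv dv' : ℕ → ℕ → ℝ}
    {pa pa' : ℕ → ℕ → ℕ} {b : ℕ} {e : Fin I.M} (h : TableRow I fl dv pa e b)
    (ht : I.time e ≤ b + 1) (hf : fl (b + 1 - I.time e) (I.src e) = 1)
    (hlt : ¬ (fl (b + 1) (I.dst e) = 1 ∧
      dv (b + 1) (I.dst e) ≤ dv (b + 1 - I.time e) (I.src e) + I.len e))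
    (hfl : ∀ c (v : Fin I.N), fl' c v = if c = b + 1 ∧ v = I.dst e then 1 else fl c v)
    (hdv : ∀ c (v : Fin I.N), dv' c v = if c = b + 1 ∧ v = I.dst e then
      dv (b + 1 - I.time e) (I.src e) + I.len e else dv c v)
    (hpa : ∀ c (v : Fin I.N), pa' c v = if c = b + 1 ∧ v = I.dst e then (e : ℕ) + 1 else pa c v) :
    TableRow I fl' dv' pa' (e + 1) b := by
  have o : ∀ c ≤ b, ∀ v : Fin I.N, fl' c v = fl c v ∧ dv' c v = dv c v := by
    intro c hc v
    rw [hfl, hdv, if_neg (by omega), if_neg (by omega)]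
    exact ⟨rfl, rfl⟩
  have ot : ∀ (e' : Fin I.M) (v : Fin I.N), fl' (b + 1 - I.time e') v = fl (b + 1 - I.time e') v ∧
      dv' (b + 1 - I.time e') v = dv (b + 1 - I.time e') v := by
    intro e' v
    have := I.time_pos e'
    exact o _ (by omega) v
  have hlt' : fl (b + 1) (I.dst e) = 1 →
      dv (b + 1 - I.time e) (I.src e) + I.len e < dv (b + 1) (I.dst e) :=
    fun h => not_le.1 fun h' => hlt ⟨h, h'⟩
  constructor
  · intro v hv
    rw [(o b le_rfl v).1] at hv
    obtain ⟨h₁, h₂⟩ := h.mono v hv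
    rw [(o b le_rfl v).2, hfl, hdv]
    split_ifs with hc
    · obtain ⟨-, rfl⟩ := hc
      exact ⟨rfl, (hlt' h₁).le.trans h₂⟩
    · exact ⟨h₁, h₂⟩
  · intro e' he' ht' hf'
    rw [(ot e' _).1] at hf'
    rw [(ot e' _).2, hfl, hdv]
    rcases Nat.lt_succ_iff_lt_or_eq.1 he' with h' | h'
    · obtain ⟨h₁, h₂⟩ := h.relax e' h' ht' hf'
      split_ifs with hc
      · rw [hc.2] at h₁ h₂
        exact ⟨rfl, (hlt' h₁).le.trans h₂⟩
      · exact ⟨h₁, h₂⟩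
    · obtain rfl := Fin.ext h'
      simp
  · intro v hp hv
    rw [hpa] at hp
    rw [hfl] at hv
    rw [(o b le_rfl v).1, (o b le_rfl v).2, hdv]
    split_ifs at hp hv ⊢ with hc
    exact h.copy v hp hv
  · intro v hp hv
    rw [hpa] at hp ⊢
    rw [hfl] at hv
    rw [(o b le_rfl v).1, (o b le_rfl v).2, hdv]
    split_ifs at hp hv ⊢ with hc
    · obtain ⟨-, rfl⟩ := hc
      refine ⟨e, rfl, rfl, ht, by rwa [(ot e _).1], by rw [(ot e _).2], fun hb => ?_⟩
      obtain ⟨h₁, h₂⟩ := h.mono _ hb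
      exact (hlt' h₁).trans_le h₂
    · obtain ⟨e', g₁, g₂, g₃, g₄, g₅, g₆⟩ := h.step v hp hv
      exact ⟨e', g₁, g₂, g₃, by rwa [(ot e' _).1], by rwa [(ot e' _).2], g₆⟩

/-- The entries of the table with index below `m` are the same in both states. -/
def SameTable (m : ℕ) (σ τ : State) : Prop :=
  ∀ i < m, τ.nat 102 i = σ.nat 102 i ∧ τ.real 100 i = σ.real 100 i ∧ τ.nat 103 i = σ.nat 103 i

theorem runs_rspRelax {I : RSPInstance} {σ : State} {b : ℕ} (e : Fin I.M) (hI : RSPAt I σ)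
    (hrow : ∀ c ≤ b + 1, σ.nat 104 c = c * I.N) (hb : σ.nat 100 0 = b + 1)
    (he : σ.nat 101 0 = e)
    (h : TableRow I (flAt I.N σ) (dvAt I.N σ) (paAt I.N σ) e b) :
    Runs rspRelax σ 90 (fun τ _ => SameTable ((b + 1) * I.N) σ τ ∧ τ.nat 101 0 = e + 1 ∧
      TableRow I (flAt I.N τ) (dvAt I.N τ) (paAt I.N τ) (e + 1) b) := by
  obtain ⟨hs, hd, ht, hl⟩ := hI.2.2.2.2.2 e
  simp only [rSrc, rDst, rTime, rLen] at hs hd ht hl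
  have hE := e.2
  have htp := I.time_pos e
  have hrow' := hrow (b + 1) le_rfl
  refine Runs.of_run 90 rfl (by decide) le_rfl ?_
  by_cases h₁ : I.time e ≤ b + 1
  · have hrow'' := hrow (b + 1 - I.time e) (by omega)
    by_cases h₂ : flAt I.N σ (b + 1 - I.time e) (I.src e) = 1 ∧
      ¬ (flAt I.N σ (b + 1) (I.dst e) = 1 ∧ dvAt I.N σ (b + 1) (I.dst e) ≤
        dvAt I.N σ (b + 1 - I.time e) (I.src e) + I.len e)
    · have h₃ := h₂
      simp only [flAt, dvAt] at h₃
      have hrun : rspRelax.run σ = (((((((σ.setNat 105 0 ((b + 1 - I.time e) * I.N + I.src e)).setNat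
          106 0 ((b + 1) * I.N + I.dst e)).setNat 102 ((b + 1) * I.N + I.dst e) 1)).setReal 100
          ((b + 1) * I.N + I.dst e)
          (σ.real 100 ((b + 1 - I.time e) * I.N + I.src e) + I.len e)).setNat 103
          ((b + 1) * I.N + I.dst e) (e + 1)).setNat 101 0 (e + 1)) := by
        simp [rspRelax, block, Cmd.run, hb, he, hs, hd, ht, hl, h₁, hrow', hrow'', h₃]
      rw [hrun]
      refine ⟨fun i hi => ?_, by simp, ?_⟩
      · simp [show i ≠ (b + 1) * I.N + I.dst e by omega]
      · refine h.succ_update h₁ h₂.1 h₂.2 ?_ ?_ ?_ <;> intro c v <;>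
          simp [flAt, dvAt, paAt, Function.update_apply, index_inj v.2 (I.dst e).2, Fin.ext_iff]
    · have hrun : rspRelax.run σ = ((σ.setNat 105 0 ((b + 1 - I.time e) * I.N + I.src e)).setNat
          106 0 ((b + 1) * I.N + I.dst e)).setNat 101 0 (e + 1) := by
        have h₃ := h₂
        simp only [flAt, dvAt] at h₃
        simp [rspRelax, block, Cmd.run, hb, he, hs, hd, ht, hl, h₁, hrow', hrow'']
        rw [if_neg]
        · simp [he]
        · simpa using h₃
      rw [hrun]
      refine ⟨fun i hi => by simp, by simp, ?_⟩
      refine TableRow.succ_skip (by simpa using h) fun _ hf => ?_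
      by_contra hn
      exact h₂ ⟨by simpa [flAt] using hf, by simpa [flAt, dvAt] using hn⟩
  · have hrun : rspRelax.run σ = σ.setNat 101 0 (e + 1) := by
      simp [rspRelax, block, Cmd.run, hb, he, ht, h₁]
    rw [hrun]
    refine ⟨fun i hi => by simp, by simp, ?_⟩
    exact TableRow.succ_skip (by simpa using h) fun h' => absurd h' h₁

/-- Copying row `b` with all predecessors 0 establishes `TableRow` with `j = 0`; every relaxed link
raises `j` by one. `SameTable` records that the finished rows are left alone. -/
theorem runs_rspRow {I : RSPInstance} {σ : State} {b : ℕ} (hI : RSPAt I σ)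
    (hrow : ∀ c ≤ b, σ.nat 104 c = c * I.N) (hb : σ.nat 100 0 = b + 1) :
    Runs rspRow σ (60 * I.N + 100 * I.M + 60) (fun τ _ => SameTable ((b + 1) * I.N) σ τ ∧
      RSPAt I τ ∧ τ.nat 100 0 = b + 2 ∧ (∀ c ≤ b + 1, τ.nat 104 c = c * I.N) ∧
      TableRow I (flAt I.N τ) (dvAt I.N τ) (paAt I.N τ) I.M b) := by
  have hN := hI.1
  have hM := hI.2.1
  simp only [rN, rM] at hN hM
  refine Runs.seq (Runs.of_run 12 rfl (by decide) (by omega) ?_)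
  refine Runs.seq (Runs.of_run 3 rfl (by decide) (by omega) ?_)
  obtain ⟨σ₁, hσ₁⟩ : ∃ σ₁, σ₁ = (assign 101 (.const 0)).run ((Cmd.setNat 104 (var 100)
    (.plus (.get 104 (.minus (var 100) (.const 1))) (var rN))).run σ) := ⟨_, rfl⟩
  rw [← hσ₁]
  have hI₁ : RSPAt I σ₁ := by
    refine hI.congr (fun a ha => ?_) (by simp [hσ₁, Cmd.run])
    have : a ≠ 104 ∧ a ≠ 101 := by revert a; decide
    simp [hσ₁, Cmd.run, this]
  have hrow₁ : ∀ c ≤ b + 1, σ₁.nat 104 c = c * I.N := by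
    intro c hc
    simp [hσ₁, Cmd.run, hb, Function.update_apply, hN, hrow b le_rfl]
    split_ifs with h
    · subst h; ring
    · exact hrow c (by omega)
  have hb₁ : σ₁.nat 100 0 = b + 1 := by simp [hσ₁, Cmd.run, hb]
  have hs₁ : SameTable ((b + 1) * I.N) σ σ₁ := by simp [SameTable, hσ₁, Cmd.run]
  refine Runs.seq (Runs.count I.N 50 (fun j τ => SameTable ((b + 1) * I.N) σ τ ∧ τ.nat 101 0 = j ∧
    ∀ v < j, flAt I.N τ (b + 1) v = flAt I.N τ b v ∧ dvAt I.N τ (b + 1) v = dvAt I.N τ b v ∧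
      paAt I.N τ (b + 1) v = 0) ⟨hs₁, by simp [hσ₁, Cmd.run], by simp⟩ ?_ ?_ ?_ ?_)
  · simp only [BExp.cost, NExp.cost, var]; omega
  · rintro j τ hj hτ ⟨-, h, -⟩
    have e := hτ.1 18 (by decide)
    have := hI₁.1
    simp only [rN] at this
    simp [e, this, h]
  · rintro j τ hj hτ ⟨h₁, h₂, h₃⟩
    have e1 : τ.nat 104 = σ₁.nat 104 := hτ.1 104 (by decide)
    have e2 : τ.nat 100 = σ₁.nat 100 := hτ.1 100 (by decide)
    refine Runs.of_run 50 rfl (by decide) le_rfl ?_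
    have hrun : rspCopy.run τ = (((((τ.setNat 105 0 (b * I.N + j)).setNat 106 0
        ((b + 1) * I.N + j)).setNat 102 ((b + 1) * I.N + j) (τ.nat 102 (b * I.N + j))).setReal 100
        ((b + 1) * I.N + j) (τ.real 100 (b * I.N + j))).setNat 103 ((b + 1) * I.N + j) 0).setNat
        101 0 (j + 1) := by
      simp [rspCopy, block, Cmd.run, e1, e2, hb₁, h₂, hrow₁ (b + 1) le_rfl, hrow₁ b (by omega)]
    rw [hrun]
    have hne : ∀ i < (b + 1) * I.N, i ≠ (b + 1) * I.N + j := by intro i hi; omega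
    refine ⟨fun i hi => ?_, by simp, fun v hv => ?_⟩
    · simpa [hne i hi] using h₁ i hi
    · have hvN : b * I.N + v < (b + 1) * I.N := by rw [Nat.succ_mul]; omega
      simp [flAt, dvAt, paAt, Function.update_apply, hne _ hvN]
      split_ifs with h
      · subst h; simp
      · have := h₃ v (by omega)
        simp only [flAt, dvAt, paAt] at this
        exact ⟨this.1, this.2.1, fun _ => this.2.2⟩
  rintro σ₂ hτ ⟨h₁, h₂, h₃⟩
  have a2 : ∀ a, a ∉ [105, 106, 102, 103, 101] → σ₂.nat a = σ₁.nat a := fun a ha => hτ.1 a ha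
  have a2' : σ₂.real 1 = σ₁.real 1 := hτ.2 1 (by decide)
  simp only [BExp.cost, NExp.cost, var]
  refine Runs.seq (Runs.of_run 3 rfl (by decide) (by omega) ?_)
  obtain ⟨σ₃, hσ₃⟩ : ∃ σ₃, σ₃ = (assign 101 (.const 0)).run σ₂ := ⟨_, rfl⟩
  rw [← hσ₃]
  have hI₃ : RSPAt I σ₃ := by
    refine hI₁.congr (fun a ha => ?_) (by simp [hσ₃, Cmd.run, a2'])
    have h : a ∉ [105, 106, 102, 103, 101] ∧ a ≠ 101 := by revert a; decide
    simp [hσ₃, Cmd.run, h.2, a2 a h.1]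
  have hrow₃ : ∀ c ≤ b + 1, σ₃.nat 104 c = c * I.N := by
    intro c hc
    simp [hσ₃, Cmd.run, a2, hrow₁ c hc]
  have hb₃ : σ₃.nat 100 0 = b + 1 := by simp [hσ₃, Cmd.run, a2, hb₁]
  refine Runs.seq (Runs.count I.M 90 (fun j τ => SameTable ((b + 1) * I.N) σ τ ∧ τ.nat 101 0 = j ∧
    TableRow I (flAt I.N τ) (dvAt I.N τ) (paAt I.N τ) j b) ⟨?_, by simp [hσ₃, Cmd.run], ?_⟩
    ?_ ?_ ?_ ?_)
  · simpa [SameTable, hσ₃, Cmd.run] using h₁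
  · have h₃' : ∀ v : Fin I.N, flAt I.N σ₃ (b + 1) v = flAt I.N σ₃ b v ∧
        dvAt I.N σ₃ (b + 1) v = dvAt I.N σ₃ b v ∧ paAt I.N σ₃ (b + 1) v = 0 := by
      intro v
      simpa [flAt, dvAt, paAt, hσ₃, Cmd.run] using h₃ v v.2
    refine ⟨fun v hv => ?_, fun e he => absurd he (by omega), fun v _ hv => ?_, fun v hv => ?_⟩
    · rw [(h₃' v).1, (h₃' v).2.1]; exact ⟨hv, le_rfl⟩
    · rw [(h₃' v).1] at hv
      exact ⟨hv, (h₃' v).2.1⟩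
    · exact absurd (h₃' v).2.2 hv
  · simp only [BExp.cost, NExp.cost, var]; omega
  · rintro j τ hj hτ ⟨-, h, -⟩
    have e := hτ.1 19 (by decide)
    have := hI₃.2.1
    simp only [rM] at this
    simp [e, this, h]
  · rintro j τ hj hτ ⟨g₁, g₂, g₃⟩
    have a3 : ∀ a, a ∉ [105, 106, 102, 103, 101] → τ.nat a = σ₃.nat a := fun a ha => hτ.1 a (by
      have : rspRelax.writes = [105, 106, 102, 103, 101] := rfl
      rwa [this])
    have a3' : τ.real 1 = σ₃.real 1 := hτ.2 1 (by decide)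
    refine (runs_rspRelax ⟨j, hj⟩ (hI₃.congr (fun a ha => a3 a ?_) a3') ?_ ?_ g₂ g₃).mono le_rfl ?_
    · revert a; decide
    · intro c hc; rw [a3 104 (by decide)]; exact hrow₃ c hc
    · rw [a3 100 (by decide)]; exact hb₃
    · rintro υ _ ⟨k₁, k₂, k₃⟩
      refine ⟨fun i hi => ?_, k₂, k₃⟩
      obtain ⟨l₁, l₂, l₃⟩ := k₁ i hi
      rw [l₁, l₂, l₃]; exact g₁ i hi
  · rintro τ hτ ⟨g₁, g₂, g₃⟩
    have a3 : ∀ a, a ∉ [105, 106, 102, 103, 101] → τ.nat a = σ₃.nat a := fun a ha => hτ.1 a (by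
      have : rspRelax.writes = [105, 106, 102, 103, 101] := rfl
      rwa [this])
    have a3' : τ.real 1 = σ₃.real 1 := hτ.2 1 (by decide)
    simp only [BExp.cost, NExp.cost, var]
    refine Runs.seq (Runs.of_run 6 rfl (by decide) (by omega) (Runs.skip (by omega) ?_))
    refine ⟨by simpa [SameTable, Cmd.run] using g₁, hI₃.congr (fun a ha => ?_)
      (by simp [Cmd.run, a3']), by simp [Cmd.run, a3, hb₃], ?_, ?_⟩
    · have h : a ∉ [105, 106, 102, 103, 101] ∧ a ≠ 100 := by revert a; decide
      simp [Cmd.run, h.2, a3 a h.1]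
    · intro c hc
      simp [Cmd.run, a3, hrow₃ c hc]
    · simpa [Cmd.run] using g₃

theorem TableRow.congr {I : RSPInstance} {fl fl' : ℕ → ℕ → ℕ} {dv dv' : ℕ → ℕ → ℝ}
    {pa pa' : ℕ → ℕ → ℕ} {j b : ℕ} (h : TableRow I fl dv pa j b)
    (he : ∀ c ≤ b + 1, ∀ v : Fin I.N, fl' c v = fl c v ∧ dv' c v = dv c v ∧ pa' c v = pa c v) :
    TableRow I fl' dv' pa' j b := by
  have o := fun v => he b (by omega) v
  have p := fun v => he (b + 1) le_rfl v
  have q := fun (e : Fin I.M) v => he (b + 1 - I.time e) (by omega) v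
  constructor
  · intro v
    rw [(o v).1, (o v).2.1, (p v).1, (p v).2.1]; exact h.mono v
  · intro e
    rw [(q e _).1, (q e _).2.1, (p _).1, (p _).2.1]; exact h.relax e
  · intro v
    rw [(o v).1, (o v).2.1, (p v).1, (p v).2.1, (p v).2.2]; exact h.copy v
  · intro v
    rw [(o v).1, (o v).2.1, (p v).1, (p v).2.1, (p v).2.2]
    intro h₁ h₂
    obtain ⟨e, g⟩ := h.step v h₁ h₂
    exact ⟨e, by rwa [(q e _).1, (q e _).2.1]⟩

theorem SameTable.entry {N m : ℕ} {σ τ : State} (h : SameTable (m * N) σ τ) {c v : ℕ} (hc : c < m)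
    (hv : v < N) : flAt N τ c v = flAt N σ c v ∧ dvAt N τ c v = dvAt N σ c v ∧
      paAt N τ c v = paAt N σ c v := by
  refine h _ ?_
  calc c * N + v < (c + 1) * N := by rw [Nat.succ_mul]; omega
    _ ≤ m * N := Nat.mul_le_mul_right _ hc

theorem runs_rspTable {I : RSPInstance} {σ : State} (hI : RSPAt I σ) :
    Runs rspTable σ (30 * I.N + 60 + I.T * (60 * I.N + 100 * I.M + 70)) (fun τ _ =>
      RSPAt I τ ∧ (∀ c ≤ I.T, τ.nat 104 c = c * I.N) ∧ TableBase I (flAt I.N τ) (dvAt I.N τ) ∧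
      ∀ b < I.T, TableRow I (flAt I.N τ) (dvAt I.N τ) (paAt I.N τ) I.M b) := by
  have hN := hI.1
  have hs := hI.2.2.1
  have hT := hI.2.2.2.2.1
  simp only [rN, rS, rBound] at hN hs hT
  refine Runs.seq (Runs.of_run 3 rfl (by decide) (by omega) ?_)
  refine Runs.seq (Runs.of_run 3 rfl (by decide) (by omega) ?_)
  refine Runs.seq (Runs.count I.N 15 (fun j τ => τ.nat 101 0 = j ∧ ∀ v < j, τ.nat 102 v = 0)
    ⟨by simp [Cmd.run], by simp⟩ ?_ ?_ ?_ ?_)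
  · simp only [BExp.cost, NExp.cost, var]; omega
  · rintro j τ hj hτ ⟨h, -⟩
    have e := hτ.1 18 (by decide)
    simp [Cmd.run, hN] at e
    simp [e, h, hN]
  · rintro j τ hj hτ ⟨h₁, h₂⟩
    refine Runs.of_run 15 rfl (by decide) le_rfl ⟨by simp [Cmd.run, block, h₁], fun v hv => ?_⟩
    simp [Cmd.run, block, h₁, Function.update_apply]
    intro h
    exact h₂ v (by omega)
  rintro τ hτ ⟨h₁, h₂⟩
  have a1 : ∀ a, a ≠ 101 → a ≠ 102 → a ≠ 104 → τ.nat a = σ.nat a := by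
    intro a h h' h''
    rw [hτ.1 a (by simp [Cmd.writes, block, *])]
    simp [Cmd.run, *]
  have a2 : τ.real = σ.real := by
    funext a; rw [hτ.2 a (by simp [Cmd.realWrites, block])]; simp [Cmd.run]
  have a3 : τ.nat 104 0 = 0 := by
    rw [hτ.1 104 (by decide)]; simp [Cmd.run]
  simp only [BExp.cost, NExp.cost, var]
  refine Runs.seq (Runs.of_run 4 rfl (by decide) (by omega) ?_)
  refine Runs.seq (Runs.of_run 4 rfl (by decide) (by omega) ?_)
  refine Runs.seq (Runs.of_run 3 rfl (by decide) (by omega) ?_)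
  obtain ⟨σ₁, hσ₁⟩ : ∃ σ₁, σ₁ = (assign 100 (.const 1)).run ((Cmd.setReal 100 (.get rS (.const 0))
    (.const 0)).run ((Cmd.setNat 102 (.get rS (.const 0)) (.const 1)).run τ)) := ⟨_, rfl⟩
  rw [← hσ₁]
  refine Runs.seq (Runs.count I.T (60 * I.N + 100 * I.M + 60) (fun b τ => RSPAt I τ ∧
    τ.nat 100 0 = b + 1 ∧ (∀ c ≤ b, τ.nat 104 c = c * I.N) ∧
    TableBase I (flAt I.N τ) (dvAt I.N τ) ∧
    ∀ c < b, TableRow I (flAt I.N τ) (dvAt I.N τ) (paAt I.N τ) I.M c) ⟨?_, ?_, ?_, ?_, ?_⟩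
    ?_ ?_ ?_ ?_)
  · refine hI.congr (fun a ha => ?_) (by simp [hσ₁, Cmd.run, a2])
    have h : a ≠ 100 ∧ a ≠ 101 ∧ a ≠ 102 ∧ a ≠ 104 := by revert a; decide
    simp [hσ₁, Cmd.run, h, a1 a]
  · simp [hσ₁, Cmd.run]
  · intro c hc
    obtain rfl : c = 0 := by omega
    simp [hσ₁, Cmd.run, a3]
  · refine ⟨⟨by simp [flAt, hσ₁, Cmd.run, a1, hs], by simp [dvAt, hσ₁, Cmd.run, a1, hs]⟩, ?_⟩
    intro v hv
    by_contra hne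
    have : (v : ℕ) ≠ I.s := fun h => hne (Fin.ext h)
    simp [flAt, hσ₁, Cmd.run, a1, hs, this, h₂ v v.2] at hv
  · simp
  · simp only [BExp.cost, NExp.cost, var]; ring_nf; omega
  · rintro j υ hj - ⟨g₁, g₂, -⟩
    have := g₁.2.2.2.2.1
    simp only [rBound] at this
    simp [g₂, this]
  · rintro b υ hb - ⟨g₁, g₂, g₃, g₄, g₅⟩
    refine (runs_rspRow g₁ g₃ g₂).mono le_rfl ?_
    rintro φ _ ⟨k₁, k₂, k₃, k₄, k₅⟩
    refine ⟨k₂, k₃, k₄, ⟨?_, fun v => ?_⟩, fun c hc => ?_⟩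
    · have := k₁.entry (Nat.succ_pos b) I.s.2
      rw [this.1, this.2.1]; exact g₄.start
    · rw [(k₁.entry (Nat.succ_pos b) v.2).1]; exact g₄.other v
    · rcases Nat.lt_succ_iff_lt_or_eq.1 hc with hc | rfl
      · exact (g₅ c hc).congr fun c' hc' v => k₁.entry (by omega) v.2
      · exact k₅
  · rintro υ - ⟨g₁, -, g₃, g₄, g₅⟩
    refine Runs.skip ?_ ⟨g₁, g₃, g₄, g₅⟩
    simp only [BExp.cost, NExp.cost, var]; ring_nf; omega

/-- Every link uses up at least one unit of the budget. This bounds the cost of reversing and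
delivering the path by `O(T)`. -/
theorem Trace.length_le {I : RSPInstance} {pa : ℕ → ℕ → ℕ} {b : ℕ} {v : Fin I.N}
    {π : List (Fin I.M)} (h : Trace I pa b v π) : π.length ≤ b := by
  induction h with
  | nil => simp
  | copy _ _ _ ih => omega
  | @step b v π e _ _ _ _ _ ih =>
    have := I.time_pos e
    simp; omega

theorem runs_rspMain {I : RSPInstance} {σ : State} (hI : RSPAt I σ) :
    Runs rspMain σ (30 * I.N + 150 + I.T * (60 * I.N + 100 * I.M + 170)) (fun τ k' =>
      (τ.nat rFound 0 = 1 ∧ ∃ π, I.IsSolution π ∧ PathAt τ rPathLen rPath π ∧ π.length ≤ k') ∨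
        (τ.nat rFound 0 = 0 ∧ ¬ ∃ π, I.IsFeasible π)) := by
  refine Runs.seq (((runs_rspTable hI).add (90 + I.T * 100)).mono (by ring_nf; omega) ?_)
  rintro σ₁ _ ⟨k₁, ⟨hI₁, hrow, hbase, hrows⟩, rfl⟩
  have hs := hI₁.2.2.1
  have ht := hI₁.2.2.2.1
  have hT := hI₁.2.2.2.2.1
  simp only [rT, rS, rBound] at ht hs hT
  have hTrow := hrow I.T le_rfl
  refine Runs.seq (Runs.ite (by simp only [BExp.cost, NExp.cost, var]; omega) (fun h => ?_)
    (fun h => ?_))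
  · have hfl : flAt I.N σ₁ I.T I.t = 1 := by
      simpa [hT, ht, hTrow, flAt] using h
    obtain ⟨π, hπ₁, hπ₂, hπ₃, hπ₄, -⟩ := table_path hbase hrows le_rfl I.t hfl
    have hsol : I.IsSolution π := by
      refine ⟨⟨hπ₂, hπ₃⟩, fun π' hπ' => ?_⟩
      rw [hπ₄]
      exact (table_opt hbase hrows π' I.T I.t le_rfl hπ'.1.1 hπ'.2).2
    have hlen := hπ₁.length_le
    simp only [BExp.cost, NExp.cost, var]
    refine Runs.seq (Runs.of_run 4 rfl (by decide) (by omega) ?_)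
    refine Runs.seq (Runs.of_run 4 rfl (by decide) (by omega) ?_)
    refine Runs.seq (Runs.of_run 3 rfl (by decide) (by omega) ?_)
    -- `ρ` remains to be traced, while `suf` is already stored in reverse order. Every round lowers
    -- the budget `b`, so `60 * b` pays for the rounds; `30 * I.T` is set aside for reversing the
    -- list and delivering it.
    refine Runs.seq (Runs.loop (fun τ k' => ∃ (b : ℕ) (v : Fin I.N) (ρ suf : List (Fin I.M)),
      Trace I (paAt I.N σ₁) b v ρ ∧ b ≤ I.T ∧ π = ρ ++ suf ∧ τ.nat 105 0 = v ∧ τ.nat 100 0 = b ∧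
      τ.nat 106 0 = suf.length ∧ (∀ (i : ℕ) (h : i < suf.reverse.length),
        τ.nat 108 i = suf.reverse[i]) ∧ 40 + 30 * I.T + 60 * b ≤ k') ?_ ?_ ?_)
    · refine ⟨I.T, I.t, π, [], hπ₁, le_rfl, by simp, ?_, ?_, ?_, by simp, by omega⟩ <;>
        simp [Cmd.run, ht, hT]
    · rintro τ k' hτ ⟨b, v, ρ, suf, htr, hbT, hπ, hv, hb, hsuf, harr, hk⟩ hne
      have a1 : ∀ a, a ∉ [107, 100, 108, 106, 105] → τ.nat a = σ₁.nat a := by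
        intro a ha
        rw [hτ.1 a (by
          have : rspBack.writes = [107, 100, 107, 108, 106, 105, 100] := rfl
          rw [this]; simp at ha ⊢; tauto)]
        simp only [List.mem_cons, not_or] at ha
        simp [Cmd.run, ha]
      have hne' : v ≠ I.s := by
        rintro rfl
        simp [hv, a1, hs] at hne
      have hrowb := hrow b hbT
      refine ⟨k' - 8, by simp only [BExp.cost, NExp.cost, var]; omega, ?_⟩
      cases htr with
      | nil => exact absurd rfl hne'
      | @copy b _ _ _ hp htr =>
        refine Runs.of_run 50 rfl (by decide) (by omega) ?_
        simp only [paAt] at hp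
        have hrun : rspBack.run τ = (τ.setNat 107 0 0).setNat 100 0 b := by
          simp [rspBack, block, Cmd.run, a1, hb, hv, hrowb, hp]
        rw [hrun]
        exact ⟨b, v, ρ, suf, htr, by omega, hπ, by simpa using hv, by simp, by simpa using hsuf,
          by simpa using harr, by omega⟩
      | @step b _ ρ e _ hp hd hte htr =>
        have htp := I.time_pos e
        have hsrc := (hI₁.2.2.2.2.2 e).1
        have htime := (hI₁.2.2.2.2.2 e).2.2.1
        simp only [rSrc, rTime] at hsrc htime
        refine Runs.of_run 50 rfl (by decide) (by omega) ?_
        simp only [paAt] at hp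
        have hrun : rspBack.run τ = (((((τ.setNat 107 0 (e + 1)).setNat 107 0 e).setNat 108
            suf.length e).setNat 106 0 (suf.length + 1)).setNat 105 0 (I.src e)).setNat 100 0
            (b + 1 - I.time e) := by
          simp [rspBack, block, Cmd.run, a1, hb, hv, hrowb, hp, hsuf, hsrc, htime]
        rw [hrun]
        refine ⟨_, _, ρ, e :: suf, htr, by omega, by rw [hπ]; simp, by simp, by simp, by simp, ?_,
          by omega⟩
        intro i hi
        simp only [List.reverse_cons, List.length_append, List.length_reverse,
          List.length_singleton] at hi
        rcases Nat.lt_succ_iff_lt_or_eq.1 hi with hi' | rfl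
        · have := harr i (by simpa using hi')
          simp only [List.reverse_cons]
          rw [List.getElem_append_left (by simpa using hi')]
          simpa [Function.update_of_ne hi'.ne] using this
        · simp
    · rintro τ k' hτ ⟨b, v, ρ, suf, htr, hbT, hπ, hv, hb, hsuf, harr, hk⟩ hne
      refine ⟨40 + 30 * I.T - 8, by simp only [BExp.cost, NExp.cost, var]; omega, ?_⟩
      have a1 : τ.nat 23 = σ₁.nat 23 := by
        rw [hτ.1 23 (by decide)]; simp [Cmd.run]
      have hvs : v = I.s := by
        simp [hv, a1, hs] at hne
        exact Fin.ext hne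
      subst hvs
      have hρ : ρ = [] := by
        cases htr with
        | nil => rfl
        | copy h => exact absurd rfl h
        | step h => exact absurd rfl h
      subst hρ
      obtain rfl : π = suf := by simpa using hπ
      refine Runs.seq (Runs.of_run 4 rfl (by decide) (by omega) ?_)
      refine Runs.seq (Runs.of_run 3 rfl (by decide) (by omega) ?_)
      refine Runs.seq (Runs.count π.length 20 (fun j τ => τ.nat 101 0 = j ∧
        ∀ (i : ℕ) (h : i < π.length), i < j → τ.nat 28 i = π[i]) ⟨by simp [Cmd.run], by simp⟩
        ?_ ?_ ?_ ?_)
      · simp only [BExp.cost, NExp.cost, var]; omega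
      · rintro j υ hj hυ ⟨h, -⟩
        have e := hυ.1 27 (by decide)
        simp [Cmd.run, hsuf] at e
        simp [e, h]
      · rintro j υ hj hυ ⟨h₁, h₂⟩
        have e1 := hυ.1 27 (by decide)
        have e2 := hυ.1 108 (by decide)
        simp [Cmd.run, hsuf] at e1 e2
        refine Runs.of_run 20 rfl (by decide) le_rfl ⟨by simp [Cmd.run, block, h₁], ?_⟩
        intro i hi hij
        have := harr (π.length - 1 - j) (by simp; omega)
        simp [Cmd.run, block, h₁, e1, e2, this, Function.update_apply]
        split_ifs with h
        · subst h
          congr 2; omega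
        · exact h₂ i hi (by omega)
      · rintro υ hυ ⟨h₁, h₂⟩
        have e1 := hυ.1 27 (by decide)
        simp [Cmd.run, hsuf] at e1
        simp only [BExp.cost, NExp.cost, var]
        refine Runs.seq (Runs.of_run 3 rfl (by decide) (by omega) (Runs.skip (by omega)
          (Runs.skip (by omega) ?_)))
        refine Or.inl ⟨by simp [Cmd.run], π, hsol, ⟨by simp [Cmd.run, e1], ?_⟩, by omega⟩
        intro i hi
        simpa [Cmd.run] using h₂ i hi hi
  · simp only [BExp.cost, NExp.cost, var]
    refine Runs.of_run 3 rfl (by decide) (by omega) (Runs.skip (by omega) (Or.inr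
      ⟨by simp [Cmd.run], ?_⟩))
    rintro ⟨π, hπ⟩
    have := (table_opt hbase hrows π I.T I.t le_rfl hπ.1.1 hπ.2).1
    refine h ?_
    simpa [hT, ht, hTrow, flAt] using this

theorem isRSPAlgorithm_rspMain : IsRSPAlgorithm rspMain (fun N M T => 600 * (M * N * T)) := by
  intro I N M σ hN hM hI
  obtain ⟨τ, n, k', hx, hn, h⟩ := runs_rspMain hI
  have hb : 30 * I.N + 150 + I.T * (60 * I.N + 100 * I.M + 170) ≤ 600 * (M * N * I.T) := by
    have h1 := I.M_pos
    have h2 := I.T_pos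
    have h3 : 1 ≤ I.N := by have := I.s.2; omega
    calc 30 * I.N + 150 + I.T * (60 * I.N + 100 * I.M + 170) ≤ 600 * (I.M * I.N * I.T) := by
          obtain ⟨a, ha⟩ := Nat.exists_eq_add_of_le h1
          obtain ⟨b, hb⟩ := Nat.exists_eq_add_of_le h2
          obtain ⟨c, hc⟩ := Nat.exists_eq_add_of_le h3
          rw [ha, hb, hc]
          nlinarith [Nat.zero_le (a * b), Nat.zero_le (a * c), Nat.zero_le (b * c),
            Nat.zero_le (a * b * c)]
      _ ≤ 600 * (M * N * I.T) := by gcongr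
  refine ⟨τ, n, hx, hx.agree.preserves _ (by decide) (by decide), ?_⟩
  rcases h with ⟨hf, π, hs, hπ, hk⟩ | ⟨hf, hno⟩
  · refine Or.inl ⟨hf, π, hs, hπ, ?_⟩
    have : n + π.length ≤ 600 * (M * N * I.T) := by omega
    beta_reduce; exact_mod_cast this
  · refine Or.inr ⟨hf, hno, ?_⟩
    have : n ≤ 600 * (M * N * I.T) := by omega
    beta_reduce; exact_mod_cast this

end CTQAMSC

namespace CTQAMSC

/-! ### Hollow heaps

A node of the heap holds an item with a key and has a rank; it is hollow (not full) if its item has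
been deleted or moved to another node. -/

@[ext] structure HNode where
  id : ℕ
  item : ℕ
  key : ℕ
  rank : ℕ
  full : Bool

/-- A forest, given by its first root, the children of that root, and the other trees. -/
inductive Forest where
  | nil
  | node (d : HNode) (c s : Forest)

/-- The memory of a heap: heads of the lists of roots, items, ranks, first children, next siblings
of the nodes; current nodes and keys of the items. -/
structure HMem where
  H : ℕ → ℕ
  it : ℕ → ℕ
  rk : ℕ → ℕ
  ch : ℕ → ℕ
  nx : ℕ → ℕ
  nod : ℕ → ℕ
  dist : ℕ → ℕ

/-- The two memories agree on node `v`. -/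
def HMem.SameAt (m m' : HMem) (v : ℕ) : Prop :=
  m'.it v = m.it v ∧ m'.rk v = m.rk v ∧ m'.ch v = m.ch v ∧ m'.nx v = m.nx v

namespace Forest

def hd : Forest → ℕ
  | nil => 0
  | node d _ _ => d.id

def Mem (e : HNode) : Forest → Prop
  | nil => False
  | node d c s => e = d ∨ Mem e c ∨ Mem e s

/-- The number of nodes with name `v`. -/
def cnt (v : ℕ) : Forest → ℕ
  | nil => 0
  | node d c s => (if d.id = v then 1 else 0) + cnt v c + cnt v s

def size : Forest → ℕ
  | nil => 0
  | node _ c s => 1 + size c + size s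

/-- The number of trees. -/
def trees : Forest → ℕ
  | nil => 0
  | node _ _ s => 1 + trees s

def Ptr (m : HMem) : Forest → Prop
  | nil => True
  | node d c s => d.id ≠ 0 ∧ m.it d.id = d.item ∧ m.rk d.id = d.rank ∧ m.ch d.id = c.hd ∧
      m.nx d.id = s.hd ∧ Ptr m c ∧ Ptr m s

/-- The ranks of the roots are `r - 1, …, 0`. -/
def Chain : Forest → ℕ → Prop
  | nil, r => r = 0
  | node d _ s, r => r = d.rank + 1 ∧ Chain s d.rank

/-- The ranks of the roots start with `r - 1, r - 2` as far as these numbers are not negative. -/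
def Top : Forest → ℕ → Prop
  | _, 0 => True
  | nil, _ + 1 => False
  | node d _ _, 1 => d.rank = 0
  | node _ _ nil, _ + 2 => False
  | node d _ (node e _ _), r + 2 => d.rank = r + 1 ∧ e.rank = r

/-- A full node of rank `r` has children of all ranks `r - 1, …, 0`. A hollow node may have given
away all children but the first two, and `Top` is what then remains; it suffices for the rank bound.
-/
def Wf : Forest → Prop
  | nil => True
  | node d c s => (∀ e, Mem e c → d.key ≤ e.key) ∧ (d.full = true → Chain c d.rank) ∧
      Top c d.rank ∧ Wf c ∧ Wf s

/-- The potential, where full and hollow roots have weights `a` and `b`. -/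
def pot (a b : ℕ) : Forest → ℕ
  | nil => 0
  | node d c s => (if d.full = true then a + pot 0 2 c else b + pot 3 2 c) + pot a b s

/-- The first two trees and the others. -/
def take2 : Forest → Forest
  | node d c (node e c' _) => node d c (node e c' nil)
  | F => F

def drop2 : Forest → Forest
  | node _ _ (node _ _ s) => s
  | _ => nil

/-! ### Elementary properties of forests and the rank bound -/

theorem cnt_ne_zero {v : ℕ} {F : Forest} : F.cnt v ≠ 0 ↔ ∃ d, F.Mem d ∧ d.id = v := by
  induction F with
  | nil => simp [cnt, Mem]
  | node d c s ihc ihs =>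
    simp only [cnt, Mem]
    constructor
    · intro h
      by_cases h₁ : d.id = v
      · exact ⟨d, Or.inl rfl, h₁⟩
      by_cases h₂ : c.cnt v = 0
      · obtain ⟨e, he, h⟩ := ihs.1 (by simp [h₁, h₂] at h; exact h)
        exact ⟨e, Or.inr (Or.inr he), h⟩
      · obtain ⟨e, he, h⟩ := ihc.1 h₂
        exact ⟨e, Or.inr (Or.inl he), h⟩
    · rintro ⟨e, rfl | he | he, rfl⟩
      · simp
      · have := ihc.2 ⟨e, he, rfl⟩; omega
      · have := ihs.2 ⟨e, he, rfl⟩; omega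

theorem Mem.cnt_pos {e : HNode} {F : Forest} (h : F.Mem e) : 1 ≤ F.cnt e.id :=
  Nat.one_le_iff_ne_zero.2 (cnt_ne_zero.2 ⟨e, h, rfl⟩)

theorem Ptr.congr {m m' : HMem} {F : Forest} (h : F.Ptr m)
    (he : ∀ v, F.cnt v ≠ 0 → m.SameAt m' v) : F.Ptr m' := by
  induction F with
  | nil => trivial
  | node d c s ihc ihs =>
    obtain ⟨h₁, h₂, h₃, h₄, h₅, h₆, h₇⟩ := h
    obtain ⟨e₁, e₂, e₃, e₄⟩ := he d.id (by simp [cnt])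
    refine ⟨h₁, by rw [e₁, h₂], by rw [e₂, h₃], by rw [e₃, h₄], by rw [e₄, h₅],
      ihc h₆ fun v hv => he v ?_, ihs h₇ fun v hv => he v ?_⟩ <;>
    · simp only [cnt]; omega

theorem Ptr.id_ne_zero {m : HMem} {F : Forest} (h : F.Ptr m) {e : HNode} (he : F.Mem e) :
    e.id ≠ 0 := by
  induction F with
  | nil => exact he.elim
  | node d c s ihc ihs =>
    rcases he with rfl | he | he
    · exact h.1
    · exact ihc h.2.2.2.2.2.1 he
    · exact ihs h.2.2.2.2.2.2 he

theorem Ptr.mem {m : HMem} {F : Forest} (h : F.Ptr m) {e : HNode} (he : F.Mem e) :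
    m.it e.id = e.item ∧ m.rk e.id = e.rank := by
  induction F with
  | nil => exact he.elim
  | node d c s ihc ihs =>
    rcases he with rfl | he | he
    · exact ⟨h.2.1, h.2.2.1⟩
    · exact ihc h.2.2.2.2.2.1 he
    · exact ihs h.2.2.2.2.2.2 he

theorem Ptr.hd_eq_zero {m : HMem} {F : Forest} (h : F.Ptr m) : F.hd = 0 ↔ F = nil := by
  cases F with
  | nil => simp [hd]
  | node d c s => simpa [hd] using h.1

theorem Chain.trees {F : Forest} {r : ℕ} (h : F.Chain r) : F.trees = r := by
  induction F generalizing r with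
  | nil => exact h.symm
  | node d c s _ ihs =>
    obtain ⟨rfl, h⟩ := h
    simp only [Forest.trees, ihs h]; omega

theorem Chain.top {F : Forest} {r : ℕ} (h : F.Chain r) : F.Top r := by
  match F, r, h with
  | _, 0, _ => simp [Top]
  | nil, r + 1, h => simp [Chain] at h
  | node d _ nil, r + 1, h =>
    obtain ⟨h₁, h₂⟩ := h
    simp only [Chain] at h₂
    obtain rfl : r = 0 := by omega
    simpa [Top] using h₂
  | node d _ (node e _ _), 1, h => simp only [Top]; have := h.1; omega
  | node d _ (node e _ _), r + 2, h =>
    obtain ⟨h₁, h₂, -⟩ := h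
    simp only [Top]; omega

theorem Top.take2 {F : Forest} {r : ℕ} (h : F.Top r) : F.take2.Top r := by
  match F, r, h with
  | _, 0, _ => simp [Top]
  | node d _ nil, r + 1, h => exact h
  | node d _ (node e _ _), 1, h => exact h
  | node d _ (node e _ _), r + 2, h => exact h

theorem Wf.take2 {F : Forest} (h : F.Wf) : F.take2.Wf := by
  match F, h with
  | nil, _ => trivial
  | node d _ nil, h => exact h
  | node d _ (node e _ _), ⟨h₁, h₂, h₃, h₄, h₅, h₆, h₇, h₈, h₉⟩ =>
    exact ⟨h₁, h₂, h₃, h₄, h₅, h₆, h₇, h₈, trivial⟩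

theorem Wf.drop2 {F : Forest} (h : F.Wf) : F.drop2.Wf := by
  match F, h with
  | nil, _ => trivial
  | node d _ nil, h => trivial
  | node d _ (node e _ _), ⟨_, _, _, _, _, _, _, _, h⟩ => exact h

theorem Chain.drop2 {F : Forest} {r : ℕ} (h : F.Chain r) : F.drop2.Chain (r - 2) := by
  match F, h with
  | nil, h => simp only [Chain] at h; subst h; simp [Forest.drop2, Chain]
  | node d _ nil, ⟨h, h'⟩ => simp only [Chain] at h'; simp [Forest.drop2, Chain]; omega
  | node d _ (node e _ _), ⟨h, h', h''⟩ =>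
    obtain rfl : r = e.rank + 2 := by omega
    exact h''

theorem cnt_take2_add (v : ℕ) (F : Forest) : F.take2.cnt v + F.drop2.cnt v = F.cnt v := by
  match F with
  | nil => simp [take2, drop2, cnt]
  | node d _ nil => simp [take2, drop2, cnt]
  | node d _ (node e _ _) => simp [take2, drop2, cnt]; omega

theorem pot_take2_add (a b : ℕ) (F : Forest) :
    F.take2.pot a b + F.drop2.pot a b = F.pot a b := by
  match F with
  | nil => simp [take2, drop2, pot]
  | node d _ nil => simp [take2, drop2, pot]
  | node d _ (node e _ _) => simp [take2, drop2, pot]; omega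

theorem trees_take2 (F : Forest) : F.take2.trees ≤ 2 := by
  match F with
  | nil => simp [take2, trees]
  | node d _ nil => simp [take2, trees]
  | node d _ (node e _ _) => simp [take2, trees]

theorem hd_take2 (F : Forest) : F.take2.hd = F.hd := by
  match F with
  | nil => rfl
  | node d _ nil => rfl
  | node d _ (node e _ _) => rfl

theorem mem_of_take2 {F : Forest} {e : HNode} (h : F.take2.Mem e) : F.Mem e := by
  match F, h with
  | node d _ nil, h => exact h
  | node d _ (node e _ _), h => simp only [take2, Mem] at h ⊢; tauto

theorem mem_of_drop2 {F : Forest} {e : HNode} (h : F.drop2.Mem e) : F.Mem e := by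
  match F, h with
  | node d _ (node e _ _), h => simp only [drop2] at h; simp only [Mem]; tauto

/-- The weights that occur in potentials. -/
theorem pot_three_le (F : Forest) : F.pot 3 2 ≤ F.pot 0 2 + 3 * F.trees := by
  induction F with
  | nil => simp [pot]
  | node d c s _ ihs =>
    simp only [pot, trees]
    split_ifs <;> omega

/-- Even a hollow node of rank `r ≥ 2` has children of ranks `r - 1` and `r - 2`. By induction both
subtrees have at least `2 ^ ((r - 2) / 2)` nodes, together `2 ^ (r / 2)`. -/
theorem two_pow_le (d : HNode) (c s : Forest) (h : (node d c s).Wf) :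
    2 ^ (d.rank / 2) ≤ 1 + c.size := by
  obtain ⟨-, -, h, hw, -⟩ := h
  match hr : d.rank, c, h with
  | 0, _, _ => simp
  | 1, _, _ => simp
  | r + 2, node d₁ c₁ (node d₂ c₂ s₂), h =>
    obtain ⟨h₁, h₂⟩ := h
    have i₁ := two_pow_le d₁ c₁ _ hw
    have i₂ := two_pow_le d₂ c₂ _ hw.2.2.2.2
    rw [h₁] at i₁
    rw [h₂] at i₂
    have : 2 ^ (r / 2) ≤ 2 ^ ((r + 1) / 2) := Nat.pow_le_pow_right (by omega) (by omega)
    rw [show (r + 2) / 2 = r / 2 + 1 by omega, pow_succ]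
    simp only [size]
    omega

theorem Wf.two_pow_le {F : Forest} (h : F.Wf) {d : HNode} (hd : F.Mem d) :
    2 ^ (d.rank / 2) ≤ F.size := by
  induction F with
  | nil => exact hd.elim
  | node e c s ihc ihs =>
    simp only [size]
    rcases hd with rfl | hd | hd
    · have := Forest.two_pow_le _ _ _ h; omega
    · have := ihc h.2.2.2.1 hd; omega
    · have := ihs h.2.2.2.2 hd; omega

/-- The names are distinct and lie in `1, …, n`. So sizes are bounded by the number of nodes ever
created, hollow ones included. -/
theorem size_le {F : Forest} {n : ℕ} (h1 : ∀ v, F.cnt v ≤ 1) (h2 : ∀ v, F.cnt v ≠ 0 → v ≠ 0 ∧ v ≤ n) :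
    F.size ≤ n := by
  have key : ∀ F : Forest, (∀ v, F.cnt v ≠ 0 → v ≠ 0 ∧ v ≤ n) →
      ∑ v ∈ Finset.Icc 1 n, F.cnt v = F.size := by
    intro F
    induction F with
    | nil => simp [cnt, size]
    | node d c s ihc ihs =>
      intro h
      have hd := h d.id (by simp [cnt])
      simp only [cnt, size, Finset.sum_add_distrib]
      rw [ihc fun v hv => h v (by simp only [cnt]; omega),
        ihs fun v hv => h v (by simp only [cnt]; omega), Finset.sum_ite_eq, if_pos]
      rw [Finset.mem_Icc]; omega
  rw [← key F h2]
  calc ∑ v ∈ Finset.Icc 1 n, F.cnt v ≤ ∑ v ∈ Finset.Icc 1 n, 1 := Finset.sum_le_sum fun v _ => h1 v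
    _ = n := by simp

/-- `F'` results from `F` by replacing a node `d` with children `c` by `d'` and `c'`. -/
inductive Repl (d : HNode) (c : Forest) (d' : HNode) (c' : Forest) : Forest → Forest → Prop
  | here (s : Forest) : Repl d c d' c' (node d c s) (node d' c' s)
  | child (e : HNode) (s : Forest) {F F' : Forest} : Repl d c d' c' F F' →
      Repl d c d' c' (node e F s) (node e F' s)
  | sibling (e : HNode) (b : Forest) {F F' : Forest} : Repl d c d' c' F F' →
      Repl d c d' c' (node e b F) (node e b F')

/-- The list `c` comes before the replacement, so that the new children can be chosen in terms of
the old ones. -/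
theorem Mem.exists_repl {d : HNode} {F : Forest} (h : F.Mem d) :
    ∃ c, ∀ d' c', ∃ F', Repl d c d' c' F F' := by
  induction F with
  | nil => exact h.elim
  | node e c s ihc ihs =>
    rcases h with rfl | h | h
    · exact ⟨c, fun d' c' => ⟨_, .here s⟩⟩
    · obtain ⟨c₁, hc⟩ := ihc h
      exact ⟨c₁, fun d' c' => (hc d' c').imp' _ fun _ => .child e s⟩
    · obtain ⟨c₁, hc⟩ := ihs h
      exact ⟨c₁, fun d' c' => (hc d' c').imp' _ fun _ => .sibling e c⟩

/-! ### Effect of replacing one node of a forest -/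

section Repl

variable {d d' : HNode} {c c' F F' : Forest}

theorem Repl.hd (h : Repl d c d' c' F F') (hid : d'.id = d.id) : F'.hd = F.hd := by
  cases h <;> simp [Forest.hd, hid]

theorem Repl.cnt (h : Repl d c d' c' F F') (hid : d'.id = d.id) (v : ℕ) :
    F'.cnt v + c.cnt v = F.cnt v + c'.cnt v := by
  induction h with
  | here s => simp only [Forest.cnt, hid]; omega
  | child e s _ ih => simp only [Forest.cnt]; omega
  | sibling e b _ ih => simp only [Forest.cnt]; omega

theorem Repl.cnt_ge (h : Repl d c d' c' F F') (v : ℕ) :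
    (if d.id = v then 1 else 0) + c.cnt v ≤ F.cnt v := by
  induction h with
  | here s => simp only [Forest.cnt]; omega
  | child e s _ ih => simp only [Forest.cnt]; omega
  | sibling e b _ ih => simp only [Forest.cnt]; omega

theorem Repl.wf_left (h : Repl d c d' c' F F') (hF : F.Wf) : (node d c nil).Wf := by
  induction h with
  | here s => exact ⟨hF.1, hF.2.1, hF.2.2.1, hF.2.2.2.1, trivial⟩
  | child e s _ ih => exact ih hF.2.2.2.1
  | sibling e b _ ih => exact ih hF.2.2.2.2

theorem Repl.ptr_left (h : Repl d c d' c' F F') {m : HMem} (hF : F.Ptr m) :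
    m.ch d.id = c.hd ∧ c.Ptr m := by
  induction h with
  | here s => exact ⟨hF.2.2.2.1, hF.2.2.2.2.2.1⟩
  | child e s _ ih => exact ih hF.2.2.2.2.2.1
  | sibling e b _ ih => exact ih hF.2.2.2.2.2.2

/-- The name of `d` occurs only once, so every other node of the new forest carries a different
name. Liveness of the remaining nodes depends on this. -/
theorem Repl.mem (h : Repl d c d' c' F F') (hc : ∀ e, c'.Mem e → c.Mem e)
    (hcnt : F.cnt d.id ≤ 1) {e : HNode} (he : F'.Mem e) : e = d' ∨ F.Mem e ∧ e.id ≠ d.id := by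
  induction h with
  | here s =>
    simp only [Forest.cnt, if_true] at hcnt
    rcases he with he | he | he
    · exact Or.inl he
    · refine Or.inr ⟨Or.inr (Or.inl (hc e he)), fun h => ?_⟩
      have := (hc e he).cnt_pos
      rw [h] at this; omega
    · refine Or.inr ⟨Or.inr (Or.inr he), fun h => ?_⟩
      have := he.cnt_pos
      rw [h] at this; omega
  | child e₀ s hr ih =>
    have h₀ := hr.cnt_ge d.id
    simp only [Forest.cnt, if_true] at hcnt h₀
    rcases he with he | he | he
    · refine Or.inr ⟨Or.inl he, fun h => ?_⟩
      rw [← he, if_pos h] at hcnt; omega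
    · exact (ih (by omega) he).imp id fun h => ⟨Or.inr (Or.inl h.1), h.2⟩
    · refine Or.inr ⟨Or.inr (Or.inr he), fun h => ?_⟩
      have := he.cnt_pos
      rw [h] at this; omega
  | sibling e₀ b hr ih =>
    have h₀ := hr.cnt_ge d.id
    simp only [Forest.cnt, if_true] at hcnt h₀
    rcases he with he | he | he
    · refine Or.inr ⟨Or.inl he, fun h => ?_⟩
      rw [← he, if_pos h] at hcnt; omega
    · refine Or.inr ⟨Or.inr (Or.inl he), fun h => ?_⟩
      have := he.cnt_pos
      rw [h] at this; omega
    · exact (ih (by omega) he).imp id fun h => ⟨Or.inr (Or.inr h.1), h.2⟩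

theorem Repl.key (h : Repl d c d' c' F F') (hc : ∀ e, c'.Mem e → c.Mem e) (hk : d'.key = d.key)
    {e : HNode} (he : F'.Mem e) : ∃ e', F.Mem e' ∧ e'.key = e.key := by
  induction h with
  | here s =>
    rcases he with rfl | he | he
    · exact ⟨d, Or.inl rfl, hk.symm⟩
    · exact ⟨e, Or.inr (Or.inl (hc e he)), rfl⟩
    · exact ⟨e, Or.inr (Or.inr he), rfl⟩
  | child e₀ s hr ih =>
    rcases he with rfl | he | he
    · exact ⟨e, Or.inl rfl, rfl⟩
    · obtain ⟨e', h₁, h₂⟩ := ih he; exact ⟨e', Or.inr (Or.inl h₁), h₂⟩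
    · exact ⟨e, Or.inr (Or.inr he), rfl⟩
  | sibling e₀ b hr ih =>
    rcases he with rfl | he | he
    · exact ⟨e, Or.inl rfl, rfl⟩
    · exact ⟨e, Or.inr (Or.inl he), rfl⟩
    · obtain ⟨e', h₁, h₂⟩ := ih he; exact ⟨e', Or.inr (Or.inr h₁), h₂⟩

theorem Repl.chain (h : Repl d c d' c' F F') (hr : d'.rank = d.rank) (r : ℕ) (hF : F.Chain r) :
    F'.Chain r := by
  induction h generalizing r with
  | here s => simpa only [Chain, hr] using hF
  | child e s _ ih => exact hF
  | sibling e b _ ih => exact ⟨hF.1, ih _ hF.2⟩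

theorem Repl.top (h : Repl d c d' c' F F') (hr : d'.rank = d.rank) (r : ℕ) (hF : F.Top r) :
    F'.Top r := by
  match r with
  | 0 => simp [Top]
  | 1 => cases h <;> simpa [Top, hr] using hF
  | r + 2 =>
    cases h with
    | here s => cases s <;> simp [Top, hr] at hF ⊢ <;> exact hF
    | child e s _ => cases s <;> simp [Top] at hF ⊢ <;> exact hF
    | sibling e b h => cases h <;> simpa [Top, hr] using hF

theorem Repl.wf (h : Repl d c d' c' F F') (hc : ∀ e, c'.Mem e → c.Mem e) (hk : d'.key = d.key)
    (hr : d'.rank = d.rank) (hf : d'.full = false) (ht : c'.Top d.rank) (hw : c'.Wf)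
    (hF : F.Wf) : F'.Wf := by
  induction h with
  | here s =>
    exact ⟨fun e he => by rw [hk]; exact hF.1 e (hc e he), by simp [hf], by rwa [hr], hw,
      hF.2.2.2.2⟩
  | child e s h ih =>
    refine ⟨fun x hx => ?_, fun hx => h.chain hr _ (hF.2.1 hx), h.top hr _ hF.2.2.1,
      ih hF.2.2.2.1, hF.2.2.2.2⟩
    obtain ⟨x', h₁, h₂⟩ := h.key hc hk hx
    rw [← h₂]; exact hF.1 x' h₁
  | sibling e b h ih => exact ⟨hF.1, hF.2.1, hF.2.2.1, hF.2.2.2.1, ih hF.2.2.2.2⟩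

/-- The memory may change at nodes below `d` only. The record of `d` itself is untouched: hollowness
is not stored in the node but read off from `nod`, and the head of its list of children stays the
same. -/
theorem Repl.ptr (h : Repl d c d' c' F F') {m m' : HMem} (hid : d'.id = d.id)
    (hit : d'.item = d.item) (hr : d'.rank = d.rank) (hhd : c'.hd = c.hd) (hc : c'.Ptr m')
    (hm : ∀ v, ¬ m.SameAt m' v → c.cnt v ≠ 0) (hcnt : ∀ v, F.cnt v ≤ 1) (hF : F.Ptr m) :
    F'.Ptr m' := by
  have key : ∀ v, c.cnt v = 0 → m.SameAt m' v := fun v hv => by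
    by_contra h; exact hm v h hv
  induction h with
  | here s =>
    have h₁ := hcnt d.id
    simp only [Forest.cnt, if_true] at h₁
    obtain ⟨e₁, e₂, e₃, e₄⟩ := key d.id (by omega)
    obtain ⟨f₁, f₂, f₃, f₄, f₅, f₆, f₇⟩ := hF
    refine ⟨by rwa [hid], by rw [hid, e₁, f₂, hit], by rw [hid, e₂, f₃, hr],
      by rw [hid, e₃, f₄, hhd], by rw [hid, e₄, f₅], hc, f₇.congr fun v hv => key v ?_⟩
    have := hcnt v
    simp only [Forest.cnt] at this
    omega
  | child e s h ih =>
    have h₀ := h.cnt_ge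
    have h₁ := hcnt e.id
    simp only [Forest.cnt, if_true] at h₁
    have := h₀ e.id
    obtain ⟨e₁, e₂, e₃, e₄⟩ := key e.id (by omega)
    obtain ⟨f₁, f₂, f₃, f₄, f₅, f₆, f₇⟩ := hF
    refine ⟨f₁, by rw [e₁, f₂], by rw [e₂, f₃], by rw [e₃, f₄, h.hd hid], by rw [e₄, f₅],
      ih (fun v => ?_) f₆, f₇.congr fun v hv => key v ?_⟩
    · have := hcnt v; simp only [Forest.cnt] at this; omega
    · have := hcnt v; simp only [Forest.cnt] at this; have := h₀ v; omega
  | sibling e b h ih =>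
    have h₀ := h.cnt_ge
    have h₁ := hcnt e.id
    simp only [Forest.cnt, if_true] at h₁
    have := h₀ e.id
    obtain ⟨e₁, e₂, e₃, e₄⟩ := key e.id (by omega)
    obtain ⟨f₁, f₂, f₃, f₄, f₅, f₆, f₇⟩ := hF
    refine ⟨f₁, by rw [e₁, f₂], by rw [e₂, f₃], by rw [e₃, f₄], by rw [e₄, f₅, h.hd hid],
      f₆.congr fun v hv => key v ?_, ih (fun v => ?_) f₇⟩
    · have := hcnt v; simp only [Forest.cnt] at this; have := h₀ v; omega
    · have := hcnt v; simp only [Forest.cnt] at this; omega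

/-- Hollowing a node raises its own weight by at most 2, which is what `hab` expresses, and the
weight of each remaining child by at most 3 (`pot_three_le`). The potential `x` of the children that
are removed leaves the forest. -/
theorem Repl.pot (h : Repl d c d' c' F F') (hd : d.full = true) (hf : d'.full = false) {x : ℕ}
    (hc : c'.pot 0 2 + x = c.pot 0 2) (a b : ℕ) (hab : b ≤ a + 2) :
    F'.pot a b + x ≤ F.pot a b + 2 + 3 * c'.trees := by
  induction h generalizing a b with
  | here s =>
    have := pot_three_le c'
    simp [Forest.pot, hd, hf]; omega
  | child e s h ih =>
    have h₁ := ih 0 2 (by omega)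
    have h₂ := ih 3 2 (by omega)
    simp only [Forest.pot]
    split_ifs <;> omega
  | sibling e b h ih =>
    have h₁ := ih _ _ hab
    simp only [Forest.pot]
    omega

end Repl

end Forest

/-! ### Forests in slots

Slot `0` holds the children of deleted nodes, slot `1` the roots, and slot `r + 2` a tree of rank
`r` (or nothing). -/

theorem sum_update_two {K i j : ℕ} (hi : i < K) (hj : j < K) (hij : i ≠ j) (g : ℕ → Forest → ℕ)
    (S : ℕ → Forest) (X Y : Forest) :
    ∑ k ∈ Finset.range K, g k (Function.update (Function.update S i X) j Y k) + g i (S i) +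
      g j (S j) = ∑ k ∈ Finset.range K, g k (S k) + g i X + g j Y := by
  have hi' : i ∈ (Finset.range K).erase j := by simp [hi, hij]
  have hj' : j ∈ Finset.range K := by simpa using hj
  rw [← Finset.add_sum_erase _ _ hj', ← Finset.add_sum_erase _ _ hi',
    ← Finset.add_sum_erase _ (fun k => g k (S k)) hj',
    ← Finset.add_sum_erase _ (fun k => g k (S k)) hi']
  have : ∑ k ∈ ((Finset.range K).erase j).erase i,
      g k (Function.update (Function.update S i X) j Y k) =
      ∑ k ∈ ((Finset.range K).erase j).erase i, g k (S k) := by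
    refine Finset.sum_congr rfl fun k hk => ?_
    simp only [Finset.mem_erase] at hk
    rw [Function.update_of_ne hk.2.1, Function.update_of_ne hk.1]
  rw [this]
  simp [hij]
  omega

/-- The heap `S` with nodes `1, …, n` for the items `0, …, N - 1` is in memory. -/
structure Heap (m : HMem) (N K n : ℕ) (S : ℕ → Forest) : Prop where
  ptr : ∀ i < K, m.H i = (S i).hd ∧ (S i).Ptr m
  cnt : ∀ v, ∑ i ∈ Finset.range K, (S i).cnt v ≤ 1
  ids : ∀ i < K, ∀ v, (S i).cnt v ≠ 0 → v ≤ n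
  wf : ∀ i < K, (S i).Wf
  live : ∀ i < K, ∀ d, (S i).Mem d →
    (d.full = true ↔ m.nod d.item = d.id) ∧ (d.full = true → m.dist d.item = d.key)
  all : ∀ x < N, m.nod x ≠ 0 → m.it (m.nod x) = x ∧ ∃ i < K, (S i).cnt (m.nod x) ≠ 0

/-- The potential of the heap. -/
def slotPot (i : ℕ) (F : Forest) : ℕ := if i = 0 then F.pot 3 2 else if i = 1 then F.pot 2 1
  else F.pot 1 0

def heapPot (K : ℕ) (S : ℕ → Forest) : ℕ := ∑ i ∈ Finset.range K, slotPot i (S i)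

/-! ### Elementary changes of a heap -/

section Heap

variable {m m' : HMem} {N K n : ℕ} {S : ℕ → Forest}

theorem Heap.cnt_le (h : Heap m N K n S) {i : ℕ} (hi : i < K) (v : ℕ) : (S i).cnt v ≤ 1 :=
  (Finset.single_le_sum (f := fun i => (S i).cnt v) (fun _ _ => Nat.zero_le _)
    (Finset.mem_range.2 hi)).trans (h.cnt v)

theorem Heap.disj (h : Heap m N K n S) {i j : ℕ} (hi : i < K) (hj : j < K) (hij : i ≠ j) (v : ℕ) :
    (S i).cnt v + (S j).cnt v ≤ 1 := by
  have h₁ := h.cnt v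
  rw [← Finset.add_sum_erase _ _ (Finset.mem_range.2 hi)] at h₁
  have h₂ := Finset.single_le_sum (f := fun i => (S i).cnt v) (fun _ _ => Nat.zero_le _)
    (show j ∈ (Finset.range K).erase i by simp [hj, hij.symm])
  omega

theorem Heap.size_le (h : Heap m N K n S) {i : ℕ} (hi : i < K) : (S i).size ≤ n := by
  refine Forest.size_le (h.cnt_le hi) fun v hv => ⟨?_, h.ids i hi v hv⟩
  obtain ⟨d, hd, rfl⟩ := Forest.cnt_ne_zero.1 hv
  exact (h.ptr i hi).2.id_ne_zero hd

/-- Tree sizes grow at least like `2 ^ (rank / 2)`, so ranks stay below `2B` and a table with `2B`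
slots, besides slots 0 and 1, suffices. -/
theorem Heap.rank_lt (h : Heap m N K n S) {B : ℕ} (hn : n < 2 ^ B) {i : ℕ}
    (hi : i < K) {d : HNode} (hd : (S i).Mem d) : d.rank < 2 * B := by
  have h₁ := ((h.wf i hi).two_pow_le hd).trans (h.size_le hi)
  have h₂ := (Nat.pow_lt_pow_iff_right (a := 2) (by omega)).1 (h₁.trans_lt hn)
  omega

theorem Heap.rest_disj (h : Heap m N K n S) {i k : ℕ} (hi : i < K) (hk : k < K) (hki : k ≠ i)
    {v : ℕ} (hv : (S k).cnt v ≠ 0) : (S i).cnt v = 0 := by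
  have := h.disj hi hk hki.symm v; omega

/-- A change of two slots. -/
theorem Heap.update_two (h : Heap m N K n S) {i j : ℕ} (hi : i < K) (hj : j < K) (hij : i ≠ j)
    {X Y : Forest} (hX : m'.H i = X.hd ∧ X.Ptr m') (hY : m'.H j = Y.hd ∧ Y.Ptr m')
    (hH : ∀ k, k ≠ i → k ≠ j → m'.H k = m.H k)
    (hsame : ∀ v, (S i).cnt v = 0 → (S j).cnt v = 0 → m.SameAt m' v)
    (hcnt : ∀ v, X.cnt v + Y.cnt v ≤ (S i).cnt v + (S j).cnt v) (hwX : X.Wf) (hwY : Y.Wf)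
    (hlive : ∀ d, X.Mem d ∨ Y.Mem d →
      (d.full = true ↔ m'.nod d.item = d.id) ∧ (d.full = true → m'.dist d.item = d.key))
    (hnod : m'.nod = m.nod) (hdist : m'.dist = m.dist) (hit : m'.it = m.it)
    (hall : ∀ x < N, m.nod x ≠ 0 → (S i).cnt (m.nod x) + (S j).cnt (m.nod x) ≠ 0 →
      m.it (m.nod x) = x → X.cnt (m.nod x) + Y.cnt (m.nod x) ≠ 0) :
    Heap m' N K n (Function.update (Function.update S i X) j Y) := by
  have hS : ∀ k, Function.update (Function.update S i X) j Y k =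
      if k = j then Y else if k = i then X else S k := by
    intro k; simp only [Function.update_apply]
  constructor
  · intro k hk
    rw [hS]
    split_ifs with h₁ h₂
    · subst h₁; exact hY
    · subst h₂; exact hX
    · rw [hH k h₂ h₁]
      refine ⟨(h.ptr k hk).1, (h.ptr k hk).2.congr fun v hv => hsame v ?_ ?_⟩
      · exact h.rest_disj hi hk h₂ hv
      · exact h.rest_disj hj hk h₁ hv
  · intro v
    have := sum_update_two hi hj hij (fun _ F => F.cnt v) S X Y
    have := h.cnt v
    have := hcnt v
    omega
  · intro k hk v hv
    rw [hS] at hv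
    have := hcnt v
    split_ifs at hv with h₁ h₂
    · by_cases h₃ : (S i).cnt v = 0
      · exact h.ids j hj v (by omega)
      · exact h.ids i hi v h₃
    · by_cases h₃ : (S i).cnt v = 0
      · exact h.ids j hj v (by omega)
      · exact h.ids i hi v h₃
    · exact h.ids k hk v hv
  · intro k hk
    rw [hS]
    split_ifs with h₁ h₂
    · exact hwY
    · exact hwX
    · exact h.wf k hk
  · intro k hk d hd
    rw [hS] at hd
    split_ifs at hd with h₁ h₂
    · exact hlive d (Or.inr hd)
    · exact hlive d (Or.inl hd)
    · rw [hnod, hdist]; exact h.live k hk d hd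
  · intro x hx hn
    rw [hnod] at hn ⊢
    rw [hit]
    obtain ⟨h₁, k, hk, h₂⟩ := h.all x hx hn
    refine ⟨h₁, ?_⟩
    have key : (S i).cnt (m.nod x) + (S j).cnt (m.nod x) ≠ 0 → ∃ k < K,
        (Function.update (Function.update S i X) j Y k).cnt (m.nod x) ≠ 0 := by
      intro h₃
      have h₄ := hall x hx hn h₃ h₁
      by_cases h₅ : Y.cnt (m.nod x) = 0
      · exact ⟨i, hi, by rw [hS, if_neg hij, if_pos rfl]; omega⟩
      · exact ⟨j, hj, by rwa [hS, if_pos rfl]⟩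
    by_cases h₃ : k = j
    · subst h₃; exact key (by omega)
    by_cases h₄ : k = i
    · subst h₄; exact key (by omega)
    · exact ⟨k, hk, by rwa [hS, if_neg h₃, if_neg h₄]⟩

theorem Heap.ne_of_cnt (h : Heap m N K n S) {i : ℕ} (hi : i < K) {d : HNode} {c s : Forest}
    (hS : S i = .node d c s) : c.cnt d.id = 0 ∧ s.cnt d.id = 0 := by
  have := h.cnt_le hi d.id
  rw [hS] at this
  simp only [Forest.cnt, if_true] at this
  omega

/-- The first tree of slot `i` is moved to slot `j`. -/
theorem Heap.move (h : Heap m N K n S) {i j : ℕ} (hi : i < K) (hj : j < K) (hij : i ≠ j)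
    {d : HNode} {c s : Forest} (hS : S i = .node d c s) :
    Heap { m with
      H := Function.update (Function.update m.H i (m.nx d.id)) j d.id
      nx := Function.update m.nx d.id (m.H j) } N K n
      (Function.update (Function.update S i s) j (.node d c (S j))) := by
  have hp := (h.ptr i hi).2
  have hne := h.ne_of_cnt hi hS
  have hdj := h.disj hi hj hij d.id
  have hl := h.live i hi
  have hw := h.wf i hi
  rw [hS] at hp hdj hl hw
  obtain ⟨p₁, p₂, p₃, p₄, p₅, p₆, p₇⟩ := hp
  simp only [Forest.cnt, if_true] at hdj
  have hsame : ∀ v, v ≠ d.id → m.SameAt { m with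
      H := Function.update (Function.update m.H i (m.nx d.id)) j d.id
      nx := Function.update m.nx d.id (m.H j) } v := by
    intro v hv
    exact ⟨rfl, rfl, rfl, by simp [Function.update_of_ne hv]⟩
  refine h.update_two hi hj hij ⟨?_, ?_⟩ ⟨?_, ?_⟩ ?_ ?_ ?_ hw.2.2.2.2 ?_ ?_ rfl rfl rfl ?_
  · simp [hij, p₅]
  · exact p₇.congr fun v hv => hsame v (by rintro rfl; exact hv hne.2)
  · simp [Forest.hd]
  · refine ⟨p₁, p₂, p₃, p₄, by simpa using (h.ptr j hj).1,
      p₆.congr fun v hv => hsame v (by rintro rfl; exact hv hne.1),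
      (h.ptr j hj).2.congr fun v hv => hsame v (by rintro rfl; omega)⟩
  · intro k h₁ h₂; simp [h₁, h₂]
  · intro v h₁ _
    refine hsame v ?_
    rintro rfl
    rw [hS] at h₁; simp [Forest.cnt] at h₁
  · intro v; rw [hS]; simp only [Forest.cnt]; omega
  · exact ⟨hw.1, hw.2.1, hw.2.2.1, hw.2.2.2.1, h.wf j hj⟩
  · rintro e (he | he | he | he)
    · exact hl e (Or.inr (Or.inr he))
    · exact hl e (Or.inl he)
    · exact hl e (Or.inr (Or.inl he))
    · exact h.live j hj e he
  · intro x _ _ h₁ _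
    rw [hS] at h₁
    simp only [Forest.cnt] at h₁ ⊢; omega

/-- A hollow root is destroyed. -/
theorem Heap.destroy (h : Heap m N K n S) (hK : 2 ≤ K) {d : HNode} {c s : Forest}
    (hS : S 1 = .node d c s) (h0 : S 0 = .nil) (hd : d.full = false) :
    Heap { m with H := Function.update (Function.update m.H 1 (m.nx d.id)) 0 (m.ch d.id) } N K n
      (Function.update (Function.update S 1 s) 0 c) := by
  have hp := (h.ptr 1 (by omega)).2
  have hl := h.live 1 (by omega)
  have hw := h.wf 1 (by omega)
  rw [hS] at hp hl hw
  obtain ⟨p₁, p₂, p₃, p₄, p₅, p₆, p₇⟩ := hp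
  have hsame : ∀ v, m.SameAt { m with
      H := Function.update (Function.update m.H 1 (m.nx d.id)) 0 (m.ch d.id) } v :=
    fun v => ⟨rfl, rfl, rfl, rfl⟩
  refine h.update_two (by omega) (by omega) (by omega) ⟨?_, ?_⟩ ⟨?_, ?_⟩ ?_ (fun v _ _ => hsame v)
    ?_ hw.2.2.2.2 hw.2.2.2.1 ?_ rfl rfl rfl ?_
  · simp [p₅]
  · exact p₇.congr fun v _ => hsame v
  · simp [p₄]
  · exact p₆.congr fun v _ => hsame v
  · intro k h₁ h₂; simp [h₁, h₂]
  · intro v; rw [hS]; simp only [Forest.cnt]; omega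
  · rintro e (he | he)
    · exact hl e (Or.inr (Or.inr he))
    · exact hl e (Or.inr (Or.inl he))
  · intro x _ _ h₁ h₂
    rw [hS, h0] at h₁
    -- The destroyed node is hollow and therefore not the current node of any item, so no item is
    -- lost.
    have : d.id ≠ m.nod x := by
      intro h₃
      rw [← h₃, p₂] at h₂
      have := (hl d (Or.inl rfl)).1
      rw [h₂, ← h₃] at this
      simp [hd] at this
    simp only [Forest.cnt, if_neg this] at h₁
    omega

/-- The first root and the root of equal rank in the table are linked; the first root wins. -/
theorem Heap.link_left (h : Heap m N K n S) {r : ℕ} (hr : r < K) (hr1 : 1 < r) {d e : HNode}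
    {c ce s : Forest} (hS : S 1 = .node d c s) (he : S r = .node e ce .nil) (hd : d.full = true)
    (hrank : e.rank = d.rank) (hkey : d.key ≤ e.key) :
    Heap { m with
      H := Function.update m.H r 0
      nx := Function.update m.nx e.id (m.ch d.id)
      ch := Function.update m.ch d.id e.id
      rk := Function.update m.rk d.id (d.rank + 1) } N K n
      (Function.update (Function.update S r .nil) 1
        (.node { d with rank := d.rank + 1 } (.node e ce c) s)) := by
  have hp := (h.ptr 1 (by omega)).2
  have hq := (h.ptr r hr).2
  have hl := h.live 1 (by omega)
  have hl' := h.live r hr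
  have hw := h.wf 1 (by omega)
  have hw' := h.wf r hr
  have hdj := fun v => h.disj (show 1 < K by omega) hr (by omega) v
  have hH := (h.ptr 1 (by omega)).1
  rw [hS] at hp hl hw hH
  rw [he] at hq hl' hw'
  simp only [hS, he, Forest.cnt] at hdj
  obtain ⟨p₁, p₂, p₃, p₄, p₅, p₆, p₇⟩ := hp
  obtain ⟨q₁, q₂, q₃, q₄, q₅, q₆, q₇⟩ := hq
  have hd1 := hdj d.id
  have he1 := hdj e.id
  simp only [if_true] at hd1 he1
  have hne : d.id ≠ e.id := by intro h; rw [if_pos h.symm] at hd1; omega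
  rw [if_neg hne.symm] at hd1
  rw [if_neg hne] at he1
  set m' : HMem := { m with
      H := Function.update m.H r 0
      nx := Function.update m.nx e.id (m.ch d.id)
      ch := Function.update m.ch d.id e.id
      rk := Function.update m.rk d.id (d.rank + 1) } with hm'
  have hsame : ∀ v, v ≠ d.id → v ≠ e.id → m.SameAt m' v := by
    intro v h₁ h₂
    exact ⟨rfl, by simp [hm', h₁], by simp [hm', h₁], by simp [hm', h₂]⟩
  refine h.update_two hr (by omega) (by omega) ⟨?_, trivial⟩ ⟨?_, ?_⟩ ?_ ?_ ?_ trivial ?_ ?_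
    rfl rfl rfl ?_
  · simp [hm', Forest.hd]
  · simp [hm', Forest.hd, show (1 : ℕ) ≠ r by omega, hH]
  · refine ⟨p₁, p₂, by simp [hm'], by simp [hm', Forest.hd], by simp [hm', hne, p₅],
      ⟨q₁, q₂, by simp [hm', hne.symm, q₃], by simp [hm', hne.symm, q₄], by simp [hm', p₄],
        q₆.congr fun v hv => hsame v ?_ ?_, p₆.congr fun v hv => hsame v ?_ ?_⟩,
      p₇.congr fun v hv => hsame v ?_ ?_⟩ <;> · rintro rfl; omega
  · intro k h₁ h₂; simp [hm', h₁]
  · intro v h₁ h₂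
    rw [he] at h₁; rw [hS] at h₂
    refine hsame v ?_ ?_ <;> · rintro rfl; simp [Forest.cnt] at h₁ h₂
  · intro v; rw [hS, he]; simp only [Forest.cnt]; omega
  · refine ⟨?_, fun _ => ⟨by rw [hrank], ?_⟩, Forest.Chain.top ⟨by rw [hrank], ?_⟩,
      ⟨hw'.1, hw'.2.1, hw'.2.2.1, hw'.2.2.2.1, hw.2.2.2.1⟩, hw.2.2.2.2⟩
    · rintro x (rfl | hx | hx)
      · exact hkey
      · exact hkey.trans (hw'.1 x hx)
      · exact hw.1 x hx
    · rw [hrank]; exact hw.2.1 hd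
    · rw [hrank]; exact hw.2.1 hd
  · rintro x (hx | hx | (hx | hx | hx) | hx)
    · exact hx.elim
    · subst hx; exact hl d (Or.inl rfl)
    · exact hl' x (Or.inl hx)
    · exact hl' x (Or.inr (Or.inl hx))
    · exact hl x (Or.inr (Or.inl hx))
    · exact hl x (Or.inr (Or.inr hx))
  · intro x _ _ h₁ _
    rw [hS, he] at h₁
    simp only [Forest.cnt] at h₁ ⊢; omega

/-- The first root and the root of equal rank in the table are linked; the latter wins. -/
theorem Heap.link_right (h : Heap m N K n S) {r : ℕ} (hr : r < K) (hr1 : 1 < r) {d e : HNode}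
    {c ce s : Forest} (hS : S 1 = .node d c s) (he : S r = .node e ce .nil) (hd : e.full = true)
    (hrank : e.rank = d.rank) (hkey : e.key ≤ d.key) :
    Heap { m with
      H := Function.update (Function.update m.H r 0) 1 e.id
      nx := Function.update (Function.update m.nx e.id (m.nx d.id)) d.id (m.ch e.id)
      ch := Function.update m.ch e.id d.id
      rk := Function.update m.rk e.id (d.rank + 1) } N K n
      (Function.update (Function.update S r .nil) 1
        (.node { e with rank := d.rank + 1 } (.node d c ce) s)) := by
  have hp := (h.ptr 1 (by omega)).2
  have hq := (h.ptr r hr).2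
  have hl := h.live 1 (by omega)
  have hl' := h.live r hr
  have hw := h.wf 1 (by omega)
  have hw' := h.wf r hr
  have hdj := fun v => h.disj (show 1 < K by omega) hr (by omega) v
  rw [hS] at hp hl hw
  rw [he] at hq hl' hw'
  simp only [hS, he, Forest.cnt] at hdj
  obtain ⟨p₁, p₂, p₃, p₄, p₅, p₆, p₇⟩ := hp
  obtain ⟨q₁, q₂, q₃, q₄, q₅, q₆, q₇⟩ := hq
  have hd1 := hdj d.id
  have he1 := hdj e.id
  simp only [if_true] at hd1 he1
  have hne : d.id ≠ e.id := by intro h; rw [if_pos h.symm] at hd1; omega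
  rw [if_neg hne.symm] at hd1
  rw [if_neg hne] at he1
  set m' : HMem := { m with
      H := Function.update (Function.update m.H r 0) 1 e.id
      nx := Function.update (Function.update m.nx e.id (m.nx d.id)) d.id (m.ch e.id)
      ch := Function.update m.ch e.id d.id
      rk := Function.update m.rk e.id (d.rank + 1) } with hm'
  have hsame : ∀ v, v ≠ d.id → v ≠ e.id → m.SameAt m' v := by
    intro v h₁ h₂
    exact ⟨rfl, by simp [hm', h₂], by simp [hm', h₂], by simp [hm', h₁, h₂]⟩
  refine h.update_two hr (by omega) (by omega) ⟨?_, trivial⟩ ⟨?_, ?_⟩ ?_ ?_ ?_ trivial ?_ ?_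
    rfl rfl rfl ?_
  · simp [hm', Forest.hd, show r ≠ 1 by omega]
  · simp [hm', Forest.hd]
  · refine ⟨q₁, q₂, by simp [hm'], by simp [hm', Forest.hd], by simp [hm', hne.symm, p₅],
      ⟨p₁, p₂, by simp [hm', hne, p₃], by simp [hm', hne, p₄], by simp [hm', q₄],
        p₆.congr fun v hv => hsame v ?_ ?_, q₆.congr fun v hv => hsame v ?_ ?_⟩,
      p₇.congr fun v hv => hsame v ?_ ?_⟩ <;> · rintro rfl; omega
  · intro k h₁ h₂; simp [hm', h₁, h₂]
  · intro v h₁ h₂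
    rw [he] at h₁; rw [hS] at h₂
    refine hsame v ?_ ?_ <;> · rintro rfl; simp [Forest.cnt] at h₁ h₂
  · intro v; rw [hS, he]; simp only [Forest.cnt]; omega
  · have hch := hw'.2.1 hd
    rw [hrank] at hch
    refine ⟨?_, fun _ => ⟨rfl, hch⟩, Forest.Chain.top ⟨rfl, hch⟩,
      ⟨hw.1, hw.2.1, hw.2.2.1, hw.2.2.2.1, hw'.2.2.2.1⟩, hw.2.2.2.2⟩
    rintro x (rfl | hx | hx)
    · exact hkey
    · exact hkey.trans (hw.1 x hx)
    · exact hw'.1 x hx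
  · rintro x (hx | hx | (hx | hx | hx) | hx)
    · exact hx.elim
    · subst hx; exact hl' e (Or.inl rfl)
    · exact hl x (Or.inl hx)
    · exact hl x (Or.inr (Or.inl hx))
    · exact hl' x (Or.inr (Or.inl hx))
    · exact hl x (Or.inr (Or.inr hx))
  · intro x _ _ h₁ _
    rw [hS, he] at h₁
    simp only [Forest.cnt] at h₁ ⊢; omega

theorem heapPot_update {i j : ℕ} (hi : i < K) (hj : j < K) (hij : i ≠ j) (X Y : Forest) :
    heapPot K (Function.update (Function.update S i X) j Y) + slotPot i (S i) + slotPot j (S j) =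
      heapPot K S + slotPot i X + slotPot j Y :=
  sum_update_two hi hj hij slotPot S X Y

end Heap

end CTQAMSC

/-! ### Heaps with all trees in one list: deletion, insertion and decrease of keys -/

namespace CTQAMSC

/-- The heap consists of the forest `F` in slot `1`. -/
structure RootHeap (m : HMem) (N K n : ℕ) (F : Forest) : Prop where
  empty : ∀ i < K, i ≠ 1 → m.H i = 0
  head : m.H 1 = F.hd
  ptr : F.Ptr m
  cnt : ∀ v, F.cnt v ≤ 1
  ids : ∀ v, F.cnt v ≠ 0 → v ≤ n
  wf : F.Wf
  live : ∀ d, F.Mem d →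
    (d.full = true ↔ m.nod d.item = d.id) ∧ (d.full = true → m.dist d.item = d.key)
  all : ∀ x < N, m.nod x ≠ 0 → m.it (m.nod x) = x ∧ F.cnt (m.nod x) ≠ 0

section RootHeap

variable {m : HMem} {N K n : ℕ} {F : Forest}

theorem RootHeap.heap (h : RootHeap m N K n F) (hK : 1 < K) :
    Heap m N K n (Function.update (fun _ => .nil) 1 F) := by
  have hS : ∀ k, Function.update (fun _ => Forest.nil) 1 F k = if k = 1 then F else .nil := by
    intro k; simp only [Function.update_apply]
  constructor
  · intro i hi
    rw [hS]
    split_ifs with h₁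
    · subst h₁; exact ⟨h.head, h.ptr⟩
    · exact ⟨h.empty i hi h₁, trivial⟩
  · intro v
    rw [Finset.sum_eq_single 1]
    · simpa using h.cnt v
    · intro b _ hb; rw [hS, if_neg hb]; rfl
    · intro h₁; simp at h₁; omega
  · intro i _ v hv
    rw [hS] at hv
    split_ifs at hv with h₁
    · exact h.ids v hv
    · exact absurd rfl hv
  · intro i _
    rw [hS]
    split_ifs
    · exact h.wf
    · trivial
  · intro i _ d hd
    rw [hS] at hd
    split_ifs at hd
    · exact h.live d hd
    · exact hd.elim
  · intro x hx hn
    obtain ⟨h₁, h₂⟩ := h.all x hx hn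
    exact ⟨h₁, 1, hK, by simpa using h₂⟩

theorem Heap.rootHeap {S : ℕ → Forest} (h : Heap m N K n S) (hK : 1 < K)
    (hS : ∀ i < K, i ≠ 1 → S i = .nil) : RootHeap m N K n (S 1) := by
  refine ⟨fun i hi h1 => by rw [(h.ptr i hi).1, hS i hi h1]; rfl, (h.ptr 1 hK).1, (h.ptr 1 hK).2,
    h.cnt_le hK, h.ids 1 hK, h.wf 1 hK, h.live 1 hK, fun x hx hn => ?_⟩
  obtain ⟨h₁, i, hi, h₂⟩ := h.all x hx hn
  refine ⟨h₁, ?_⟩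
  by_cases hi1 : i = 1
  · rwa [hi1] at h₂
  · rw [hS i hi hi1] at h₂; exact absurd rfl h₂

theorem heapPot_rootHeap (hK : 1 < K) :
    heapPot K (Function.update (fun _ => .nil) 1 F) = F.pot 2 1 := by
  rw [heapPot, Finset.sum_eq_single 1]
  · simp [slotPot]
  · intro b _ hb
    rw [Function.update_of_ne hb]
    simp [slotPot, Forest.pot]
  · intro h₁; simp at h₁; omega

/-- The node of an item in the heap. -/
theorem RootHeap.exists_node (h : RootHeap m N K n F) {x : ℕ} (hx : x < N) (hn : m.nod x ≠ 0) :
    ∃ d, F.Mem d ∧ d.id = m.nod x ∧ d.item = x ∧ d.full = true ∧ d.key = m.dist x := by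
  obtain ⟨h₁, h₂⟩ := h.all x hx hn
  obtain ⟨d, hd, hid⟩ := Forest.cnt_ne_zero.1 h₂
  have hit := (h.ptr.mem hd).1
  rw [hid, h₁] at hit
  have hl := h.live d hd
  have hf : d.full = true := hl.1.2 (by rw [← hit, hid])
  exact ⟨d, hd, hid, hit.symm, hf, by rw [← hl.2 hf, ← hit]⟩

/-- The node of an item becomes hollow. -/
theorem RootHeap.extract (h : RootHeap m N K n F) {d : HNode} (hd : F.Mem d)
    (hf : d.full = true) : ∃ F', RootHeap { m with nod := Function.update m.nod d.item 0 } N K n F' ∧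
      F'.pot 2 1 ≤ F.pot 2 1 + 2 + 3 * d.rank := by
  obtain ⟨c, hc⟩ := hd.exists_repl
  obtain ⟨F', hr⟩ := hc { d with full := false } c
  have hw := hr.wf_left h.wf
  have hnod := (h.live d hd).1.1 hf
  refine ⟨F', ⟨h.empty, by rw [hr.hd rfl]; exact h.head, ?_, fun v => ?_, fun v hv => ?_,
    hr.wf (fun _ => id) rfl rfl rfl hw.2.2.1 hw.2.2.2.1 h.wf, fun e he => ?_, fun x hx hn => ?_⟩, ?_⟩
  · refine hr.ptr (m := m) rfl rfl rfl rfl ((hr.ptr_left h.ptr).2.congr fun v _ => ?_)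
      (fun v hv => absurd ?_ hv) h.cnt h.ptr <;> exact ⟨rfl, rfl, rfl, rfl⟩
  · have := hr.cnt rfl v; have := h.cnt v; omega
  · have := hr.cnt rfl v; exact h.ids v (by omega)
  · rcases hr.mem (fun _ => id) (h.cnt _) he with rfl | ⟨he', hne⟩
    · simp
      exact (h.ptr.id_ne_zero hd).symm
    · obtain ⟨l₁, l₂⟩ := h.live e he'
      -- Further nodes with the same item were hollow before, since `d` was the current one;
      -- resetting `nod` to 0 is consistent with them.
      by_cases hx : e.item = d.item
      · have hef : e.full = false := by
          by_contra h'
          exact hne (by rw [← l₁.1 (by simpa using h'), hx, hnod])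
        simp only [hx, Function.update_self, hef]
        simpa using (h.ptr.id_ne_zero he').symm
      · simp only [Function.update_of_ne hx]
        exact ⟨l₁, l₂⟩
  · have h₁ : x ≠ d.item := by rintro rfl; simp at hn
    simp only [Function.update_of_ne h₁] at hn ⊢
    obtain ⟨g₁, g₂⟩ := h.all x hx hn
    have := hr.cnt rfl (m.nod x)
    exact ⟨g₁, by omega⟩
  · have := hr.pot hf rfl (x := 0) rfl 2 1 (by omega)
    -- A full node has exactly as many children as its rank says.
    rw [(hw.2.1 hf).trees] at this
    omega

/-- The memory after item `x` with key `k` has been inserted in a new node `n + 1`; an old node of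
this item becomes hollow and keeps its first two children only. -/
def HMem.push (m : HMem) (n x k : ℕ) : HMem where
  H := Function.update m.H 1 (n + 1)
  it := Function.update m.it (n + 1) x
  rk := Function.update m.rk (n + 1) (m.rk (m.nod x) - 2)
  ch := Function.update m.ch (n + 1)
    (if 2 ≤ m.rk (m.nod x) then m.nx (m.nx (m.ch (m.nod x))) else 0)
  nx := Function.update (if 2 ≤ m.rk (m.nod x) then
    Function.update m.nx (m.nx (m.ch (m.nod x))) 0 else m.nx) (n + 1) (m.H 1)
  nod := Function.update m.nod x (n + 1)
  dist := Function.update m.dist x k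

/-- `F'` is the forest after the old node has been hollowed, `G` the list of children that the new
node takes over. Cutting the list of children by one change of `nx` is all that happens to old
nodes; everything else is written to the fresh name `n + 1`. -/
theorem RootHeap.push_aux (h : RootHeap m N K n F) {x k : ℕ} {F' G : Forest}
    (hhd : F'.hd = F.hd) (hsame : ∀ v, F'.cnt v ≠ 0 ∨ G.cnt v ≠ 0 → v ≤ n)
    (hch : (m.push n x k).ch (n + 1) = G.hd)
    (hF : F'.Ptr { m with nx := (if 2 ≤ m.rk (m.nod x) then
      Function.update m.nx (m.nx (m.ch (m.nod x))) 0 else m.nx) })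
    (hG : G.Ptr { m with nx := (if 2 ≤ m.rk (m.nod x) then
      Function.update m.nx (m.nx (m.ch (m.nod x))) 0 else m.nx) })
    (hcnt : ∀ v, F'.cnt v + G.cnt v = F.cnt v) (hwF : F'.Wf) (hwG : G.Wf)
    (hchain : G.Chain (m.rk (m.nod x) - 2)) (hkey : ∀ e, G.Mem e → k ≤ e.key)
    (hlive : ∀ e, F'.Mem e ∨ G.Mem e → if e.item = x then e.full = false else
      (e.full = true ↔ m.nod e.item = e.id) ∧ (e.full = true → m.dist e.item = e.key)) :
    RootHeap (m.push n x k) N K (n + 1)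
      (.node ⟨n + 1, x, k, m.rk (m.nod x) - 2, true⟩ G F') := by
  have hs : ∀ v ≤ n, HMem.SameAt { m with nx := (if 2 ≤ m.rk (m.nod x) then
      Function.update m.nx (m.nx (m.ch (m.nod x))) 0 else m.nx) } (m.push n x k) v := by
    intro v hv
    have : v ≠ n + 1 := by omega
    refine ⟨?_, ?_, ?_, ?_⟩ <;> simp [HMem.push, this]
  have hnew : F.cnt (n + 1) = 0 := by
    by_contra hc; have := h.ids _ hc; omega
  constructor
  · intro i hi h1
    simpa [HMem.push, h1] using h.empty i hi h1
  · simp [HMem.push, Forest.hd]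
  · refine ⟨by simp, by simp [HMem.push], by simp [HMem.push], hch, ?_,
      hG.congr fun v hv => hs v (hsame v (Or.inr hv)), hF.congr fun v hv => hs v (hsame v (Or.inl hv))⟩
    simp [HMem.push, hhd, h.head]
  · intro v
    have h₁ := hcnt v
    have h₂ := h.cnt v
    simp only [Forest.cnt]
    split_ifs with h₃
    · subst h₃; omega
    · omega
  · intro v hv
    simp only [Forest.cnt] at hv
    split_ifs at hv with h₃
    · omega
    · have := hsame v (by omega); omega
  · exact ⟨hkey, fun _ => hchain, hchain.top, hwG, hwF⟩
  · intro e he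
    rcases he with rfl | he
    · simp [HMem.push]
    · have hl := hlive e he.symm
      have hid : e.id ≤ n := hsame e.id (by
        rcases he with he | he
        · exact Or.inr (by have := he.cnt_pos; omega)
        · exact Or.inl (by have := he.cnt_pos; omega))
      split_ifs at hl with h₁
      · simp [HMem.push, h₁, hl]; omega
      · simpa [HMem.push, h₁] using hl
  · intro y hy hn
    by_cases hyx : y = x
    · subst hyx; simp [HMem.push, Forest.cnt]
    · simp only [HMem.push, Function.update_of_ne hyx] at hn ⊢
      obtain ⟨h₁, h₂⟩ := h.all y hy hn
      have h₃ := h.ids _ h₂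
      have := hcnt (m.nod y)
      simp only [Forest.cnt]
      rw [Function.update_of_ne (by omega)]
      exact ⟨h₁, by omega⟩

/-- Insertion and decrease of a key are one operation. An item without node has `nod = 0`, and node
0 has rank 0 by `h0`, so nothing is taken over. Otherwise the children after the first two, of ranks
`r - 3, …, 0`, go to the new node, which gets rank `r - 2`; heap order holds because their keys are
at least the old key, hence at least `k`. The potential grows by at most 2 for the new root, 2 for
the hollowed node and 3 for each of its two children, in total 10. -/
theorem RootHeap.push (h : RootHeap m N K n F) {x k : ℕ} (hx : x < N)
    (hk : m.nod x ≠ 0 → k ≤ m.dist x) (h0 : m.rk 0 = 0) :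
    ∃ F', RootHeap (m.push n x k) N K (n + 1) F' ∧ F'.pot 2 1 ≤ F.pot 2 1 + 10 := by
  by_cases hn : m.nod x = 0
  · have hr : m.rk (m.nod x) = 0 := by rw [hn, h0]
    refine ⟨_, h.push_aux (F' := F) (G := .nil) rfl ?_ ?_ ?_ trivial (fun v => by simp [Forest.cnt])
      h.wf trivial ?_ (fun e he => he.elim) ?_, ?_⟩
    · rintro v (hv | hv)
      · exact h.ids v hv
      · exact absurd rfl hv
    · simp [HMem.push, hr, Forest.hd]
    · rw [hr]; exact h.ptr
    · simp [hr, Forest.Chain]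
    · rintro e (he | he)
      · have hl := h.live e he
        split_ifs with h₁
        · by_contra hf
          have := hl.1.1 (by simpa using hf)
          rw [h₁, hn] at this
          exact h.ptr.id_ne_zero he this.symm
        · exact hl
      · exact he.elim
    · simp [Forest.pot]; omega
  · obtain ⟨d, hd, hid, hit, hf, hdk⟩ := h.exists_node hx hn
    obtain ⟨c, hc⟩ := hd.exists_repl
    obtain ⟨F', hr⟩ := hc { d with full := false } c.take2
    have hw := hr.wf_left h.wf
    have hrk : m.rk (m.nod x) = d.rank := by rw [← hid]; exact (h.ptr.mem hd).2
    have hch := hw.2.1 hf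
    obtain ⟨hcd, hcp⟩ := hr.ptr_left h.ptr
    rw [hid] at hcd
    have hge := hr.cnt_ge
    have hcnt : ∀ v, F'.cnt v + c.drop2.cnt v = F.cnt v := by
      intro v
      have := hr.cnt rfl v
      have := c.cnt_take2_add v
      omega
    have hmem : ∀ e, c.drop2.Mem e → F.Mem e ∧ e.id ≠ d.id := by
      intro e he
      have h₁ := he.cnt_pos
      have h₂ := hcnt e.id
      have h₃ := h.cnt e.id
      have h₄ := hge d.id
      have h₅ := h.cnt d.id
      simp only [if_true] at h₄
      refine ⟨?_, fun h' => ?_⟩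
      · obtain ⟨F'', hr'⟩ := hc d c
        clear * - hr' he
        have hm : c.Mem e := Forest.mem_of_drop2 he
        induction hr' with
        | here s => exact Or.inr (Or.inl hm)
        | child _ _ _ ih => exact Or.inr (Or.inl ih)
        | sibling _ _ _ ih => exact Or.inr (Or.inr ih)
      · have := c.cnt_take2_add d.id
        rw [h'] at h₁
        omega
    have hptr : c.take2.Ptr { m with nx := (if 2 ≤ m.rk (m.nod x) then
          Function.update m.nx (m.nx (m.ch (m.nod x))) 0 else m.nx) } ∧
        c.drop2.Ptr { m with nx := (if 2 ≤ m.rk (m.nod x) then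
          Function.update m.nx (m.nx (m.ch (m.nod x))) 0 else m.nx) } ∧
        (∀ v, ¬ m.SameAt { m with nx := (if 2 ≤ m.rk (m.nod x) then
          Function.update m.nx (m.nx (m.ch (m.nod x))) 0 else m.nx) } v → c.cnt v ≠ 0) ∧
        (m.push n x k).ch (n + 1) = c.drop2.hd := by
      have hc1 : ∀ v, c.cnt v ≤ 1 := fun v => by have := hge v; have := h.cnt v; omega
      simp only [HMem.push, hrk, hcd, Function.update_self]
      match c, hch, hcp, hc1 with
      | .nil, hch, hcp, hc1 =>
        have : d.rank = 0 := hch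
        simp only [this]
        exact ⟨trivial, trivial, fun v hv => absurd ⟨rfl, rfl, rfl, rfl⟩ hv, rfl⟩
      | .node d₁ c₁ .nil, hch, hcp, hc1 =>
        have : d.rank = 1 := by have := hch.1; have : d₁.rank = 0 := hch.2; omega
        simp only [this]
        exact ⟨hcp, trivial, fun v hv => absurd ⟨rfl, rfl, rfl, rfl⟩ hv, rfl⟩
      | .node d₁ c₁ (.node d₂ c₂ s₂), hch, hcp, hc1 =>
        have : 2 ≤ d.rank := by have := hch.1; have := hch.2.1; omega
        simp only [if_pos this, Forest.hd]
        obtain ⟨p₁, p₂, p₃, p₄, p₅, p₆, q₁, q₂, q₃, q₄, q₅, q₆, q₇⟩ := hcp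
        simp only [Forest.hd] at p₅
        rw [p₅]
        have hd2 := hc1 d₂.id
        simp only [Forest.cnt, if_true] at hd2
        have hd1 : d₁.id ≠ d₂.id := by intro h'; rw [if_pos h'] at hd2; omega
        rw [if_neg hd1] at hd2
        have hsame : ∀ v, v ≠ d₂.id →
            m.SameAt { m with nx := Function.update m.nx d₂.id 0 } v := fun v hv =>
          ⟨rfl, rfl, rfl, by simp [Function.update_of_ne hv]⟩
        refine ⟨⟨p₁, p₂, p₃, p₄, by simp [hd1, p₅, Forest.hd],
          p₆.congr fun v hv => hsame v ?_, q₁, q₂, q₃, q₄, by simp [Forest.hd],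
          q₆.congr fun v hv => hsame v ?_, trivial⟩, q₇.congr fun v hv => hsame v ?_,
          fun v hv => ?_, by rw [q₅]; rfl⟩
        · rintro rfl; omega
        · rintro rfl; omega
        · rintro rfl; omega
        · have : v = d₂.id := by by_contra h'; exact hv (hsame v h')
          subst this
          simp [Forest.cnt]
    obtain ⟨hp₁, hp₂, hp₃, hp₄⟩ := hptr
    refine ⟨_, h.push_aux (F' := F') (G := c.drop2) (hr.hd rfl) ?_ hp₄ ?_ hp₂ hcnt
      (hr.wf (fun _ => Forest.mem_of_take2) rfl rfl rfl hw.2.2.1.take2 hw.2.2.2.1.take2 h.wf)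
      hw.2.2.2.1.drop2 (by rw [hrk]; exact hch.drop2) ?_ ?_, ?_⟩
    · intro v hv; have := hcnt v; exact h.ids v (by omega)
    · exact hr.ptr (m := m) rfl rfl rfl c.hd_take2 hp₁ hp₃ h.cnt h.ptr
    · intro e he
      exact (hk hn).trans (hdk ▸ hw.1 e (Forest.mem_of_drop2 he))
    · have key : ∀ e, F.Mem e → e.id ≠ d.id → if e.item = x then e.full = false else
          (e.full = true ↔ m.nod e.item = e.id) ∧ (e.full = true → m.dist e.item = e.key) := by
        intro e he hne
        have hl := h.live e he
        split_ifs with h₁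
        · by_contra hf'
          have := hl.1.1 (by simpa using hf')
          rw [h₁, ← hid] at this
          exact hne this.symm
        · exact hl
      rintro e (he | he)
      · rcases hr.mem (fun _ => Forest.mem_of_take2) (h.cnt _) he with rfl | ⟨he', hne⟩
        · rw [if_pos hit]
        · exact key e he' hne
      · obtain ⟨he', hne⟩ := hmem e he
        exact key e he' hne
    · have h₁ := hr.pot hf rfl (x := c.drop2.pot 0 2) (c.pot_take2_add 0 2) 2 1 (by omega)
      have h₂ := c.trees_take2
      simp [Forest.pot]
      omega

end RootHeap

end CTQAMSC

namespace CTQAMSC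

/-! ### Heap programs -/

/-- The heap in memory. -/
def hmem (σ : State) : HMem :=
  ⟨σ.nat 120, σ.nat 121, σ.nat 122, σ.nat 123, σ.nat 124, σ.nat 125, σ.nat 126⟩

/-- Move the first tree of slot `i` to slot `j`. -/
def hpMove (i j : NExp) : Cmd :=
  block [
    assign 133 (.get 120 i),
    assign 136 (.get 124 (var 133)),
    .setNat 124 (var 133) (.get 120 j),
    .setNat 120 j (var 133),
    .setNat 120 i (var 136)]

def hpDestroy : Cmd :=
  block [
    .setNat 120 (.const 1) (.get 124 (var 133)),
    .setNat 120 (.const 0) (.get 123 (var 133))]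

/-- Link the root `133` and the root `134` of the table. -/
def hpLink : Cmd :=
  block [
    .setNat 120 (.plus (.get 122 (var 133)) (.const 2)) (.const 0),
    .ite (.natLe (.get 126 (.get 121 (var 133))) (.get 126 (.get 121 (var 134))))
      (block [
        .setNat 124 (var 134) (.get 123 (var 133)),
        .setNat 123 (var 133) (var 134),
        .setNat 122 (var 133) (.plus (.get 122 (var 133)) (.const 1))])
      (block [
        .setNat 124 (var 134) (.get 124 (var 133)),
        .setNat 124 (var 133) (.get 123 (var 134)),
        .setNat 123 (var 134) (var 133),
        .setNat 122 (var 134) (.plus (.get 122 (var 133)) (.const 1)),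
        .setNat 120 (.const 1) (var 134)])]

def hpStep : Cmd :=
  .ite (.natEq (.get 120 (.const 0)) (.const 0))
    (block [
      assign 133 (.get 120 (.const 1)),
      .ite (.natEq (.get 125 (.get 121 (var 133))) (var 133))
        (block [
          assign 134 (.get 120 (.plus (.get 122 (var 133)) (.const 2))),
          .ite (.natEq (var 134) (.const 0))
            (hpMove (.const 1) (.plus (.get 122 (var 133)) (.const 2)))
            hpLink])
        hpDestroy])
    (hpMove (.const 0) (.const 1))

def hpScan : Cmd :=
  block [
    .ite (.natEq (.get 120 (var 135)) (.const 0)) .skip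
      (block [
        hpMove (var 135) (.const 1),
        .ite (.and (.not (.natEq (var 137) (.const 0)))
            (.natLe (.get 126 (.get 121 (var 137))) (.get 126 (.get 121 (var 133)))))
          .skip
          (assign 137 (var 133))]),
    incr 135]

/-- Reorganize the heap and find a node `137` with minimum key (`0` if the heap is empty). -/
def hpMin : Cmd :=
  block [
    .loop (.not (.and (.natEq (.get 120 (.const 0)) (.const 0))
      (.natEq (.get 120 (.const 1)) (.const 0)))) hpStep,
    assign 137 (.const 0),
    assign 135 (.const 2),
    .loop (.natLt (var 135) (var 131)) hpScan]

/-- The slots of the table hold at most one tree, of the rank of the slot. -/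
def Tabled (i₀ K : ℕ) (S : ℕ → Forest) : Prop :=
  ∀ i, i₀ ≤ i → i < K → S i = .nil ∨
    ∃ d c, S i = .node d c .nil ∧ d.full = true ∧ d.rank + 2 = i

/-- The slots are expressions that are evaluated anew at each assignment and may read memory, such
as a counter or a rank. The hypotheses ask that the intermediate writes do not change their values.
-/
theorem hmem_hpMove {σ : State} {i j : NExp} {a b : ℕ} (hi : i.eval σ = a)
    (hj : ∀ x y z, j.eval (((σ.setNat 133 0 (σ.nat 120 a)).setNat 136 0 x).setNat 124 y z) = b)
    (hj' : j.eval ((σ.setNat 133 0 (σ.nat 120 a)).setNat 136 0 (σ.nat 124 (σ.nat 120 a))) = b)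
    (hi' : ∀ x y z w v u, i.eval ((((σ.setNat 133 0 x).setNat 136 0 y).setNat 124 z w).setNat 120
      v u) = a)
    (hab : a ≠ b) :
    hmem ((hpMove i j).run σ) = { hmem σ with
      H := Function.update (Function.update (σ.nat 120) a (σ.nat 124 (σ.nat 120 a))) b (σ.nat 120 a)
      nx := Function.update (σ.nat 124) (σ.nat 120 a) (σ.nat 120 b) } ∧
    ((hpMove i j).run σ).nat 133 0 = σ.nat 120 a := by
  simp [hpMove, block, Cmd.run, hi, hj, hj', hi', hmem]
  rw [Function.update_comm hab]

section HpStep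

variable {σ : State} {N K n B : ℕ} {S : ℕ → Forest}

theorem Tabled.mono {i j : ℕ} (h : Tabled i K S) (hij : i ≤ j) : Tabled j K S :=
  fun k hk => h k (hij.trans hk)

theorem Heap.of_eq {m m' : HMem} (h : Heap m N K n S) (e : m' = m) : Heap m' N K n S := e ▸ h

/-- Each case releases exactly one unit of `slotPot`. From slot 0 to slot 1 the weight of a tree
drops from 3 to 2 if its root is full and from 2 to 1 if it is hollow. Destroying a hollow root
frees its weight 1, since its children already counted with the weights of slot 0. Putting a full
root into the table changes 2 to 1. Linking replaces weights 2 and 1 by a root of weight 2 and a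
full child of a full node, of weight 0. -/
theorem hpStep_run (h : Heap (hmem σ) N K n S) (ht : Tabled 2 K S) (hK : K = 2 * B + 2)
    (hn : n < 2 ^ B) (h0 : σ.nat 122 0 = 0) (hne : ¬ (σ.nat 120 0 = 0 ∧ σ.nat 120 1 = 0)) :
    ∃ S', Heap (hmem (hpStep.run σ)) N K n S' ∧ Tabled 2 K S' ∧ heapPot K S' + 1 ≤ heapPot K S ∧
      (hpStep.run σ).nat 122 0 = 0 := by
  have p0 := h.ptr 0 (by omega)
  have p1 := h.ptr 1 (by omega)
  have e0 : σ.nat 120 0 = (S 0).hd := p0.1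
  have e1 : σ.nat 120 1 = (S 1).hd := p1.1
  by_cases hk : σ.nat 120 0 = 0
  swap
  · -- a child of a destroyed node becomes a root
    have hrun : hpStep.run σ = (hpMove (.const 0) (.const 1)).run σ := by
      simp [hpStep, Cmd.run, hk]
    rw [hrun]
    obtain ⟨d, c, s, hS⟩ : ∃ d c s, S 0 = .node d c s := by
      cases hS : S 0 with
      | nil => rw [hS] at e0; exact absurd e0 hk
      | node d c s => exact ⟨d, c, s, rfl⟩
    have hd : σ.nat 120 0 = d.id := by rw [e0, hS]; rfl
    have hm := (hmem_hpMove (σ := σ) (i := .const 0) (j := .const 1) (a := 0) (b := 1) rfl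
      (fun _ _ _ => rfl) rfl (fun _ _ _ _ _ _ => rfl) (by decide)).1
    rw [hd] at hm
    refine ⟨_, by rw [hm]; exact h.move (i := 0) (j := 1) (by omega) (by omega) (by omega) hS,
      fun i hi hiK => ?_, ?_, ?_⟩
    · rw [Function.update_of_ne (by omega), Function.update_of_ne (by omega)]
      exact ht i hi hiK
    · have := heapPot_update (S := S) (show 0 < K by omega) (show 1 < K by omega) (by omega) s
        (.node d c (S 1))
      rw [hS] at this
      simp only [slotPot, if_true, one_ne_zero, if_false, Forest.pot] at this
      split_ifs at this <;> omega
    · have : d.id ≠ 0 := by rwa [← hd]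
      simp [hpMove, block, Cmd.run, h0]
  have hS0 : S 0 = .nil := p0.2.hd_eq_zero.1 (by rw [← e0, hk])
  have h1 : σ.nat 120 1 ≠ 0 := fun h => hne ⟨hk, h⟩
  obtain ⟨d, c, s, hS⟩ : ∃ d c s, S 1 = .node d c s := by
    cases hS : S 1 with
    | nil => rw [hS] at e1; exact absurd e1 h1
    | node d c s => exact ⟨d, c, s, rfl⟩
  have hd : σ.nat 120 1 = d.id := by rw [e1, hS]; rfl
  have hd0 : d.id ≠ 0 := by rwa [← hd]
  have hp := p1.2
  rw [hS] at hp
  have it_d : σ.nat 121 d.id = d.item := hp.2.1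
  have rk_d : σ.nat 122 d.id = d.rank := hp.2.2.1
  have hmem1 : (S 1).Mem d := by rw [hS]; exact Or.inl rfl
  have live_d := h.live 1 (by omega) d hmem1
  have hrank := h.rank_lt hn (show 1 < K by omega) hmem1
  by_cases hf : d.full = true
  swap
  · -- a hollow root is destroyed
    have hnod : σ.nat 125 d.item ≠ d.id := fun h => hf (live_d.1.2 h)
    have hrun : hpStep.run σ = ((σ.setNat 133 0 d.id).setNat 120 1 (σ.nat 124 d.id)).setNat 120 0
        (σ.nat 123 d.id) := by
      simp [hpStep, hpDestroy, block, Cmd.run, hk, hd, it_d, hnod]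
    rw [hrun]
    refine ⟨_, h.destroy (by omega) hS hS0 (by simpa using hf), fun i hi hiK => ?_, ?_,
      by simp [h0]⟩
    · rw [Function.update_of_ne (by omega), Function.update_of_ne (by omega)]
      exact ht i hi hiK
    · have := heapPot_update (S := S) (show 1 < K by omega) (show 0 < K by omega) (by omega) s c
      rw [hS, hS0] at this
      simp only [slotPot, if_true, one_ne_zero, if_false, Forest.pot, hf] at this
      simp at this
      omega
  have hnod : σ.nat 125 d.item = d.id := live_d.1.1 hf
  have hr2 : d.rank + 2 < K := by omega
  have pr := h.ptr (d.rank + 2) hr2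
  have er : σ.nat 120 (d.rank + 2) = (S (d.rank + 2)).hd := pr.1
  rcases ht (d.rank + 2) (by omega) hr2 with hnil | ⟨e, ce, he, hef, her⟩
  · -- a root is put into the table
    rw [hnil] at er
    simp only [Forest.hd] at er
    have hrun : hpStep.run σ = (hpMove (.const 1) (.plus (.get 122 (var 133)) (.const 2))).run
        ((σ.setNat 133 0 d.id).setNat 134 0 0) := by
      simp [hpStep, block, Cmd.run, hk, hd, it_d, hnod, rk_d, er]
    rw [hrun]
    have hm := (hmem_hpMove (σ := (σ.setNat 133 0 d.id).setNat 134 0 0) (i := .const 1)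
      (j := .plus (.get 122 (var 133)) (.const 2)) (a := 1) (b := d.rank + 2) rfl
      (by intros; simp [hd, rk_d]) (by simp [hd, rk_d]) (fun _ _ _ _ _ _ => rfl) (by omega)).1
    replace hm := hm.trans (c := { hmem σ with
      H := Function.update (Function.update (σ.nat 120) 1 (σ.nat 124 d.id)) (d.rank + 2) d.id
      nx := Function.update (σ.nat 124) d.id (σ.nat 120 (d.rank + 2)) }) (by simp [hmem, hd])
    refine ⟨_, by rw [hm]; exact h.move (i := 1) (j := d.rank + 2) (by omega) hr2 (by omega) hS,
      fun i hi hiK => ?_, ?_, by simp [hpMove, block, Cmd.run, h0]⟩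
    · by_cases hi' : i = d.rank + 2
      · subst hi'
        rw [Function.update_self, hnil]
        exact Or.inr ⟨d, c, rfl, hf, rfl⟩
      · rw [Function.update_of_ne hi', Function.update_of_ne (by omega)]
        exact ht i hi hiK
    · have := heapPot_update (S := S) (show 1 < K by omega) hr2 (by omega) s
        (.node d c (S (d.rank + 2)))
      rw [hS, hnil] at this
      rw [hnil]
      simp [slotPot, Forest.pot, hf] at this
      omega
  · -- two roots are linked
    have hrank' : e.rank = d.rank := by omega
    have hq := pr.2
    rw [he] at er hq
    simp only [Forest.hd] at er
    have he0 : e.id ≠ 0 := hq.1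
    have it_e : σ.nat 121 e.id = e.item := hq.2.1
    have hmeme : (S (d.rank + 2)).Mem e := by rw [he]; exact Or.inl rfl
    have live_e := h.live _ hr2 e hmeme
    have kd : σ.nat 126 d.item = d.key := live_d.2 hf
    have ke : σ.nat 126 e.item = e.key := live_e.2 hef
    have hne' : e.id ≠ d.id := by
      have := h.disj (show 1 < K by omega) hr2 (by omega) d.id
      have h₁ := hmem1.cnt_pos
      have h₂ := hmeme.cnt_pos
      intro h₃
      rw [h₃] at h₂
      omega
    by_cases hkey : d.key ≤ e.key
    · have hrun : hpStep.run σ = (((((σ.setNat 133 0 d.id).setNat 134 0 e.id).setNat 120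
          (d.rank + 2) 0).setNat 124 e.id (σ.nat 123 d.id)).setNat 123 d.id e.id).setNat 122 d.id
          (d.rank + 1) := by
        simp [hpStep, hpLink, block, Cmd.run, hk, hd, it_d, hnod, rk_d, er, he0, it_e, kd, ke, hkey]
      rw [hrun]
      refine ⟨_, (h.link_left hr2 (by omega) hS he hf hrank' hkey).of_eq (by simp [hmem]), fun i hi hiK => ?_, ?_,
        by simp [h0, hd0.symm]⟩
      · by_cases hi' : i = d.rank + 2
        · subst hi'; left; simp [show d.rank + 2 ≠ 1 by omega]
        · rw [Function.update_of_ne (by omega), Function.update_of_ne hi']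
          exact ht i hi hiK
      · have := heapPot_update (S := S) hr2 (show 1 < K by omega) (by omega) .nil
          (.node { d with rank := d.rank + 1 } (.node e ce c) s)
        rw [hS, he] at this
        simp [slotPot, Forest.pot, hf, hef] at this
        simp only [hf, hef]
        omega
    · have hrun : hpStep.run σ = (((((((σ.setNat 133 0 d.id).setNat 134 0 e.id).setNat 120
          (d.rank + 2) 0).setNat 124 e.id (σ.nat 124 d.id)).setNat 124 d.id (σ.nat 123 e.id)).setNat
          123 e.id d.id).setNat 122 e.id (d.rank + 1)).setNat 120 1 e.id := by
        simp [hpStep, hpLink, block, Cmd.run, hk, hd, it_d, hnod, rk_d, er, he0, it_e, kd, ke, hkey,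
          hne'.symm]
      rw [hrun]
      refine ⟨_, (h.link_right hr2 (by omega) hS he hef hrank' (by omega)).of_eq (by simp [hmem]), fun i hi hiK => ?_, ?_,
        by simp [h0, he0.symm]⟩
      · by_cases hi' : i = d.rank + 2
        · subst hi'; left; simp [show d.rank + 2 ≠ 1 by omega]
        · rw [Function.update_of_ne (by omega), Function.update_of_ne hi']
          exact ht i hi hiK
      · have := heapPot_update (S := S) hr2 (show 1 < K by omega) (by omega) .nil
          (.node { e with rank := d.rank + 1 } (.node d c ce) s)
        rw [hS, he] at this
        simp [slotPot, Forest.pot, hf, hef] at this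
        simp only [hf, hef]
        omega

/-- The node `mn` has minimum key in `F`. -/
def IsMinNode (F : Forest) (mn : ℕ) : Prop :=
  (mn = 0 ∧ F = .nil) ∨ ∃ d, F.Mem d ∧ d.id = mn ∧ d.full = true ∧ ∀ e, F.Mem e → d.key ≤ e.key

/-- By heap order the root of the moved tree is minimal in it, so one comparison with the previous
minimum updates `IsMinNode`. The move back from the table to slot 1 costs one unit of potential. -/
theorem hpScan_run {i : ℕ} (h : Heap (hmem σ) N K n S) (ht : Tabled i K S) (hi : 2 ≤ i)
    (hiK : i < K) (hnil : ∀ j < i, j ≠ 1 → S j = .nil) (hvi : σ.nat 135 0 = i)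
    (hmin : IsMinNode (S 1) (σ.nat 137 0)) :
    ∃ S', Heap (hmem (hpScan.run σ)) N K n S' ∧ Tabled (i + 1) K S' ∧
      (∀ j < i + 1, j ≠ 1 → S' j = .nil) ∧ (hpScan.run σ).nat 135 0 = i + 1 ∧
      IsMinNode (S' 1) ((hpScan.run σ).nat 137 0) ∧ heapPot K S' ≤ heapPot K S + 1 := by
  have pi := h.ptr i hiK
  have ei : σ.nat 120 i = (S i).hd := pi.1
  rcases ht i le_rfl hiK with hS | ⟨d, c, hS, hf, hr⟩
  · rw [hS] at ei
    simp only [Forest.hd] at ei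
    have hrun : hpScan.run σ = σ.setNat 135 0 (i + 1) := by
      simp [hpScan, block, Cmd.run, hvi, ei]
    rw [hrun]
    refine ⟨S, h, ht.mono (by omega), fun j hj hj1 => ?_, by simp, by simpa using hmin, by omega⟩
    rcases Nat.lt_succ_iff_lt_or_eq.1 hj with hj | rfl
    · exact hnil j hj hj1
    · exact hS
  · have hd : σ.nat 120 i = d.id := by rw [ei, hS]; rfl
    have hp := pi.2
    rw [hS] at hp
    have hd0 : d.id ≠ 0 := hp.1
    have it_d : σ.nat 121 d.id = d.item := hp.2.1
    have hmemd : (S i).Mem d := by rw [hS]; exact Or.inl rfl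
    have live_d := h.live i hiK d hmemd
    have kd : σ.nat 126 d.item = d.key := live_d.2 hf
    have hw := h.wf i hiK
    rw [hS] at hw
    obtain ⟨hm, hu⟩ := hmem_hpMove (σ := σ) (i := var 135) (j := .const 1) (a := i) (b := 1)
      (by simpa using hvi) (fun _ _ _ => rfl) rfl (by intros; simpa using hvi) (by omega)
    have hmove := h.move (i := i) (j := 1) hiK (by omega) (by omega) hS
    rw [hd] at hm hu
    set σ' := (hpMove (var 135) (.const 1)).run σ with hσ'
    have hh : Heap (hmem σ') N K n (Function.update (Function.update S i .nil) 1
      (.node d c (S 1))) := by rw [hm]; exact hmove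
    have f1 : σ'.nat 135 = σ.nat 135 := by simp [hσ', hpMove, block, Cmd.run]
    have f2 : σ'.nat 137 = σ.nat 137 := by simp [hσ', hpMove, block, Cmd.run]
    have f3 : σ'.nat 121 = σ.nat 121 := by simp [hσ', hpMove, block, Cmd.run]
    have f4 : σ'.nat 126 = σ.nat 126 := by simp [hσ', hpMove, block, Cmd.run]
    have hpot := heapPot_update (S := S) hiK (show 1 < K by omega) (by omega) .nil
      (.node d c (S 1))
    have hpot' : heapPot K (Function.update (Function.update S i .nil) 1 (.node d c (S 1))) ≤
        heapPot K S + 1 := by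
      rw [hS] at hpot
      simp [slotPot, Forest.pot, hf, show i ≠ 0 by omega, show i ≠ 1 by omega] at hpot
      omega
    have htab : Tabled (i + 1) K
        (Function.update (Function.update S i .nil) 1 (.node d c (S 1))) := by
      intro j hj hjK
      rw [Function.update_of_ne (by omega), Function.update_of_ne (by omega)]
      exact ht j (by omega) hjK
    have hnil' : ∀ j < i + 1, j ≠ 1 →
        Function.update (Function.update S i .nil) 1 (.node d c (S 1)) j = .nil := by
      intro j hj hj1
      rw [Function.update_of_ne hj1]
      rcases Nat.lt_succ_iff_lt_or_eq.1 hj with hj | rfl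
      · rw [Function.update_of_ne (by omega)]; exact hnil j hj hj1
      · simp
    have hrun0 : hpScan.run σ = if (¬ σ.nat 137 0 = 0 ∧
        σ.nat 126 (σ.nat 121 (σ.nat 137 0)) ≤ σ.nat 126 (σ.nat 121 d.id)) then
        σ'.setNat 135 0 (i + 1) else (σ'.setNat 137 0 d.id).setNat 135 0 (i + 1) := by
      simp only [hpScan, block, Cmd.run, ← hσ']
      simp [Cmd.run, hvi, hd, hd0, f1, f2, f3, f4, hu]
      split_ifs <;> simp [f1, hvi]
    rw [hrun0]
    have hmin' : (S 1 = .nil ∨ ∃ e, (S 1).Mem e ∧ e.full = true ∧ σ.nat 137 0 = e.id ∧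
        σ.nat 137 0 ≠ 0 ∧ σ.nat 126 (σ.nat 121 (σ.nat 137 0)) = e.key ∧
        ∀ e', (S 1).Mem e' → e.key ≤ e'.key) := by
      rcases hmin with ⟨-, h₁⟩ | ⟨e, h₁, h₂, h₃, h₄⟩
      · exact Or.inl h₁
      · refine Or.inr ⟨e, h₁, h₃, h₂.symm, ?_, ?_, h₄⟩
        · rw [← h₂]; exact (h.ptr 1 (by omega)).2.id_ne_zero h₁
        · have g₁ : σ.nat 121 e.id = e.item := ((h.ptr 1 (by omega)).2.mem h₁).1
          have g₂ : σ.nat 126 e.item = e.key := (h.live 1 (by omega) e h₁).2 h₃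
          rw [← h₂, g₁, g₂]
    rw [it_d, kd]
    split_ifs with hc
    · refine ⟨_, by simpa [hmem] using hh, htab, hnil', by simp, ?_, hpot'⟩
      rcases hmin with ⟨h₁, -⟩ | ⟨e, h₁, h₂, h₃, h₄⟩
      · exact absurd h₁ hc.1
      rcases hmin' with h₅ | ⟨e', g₁, g₂, g₃, g₄, g₅, g₆⟩
      · rw [h₅] at h₁; exact h₁.elim
      rw [g₅] at hc
      refine Or.inr ⟨e', by simp; exact Or.inr (Or.inr g₁), by simp [f2, g₃], g₂, ?_⟩
      simp only [Function.update_self]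
      rintro x (rfl | hx | hx)
      · exact hc.2
      · exact hc.2.trans (hw.1 x hx)
      · exact g₆ x hx
    · refine ⟨_, by simpa [hmem] using hh, htab, hnil', by simp, ?_, hpot'⟩
      refine Or.inr ⟨d, by simp; exact Or.inl rfl, by simp, hf, ?_⟩
      simp only [Function.update_self]
      rintro x (rfl | hx | hx)
      · exact le_rfl
      · exact hw.1 x hx
      · rcases hmin' with h₅ | ⟨e', g₁, g₂, g₃, g₄, g₅, g₆⟩
        · rw [h₅] at hx; exact hx.elim
        · rw [g₅] at hc
          have : ¬ e'.key ≤ d.key := fun h' => hc ⟨g₄, h'⟩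
          have := g₆ x hx
          omega

/-- A unit of potential is worth 100 credits. A round of the first loop takes at most 96 steps and
releases one unit. The scan visits `2B` slots, at most 96 steps each, and adds at most one unit per
slot, which accounts for `200 * K`. The credits `R` are carried along. -/
theorem runs_hpMin {F : Forest} {k R : ℕ} (h : RootHeap (hmem σ) N K n F) (hK : K = 2 * B + 2)
    (hn : n < 2 ^ B) (h0 : σ.nat 122 0 = 0) (hvK : σ.nat 131 0 = K)
    (hk : 100 * F.pot 2 1 + 200 * K + 30 + R ≤ k) :
    Runs hpMin σ k (fun τ k' => ∃ F', RootHeap (hmem τ) N K n F' ∧ τ.nat 122 0 = 0 ∧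
      IsMinNode F' (τ.nat 137 0) ∧ 100 * F'.pot 2 1 + R ≤ k') := by
  refine Runs.seq (Runs.loop (fun τ k' => ∃ S, Heap (hmem τ) N K n S ∧ Tabled 2 K S ∧
    τ.nat 122 0 = 0 ∧ 100 * heapPot K S + 200 * K + 30 + R ≤ k') ⟨_, h.heap (by omega), ?_, h0, ?_⟩
    ?_ ?_)
  · intro i hi _
    rw [Function.update_of_ne (by omega)]; exact Or.inl rfl
  · rw [heapPot_rootHeap (by omega)]; exact hk
  · rintro τ k' hτ ⟨S, h₁, h₂, h₃, h₄⟩ hb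
    obtain ⟨S', g₁, g₂, g₃, g₄⟩ := hpStep_run h₁ h₂ hK hn h₃ (by simpa using hb)
    refine ⟨k' - 11, by simp only [BExp.cost, NExp.cost]; omega, ?_⟩
    exact Runs.of_run 85 rfl (by decide) (by omega) ⟨S', g₁, g₂, g₄, by omega⟩
  · rintro τ k' hτ ⟨S, h₁, h₂, h₃, h₄⟩ hb
    refine ⟨k' - 11, by simp only [BExp.cost, NExp.cost]; omega, ?_⟩
    have hH : τ.nat 120 0 = 0 ∧ τ.nat 120 1 = 0 := by simpa using hb
    have hS0 : S 0 = .nil := (h₁.ptr 0 (by omega)).2.hd_eq_zero.1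
      (by rw [← (h₁.ptr 0 (by omega)).1]; exact hH.1)
    have hS1 : S 1 = .nil := (h₁.ptr 1 (by omega)).2.hd_eq_zero.1
      (by rw [← (h₁.ptr 1 (by omega)).1]; exact hH.2)
    have hvK' : τ.nat 131 0 = K := by
      rw [hτ.1 131 (by decide)]; exact hvK
    refine Runs.seq (Runs.of_run 3 rfl (by decide) (by omega) ?_)
    refine Runs.seq (Runs.of_run 3 rfl (by decide) (by omega) ?_)
    refine Runs.seq (Runs.count (2 * B) 90 (fun j υ => ∃ S', Heap (hmem υ) N K n S' ∧
      Tabled (j + 2) K S' ∧ (∀ i < j + 2, i ≠ 1 → S' i = .nil) ∧ υ.nat 135 0 = j + 2 ∧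
      IsMinNode (S' 1) (υ.nat 137 0) ∧ heapPot K S' ≤ heapPot K S + j) ?_ ?_ ?_ ?_ ?_)
    · refine ⟨S, h₁, h₂, fun i hi h1 => ?_, by simp [Cmd.run], Or.inl ⟨by simp [Cmd.run], hS1⟩, le_rfl⟩
      obtain rfl : i = 0 := by omega
      exact hS0
    · simp only [BExp.cost, NExp.cost, var]; omega
    · rintro j υ hj hυ ⟨S', -, -, -, g₄, -⟩
      have e := hυ.1 131 (by decide)
      simp [Cmd.run, hvK'] at e
      simp [e, g₄]
      omega
    · rintro j υ hj hυ ⟨S', g₁, g₂, g₃, g₄, g₅, g₆⟩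
      obtain ⟨S'', f₁, f₂, f₃, f₄, f₅, f₆⟩ := hpScan_run g₁ g₂ (by omega) (by omega) g₃ g₄ g₅
      exact Runs.of_run 90 rfl (by decide) le_rfl ⟨S'', f₁, f₂, f₃, f₄, f₅, by omega⟩
    · rintro υ hυ ⟨S', g₁, g₂, g₃, g₄, g₅, g₆⟩
      have e := hυ.1 122 (by decide)
      simp only [BExp.cost, NExp.cost, var]
      have hpot : (S' 1).pot 2 1 ≤ heapPot K S' := by
        refine le_trans ?_ (Finset.single_le_sum (f := fun i => slotPot i (S' i))
          (fun _ _ => Nat.zero_le _) (Finset.mem_range.2 (show 1 < K by omega)))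
        simp [slotPot]
      refine Runs.skip (by omega) ⟨S' 1, g₁.rootHeap (by omega) fun i hi h1 => g₃ i (by omega) h1,
        ?_, g₅, ?_⟩
      · rw [e]; simpa [Cmd.run] using h₃
      · omega

end HpStep

end CTQAMSC

namespace CTQAMSC

/-! ### Adjacency lists -/

/-- The linked list that starts with `h` and continues with the pointers `nx`; a link `e` is
represented by `e + 1`, and `0` is the end of the list. -/
def Linked {M : ℕ} (nx : ℕ → ℕ) : ℕ → List (Fin M) → Prop
  | h, [] => h = 0
  | h, e :: l => h = e + 1 ∧ Linked nx (nx e) l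

theorem Linked.congr {M : ℕ} {nx nx' : ℕ → ℕ} {l : List (Fin M)} {h : ℕ} (hl : Linked nx h l)
    (hn : ∀ e ∈ l, nx' e = nx e) : Linked nx' h l := by
  induction l generalizing h with
  | nil => exact hl
  | cons e l ih =>
    refine ⟨hl.1, ?_⟩
    rw [hn e (by simp)]
    exact ih hl.2 fun e' he' => hn e' (by simp [he'])

/-- The arrays of natural numbers outside `l` are the same in both states. -/
def SameBut (l : List ℕ) (σ τ : State) : Prop := ∀ a, a ∉ l → τ.nat a = σ.nat a

theorem SameBut.refl (l : List ℕ) (σ : State) : SameBut l σ σ := fun _ _ => rfl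

theorem SameBut.trans {l : List ℕ} {σ τ υ : State} (h₁ : SameBut l σ τ) (h₂ : SameBut l τ υ) :
    SameBut l σ υ := fun a ha => (h₂ a ha).trans (h₁ a ha)

theorem SameBut.mono {l l' : List ℕ} {σ τ : State} (h : SameBut l σ τ) (hl : l ⊆ l') :
    SameBut l' σ τ := fun a ha => h a fun h' => ha (hl h')

theorem Agree.sameBut {c : Cmd} {σ τ : State} (h : Agree c σ τ) {l : List ℕ} (hl : c.writes ⊆ l) :
    SameBut l σ τ := fun a ha => h.1 a fun h' => ha (hl h')

theorem SameBut.setNat {l : List ℕ} {σ τ : State} (h : SameBut l σ τ) {a : ℕ} (i x : ℕ)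
    (ha : a ∈ l) : SameBut l σ (τ.setNat a i x) := fun b hb => by
  have : b ≠ a := fun h' => hb (h'.symm ▸ ha)
  rw [setNat_nat_of_ne _ _ _ this, h b hb]

theorem SameBut.run {l : List ℕ} {σ τ : State} (h : SameBut l σ τ) {c : Cmd}
    (hc : c.LoopFree = true) (hl : c.writes ⊆ l) : SameBut l σ (c.run τ) := by
  obtain ⟨n, -, he⟩ := c.exec_run hc τ
  exact h.trans (he.agree.sameBut hl)

/-- The working memory holds a weighted graph and a node of it. -/
structure GraphAt {N M : ℕ} (src dst : Fin M → Fin N) (w : Fin M → ℕ) (s : Fin N) (σ : State) :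
    Prop where
  N_eq : σ.nat 110 0 = N
  M_eq : σ.nat 111 0 = M
  s_eq : σ.nat 115 0 = s
  src_eq : ∀ e : Fin M, σ.nat 112 e = src e
  dst_eq : ∀ e : Fin M, σ.nat 113 e = dst e
  w_eq : ∀ e : Fin M, σ.nat 114 e = w e

theorem GraphAt.congr {N M : ℕ} {src dst : Fin M → Fin N} {w : Fin M → ℕ} {s : Fin N}
    {σ τ : State} (h : GraphAt src dst w s σ) {l : List ℕ} (hl : SameBut l σ τ)
    (hd : ∀ a ∈ [110, 111, 112, 113, 114, 115], a ∉ l) : GraphAt src dst w s τ := by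
  have e : ∀ a ∈ [110, 111, 112, 113, 114, 115], τ.nat a = σ.nat a := fun a ha => hl a (hd a ha)
  exact ⟨by rw [e _ (by decide), h.N_eq], by rw [e _ (by decide), h.M_eq],
    by rw [e _ (by decide), h.s_eq], fun x => by rw [e _ (by decide), h.src_eq],
    fun x => by rw [e _ (by decide), h.dst_eq], fun x => by rw [e _ (by decide), h.w_eq]⟩

/-- The memory holds lists of the links with property `p` that leave the nodes. -/
def AdjAt {N M : ℕ} (src : Fin M → Fin N) (p : Fin M → Prop) (σ : State)
    (A : Fin N → List (Fin M)) : Prop :=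
  ∀ u : Fin N, Linked (σ.nat 130) (σ.nat 129 u) (A u) ∧ (A u).Nodup ∧
    ∀ e, e ∈ A u ↔ src e = u ∧ p e

theorem AdjAt.congr {N M : ℕ} {src : Fin M → Fin N} {p : Fin M → Prop} {σ τ : State}
    {A : Fin N → List (Fin M)} (h : AdjAt src p σ A) {l : List ℕ} (hl : SameBut l σ τ)
    (hd : ∀ a ∈ [129, 130], a ∉ l) : AdjAt src p τ A := by
  have e : ∀ a ∈ [129, 130], τ.nat a = σ.nat a := fun a ha => hl a (hd a ha)
  intro u
  rw [e 129 (by decide), e 130 (by decide)]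
  exact h u

def clearHeads : Cmd :=
  .loop (.natLt (var 135) (var 110)) (block [.setNat 129 (var 135) (.const 0), incr 135])

def addLink (b : BExp) : Cmd :=
  block [
    .ite b
      (block [
        .setNat 130 (var 140) (.get 129 (.get 112 (var 140))),
        .setNat 129 (.get 112 (var 140)) (.plus (var 140) (.const 1))])
      .skip,
    incr 140]

/-- Build lists of the links with property `b` that leave the nodes. -/
def buildAdj (b : BExp) : Cmd :=
  block [
    assign 135 (.const 0),
    clearHeads,
    assign 140 (.const 0),
    .loop (.natLt (var 140) (var 111)) (addLink b)]

/-- The test `b` is evaluated while the lists are under construction, so `hb` asks for its meaning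
in all states that differ from `σ` in the working arrays only. In the invariant the lists contain
the links with index below the counter. -/
theorem runs_buildAdj {N M : ℕ} {src dst : Fin M → Fin N} {w : Fin M → ℕ} {s : Fin N} {σ : State}
    {b : BExp} {p : Fin M → Prop} {k R : ℕ} (hg : GraphAt src dst w s σ)
    (hb : ∀ τ, ∀ e : Fin M, SameBut [129, 130, 135, 140] σ τ → τ.nat 140 0 = e →
      (b.Holds τ ↔ p e))
    (hc : b.cost ≤ 20) (hk : 60 * (N + M + 1) + R ≤ k) :
    Runs (buildAdj b) σ k (fun τ k' => (∃ A, AdjAt src p τ A) ∧ R ≤ k') := by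
  refine Runs.seq (Runs.of_run 3 rfl (by decide) (by omega) ?_)
  refine Runs.seq (Runs.count N 15 (fun j τ => τ.nat 135 0 = j ∧ ∀ u < j, τ.nat 129 u = 0)
    ⟨by simp [Cmd.run], by simp⟩ (by simp only [BExp.cost, NExp.cost, var]; omega) ?_ ?_ ?_)
  · rintro j τ hj hτ ⟨h₁, h₂⟩
    have e := hτ.1 110 (by decide)
    simp [Cmd.run] at e
    simp [h₁, e, hg.N_eq]
  · rintro j τ hj hτ ⟨h₁, h₂⟩
    refine Runs.of_run 15 rfl (by decide) le_rfl ⟨by simp [Cmd.run, block, h₁], fun u hu => ?_⟩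
    simp only [Cmd.run, block, assign, incr]
    simp [h₁, Function.update_apply]
    intro h
    exact h₂ u (by omega)
  rintro τ hτ ⟨-, h₂⟩
  have hτ' : SameBut [129, 130, 135, 140] σ τ :=
    (((SameBut.refl _ σ).run (c := assign 135 (.const 0)) rfl (by decide))).trans
      (hτ.sameBut (by decide))
  simp only [BExp.cost, NExp.cost, var]
  refine Runs.seq (Runs.of_run 3 rfl (by decide) (by omega) ?_)
  refine Runs.seq (Runs.count M 52 (fun j υ => υ.nat 140 0 = j ∧
      ∃ A, AdjAt src (fun e => p e ∧ (e : ℕ) < j) υ A) ⟨by simp [Cmd.run], fun _ => [], fun u => ?_⟩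
    (by simp only [BExp.cost, NExp.cost, var]; omega) ?_ ?_ ?_)
  · simp [Linked, Cmd.run, h₂ u u.2]
  · rintro j υ hj hυ ⟨h₁, -⟩
    have e := hυ.1 111 (by simp [Cmd.writes, addLink, block, incr, assign])
    simp [Cmd.run, hτ' 111 (by decide)] at e
    simp [h₁, e, hg.M_eq]
  · rintro j υ hj hυ ⟨h₁, A, hA⟩
    have hυ' : SameBut [129, 130, 135, 140] σ υ :=
      (hτ'.run (c := assign 140 (.const 0)) rfl (by decide)).trans
        (hυ.sameBut (by simp [Cmd.writes, addLink, block, incr, assign]))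
    have hsrc : υ.nat 112 j = src ⟨j, hj⟩ := by rw [hυ' 112 (by decide), hg.src_eq ⟨j, hj⟩]
    have hbj := hb υ ⟨j, hj⟩ hυ' h₁
    refine Runs.of_run 52 rfl ?_ le_rfl ?_
    · simp [Cmd.bound, addLink, block, NExp.cost]; omega
    by_cases hp : p ⟨j, hj⟩
    · have hrun : (addLink b).run υ = ((υ.setNat 130 j (υ.nat 129 (src ⟨j, hj⟩))).setNat 129
          (src ⟨j, hj⟩) (j + 1)).setNat 140 0 (j + 1) := by
        simp [Cmd.run, addLink, block, hbj, hp, h₁, hsrc]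
      rw [hrun]
      refine ⟨by simp, Function.update A (src ⟨j, hj⟩) (⟨j, hj⟩ :: A (src ⟨j, hj⟩)), fun u => ?_⟩
      obtain ⟨l₁, l₂, l₃⟩ := hA u
      have hn : ∀ e ∈ A u, Function.update (υ.nat 130) j (υ.nat 129 (src ⟨j, hj⟩)) e =
          υ.nat 130 e := fun e he => Function.update_of_ne (by have := ((l₃ e).1 he).2.2; omega) _ _
      by_cases hu : u = src ⟨j, hj⟩
      · subst hu
        simp only [Function.update_self]
        refine ⟨by simpa [Linked] using l₁.congr hn, List.nodup_cons.2 ⟨fun h => ?_, l₂⟩, fun e => ?_⟩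
        · exact absurd ((l₃ _).1 h).2.2 (lt_irrefl _)
        · rw [List.mem_cons, l₃]
          constructor
          · rintro (rfl | ⟨g₁, g₂, g₃⟩)
            · exact ⟨rfl, hp, Nat.lt_succ_self _⟩
            · exact ⟨g₁, g₂, by omega⟩
          · rintro ⟨g₁, g₂, g₃⟩
            rcases Nat.lt_succ_iff_lt_or_eq.1 g₃ with g₃ | g₃
            · exact Or.inr ⟨g₁, g₂, g₃⟩
            · exact Or.inl (Fin.ext g₃)
      · rw [Function.update_of_ne hu]
        have hu' : (u : ℕ) ≠ src ⟨j, hj⟩ := fun h => hu (Fin.ext h)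
        refine ⟨by simpa [hu'] using l₁.congr hn, l₂, fun e => ?_⟩
        rw [l₃]
        refine ⟨fun ⟨g₁, g₂, g₃⟩ => ⟨g₁, g₂, by omega⟩, fun ⟨g₁, g₂, g₃⟩ => ⟨g₁, g₂, ?_⟩⟩
        rcases Nat.lt_succ_iff_lt_or_eq.1 g₃ with g₃ | g₃
        · exact g₃
        · exact absurd (g₁.symm.trans (congrArg src (Fin.ext g₃))) hu
    · have hrun : (addLink b).run υ = υ.setNat 140 0 (j + 1) := by
        simp [Cmd.run, addLink, block, hbj, hp, h₁]
      rw [hrun]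
      refine ⟨by simp, A, fun u => ?_⟩
      obtain ⟨l₁, l₂, l₃⟩ := hA u
      refine ⟨by simpa using l₁, l₂, fun e => ?_⟩
      rw [l₃]
      refine ⟨fun ⟨g₁, g₂, g₃⟩ => ⟨g₁, g₂, by omega⟩, fun ⟨g₁, g₂, g₃⟩ => ⟨g₁, g₂, ?_⟩⟩
      rcases Nat.lt_succ_iff_lt_or_eq.1 g₃ with g₃ | g₃
      · exact g₃
      · exact absurd (by rwa [show e = ⟨j, hj⟩ from Fin.ext g₃] at g₂) hp
  · rintro υ hυ ⟨-, A, hA⟩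
    simp only [BExp.cost, NExp.cost, var]
    refine Runs.skip (by omega) ⟨⟨A, fun u => ?_⟩, by omega⟩
    obtain ⟨l₁, l₂, l₃⟩ := hA u
    exact ⟨l₁, l₂, fun e => by rw [l₃]; simp⟩

end CTQAMSC

namespace CTQAMSC

/-! ### The invariant of Dijkstra's algorithm -/

section Dijkstra

variable {N M : ℕ} (src dst : Fin M → Fin N) (w : Fin M → ℕ) (s : Fin N)

/-- The nodes `S` are settled, at distance at most `D`; the links in `rem` that leave a settled node
have not yet been relaxed. -/
structure DijInv (lab dist par : ℕ → ℕ) (S : Finset (Fin N)) (D : ℕ) (P : Fin N → List (Fin M))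
    (rem : List (Fin M)) : Prop where
  lab_s : lab s ≠ 0
  dist_s : dist s = 0
  P_s : P s = []
  s_mem : S.Nonempty → s ∈ S
  tree : ∀ x : Fin N, lab x ≠ 0 → x ≠ s → ∃ e : Fin M, par x = e ∧ dst e = x ∧ src e ∈ S ∧
    P x = P (src e) ++ [e] ∧ dist x = dist (src e) + w e
  lab_of_mem : ∀ x ∈ S, lab x ≠ 0
  le : ∀ x ∈ S, dist x ≤ D
  ge : ∀ x : Fin N, x ∉ S → lab x ≠ 0 → D ≤ dist x
  path : ∀ x ∈ S, IsSimplePath src dst s x (P x) ∧ (∀ e ∈ P x, dst e ∈ S) ∧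
    ((P x).map w).sum = dist x
  relaxed : ∀ e : Fin M, src e ∈ S → e ∉ rem →
    lab (dst e) ≠ 0 ∧ dist (dst e) ≤ dist (src e) + w e

/-- The result of Dijkstra's algorithm: `lab` marks the nodes that are reachable, `dist` is their
distance and `P` a tree of shortest paths. -/
structure DijResult (lab dist par : ℕ → ℕ) (P : Fin N → List (Fin M)) : Prop where
  lab_s : lab s ≠ 0
  dist_s : dist s = 0
  P_s : P s = []
  tree : ∀ x : Fin N, lab x ≠ 0 → x ≠ s → ∃ e : Fin M, par x = e ∧ dst e = x ∧ lab (src e) ≠ 0 ∧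
    P x = P (src e) ++ [e]
  path : ∀ x : Fin N, lab x ≠ 0 → IsSimplePath src dst s x (P x) ∧ ((P x).map w).sum = dist x
  relaxed : ∀ e : Fin M, lab (src e) ≠ 0 →
    lab (dst e) ≠ 0 ∧ dist (dst e) ≤ dist (src e) + w e

variable {src dst w s} {lab dist par : ℕ → ℕ} {S : Finset (Fin N)} {D : ℕ}
  {P : Fin N → List (Fin M)} {rem : List (Fin M)}

theorem DijInv.init (h₁ : lab s ≠ 0) (h₂ : ∀ x : Fin N, x ≠ s → lab x = 0) (h₃ : dist s = 0) :
    DijInv src dst w s lab dist par ∅ 0 (fun _ => []) [] :=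
  ⟨h₁, h₃, rfl, by simp, fun x h hx => absurd (h₂ x hx) h, by simp, by simp, by simp, by simp,
    by simp⟩

/-- The tree path to `y` is the path to a settled tail followed by one link. All nodes of the former
are settled and `y` is not, so the extended path is simple. -/
theorem DijInv.settle (h : DijInv src dst w s lab dist par S D P []) {y : Fin N} (hy : y ∉ S)
    (hl : lab y ≠ 0) (hmin : ∀ x : Fin N, x ∉ S → lab x ≠ 0 → dist y ≤ dist x)
    (hrem : ∀ e, src e = y → e ∈ rem) :
    DijInv src dst w s lab dist par (insert y S) (dist y) P rem := by
  have hpy : IsSimplePath src dst s y (P y) ∧ (∀ e ∈ P y, dst e ∈ insert y S) ∧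
      ((P y).map w).sum = dist y := by
    by_cases hys : y = s
    · subst hys
      rw [h.P_s, h.dist_s]
      exact ⟨⟨rfl, by simp⟩, by simp, by simp⟩
    · obtain ⟨e, -, h₂, h₃, h₄, h₅⟩ := h.tree y hl hys
      obtain ⟨p₁, p₂, p₃⟩ := h.path _ h₃
      rw [h₄]
      refine ⟨isSimplePath_concat p₁ h₂ ?_, ?_, by simp [p₃, h₅]⟩
      · intro hm
        rcases List.mem_cons.1 hm with rfl | hm
        · exact hys rfl
        · obtain ⟨e', he', rfl⟩ := List.mem_map.1 hm
          exact hy (p₂ e' he')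
      · intro e' he'
        rcases List.mem_append.1 he' with he' | he'
        · exact Finset.mem_insert_of_mem (p₂ e' he')
        · obtain rfl : e' = e := by simpa using he'
          rw [h₂]; exact Finset.mem_insert_self _ _
  refine ⟨h.lab_s, h.dist_s, h.P_s, fun _ => ?_, fun x hx hxs => ?_, fun x hx => ?_, fun x hx => ?_,
    fun x hx hlx => ?_, fun x hx => ?_, fun e he her => ?_⟩
  · by_cases hne : S.Nonempty
    · exact Finset.mem_insert_of_mem (h.s_mem hne)
    · by_cases hys : y = s
      · rw [hys]; exact Finset.mem_insert_self _ _
      · obtain ⟨e, -, -, h₃, -⟩ := h.tree y hl hys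
        exact absurd ⟨_, h₃⟩ hne
  · obtain ⟨e, h₁, h₂, h₃, h₄⟩ := h.tree x hx hxs
    exact ⟨e, h₁, h₂, Finset.mem_insert_of_mem h₃, h₄⟩
  · rcases Finset.mem_insert.1 hx with rfl | hx
    · exact hl
    · exact h.lab_of_mem x hx
  · rcases Finset.mem_insert.1 hx with rfl | hx
    · exact le_rfl
    · exact (h.le x hx).trans (h.ge y hy hl)
  · exact hmin x (fun h' => hx (Finset.mem_insert_of_mem h')) hlx
  · rcases Finset.mem_insert.1 hx with rfl | hx
    · exact hpy
    · obtain ⟨p₁, p₂, p₃⟩ := h.path x hx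
      exact ⟨p₁, fun e he => Finset.mem_insert_of_mem (p₂ e he), p₃⟩
  · rcases Finset.mem_insert.1 he with he | he
    · exact absurd (hrem e he) her
    · exact h.relaxed e he (by simp)

/-- A settled node is labelled and has distance at most `D = dist (src e)`, so it cannot be improved
by a link of nonnegative weight. Hence the head is unsettled, and no settled node or tree path
changes. -/
theorem DijInv.relax {e : Fin M} (h : DijInv src dst w s lab dist par S D P (e :: rem))
    (he : src e ∈ S) (hD : dist (src e) = D)
    (hlt : lab (dst e) = 0 ∨ dist (src e) + w e < dist (dst e)) :
    dst e ∉ S ∧ DijInv src dst w s (Function.update lab (dst e) 1)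
      (Function.update dist (dst e) (dist (src e) + w e)) (Function.update par (dst e) e) S D
      (Function.update P (dst e) (P (src e) ++ [e])) rem := by
  have hx : dst e ∉ S := by
    intro hx
    rcases hlt with h₁ | h₁
    · exact h.lab_of_mem _ hx h₁
    · have := h.le _ hx; omega
  have hs : s ∈ S := h.s_mem ⟨_, he⟩
  have hv : ∀ y ∈ S, (y : ℕ) ≠ dst e := fun y hy h' => hx (Fin.ext h' ▸ hy)
  have hv' : ∀ y ∈ S, y ≠ dst e := fun y hy h' => hx (h' ▸ hy)
  refine ⟨hx, ?_, ?_, ?_, h.s_mem, fun x hl hxs => ?_, fun x hm => ?_, fun x hm => ?_,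
    fun x hm hl => ?_, fun x hm => ?_, fun e' he' her => ?_⟩
  · rw [Function.update_of_ne (hv s hs)]; exact h.lab_s
  · rw [Function.update_of_ne (hv s hs)]; exact h.dist_s
  · rw [Function.update_of_ne (hv' s hs)]; exact h.P_s
  · by_cases hxe : x = dst e
    · subst hxe
      refine ⟨e, by simp, rfl, he, ?_, ?_⟩
      · rw [Function.update_self, Function.update_of_ne (hv' _ he)]
      · rw [Function.update_self, Function.update_of_ne (hv _ he)]
    · have hxe' : (x : ℕ) ≠ dst e := fun h' => hxe (Fin.ext h')
      rw [Function.update_of_ne hxe'] at hl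
      obtain ⟨e', h₁, h₂, h₃, h₄, h₅⟩ := h.tree x hl hxs
      refine ⟨e', ?_, h₂, h₃, ?_, ?_⟩
      · rw [Function.update_of_ne hxe', h₁]
      · rw [Function.update_of_ne hxe, Function.update_of_ne (hv' _ h₃), h₄]
      · rw [Function.update_of_ne hxe', Function.update_of_ne (hv _ h₃), h₅]
  · rw [Function.update_of_ne (hv x hm)]; exact h.lab_of_mem x hm
  · rw [Function.update_of_ne (hv x hm)]; exact h.le x hm
  · by_cases hxe : x = dst e
    · subst hxe; rw [Function.update_self]; omega
    · have hxe' : (x : ℕ) ≠ dst e := fun h' => hxe (Fin.ext h')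
      rw [Function.update_of_ne hxe'] at hl ⊢
      exact h.ge x hm hl
  · rw [Function.update_of_ne (hv x hm), Function.update_of_ne (hv' x hm)]; exact h.path x hm
  · rw [Function.update_of_ne (hv _ he')]
    by_cases hee : dst e' = dst e
    · rw [hee, Function.update_self, Function.update_self]
      refine ⟨one_ne_zero, ?_⟩
      by_cases hee' : e' = e
      · rw [hee']
      · have := h.relaxed e' he' (by simp [hee', her])
        rw [hee] at this
        rcases hlt with h₁ | h₁
        · exact absurd h₁ this.1
        · exact h₁.le.trans this.2
    · have hne : ((dst e' : Fin N) : ℕ) ≠ dst e := fun h' => hee (Fin.ext h')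
      rw [Function.update_of_ne hne, Function.update_of_ne hne]
      refine h.relaxed e' he' ?_
      rintro (_ | ⟨_, h'⟩)
      · exact hee rfl
      · exact her h'

theorem DijInv.skip {e : Fin M} (h : DijInv src dst w s lab dist par S D P (e :: rem))
    (hle : lab (dst e) ≠ 0 ∧ dist (dst e) ≤ dist (src e) + w e) :
    DijInv src dst w s lab dist par S D P rem := by
  refine ⟨h.lab_s, h.dist_s, h.P_s, h.s_mem, h.tree, h.lab_of_mem, h.le, h.ge, h.path,
    fun e' he' her => ?_⟩
  by_cases hee : e' = e
  · rw [hee]; exact hle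
  · exact h.relaxed e' he' (by simp [hee, her])

theorem DijInv.result (h : DijInv src dst w s lab dist par S D P [])
    (hS : ∀ x : Fin N, lab x ≠ 0 → x ∈ S) : DijResult src dst w s lab dist par P := by
  refine ⟨h.lab_s, h.dist_s, h.P_s, fun x hx hxs => ?_, fun x hx => ?_, fun e he => ?_⟩
  · obtain ⟨e, h₁, h₂, h₃, h₄, -⟩ := h.tree x hx hxs
    exact ⟨e, h₁, h₂, h.lab_of_mem _ h₃, h₄⟩
  · obtain ⟨p₁, -, p₃⟩ := h.path x (hS x hx)
    exact ⟨p₁, p₃⟩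
  · exact h.relaxed e (hS _ he) (by simp)

/-- Potentials bound the weights of walks from below. -/
theorem DijResult.le_sum (h : DijResult src dst w s lab dist par P) {x y : Fin N}
    {π : List (Fin M)} (hx : lab x ≠ 0) (hπ : IsWalk src dst x y π) :
    lab y ≠ 0 ∧ dist y ≤ dist x + (π.map w).sum := by
  induction π generalizing x with
  | nil => obtain rfl : x = y := hπ; simp [hx]
  | cons e π ih =>
    obtain ⟨rfl, h₂⟩ := hπ
    obtain ⟨h₃, h₄⟩ := h.relaxed e hx
    obtain ⟨h₅, h₆⟩ := ih h₃ h₂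
    refine ⟨h₅, ?_⟩
    simp only [List.map_cons, List.sum_cons]
    omega

end Dijkstra

/-! ### Insertion into the heap -/

/-- Insert the node `141` with key `142` and predecessor `140`. -/
def pushNode : Cmd :=
  block [
    assign 133 (.get 125 (var 141)),
    incr 132,
    .ite (.natLe (.const 2) (.get 122 (var 133)))
      (block [
        assign 134 (.get 124 (.get 123 (var 133))),
        .setNat 123 (var 132) (.get 124 (var 134)),
        .setNat 124 (var 134) (.const 0)])
      (.setNat 123 (var 132) (.const 0)),
    .setNat 122 (var 132) (.minus (.get 122 (var 133)) (.const 2)),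
    .setNat 121 (var 132) (var 141),
    .setNat 124 (var 132) (.get 120 (.const 1)),
    .setNat 120 (.const 1) (var 132),
    .setNat 125 (var 141) (var 132),
    .setNat 126 (var 141) (var 142),
    .setNat 127 (var 141) (.const 1),
    .setNat 128 (var 141) (var 140)]

/-- Both branches of the test produce the memory of `HMem.push`. The clause on cell 0 of array `122`
says that node 0 keeps its rank, as the name of the new node is a successor. -/
theorem pushNode_run (σ : State) : hmem (pushNode.run σ) =
      (hmem σ).push (σ.nat 132 0) (σ.nat 141 0) (σ.nat 142 0) ∧
    (pushNode.run σ).nat 127 = Function.update (σ.nat 127) (σ.nat 141 0) 1 ∧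
    (pushNode.run σ).nat 128 = Function.update (σ.nat 128) (σ.nat 141 0) (σ.nat 140 0) ∧
    (pushNode.run σ).nat 126 = Function.update (σ.nat 126) (σ.nat 141 0) (σ.nat 142 0) ∧
    (pushNode.run σ).nat 125 = Function.update (σ.nat 125) (σ.nat 141 0) (σ.nat 132 0 + 1) ∧
    (pushNode.run σ).nat 122 0 = (if σ.nat 132 0 + 1 = 0 then 0 else σ.nat 122 0) ∧
    (pushNode.run σ).nat 132 0 = σ.nat 132 0 + 1 := by
  by_cases h : 2 ≤ σ.nat 122 (σ.nat 125 (σ.nat 141 0))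
  · simp [pushNode, block, Cmd.run, h, hmem, HMem.push]
  · simp [pushNode, block, Cmd.run, h, hmem, HMem.push]

end CTQAMSC

namespace CTQAMSC

/-! ### Dijkstra's algorithm -/

/-- Relax the link `139 - 1`, which leaves the node `143`, and go on to the next link. -/
def relaxLink : Cmd :=
  block [
    assign 140 (.minus (var 139) (.const 1)),
    assign 141 (.get 113 (var 140)),
    assign 142 (.plus (.get 126 (var 143)) (.get 114 (var 140))),
    assign 139 (.get 130 (var 140)),
    .ite (.and (.not (.natEq (.get 127 (var 141)) (.const 0)))
        (.natLe (.get 126 (var 141)) (var 142)))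
      .skip
      pushNode]

def relaxLinks : Cmd := .loop (.not (.natEq (var 139) (.const 0))) relaxLink

def extractMin : Cmd :=
  block [
    assign 143 (.get 121 (var 137)),
    .setNat 125 (var 143) (.const 0),
    assign 139 (.get 129 (var 143))]

def settleMin : Cmd :=
  .seq hpMin (.ite (.natEq (var 137) (.const 0)) (assign 138 (.const 0))
    (.seq extractMin relaxLinks))

def dijLoop : Cmd := .loop (.natEq (var 138) (.const 1)) settleMin

section DijState

variable {N M : ℕ} (src dst : Fin M → Fin N) (w : Fin M → ℕ) (s : Fin N) (K : ℕ)
  (A : Fin N → List (Fin M))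

/-- The number of links that leave nodes outside `S`. -/
def outLinks (S : Finset (Fin N)) : ℕ := (Finset.univ.filter fun e => src e ∉ S).card

/-- The state in the main loop of Dijkstra's algorithm. -/
structure DijState (S : Finset (Fin N)) (D : ℕ) (P : Fin N → List (Fin M)) (rem : List (Fin M))
    (F : Forest) (σ : State) : Prop where
  heap : RootHeap (hmem σ) N K (σ.nat 132 0) F
  rank_zero : σ.nat 122 0 = 0
  size : σ.nat 131 0 = K
  items : ∀ v, v ≠ 0 → v ≤ σ.nat 132 0 → σ.nat 121 v < N
  graph : GraphAt src dst w s σ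
  adj : AdjAt src (fun _ => True) σ A
  inv : DijInv src dst w s (σ.nat 127) (σ.nat 126) (σ.nat 128) S D P rem
  nod : ∀ x : Fin N, σ.nat 125 x ≠ 0 ↔ σ.nat 127 x ≠ 0 ∧ x ∉ S
  -- A relaxed link creates at most one heap node and the source one more, so at most `M + 1` nodes
  -- are ever created. This bounds the ranks.
  count : σ.nat 132 0 + outLinks src S + rem.length ≤ M + 1

variable {src dst w s K A} {S : Finset (Fin N)} {D : ℕ} {P : Fin N → List (Fin M)}
  {rem : List (Fin M)} {F : Forest} {σ : State}

theorem outLinks_insert {y : Fin N} (hy : y ∉ S) {l : List (Fin M)} (hl : l.Nodup)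
    (hm : ∀ e, e ∈ l ↔ src e = y ∧ True) :
    outLinks src S = outLinks src (insert y S) + l.length := by
  rw [← List.toFinset_card_of_nodup hl, outLinks, outLinks, ← Finset.card_union_of_disjoint]
  · congr 1
    ext e
    simp only [Finset.mem_union, Finset.mem_filter, Finset.mem_univ, true_and, List.mem_toFinset,
      hm, and_true, Finset.mem_insert, not_or]
    by_cases h : src e = y
    · simp [h, hy]
    · simp [h]
  · rw [Finset.disjoint_left]
    intro e he
    simp only [Finset.mem_filter, Finset.mem_insert, not_or] at he
    simp [hm, he.2.1]

theorem relaxLink_run {e : Fin M} (h : DijState src dst w s K A S D P (e :: rem) F σ)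
    (he : src e ∈ S) (hy : σ.nat 143 0 = src e) (hD : σ.nat 126 (src e) = D)
    (hl : Linked (σ.nat 130) (σ.nat 139 0) (e :: rem)) :
    (∃ P' F', DijState src dst w s K A S D P' rem F' (relaxLink.run σ) ∧
      F'.pot 2 1 ≤ F.pot 2 1 + 10) ∧ (relaxLink.run σ).nat 143 0 = src e ∧
      (relaxLink.run σ).nat 126 (src e) = D ∧
      Linked ((relaxLink.run σ).nat 130) ((relaxLink.run σ).nat 139 0) rem := by
  have h139 : σ.nat 139 0 = e + 1 := hl.1
  have hd := h.graph.dst_eq e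
  have hw := h.graph.w_eq e
  have hcount := h.count
  simp only [List.length_cons] at hcount
  by_cases hc : σ.nat 127 (dst e) ≠ 0 ∧ σ.nat 126 (dst e) ≤ σ.nat 126 (src e) + w e
  · have hrun : relaxLink.run σ = (((σ.setNat 140 0 e).setNat 141 0 (dst e)).setNat 142 0
        (σ.nat 126 (src e) + w e)).setNat 139 0 (σ.nat 130 e) := by
      simp [relaxLink, block, Cmd.run, h139, hd, hw, hy, hc.1, hc.2]
    rw [hrun]
    refine ⟨⟨P, F, ⟨by simpa [hmem] using h.heap, by simpa using h.rank_zero, by simpa using h.size,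
      by simpa using h.items, ?_, ?_, by simpa using h.inv.skip hc, by simpa using h.nod, ?_⟩,
      by omega⟩, by simpa using hy, by simpa using hD, by simpa using hl.2⟩
    · refine h.graph.congr (l := [139, 140, 141, 142]) ?_ (by decide)
      exact ((((SameBut.refl _ σ).setNat _ _ (by decide)).setNat _ _ (by decide)).setNat _ _
        (by decide)).setNat _ _ (by decide)
    · refine h.adj.congr (l := [139, 140, 141, 142]) ?_ (by decide)
      exact ((((SameBut.refl _ σ).setNat _ _ (by decide)).setNat _ _ (by decide)).setNat _ _
        (by decide)).setNat _ _ (by decide)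
    · simp; omega
  · have hrun : relaxLink.run σ = pushNode.run ((((σ.setNat 140 0 e).setNat 141 0 (dst e)).setNat
        142 0 (σ.nat 126 (src e) + w e)).setNat 139 0 (σ.nat 130 e)) := by
      have : ¬ (¬ σ.nat 127 (dst e) = 0 ∧ σ.nat 126 (dst e) ≤ σ.nat 126 (src e) + w e) := hc
      simp [relaxLink, block, Cmd.run, h139, hd, hw, hy, this]
    have hlt : σ.nat 127 (dst e) = 0 ∨ σ.nat 126 (src e) + w e < σ.nat 126 (dst e) := by
      by_contra h'; push Not at h'; exact hc h'
    obtain ⟨hx, hinv⟩ := h.inv.relax he hD hlt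
    set σ' := (((σ.setNat 140 0 e).setNat 141 0 (dst e)).setNat
        142 0 (σ.nat 126 (src e) + w e)).setNat 139 0 (σ.nat 130 e) with hσ'
    have hsame : SameBut [139, 140, 141, 142] σ σ' :=
      ((((SameBut.refl _ σ).setNat _ _ (by decide)).setNat _ _ (by decide)).setNat _ _
        (by decide)).setNat _ _ (by decide)
    obtain ⟨r₁, r₂, r₃, r₄, r₅, r₆, r₇⟩ := pushNode_run σ'
    have hsame' : SameBut ([139, 140, 141, 142] ++ pushNode.writes) σ (pushNode.run σ') :=
      (hsame.mono (List.subset_append_left _ _)).run rfl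
        (List.subset_append_right _ _)
    have e₁ : σ'.nat 141 0 = dst e := by simp [hσ']
    have e₂ : σ'.nat 142 0 = σ.nat 126 (src e) + w e := by simp [hσ']
    have e₃ : σ'.nat 140 0 = e := by simp [hσ']
    have e₄ : hmem σ' = hmem σ := by simp [hσ', hmem]
    rw [e₁] at r₁ r₂ r₃ r₄ r₅
    rw [e₂] at r₁ r₄
    rw [e₃] at r₃
    rw [e₄] at r₁
    rw [hsame 132 (by decide)] at r₁ r₅ r₆ r₇
    rw [hsame 127 (by decide)] at r₂
    rw [hsame 128 (by decide)] at r₃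
    rw [hsame 126 (by decide)] at r₄
    rw [hsame 125 (by decide)] at r₅
    rw [hsame 122 (by decide), if_neg (Nat.succ_ne_zero _)] at r₆
    obtain ⟨F', hF', hpot⟩ := h.heap.push (x := dst e) (k := σ.nat 126 (src e) + w e) (dst e).2
      (fun hn => by
        rcases hlt with h₁ | h₁
        · exact absurd h₁ ((h.nod _).1 hn).1
        · exact h₁.le) h.rank_zero
    rw [hrun]
    have hne : ((src e : Fin N) : ℕ) ≠ dst e := fun h' => hx (Fin.ext h' ▸ he)
    have hit : (pushNode.run σ').nat 121 =
        Function.update (σ.nat 121) (σ.nat 132 0 + 1) (dst e) := congrArg HMem.it r₁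
    refine ⟨⟨Function.update P (dst e) (P (src e) ++ [e]), F', ⟨?_, ?_, ?_, ?_,
      h.graph.congr hsame' (by decide), ?_, ?_, ?_, ?_⟩, hpot⟩, ?_, ?_, ?_⟩
    · rw [r₁, r₇]; exact hF'
    · rw [r₆]; exact h.rank_zero
    · rw [hsame' 131 (by decide)]; exact h.size
    · intro v hv0 hv
      rw [r₇] at hv
      rw [hit, Function.update_apply]
      split_ifs
      · exact (dst e).2
      · exact h.items v hv0 (by omega)
    · exact h.adj.congr hsame' (by decide)
    · rw [r₂, r₃, r₄]; exact hinv
    · intro x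
      rw [r₂, r₅]
      by_cases hxe : x = dst e
      · subst hxe; simp [hx]
      · have hxe' : (x : ℕ) ≠ dst e := fun h' => hxe (Fin.ext h')
        rw [Function.update_of_ne hxe', Function.update_of_ne hxe']
        exact h.nod x
    · rw [r₇]; omega
    · rw [hsame' 143 (by decide)]; exact hy
    · rw [r₄, Function.update_of_ne hne]; exact hD
    · rw [hsame' 130 (by decide)]
      have : (pushNode.run σ').nat 139 = σ'.nat 139 :=
        ((SameBut.refl pushNode.writes σ').run rfl (by simp)) 139 (by decide)
      rw [this]
      simpa [hσ'] using hl.2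

/-- The 1300 credits of a link cover at most 206 steps and ten units of potential at 100 credits
each. -/
theorem runs_relaxLinks {y : Fin N} {k R : ℕ} (h : DijState src dst w s K A S D P rem F σ)
    (hs : y ∈ S) (hy : σ.nat 143 0 = y) (hD : σ.nat 126 y = D) (hrem : ∀ e ∈ rem, src e = y)
    (hl : Linked (σ.nat 130) (σ.nat 139 0) rem)
    (hk : 100 * F.pot 2 1 + 1300 * rem.length + 10 + R ≤ k) :
    Runs relaxLinks σ k (fun τ k' => ∃ P' F', DijState src dst w s K A S D P' [] F' τ ∧
      100 * F'.pot 2 1 + R ≤ k') := by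
  refine Runs.loop (fun τ k' => ∃ rem P' F', DijState src dst w s K A S D P' rem F' τ ∧
    τ.nat 143 0 = y ∧ τ.nat 126 y = D ∧ (∀ e ∈ rem, src e = y) ∧
    Linked (τ.nat 130) (τ.nat 139 0) rem ∧
    100 * F'.pot 2 1 + 1300 * rem.length + 10 + R ≤ k') ⟨_, _, _, h, hy, hD, hrem, hl, hk⟩ ?_ ?_
  · rintro τ k' - ⟨rem, P', F', h₁, h₂, h₃, h₄, h₅, h₆⟩ hb
    cases rem with
    | nil => exact absurd h₅ (by simpa [Linked] using hb)
    | cons e rem =>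
      have hey : src e = y := h₄ e (by simp)
      subst hey
      obtain ⟨⟨P'', F'', g₁, g₂⟩, g₃, g₄, g₅⟩ := relaxLink_run h₁ hs h₂ h₃ h₅
      simp only [List.length_cons] at h₆
      refine ⟨k' - 6, by simp only [BExp.cost, NExp.cost, var]; omega, ?_⟩
      exact Runs.of_run 200 rfl (by decide) (by omega) ⟨rem, P'', F'', g₁, g₃, g₄,
        fun e' he' => h₄ e' (by simp [he']), g₅, by omega⟩
  · rintro τ k' - ⟨rem, P', F', h₁, h₂, h₃, h₄, h₅, h₆⟩ hb
    have : τ.nat 139 0 = 0 := by simpa using hb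
    cases rem with
    | nil =>
      simp only [List.length_nil] at h₆
      exact ⟨k' - 6, by simp only [BExp.cost, NExp.cost, var]; omega, P', F', h₁, by omega⟩
    | cons e rem => exact absurd (this.symm.trans h₅.1) (by omega)

set_option maxRecDepth 4000 in
-- Credits are held per link leaving an unsettled node (1300), per unsettled node (`700 * (K + 1)`),
-- and once more for the last call, which finds the heap empty. The share of a node pays `200 * K`
-- for reorganizing the heap and the potential `2 + 3 * rank` for hollowing the minimum, where `rank
-- < 2 * B < K`. In `k - 5` the test of the surrounding loop is already paid.
theorem runs_settleMin {B k R : ℕ} (h : DijState src dst w s K A S D P [] F σ)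
    (hK : K = 2 * B + 2) (hB : M + 1 < 2 ^ B) (hgo : σ.nat 138 0 = 1)
    (hk : 100 * F.pot 2 1 + 1300 * outLinks src S + 700 * ((N - S.card + 1) * (K + 1)) + R ≤ k) :
    Runs settleMin σ (k - 5) (fun τ k' => ∃ S' D' P' F',
      DijState src dst w s K A S' D' P' [] F' τ ∧
      ((τ.nat 138 0 = 1 ∧ 100 * F'.pot 2 1 + 1300 * outLinks src S' +
        700 * ((N - S'.card + 1) * (K + 1)) + R ≤ k') ∨
      (τ.nat 138 0 = 0 ∧ (∀ x : Fin N, τ.nat 127 x ≠ 0 → x ∈ S') ∧ R + 5 ≤ k'))) := by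
  have hn : σ.nat 132 0 < 2 ^ B := by have := h.count; omega
  have hk' : (N - S.card + 1) * (K + 1) = (N - S.card) * (K + 1) + (K + 1) := by ring
  refine Runs.seq (((runs_hpMin (R := 1300 * outLinks src S + 700 * ((N - S.card) * (K + 1)) +
    500 * K + 500 + R) h.heap hK hn h.rank_zero h.size (by omega)).frame).mono le_rfl ?_)
  rintro τ k' ⟨⟨F', h₁, h₂, h₃, h₄⟩, h₅⟩
  have hsame : SameBut [120, 122, 123, 124, 133, 134, 135, 136, 137] σ τ := h₅.sameBut (by decide)
  have hτ : DijState src dst w s K A S D P [] F' τ := by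
    refine ⟨?_, h₂, ?_, ?_, h.graph.congr hsame (by decide), h.adj.congr hsame (by decide), ?_, ?_, ?_⟩
    · rw [hsame 132 (by decide)]; exact h₁
    · rw [hsame 131 (by decide)]; exact h.size
    · rw [hsame 132 (by decide), hsame 121 (by decide)]; exact h.items
    · rw [hsame 127 (by decide), hsame 126 (by decide), hsame 128 (by decide)]; exact h.inv
    · rw [hsame 127 (by decide), hsame 125 (by decide)]; exact h.nod
    · rw [hsame 132 (by decide)]; exact h.count
  have hgo' : τ.nat 138 0 = 1 := by rw [hsame 138 (by decide)]; exact hgo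
  refine Runs.ite (by simp only [BExp.cost, NExp.cost, var]; omega) (fun hb => ?_) (fun hb => ?_)
  · have hb : τ.nat 137 0 = 0 := by simpa using hb
    simp only [BExp.cost, NExp.cost, var]
    have hnil : F' = .nil := by
      rcases h₃ with ⟨-, h₃⟩ | ⟨d, g₁, g₂, -⟩
      · exact h₃
      · exact absurd (g₂.trans hb) (h₁.ptr.id_ne_zero g₁)
    have hs : SameBut [138] τ ((assign 138 (.const 0)).run τ) := (SameBut.refl _ _).run rfl (by decide)
    refine Runs.of_run 3 rfl (by decide) (by omega) ⟨S, D, P, F', ?_, Or.inr ⟨by simp [Cmd.run],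
      fun x hx => ?_, by omega⟩⟩
    · refine ⟨?_, ?_, ?_, ?_, hτ.graph.congr hs (by decide), hτ.adj.congr hs (by decide), ?_, ?_, ?_⟩
      · simpa [hmem, Cmd.run] using hτ.heap
      · simpa [Cmd.run] using hτ.rank_zero
      · simpa [Cmd.run] using hτ.size
      · simpa [Cmd.run] using hτ.items
      · simpa [Cmd.run] using hτ.inv
      · simpa [Cmd.run] using hτ.nod
      · simpa [Cmd.run] using hτ.count
    -- A labelled unsettled node would have a current node in the heap, which is empty.
    · by_contra hxS
      rw [hs 127 (by decide)] at hx
      obtain ⟨d, g₁, -⟩ := hτ.heap.exists_node x.2 ((hτ.nod x).2 ⟨hx, hxS⟩)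
      rw [hnil] at g₁
      exact g₁
  · have hb : τ.nat 137 0 ≠ 0 := by simpa using hb
    simp only [BExp.cost, NExp.cost, var]
    rcases h₃ with ⟨h₃, -⟩ | ⟨d, hd, hid, hfull, hmin⟩
    · exact absurd h₃ hb
    have hdn := hτ.heap.ids d.id (Nat.one_le_iff_ne_zero.1 hd.cnt_pos)
    have hd0 := hτ.heap.ptr.id_ne_zero hd
    have hit : τ.nat 121 d.id = d.item := (hτ.heap.ptr.mem hd).1
    have hitem : d.item < N := hit ▸ hτ.items _ hd0 hdn
    have hlive := hτ.heap.live d hd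
    have hnod : τ.nat 125 d.item = d.id := hlive.1.1 hfull
    have hkey : τ.nat 126 d.item = d.key := hlive.2 hfull
    obtain ⟨y, hy⟩ : ∃ y : Fin N, (y : ℕ) = d.item := ⟨⟨_, hitem⟩, rfl⟩
    obtain ⟨hly, hyS⟩ := (hτ.nod y).1 (by rw [hy, hnod]; exact hd0)
    obtain ⟨F'', hF'', hpot⟩ := hτ.heap.extract hd hfull
    have hrank : d.rank < 2 * B := (hτ.heap.heap (show 1 < K by omega)).rank_lt
      (by rwa [hsame 132 (by decide)]) (show 1 < K by omega) (by simpa using hd)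
    rw [← hy] at hF''
    have hrun : extractMin.run τ = ((τ.setNat 143 0 y).setNat 125 y 0).setNat 139 0
        (τ.nat 129 y) := by
      simp [extractMin, block, Cmd.run, ← hid, hit, hy]
    obtain ⟨a₁, a₂, a₃⟩ := hτ.adj y
    have hout := outLinks_insert hyS a₂ a₃
    have hs : SameBut [125, 139, 143] τ (extractMin.run τ) := (SameBut.refl _ _).run rfl (by decide)
    have hcard : (insert y S).card = S.card + 1 := Finset.card_insert_of_notMem hyS
    have hcard' : (insert y S).card ≤ N := by simpa using Finset.card_le_univ (insert y S)
    have hNS : N - S.card = N - (insert y S).card + 1 := by omega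
    have hstate : DijState src dst w s K A (insert y S) (τ.nat 126 y) P (A y) F''
        (extractMin.run τ) := by
      refine ⟨?_, ?_, ?_, ?_, hτ.graph.congr hs (by decide), hτ.adj.congr hs (by decide), ?_, ?_, ?_⟩
      · rw [hrun]; simpa [hmem] using hF''
      · rw [hs 122 (by decide)]; exact hτ.rank_zero
      · rw [hs 131 (by decide)]; exact hτ.size
      · rw [hs 132 (by decide), hs 121 (by decide)]; exact hτ.items
      · rw [hs 127 (by decide), hs 126 (by decide), hs 128 (by decide)]
        refine hτ.inv.settle hyS hly (fun x hx hlx => ?_) fun e he => (a₃ e).2 ⟨he, trivial⟩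
        obtain ⟨d', g₁, -, -, -, g₂⟩ := hτ.heap.exists_node x.2 ((hτ.nod x).2 ⟨hlx, hx⟩)
        have g₂ : d'.key = τ.nat 126 x := g₂
        rw [← g₂, hy, hkey]
        exact hmin d' g₁
      · intro x
        rw [hs 127 (by decide), hrun]
        by_cases hxy : x = y
        · subst hxy; simp
        · have hxy' : (x : ℕ) ≠ y := fun h' => hxy (Fin.ext h')
          simp [hxy, hxy']
          simpa using hτ.nod x
      · rw [hs 132 (by decide)]
        have := hτ.count
        simp only [List.length_nil] at this
        omega
    refine Runs.seq (Runs.of_run 20 rfl (by decide) (by omega) ?_)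
    have hNS' : 700 * ((N - S.card) * (K + 1)) =
      700 * ((N - (insert y S).card + 1) * (K + 1)) := by rw [hNS]
    refine ((runs_relaxLinks (R := 1300 * outLinks src (insert y S) +
      700 * ((N - (insert y S).card + 1) * (K + 1)) + R) hstate (Finset.mem_insert_self _ _) ?_ ?_
      (fun e he => ((a₃ e).1 he).1) ?_ ?_).frame).mono le_rfl ?_
    · rw [hrun]; simp
    · rw [hs 126 (by decide)]
    · rw [hs 130 (by decide), hrun]; simpa using a₁
    · omega
    · rintro υ k'' ⟨⟨P', F₃, f₁, f₂⟩, f₃⟩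
      refine ⟨_, _, P', F₃, f₁, Or.inl ⟨?_, by omega⟩⟩
      rw [f₃.1 138 (by decide), hs 138 (by decide)]
      exact hgo'

theorem runs_dijLoop {B k R : ℕ} (h : DijState src dst w s K A S D P [] F σ)
    (hK : K = 2 * B + 2) (hB : M + 1 < 2 ^ B) (hgo : σ.nat 138 0 = 1)
    (hk : 100 * F.pot 2 1 + 1300 * outLinks src S + 700 * ((N - S.card + 1) * (K + 1)) + R ≤ k) :
    Runs dijLoop σ k (fun τ k' =>
      (∃ P', DijResult src dst w s (τ.nat 127) (τ.nat 126) (τ.nat 128) P') ∧ R ≤ k') := by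
  refine Runs.loop (fun τ k' => ∃ S' D' P' F',
      DijState src dst w s K A S' D' P' [] F' τ ∧
      ((τ.nat 138 0 = 1 ∧ 100 * F'.pot 2 1 + 1300 * outLinks src S' +
        700 * ((N - S'.card + 1) * (K + 1)) + R ≤ k') ∨
      (τ.nat 138 0 = 0 ∧ (∀ x : Fin N, τ.nat 127 x ≠ 0 → x ∈ S') ∧ R + 5 ≤ k')))
    ⟨S, D, P, F, h, Or.inl ⟨hgo, hk⟩⟩ ?_ ?_
  · rintro τ k' - ⟨S', D', P', F', h₁, h₂⟩ hb
    have hb : τ.nat 138 0 = 1 := by simpa using hb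
    rcases h₂ with ⟨-, h₂⟩ | ⟨h₂, -⟩
    · refine ⟨k' - 5, ?_, runs_settleMin h₁ hK hB hb h₂⟩
      have : (N - S'.card + 1) * (K + 1) = (N - S'.card) * (K + 1) + (K + 1) := by ring
      simp only [BExp.cost, NExp.cost, var]; omega
    · exact absurd (hb.symm.trans h₂) (by decide)
  · rintro τ k' - ⟨S', D', P', F', h₁, h₂⟩ hb
    have hb : τ.nat 138 0 ≠ 1 := by simpa using hb
    rcases h₂ with ⟨h₂, -⟩ | ⟨-, h₂, h₃⟩
    · exact absurd h₂ hb
    · refine ⟨k' - 5, ?_, ⟨P', h₁.inv.result h₂⟩, ?_⟩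
      · simp only [BExp.cost, NExp.cost, var]; omega
      · omega

end DijState

end CTQAMSC

/-! ### Initialization and total cost of Dijkstra's algorithm -/

namespace CTQAMSC

def clearNodes : Cmd :=
  .loop (.natLt (var 135) (var 110)) (block [
    .setNat 125 (var 135) (.const 0),
    .setNat 127 (var 135) (.const 0),
    incr 135])

/-- Doubling `136` until it exceeds `M + 1` counts the binary digits `B` of `M + 1`. Each digit
contributes two slots because ranks can be as large as `2B - 1`. -/
def tableSize : Cmd :=
  .loop (.natLe (var 136) (.plus (var 111) (.const 1))) (block [
    assign 136 (.plus (var 136) (var 136)),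
    assign 131 (.plus (var 131) (.const 2))])

def clearTable : Cmd :=
  .loop (.natLt (var 135) (var 131)) (block [.setNat 120 (var 135) (.const 0), incr 135])

/-- Name 0 stands for the absence of a node; clearing its rank makes the first insertion of an item
take over no children. -/
def dijStart : Cmd :=
  block [
    .setNat 122 (.const 0) (.const 0),
    assign 132 (.const 0),
    assign 138 (.const 1),
    assign 141 (var 115),
    assign 142 (.const 0),
    pushNode]

/-- Dijkstra's algorithm. -/
def dij : Cmd :=
  block [
    buildAdj (.natEq (.const 0) (.const 0)),
    assign 135 (.const 0),
    clearNodes,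
    assign 136 (.const 1),
    assign 131 (.const 2),
    tableSize,
    assign 135 (.const 0),
    clearTable,
    dijStart,
    dijLoop]

/-- A bound on the running time of Dijkstra's algorithm. -/
def dijCost (N M : ℕ) : ℕ := 3000 * (M + (N + 1) * (Nat.size (M + 1) + 1))

section

variable {N M : ℕ} {src dst : Fin M → Fin N} {w : Fin M → ℕ} {s : Fin N} {σ : State}

theorem runs_clearNodes {k R : ℕ} (hN : σ.nat 110 0 = N) (hi : σ.nat 135 0 = 0)
    (hk : 30 * (N + 1) + R ≤ k) :
    Runs clearNodes σ k (fun τ k' => (∀ u < N, τ.nat 125 u = 0 ∧ τ.nat 127 u = 0) ∧ R ≤ k') := by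
  refine Runs.count N 22 (fun j τ => τ.nat 135 0 = j ∧ ∀ u < j, τ.nat 125 u = 0 ∧ τ.nat 127 u = 0)
    ⟨hi, by simp⟩ (by simp only [BExp.cost, NExp.cost, var]; omega) ?_ ?_ ?_
  · rintro j τ hj hτ ⟨h₁, -⟩
    simp [h₁, hτ.1 110 (by decide), hN]
  · rintro j τ hj hτ ⟨h₁, h₂⟩
    refine Runs.of_run 22 rfl (by decide) le_rfl ⟨by simp [Cmd.run, block, h₁], fun u hu => ?_⟩
    by_cases huj : u = j
    · simp [Cmd.run, block, h₁, huj]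
    · simpa [Cmd.run, block, h₁, huj] using h₂ u (by omega)
  · rintro τ hτ ⟨-, h₂⟩
    refine ⟨h₂, ?_⟩
    simp only [BExp.cost, NExp.cost, var]; omega

theorem runs_tableSize {k R : ℕ} (hM : σ.nat 111 0 = M) (hi : σ.nat 136 0 = 1)
    (hi' : σ.nat 131 0 = 2) (hk : 40 * (Nat.size (M + 1) + 1) + R ≤ k) :
    Runs tableSize σ k (fun τ k' => τ.nat 131 0 = 2 * Nat.size (M + 1) + 2 ∧ R ≤ k') := by
  refine Runs.count (Nat.size (M + 1)) 20 (fun j τ => τ.nat 136 0 = 2 ^ j ∧ τ.nat 131 0 = 2 * j + 2)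
    ⟨hi, hi'⟩ (by simp only [BExp.cost, NExp.cost, var]; omega) ?_ ?_ ?_
  · rintro j τ hj hτ ⟨h₁, -⟩
    simp [h₁, hτ.1 111 (by decide), hM, Nat.lt_size]
  · rintro j τ hj hτ ⟨h₁, h₂⟩
    refine Runs.of_run 20 rfl (by decide) le_rfl ⟨by simp [Cmd.run, block, h₁]; ring,
      by simp [Cmd.run, block, h₂]; ring⟩
  · rintro τ hτ ⟨-, h₂⟩
    refine ⟨h₂, ?_⟩
    simp only [BExp.cost, NExp.cost, var]; omega

theorem runs_clearTable {k K R : ℕ} (hK : σ.nat 131 0 = K) (hi : σ.nat 135 0 = 0)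
    (hk : 30 * (K + 1) + R ≤ k) :
    Runs clearTable σ k (fun τ k' => (∀ u < K, τ.nat 120 u = 0) ∧ R ≤ k') := by
  refine Runs.count K 20 (fun j τ => τ.nat 135 0 = j ∧ ∀ u < j, τ.nat 120 u = 0)
    ⟨hi, by simp⟩ (by simp only [BExp.cost, NExp.cost, var]; omega) ?_ ?_ ?_
  · rintro j τ hj hτ ⟨h₁, -⟩
    simp [h₁, hτ.1 131 (by decide), hK]
  · rintro j τ hj hτ ⟨h₁, h₂⟩
    refine Runs.of_run 20 rfl (by decide) le_rfl ⟨by simp [Cmd.run, block, h₁], fun u hu => ?_⟩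
    by_cases huj : u = j
    · simp [Cmd.run, block, h₁, huj]
    · simpa [Cmd.run, block, h₁, huj] using h₂ u (by omega)
  · rintro τ hτ ⟨-, h₂⟩
    refine ⟨h₂, ?_⟩
    simp only [BExp.cost, NExp.cost, var]; omega

theorem dijStart_run {K : ℕ} {A : Fin N → List (Fin M)} (hg : GraphAt src dst w s σ)
    (hA : AdjAt src (fun _ => True) σ A) (hK : σ.nat 131 0 = K) (hK1 : 1 < K)
    (hn : ∀ u < N, σ.nat 125 u = 0 ∧ σ.nat 127 u = 0) (ht : ∀ u < K, σ.nat 120 u = 0) :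
    ∃ P F, DijState src dst w s K A ∅ 0 P [] F (dijStart.run σ) ∧ F.pot 2 1 ≤ 10 ∧
      (dijStart.run σ).nat 138 0 = 1 := by
  set σ' := ((((σ.setNat 122 0 0).setNat 132 0 0).setNat 138 0 1).setNat 141 0 s).setNat 142 0 0
    with hσ'
  have hrun : dijStart.run σ = pushNode.run σ' := by
    simp [dijStart, Cmd.run, block, hσ', hg.s_eq]
  have hsame : SameBut ([122, 132, 138, 141, 142]) σ σ' :=
    (((((SameBut.refl _ σ).setNat _ _ (by decide)).setNat _ _ (by decide)).setNat _ _
        (by decide)).setNat _ _ (by decide)).setNat _ _ (by decide)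
  have hsame' : SameBut ([122, 132, 138, 141, 142] ++ pushNode.writes) σ (pushNode.run σ') :=
    (hsame.mono (List.subset_append_left _ _)).run rfl (List.subset_append_right _ _)
  have hsame₂ : SameBut pushNode.writes σ' (pushNode.run σ') :=
    (SameBut.refl _ σ').run rfl (List.Subset.refl _)
  have e₀ : σ'.nat 132 0 = 0 := by simp [hσ']
  have e₁ : σ'.nat 141 0 = s := by simp [hσ']
  have e₂ : σ'.nat 142 0 = 0 := by simp [hσ']
  have e₃ : σ'.nat 122 0 = 0 := by simp [hσ']
  have e₄ : σ'.nat 138 0 = 1 := by simp [hσ']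
  have hempty : RootHeap (hmem σ') N K 0 .nil := by
    refine ⟨fun i hi _ => ?_, ?_, trivial, by simp [Forest.cnt], by simp [Forest.cnt], trivial,
      fun d hd => hd.elim, fun x hx h => absurd ?_ h⟩
    · exact (congrFun (hsame 120 (by decide)) i).trans (ht i hi)
    · exact (congrFun (hsame 120 (by decide)) 1).trans (ht 1 hK1)
    · exact (congrFun (hsame 125 (by decide)) x).trans (hn x hx).1
  obtain ⟨F, hF, hpot⟩ := hempty.push (x := s) (k := 0) s.2
    (fun h => absurd ((congrFun (hsame 125 (by decide)) s).trans (hn s s.2).1) h) e₃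
  obtain ⟨r₁, r₂, r₃, r₄, r₅, r₆, r₇⟩ := pushNode_run σ'
  rw [e₁] at r₁ r₂ r₃ r₄ r₅
  rw [e₂] at r₁ r₄
  rw [e₀] at r₁ r₅ r₆ r₇
  rw [hsame 127 (by decide)] at r₂
  rw [hsame 126 (by decide)] at r₄
  rw [hsame 125 (by decide)] at r₅
  rw [if_neg (Nat.succ_ne_zero _), e₃] at r₆
  have hit : (pushNode.run σ').nat 121 = Function.update (σ'.nat 121) 1 s := congrArg HMem.it r₁
  rw [hrun]
  refine ⟨fun _ => [], F, ⟨?_, r₆, ?_, ?_, hg.congr hsame' (by decide), hA.congr hsame' (by decide), ?_,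
    ?_, ?_⟩, by simpa [Forest.pot] using hpot, by rw [hsame₂ 138 (by decide), e₄]⟩
  · rw [r₁, r₇]; exact hF
  · rw [hsame' 131 (by decide)]; exact hK
  · intro v hv0 hv
    rw [r₇] at hv
    obtain rfl : v = 1 := by omega
    rw [hit, Function.update_self]
    exact s.2
  · rw [r₂, r₄]
    refine DijInv.init (by simp) (fun x hx => ?_) (by simp)
    rw [Function.update_of_ne fun h => hx (Fin.ext h)]
    exact (hn x x.2).2
  · intro x
    rw [r₂, r₅]
    by_cases hx : x = s
    · subst hx; simp
    · have hx' : (x : ℕ) ≠ s := fun h => hx (Fin.ext h)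
      rw [Function.update_of_ne hx', Function.update_of_ne hx']
      simp [hn x x.2]
  · rw [r₇]
    have : outLinks src ∅ = M := by simp [outLinks]
    rw [this]
    simp; omega

/-- Memory is arbitrary at the start, so the current heap nodes, the labels, the list heads and the
slots are cleared, at cost `O(N + log M)`. The arrays indexed by names of heap nodes need no
clearing, because a node is written when it is created; distances and predecessors are meaningful
for labelled nodes only. -/
theorem runs_dij {k R : ℕ} (hg : GraphAt src dst w s σ) (hk : dijCost N M + R ≤ k) :
    Runs dij σ k (fun τ k' =>
      (∃ P, DijResult src dst w s (τ.nat 127) (τ.nat 126) (τ.nat 128) P) ∧ R ≤ k') := by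
  set B := Nat.size (M + 1) with hB
  have hBM : M + 1 < 2 ^ B := Nat.lt_size_self _
  have hB1 : 1 ≤ B := Nat.lt_size.2 (by simp)
  have hcost : dijCost N M = 3000 * M + 3000 * ((N + 1) * (B + 1)) := by simp only [dijCost]; ring
  have h1 : 2 * (N + 1) ≤ (N + 1) * (B + 1) := by
    rw [mul_comm]; exact Nat.mul_le_mul_left _ (by omega)
  have h2 : 1 * (B + 1) ≤ (N + 1) * (B + 1) := Nat.mul_le_mul_right _ (by omega)
  have h3 : (N - 0 + 1) * (2 * B + 2 + 1) ≤ 3 * ((N + 1) * (B + 1)) := by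
    rw [Nat.sub_zero, ← mul_assoc, mul_comm 3, mul_assoc]
    exact Nat.mul_le_mul_left _ (by omega)
  have hpos := s.2
  refine Runs.seq (((runs_buildAdj (p := fun _ => True) (R := k - 60 * (N + M + 1)) hg (by simp)
    (by simp [BExp.cost, NExp.cost]) (by omega)).frame).mono le_rfl ?_)
  rintro σ₁ k₁ ⟨⟨⟨A, hA⟩, hk₁⟩, ha₁⟩
  have hs₁ : SameBut [129, 130, 135, 140] σ σ₁ := ha₁.sameBut (by decide)
  refine Runs.seq (Runs.of_run 3 rfl (by decide) (by omega) ?_)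
  set σ₂ := (assign 135 (.const 0)).run σ₁ with hσ₂
  have hs₂ : SameBut [129, 130, 135, 140] σ σ₂ := hs₁.run rfl (by decide)
  have hA₂ : AdjAt src (fun _ => True) σ₂ A :=
    hA.congr (l := [135]) ((SameBut.refl _ σ₁).run rfl (by decide)) (by decide)
  refine Runs.seq (((runs_clearNodes (N := N) (R := k₁ - 3 - 30 * (N + 1))
    (by rw [hs₂ 110 (by decide), hg.N_eq]) (by simp [hσ₂, Cmd.run]) (by omega)).frame).mono le_rfl ?_)
  rintro σ₃ k₃ ⟨⟨hn, hk₃⟩, ha₃⟩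
  have hs₃ : SameBut [125, 127, 129, 130, 135, 140] σ σ₃ :=
    (hs₂.mono (by decide)).trans (ha₃.sameBut (by decide))
  have hA₃ : AdjAt src (fun _ => True) σ₃ A :=
    hA₂.congr (l := [125, 127, 135]) (ha₃.sameBut (by decide)) (by decide)
  refine Runs.seq (Runs.of_run 3 rfl (by decide) (by omega) ?_)
  refine Runs.seq (Runs.of_run 3 rfl (by decide) (by omega) ?_)
  set σ₄ := (assign 131 (.const 2)).run ((assign 136 (.const 1)).run σ₃) with hσ₄
  have hs₄ : SameBut [131, 136] σ₃ σ₄ :=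
    ((SameBut.refl _ σ₃).run rfl (by decide)).run rfl (by decide)
  refine Runs.seq (((runs_tableSize (M := M) (R := k₃ - 6 - 40 * (B + 1))
    (by rw [hs₄ 111 (by decide), hs₃ 111 (by decide), hg.M_eq]) (by simp [hσ₄, Cmd.run])
    (by simp [hσ₄, Cmd.run]) (by omega)).frame).mono le_rfl ?_)
  rintro σ₅ k₅ ⟨⟨hK, hk₅⟩, ha₅⟩
  have hs₅ : SameBut [131, 136] σ₃ σ₅ := hs₄.trans (ha₅.sameBut (by decide))
  refine Runs.seq (Runs.of_run 3 rfl (by decide) (by omega) ?_)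
  set σ₆ := (assign 135 (.const 0)).run σ₅ with hσ₆
  have hs₆ : SameBut [131, 135, 136] σ₃ σ₆ := (hs₅.mono (by decide)).run rfl (by decide)
  refine Runs.seq (((runs_clearTable (K := 2 * B + 2) (R := k₅ - 3 - 30 * (2 * B + 3))
    (by simp [hσ₆, Cmd.run, hK, hB]) (by simp [hσ₆, Cmd.run]) (by omega)).frame).mono le_rfl ?_)
  rintro σ₇ k₇ ⟨⟨ht, hk₇⟩, ha₇⟩
  have hs₇ : SameBut [120, 131, 135, 136] σ₃ σ₇ :=
    (hs₆.mono (by decide)).trans (ha₇.sameBut (by decide))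
  have hK₇ : σ₇.nat 131 0 = 2 * B + 2 := by
    rw [ha₇.1 131 (by decide)]; simp [hσ₆, Cmd.run, hK, hB]
  obtain ⟨P, F, hst, hpot, hgo⟩ := dijStart_run (K := 2 * B + 2) (A := A)
    (hg.congr (hs₃.mono (l' := [120, 125, 127, 129, 130, 131, 135, 136, 140]) (by decide) |>.trans
      (hs₇.mono (by decide))) (by decide)) (hA₃.congr hs₇ (by decide)) hK₇ (by omega)
    (by rw [hs₇ 125 (by decide), hs₇ 127 (by decide)]; exact hn) ht
  refine Runs.seq (Runs.of_run 120 rfl (by decide) (by omega) ?_)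
  have hout : outLinks src ∅ ≤ M := by simp [outLinks]
  refine Runs.seq ((runs_dijLoop (R := R + 1) hst rfl hBM hgo ?_).mono le_rfl ?_)
  · rw [Finset.card_empty]; omega
  · rintro τ k' ⟨hP, hk'⟩
    exact Runs.skip (by omega) ⟨hP, by omega⟩

end

end CTQAMSC

namespace CTQAMSC

/-! ### Reading back the shortest paths -/

/-- Copy the network to the working memory; `a` is the source. -/
def loadGraph (a : ℕ) : Cmd :=
  block [
    assign 110 (var 0),
    assign 111 (var 1),
    assign 115 (var a),
    assign 140 (.const 0),
    .loop (.natLt (var 140) (var 111)) (block [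
      .setNat 112 (var 140) (.get 2 (var 140)),
      .setNat 113 (var 140) (.get 3 (var 140)),
      .setNat 114 (var 140) (.get 4 (var 140)),
      incr 140])]

def backStep (c : Cmd) : Cmd :=
  block [assign 140 (.get 128 (var 141)), c, assign 141 (.get 112 (var 140))]

/-- Run `c` for all links of the tree path to the node `v`, from the last one to the first one. -/
def walkBack (v : ℕ) (c : Cmd) : Cmd :=
  block [
    assign 141 (var v),
    .loop (.not (.natEq (var 141) (var 115))) (backStep c)]

def storeLink (arr : ℕ) : Cmd :=
  block [assign 142 (.minus (var 142) (.const 1)), .setNat arr (var 142) (var 140)]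

/-- Write the tree path to the node `v` to `(len, arr)`. -/
def readPath (v len arr : ℕ) : Cmd :=
  block [
    assign 142 (.const 0),
    walkBack v (incr 142),
    assign len (var 142),
    walkBack v (storeLink arr)]

/-- The shortest-path subroutine. -/
def spMain : Cmd :=
  block [
    loadGraph 5,
    dij,
    .ite (.natEq (.get 127 (var 6)) (.const 0))
      (assign 8 (.const 0))
      (block [assign 8 (.const 1), readPath 6 9 10])]

section

/-- The memory holds the links of the network and their weights. -/
structure LinksAt (G : Network) (σ : State) : Prop where
  N_eq : σ.nat 0 0 = G.N
  M_eq : σ.nat 1 0 = G.M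
  src_eq : ∀ e : Fin G.M, σ.nat 2 e = G.src e
  dst_eq : ∀ e : Fin G.M, σ.nat 3 e = G.dst e
  w_eq : ∀ e : Fin G.M, σ.nat 4 e = G.w e

theorem NetworkAt.linksAt {G : Network} {s t : Fin G.N} {σ : State} (h : NetworkAt G s t σ) :
    LinksAt G σ :=
  ⟨h.1, h.2.1, fun e => (h.2.2.2.2 e).1, fun e => (h.2.2.2.2 e).2.1, fun e => (h.2.2.2.2 e).2.2.1⟩

theorem LinksAt.congr {G : Network} {σ τ : State} (h : LinksAt G σ) {l : List ℕ}
    (hl : SameBut l σ τ) (hd : ∀ a ∈ [0, 1, 2, 3, 4], a ∉ l) : LinksAt G τ := by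
  have e : ∀ a ∈ [0, 1, 2, 3, 4], τ.nat a = σ.nat a := fun a ha => hl a (hd a ha)
  exact ⟨by rw [e _ (by decide), h.N_eq], by rw [e _ (by decide), h.M_eq],
    fun x => by rw [e _ (by decide), h.src_eq], fun x => by rw [e _ (by decide), h.dst_eq],
    fun x => by rw [e _ (by decide), h.w_eq]⟩

theorem runs_loadGraph {a : ℕ} {G : Network} {x : Fin G.N} {σ : State} {k R : ℕ}
    (hσ : LinksAt G σ) (ha : σ.nat a 0 = x) (ha' : a < 100)
    (hk : 50 * (G.M + 1) + R ≤ k) :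
    Runs (loadGraph a) σ k (fun τ k' => GraphAt G.src G.dst G.w x τ ∧ R ≤ k') := by
  obtain ⟨hN, hM, hE₂, hE₃, hE₄⟩ := hσ
  refine Runs.seq (Runs.of_run 4 rfl (by decide) (by omega) ?_)
  refine Runs.seq (Runs.of_run 4 rfl (by decide) (by omega) ?_)
  refine Runs.seq (Runs.of_run 4 rfl (by simp [Cmd.bound, NExp.cost]) (by omega) ?_)
  refine Runs.seq (Runs.of_run 3 rfl (by decide) (by omega) ?_)
  set σ₁ := (assign 140 (.const 0)).run ((assign 115 (var a)).run ((assign 111 (var 1)).run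
    ((assign 110 (var 0)).run σ))) with hσ₁
  have hs₁ : SameBut [110, 111, 115, 140] σ σ₁ :=
    ((((SameBut.refl _ σ).run rfl (by decide)).run rfl (by decide)).run rfl
      (by simp [Cmd.writes])).run rfl (by decide)
  have e₁ : σ₁.nat 110 0 = G.N ∧ σ₁.nat 111 0 = G.M ∧ σ₁.nat 115 0 = x := by
    have h₁ : a ≠ 111 := by omega
    have h₂ : a ≠ 110 := by omega
    simp [hσ₁, Cmd.run, hN, hM, ha, h₁, h₂]
  refine Runs.seq (Runs.count G.M 30 (fun j τ => τ.nat 140 0 = j ∧ ∀ e : Fin G.M, (e : ℕ) < j →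
    τ.nat 112 e = G.src e ∧ τ.nat 113 e = G.dst e ∧ τ.nat 114 e = G.w e)
    ⟨by simp [hσ₁, Cmd.run], by simp⟩ (by simp only [BExp.cost, NExp.cost, var]; omega) ?_ ?_ ?_)
  · rintro j τ hj hτ ⟨h₁, -⟩
    simp [h₁, hτ.1 111 (by decide), e₁.2.1]
  · rintro j τ hj hτ ⟨h₁, h₂⟩
    have hs : SameBut [110, 111, 112, 113, 114, 115, 140] σ τ :=
      (hs₁.mono (by decide)).trans (hτ.sameBut (by decide))
    have g₁ := hE₂ ⟨j, hj⟩
    have g₂ := hE₃ ⟨j, hj⟩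
    have g₃ := hE₄ ⟨j, hj⟩
    rw [← hs 2 (by decide)] at g₁
    rw [← hs 3 (by decide)] at g₂
    rw [← hs 4 (by decide)] at g₃
    refine Runs.of_run 30 rfl (by decide) le_rfl ⟨by simp [Cmd.run, block, h₁], fun e he => ?_⟩
    by_cases hej : e = ⟨j, hj⟩
    · subst hej
      simp [Cmd.run, block, h₁, g₁, g₂, g₃]
    · have hej' : (e : ℕ) ≠ j := fun h => hej (Fin.ext h)
      simpa [Cmd.run, block, h₁, hej'] using h₂ e (by omega)
  · rintro τ hτ ⟨-, h₂⟩
    simp only [BExp.cost, NExp.cost, var]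
    refine Runs.skip (by omega) ⟨⟨?_, ?_, ?_, fun e => (h₂ e e.2).1, fun e => (h₂ e e.2).2.1,
      fun e => (h₂ e e.2).2.2⟩, by omega⟩
    · rw [hτ.1 110 (by decide)]; exact e₁.1
    · rw [hτ.1 111 (by decide)]; exact e₁.2.1
    · rw [hτ.1 115 (by decide)]; exact e₁.2.2

variable {N M : ℕ} {src dst : Fin M → Fin N} {w : Fin M → ℕ} {s : Fin N} {σ : State}
  {P : Fin N → List (Fin M)}

/-- `I l` is the invariant when the links of the suffix `l` of the tree path have been visited, from
the last one backwards. The rounds are paid by the length of the remaining prefix. `hc` keeps `c`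
away from what the traversal reads, and `hs` may use that `e :: l` is a suffix of the path, for
instance that `e` is new. -/
theorem runs_walkBack {c : Cmd} {a B k R : ℕ} {x : Fin N} (I : List (Fin M) → State → Prop)
    (hg : GraphAt src dst w s σ)
    (hP : DijResult src dst w s (σ.nat 127) (σ.nat 126) (σ.nat 128) P)
    (hx : σ.nat 127 x ≠ 0) (ha : σ.nat a 0 = x)
    (h0 : ∀ τ, SameBut [141] σ τ → I [] τ)
    (hc : ∀ b ∈ [112, 115, 128, 140, 141], b ∉ c.writes)
    (hI : ∀ τ τ' l, I l τ → SameBut [140, 141] τ τ' → I l τ')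
    (hs : ∀ τ e l, SameBut (140 :: 141 :: c.writes) σ τ → I l τ → τ.nat 140 0 = (e : Fin M) →
      e :: l <:+ P x → Runs c τ B (fun τ' _ => I (e :: l) τ'))
    (hk : (P x).length * (B + 20) + 20 + R ≤ k) :
    Runs (walkBack a c) σ k (fun τ k' => I (P x) τ ∧ R ≤ k') := by
  refine Runs.seq (Runs.of_run 4 rfl (by simp [Cmd.bound, NExp.cost]) (by omega) ?_)
  set σ₁ := (assign 141 (var a)).run σ with hσ₁
  have hs₁ : SameBut [141] σ σ₁ := (SameBut.refl _ σ).run rfl (by simp [Cmd.writes])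
  have hw : (backStep c).writes ⊆ 140 :: 141 :: c.writes := by
    intro b hb
    simp [backStep, block, Cmd.writes] at hb ⊢
    tauto
  refine Runs.seq (Runs.loop (fun τ k' => ∃ (y : Fin N) (l : List (Fin M)), τ.nat 141 0 = y ∧
    σ.nat 127 y ≠ 0 ∧ P x = P y ++ l ∧ I l τ ∧ (P y).length * (B + 20) + 10 + R ≤ k')
    ⟨x, [], by simp [hσ₁, Cmd.run, ha], hx, by simp, h0 _ hs₁, by omega⟩ ?_ ?_)
  · rintro τ k' hτ ⟨y, l, h₁, h₂, h₃, h₄, h₅⟩ hb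
    have hτ' : SameBut (140 :: 141 :: c.writes) σ τ :=
      (hs₁.mono (by simp)).trans (hτ.sameBut hw)
    have f : ∀ b ∈ [112, 115, 128], τ.nat b = σ.nat b := by
      intro b hb
      refine hτ' b fun h' => ?_
      rcases List.mem_cons.1 h' with rfl | h'
      · exact absurd hb (by decide)
      rcases List.mem_cons.1 h' with rfl | h'
      · exact absurd hb (by decide)
      · exact hc b (by simp at hb ⊢; omega) h'
    have hys : y ≠ s := by
      rintro rfl
      refine absurd ?_ hb
      simp [h₁, f 115 (by decide), hg.s_eq]
    obtain ⟨e, p₁, p₂, p₃, p₄⟩ := hP.tree y h₂ hys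
    have hlen : (P y).length = (P (src e)).length + 1 := by rw [p₄]; simp
    have hlen' : (P y).length * (B + 20) = (P (src e)).length * (B + 20) + (B + 20) := by
      rw [hlen]; ring
    refine ⟨k' - 8, by simp only [BExp.cost, NExp.cost, var]; omega, ?_⟩
    refine Runs.seq (Runs.of_run 5 rfl (by decide) (by omega) ?_)
    have hs₂ : SameBut [140, 141] τ ((assign 140 (.get 128 (var 141))).run τ) :=
      (SameBut.refl _ τ).run rfl (by decide)
    have he : ((assign 140 (.get 128 (var 141))).run τ).nat 140 0 = e := by
      simp [Cmd.run, h₁, f 128 (by decide), p₁]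
    have hstep := hs _ e l (hτ'.trans (hs₂.mono (by simp))) (hI _ _ l h₄ hs₂) he
      ⟨P (src e), by rw [h₃, p₄]; simp⟩
    refine Runs.seq ((((hstep.add (k' - 8 - 5 - B)).frame).mono (by omega) ?_))
    rintro υ k'' ⟨⟨j, h₆, h₇⟩, h₈⟩
    refine Runs.seq (Runs.of_run 5 rfl (by decide) (by omega) (Runs.skip (by omega) ?_))
    have g₁ : υ.nat 112 = σ.nat 112 := by
      rw [h₈.1 112 (hc 112 (by decide)), hs₂ 112 (by decide), f 112 (by decide)]
    refine ⟨src e, e :: l, ?_, p₃, ?_, hI _ _ _ h₆ ((SameBut.refl _ υ).run rfl (by decide)),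
      by omega⟩
    · have g₂ : υ.nat 140 0 = e := by rw [h₈.1 140 (hc 140 (by decide)), he]
      simp [Cmd.run, g₂, g₁, hg.src_eq]
    · rw [h₃, p₄]; simp
  · rintro τ k' hτ ⟨y, l, h₁, h₂, h₃, h₄, h₅⟩ hb
    have hτ' : SameBut (140 :: 141 :: c.writes) σ τ :=
      (hs₁.mono (by simp)).trans (hτ.sameBut hw)
    have f : τ.nat 115 = σ.nat 115 := by
      exact hτ' _ (by simpa using hc 115 (by decide))
    have hys : y = s := by
      have : τ.nat 141 0 = τ.nat 115 0 := by simpa using hb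
      rw [h₁, f, hg.s_eq] at this
      exact Fin.ext this
    subst hys
    rw [hP.P_s] at h₃ h₅
    simp only [List.length_nil, Nat.zero_mul] at h₅
    refine ⟨k' - 7, by simp only [BExp.cost, NExp.cost, var]; omega, Runs.skip (by omega) ⟨?_, ?_⟩⟩
    · rw [h₃]; simpa using h₄
    · omega

/-- The first traversal only counts the links; the second, which meets them in reverse order, can
then fill the array from its end downwards. -/
theorem runs_readPath {a len arr k R : ℕ} {x : Fin N} (hg : GraphAt src dst w s σ)
    (hP : DijResult src dst w s (σ.nat 127) (σ.nat 126) (σ.nat 128) P)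
    (hx : σ.nat 127 x ≠ 0) (ha : σ.nat a 0 = x) (hl : len < 100) (hr : arr < 100)
    (hla : len ≠ arr) (hal : a ≠ len) (haw : a < 100)
    (hk : 100 * N + 100 + R ≤ k) :
    Runs (readPath a len arr) σ k (fun τ k' => PathAt τ len arr (P x) ∧ R ≤ k') := by
  have hlen : (P x).length < N := ((hP.path x hx).1).length_lt
  refine Runs.seq (Runs.of_run 3 rfl (by decide) (by omega) ?_)
  set σ₁ := (assign 142 (.const 0)).run σ with hσ₁
  have hs₁ : SameBut [142] σ σ₁ := (SameBut.refl _ σ).run rfl (by decide)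
  refine Runs.seq (((runs_walkBack (c := incr 142) (B := 8) (R := k - 103 - 28 * N)
    (fun l τ => τ.nat 142 0 = l.length) (hg.congr hs₁ (by decide))
    (by rw [hs₁ 126 (by decide), hs₁ 127 (by decide), hs₁ 128 (by decide)]; exact hP)
    (by rw [hs₁ 127 (by decide)]; exact hx)
    (by rw [hs₁ a (by simp; omega)]; exact ha) (fun τ hτ => ?_) (by decide) (fun τ τ' l h₁ h₂ => ?_)
    (fun τ e l h₁ h₂ h₃ h₄ => ?_) (by omega)).frame).mono le_rfl ?_)
  · rw [hτ 142 (by decide)]; simp [hσ₁, Cmd.run]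
  · rw [h₂ 142 (by decide)]; exact h₁
  · exact Runs.of_run 8 rfl (by decide) le_rfl (by simp [Cmd.run, h₂])
  rintro σ₂ k₂ ⟨⟨h₁, h₂⟩, h₃⟩
  have hs₂ : SameBut [140, 141, 142] σ σ₂ :=
    (hs₁.mono (by decide)).trans (h₃.sameBut (by simp [Cmd.writes, walkBack, block, backStep]))
  refine Runs.seq (Runs.of_run 4 rfl (by simp [Cmd.bound, NExp.cost]) (by omega) ?_)
  set σ₃ := (assign len (var 142)).run σ₂ with hσ₃
  have hs₃ : SameBut [len] σ₂ σ₃ := (SameBut.refl _ σ₂).run rfl (by simp [Cmd.writes])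
  have hs₃' : SameBut [140, 141, 142, len] σ σ₃ :=
    (hs₂.mono (by simp)).trans (hs₃.mono (by simp))
  have g₁ : σ₃.nat len 0 = (P x).length := by simp [hσ₃, Cmd.run, h₁]
  have g₂ : σ₃.nat 142 0 = (P x).length := by rw [hs₃ 142 (by simp; omega), h₁]
  refine Runs.seq ((((runs_walkBack (c := storeLink arr) (B := 13) (R := R + 1)
    (fun l τ => l <:+ P x ∧ τ.nat 142 0 + l.length = (P x).length ∧ ∀ (i : ℕ) (h : i < l.length),
      τ.nat arr (τ.nat 142 0 + i) = l[i]) (hg.congr hs₃' (by simp; omega))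
    (by rw [hs₃' 126 (by simp; omega), hs₃' 127 (by simp; omega), hs₃' 128 (by simp; omega)]
        exact hP)
    (by rw [hs₃' 127 (by simp; omega)]; exact hx)
    (by rw [hs₃' a (by simp; omega)]; exact ha) (fun τ hτ => ?_)
    (by simp [storeLink, block, Cmd.writes]; omega) (fun τ τ' l h₁ h₂ => ?_)
    (fun τ e l h₁ h₂ h₃ h₄ => ?_) (by omega)).frame).mono le_rfl ?_))
  · rw [hτ 142 (by decide)]
    exact ⟨List.nil_suffix, by simp [g₂], by simp⟩
  · rw [h₂ 142 (by decide), h₂ arr (by simp; omega)]; exact h₁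
  · obtain ⟨f₁, f₂, f₃⟩ := h₂
    have hle := h₄.length_le
    simp only [List.length_cons] at hle
    have harr : arr ≠ 142 := by omega
    refine Runs.of_run 13 rfl (by simp [Cmd.bound, storeLink, block, NExp.cost]) le_rfl
      ⟨h₄, ?_, fun i hi => ?_⟩
    · simp [Cmd.run, storeLink, block, harr, harr.symm]; omega
    · cases i with
      | zero => simp [Cmd.run, storeLink, block, harr, harr.symm, h₃]
      | succ i =>
        have hi' : i < l.length := by simpa using hi
        have := f₃ i hi'
        have e₁ : τ.nat 142 0 - 1 + (i + 1) = τ.nat 142 0 + i := by omega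
        have e₂ : τ.nat 142 0 + i ≠ τ.nat 142 0 - 1 := by omega
        simp [Cmd.run, storeLink, block, harr, harr.symm, e₁, e₂, this]
  · rintro τ k' ⟨⟨⟨-, f₁, f₂⟩, f₃⟩, f₄⟩
    have f₅ : τ.nat 142 0 = 0 := by omega
    rw [f₅] at f₂
    refine Runs.skip (by omega) ⟨⟨?_, fun i hi => by simpa using f₂ i hi⟩, by omega⟩
    rw [f₄.1 len (by simp [Cmd.writes, walkBack, block, backStep, storeLink]; omega), g₁]

end

/-- A bound on the running time of the shortest-path subroutine. -/
def spCost (N M : ℕ) : ℕ := dijCost N M + 50 * (M + 1) + 101 * N + 200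

theorem isSPAlgorithm_spMain : IsSPAlgorithm spMain (fun N M => (spCost N M : ℝ)) := by
  intro G s t σ hst hσ
  have hs : σ.nat 5 0 = s := hσ.2.2.1
  have ht : σ.nat 6 0 = t := hσ.2.2.2.1
  -- At least `G.N` credits are left over for the delivery, since a simple path has fewer than `G.N`
  -- links.
  have key : Runs spMain σ (spCost G.N G.M) (fun τ k' =>
      (τ.nat 8 0 = 1 ∧ ∃ π, G.IsWeightShortest s t π ∧ PathAt τ 9 10 π ∧ G.N ≤ k') ∨
      (τ.nat 8 0 = 0 ∧ ¬ ∃ π, G.IsPath s t π)) := by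
    simp only [spCost]
    refine Runs.seq (((runs_loadGraph (R := dijCost G.N G.M + 101 * G.N + 150) hσ.linksAt hs (by omega)
      (by omega)).frame).mono le_rfl ?_)
    rintro σ₁ k₁ ⟨⟨hg, hk₁⟩, ha₁⟩
    refine Runs.seq (((runs_dij (R := 101 * G.N + 150) hg (by omega)).frame).mono le_rfl ?_)
    rintro σ₂ k₂ ⟨⟨⟨P, hP⟩, hk₂⟩, ha₂⟩
    have ht₂ : σ₂.nat 6 0 = t := by
      rw [ha₂.1 6 (by decide), ha₁.1 6 (by decide), ht]
    have hg₂ : GraphAt G.src G.dst G.w s σ₂ :=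
      hg.congr (l := dij.writes) (ha₂.sameBut (List.Subset.refl _)) (by decide)
    refine Runs.seq (Runs.ite (by simp only [BExp.cost, NExp.cost, var]; omega) (fun hb => ?_)
      (fun hb => ?_))
    · have hb : σ₂.nat 127 t = 0 := by simpa [ht₂] using hb
      simp only [BExp.cost, NExp.cost, var]
      refine Runs.of_run 3 rfl (by decide) (by omega) (Runs.skip (by omega)
        (Or.inr ⟨by simp [Cmd.run], ?_⟩))
      rintro ⟨π, hπ⟩
      exact (hP.le_sum hP.lab_s hπ.1).1 hb
    · have hb : σ₂.nat 127 t ≠ 0 := by simpa [ht₂] using hb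
      simp only [BExp.cost, NExp.cost, var]
      refine Runs.seq (Runs.of_run 3 rfl (by decide) (by omega) ?_)
      set σ₃ := (assign 8 (.const 1)).run σ₂ with hσ₃
      have hs₃ : SameBut [8] σ₂ σ₃ := (SameBut.refl _ σ₂).run rfl (by decide)
      refine Runs.seq (((runs_readPath (len := 9) (arr := 10) (R := G.N + 2)
        (hg₂.congr hs₃ (by decide))
        (by rw [hs₃ 126 (by decide), hs₃ 127 (by decide), hs₃ 128 (by decide)]; exact hP)
        (by rw [hs₃ 127 (by decide)]; exact hb) (by rw [hs₃ 6 (by decide)]; exact ht₂)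
        (by omega) (by omega) (by omega) (by omega) (by omega) (by omega)).frame).mono le_rfl ?_)
      rintro τ k' ⟨⟨h₁, h₂⟩, h₃⟩
      refine Runs.skip (by omega) (Runs.skip (by omega) (Or.inl ⟨?_, P t, ⟨(hP.path t hb).1,
        fun π' hπ' => ?_⟩, h₁, by omega⟩))
      · rw [h₃.1 8 (by decide)]; simp [hσ₃, Cmd.run]
      · have h₄ := (hP.path t hb).2
        have h₅ := (hP.le_sum hP.lab_s hπ'.1).2
        rw [hP.dist_s] at h₅
        simp only [Network.weight]
        omega
  obtain ⟨τ, n, k', h₁, h₂, h₃⟩ := key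
  refine ⟨τ, n, h₁, h₁.agree.preserves _ (by decide) (by decide), ?_⟩
  rcases h₃ with ⟨h₃, π, h₄, h₅, h₆⟩ | ⟨h₃, h₄⟩
  · refine Or.inl ⟨h₃, π, h₄, h₅, ?_⟩
    have := h₄.1.length_lt
    show (n + π.length : ℝ) ≤ (spCost G.N G.M : ℝ)
    exact_mod_cast (by omega : n + π.length ≤ spCost G.N G.M)
  · refine Or.inr ⟨h₃, h₄, ?_⟩
    show (n : ℝ) ≤ (spCost G.N G.M : ℝ)
    exact_mod_cast (by omega : n ≤ spCost G.N G.M)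

end CTQAMSC

namespace CTQAMSC

/-! ### Edge-disjoint pairs: walks, cuts and weak duality -/

section

variable {N M : ℕ} {src dst : Fin M → Fin N} {u v : Fin N}

theorem IsSimplePath.nodup {π : List (Fin M)} (h : IsSimplePath src dst u v π) : π.Nodup :=
  List.Nodup.of_map dst (List.nodup_cons.1 h.2).2

theorem IsSimplePath.exists_suffix {x : Fin N} {π : List (Fin M)} (h : IsSimplePath src dst x v π)
    (hu : u ∈ x :: π.map dst) : ∃ π', π' <:+ π ∧ IsSimplePath src dst u v π' := by
  induction π generalizing x with
  | nil =>
    obtain rfl : u = x := by simpa using hu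
    exact ⟨[], List.nil_suffix, h⟩
  | cons e π ih =>
    by_cases hux : u = x
    · subst hux; exact ⟨_, List.suffix_refl _, h⟩
    · obtain ⟨π', h₁, h₂⟩ := ih (x := dst e) ⟨h.1.2, (List.nodup_cons.1 h.2).2⟩
        (by simpa [hux] using hu)
      exact ⟨π', h₁.trans (List.suffix_cons _ _), h₂⟩

/-- Every walk contains a simple path. -/
theorem IsWalk.exists_isSimplePath {π : List (Fin M)} (h : IsWalk src dst u v π) :
    ∃ π', π'.Sublist π ∧ IsSimplePath src dst u v π' := by
  induction π generalizing u with
  | nil => exact ⟨[], .refl _, h, by simp⟩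
  | cons e π ih =>
    obtain ⟨rfl, h₂⟩ := h
    obtain ⟨π', h₃, h₄⟩ := ih h₂
    by_cases hu : src e ∈ dst e :: π'.map dst
    · obtain ⟨π'', h₅, h₆⟩ := h₄.exists_suffix hu
      exact ⟨π'', (h₅.sublist.trans h₃).cons _, h₆⟩
    · exact ⟨e :: π', h₃.cons_cons _, ⟨rfl, h₄.1⟩, List.nodup_cons.2 ⟨hu, h₄.2⟩⟩

/-- Every dropped element lowers the sum by at least one. So a sublist of at least the same weight
must be the whole list, which is how walks of minimum weight turn out to be simple. -/
theorem _root_.List.Sublist.sum_map_add_length_le {α : Type*} {l₁ l₂ : List α} (h : l₁.Sublist l₂)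
    {w : α → ℕ} (hw : ∀ a, 0 < w a) :
    (l₁.map w).sum + l₂.length ≤ (l₂.map w).sum + l₁.length := by
  induction h with
  | slnil => simp
  | cons a _ ih => have := hw a; simp; omega
  | cons_cons a _ ih => simp; omega

theorem IsWalk.sum_sub {π : List (Fin M)} (h : IsWalk src dst u v π) (φ : Fin N → ℤ) :
    (π.map fun e => φ (src e) - φ (dst e)).sum = φ u - φ v := by
  induction π generalizing u with
  | nil => obtain rfl : u = v := h; simp
  | cons e π ih =>
    obtain ⟨rfl, h₂⟩ := h
    rw [List.map_cons, List.sum_cons, ih h₂]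
    ring

theorem sum_map_add {l : List (Fin M)} (f g : Fin M → ℤ) :
    (l.map fun e => f e + g e).sum = (l.map f).sum + (l.map g).sum := by
  induction l with
  | nil => simp
  | cons a l ih => simp only [List.map_cons, List.sum_cons, ih]; ring

/-- Weak duality for pairs of edge-disjoint walks. -/
theorem add_sub_le_sum_of_disjoint {w : Fin M → ℤ} {φ : Fin N → ℤ} {π Q₁ Q₂ : List (Fin M)}
    (hπ : IsWalk src dst u v π) (hn : π.Nodup) (h₁ : IsWalk src dst u v Q₁)
    (h₂ : IsWalk src dst u v Q₂) (hd : (Q₁ ++ Q₂).Nodup)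
    (hoff : ∀ e, e ∉ π → 0 ≤ w e + (φ (src e) - φ (dst e)))
    (hon : ∀ e ∈ π, w e + (φ (src e) - φ (dst e)) ≤ 0) :
    (π.map w).sum + (φ v - φ u) ≤ ((Q₁ ++ Q₂).map w).sum := by
  -- The reduced costs are nonpositive on `π` and nonnegative off it, so no set of links has a
  -- smaller total than `π`. The potential terms telescope to `φ u - φ v`, once along `π` and twice
  -- along the pair.
  set c : Fin M → ℤ := fun e => w e + (φ (src e) - φ (dst e)) with hc
  have e₁ : (π.map c).sum = (π.map w).sum + (φ u - φ v) := by rw [hc, sum_map_add, hπ.sum_sub]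
  have e₂ : ((Q₁ ++ Q₂).map c).sum = ((Q₁ ++ Q₂).map w).sum + (φ u - φ v) + (φ u - φ v) := by
    rw [hc, sum_map_add, List.map_append (f := fun e => φ (src e) - φ (dst e)), List.sum_append,
      h₁.sum_sub, h₂.sum_sub]
    ring
  have e₃ : (π.map c).sum ≤ ((Q₁ ++ Q₂).map c).sum := by
    rw [← List.sum_toFinset c hn, ← List.sum_toFinset c hd,
      ← Finset.sum_inter_add_sum_sdiff π.toFinset (Q₁ ++ Q₂).toFinset,
      ← Finset.sum_inter_add_sum_sdiff (Q₁ ++ Q₂).toFinset π.toFinset, Finset.inter_comm]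
    have f₁ : ∑ e ∈ π.toFinset \ (Q₁ ++ Q₂).toFinset, c e ≤ 0 :=
      Finset.sum_nonpos fun e he => hon e (by simp at he; exact he.1)
    have f₂ : 0 ≤ ∑ e ∈ (Q₁ ++ Q₂).toFinset \ π.toFinset, c e :=
      Finset.sum_nonneg fun e he => hoff e (by
        simp only [Finset.mem_sdiff, List.mem_toFinset] at he; exact he.2)
    linarith
  linarith

/-- The sum over the symmetric difference of two paths. -/
theorem sum_symmDiff_toFinset {π ρ : List (Fin M)} (h₁ : π.Nodup) (h₂ : ρ.Nodup) (g : Fin M → ℤ) :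
    ∑ e ∈ symmDiff π.toFinset ρ.toFinset, g e =
      (π.map g).sum + (ρ.map fun e => if e ∈ π then - g e else g e).sum := by
  rw [← List.sum_toFinset g h₁, ← List.sum_toFinset _ h₂, symmDiff_def, Finset.sup_eq_union,
    Finset.sum_union disjoint_sdiff_sdiff,
    ← Finset.sum_inter_add_sum_sdiff π.toFinset ρ.toFinset g,
    ← Finset.sum_inter_add_sum_sdiff ρ.toFinset π.toFinset]
  have e₁ : ∑ e ∈ ρ.toFinset ∩ π.toFinset, (if e ∈ π then - g e else g e) =
      ∑ e ∈ ρ.toFinset ∩ π.toFinset, - g e := by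
    refine Finset.sum_congr rfl fun e he => if_pos ?_
    simp only [Finset.mem_inter, List.mem_toFinset] at he
    exact he.2
  have e₂ : ∑ e ∈ ρ.toFinset \ π.toFinset, (if e ∈ π then - g e else g e) =
      ∑ e ∈ ρ.toFinset \ π.toFinset, g e := by
    refine Finset.sum_congr rfl fun e he => if_neg ?_
    simp only [Finset.mem_sdiff, List.mem_toFinset] at he
    exact he.2
  rw [e₁, e₂, Finset.sum_neg_distrib, Finset.inter_comm π.toFinset]
  ring

end

/-! ### Potentials and the residual graph -/

section Residual

variable {N M : ℕ} (src dst : Fin M → Fin N) (w : Fin M → ℕ) (π : List (Fin M)) (h : Fin N → ℕ)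

/-- Tails in the residual graph: the links of `π` are reversed. -/
def resSrc (e : Fin M) : Fin N := if e ∈ π then dst e else src e

/-- Heads in the residual graph. -/
def resDst (e : Fin M) : Fin N := if e ∈ π then src e else dst e

/-- Reduced weights in the residual graph for the potential `h`. -/
def resW (e : Fin M) : ℕ := if e ∈ π then 0 else w e + h (src e) - h (dst e)

/-- A distance, truncated at the distance `D` of the destination. -/
def trunc (lab dist : ℕ → ℕ) (D : ℕ) (x : ℕ) : ℕ :=
  if lab x ≠ 0 ∧ dist x < D then dist x else D

variable {src dst w π h} {u v : Fin N} {lab dist par : ℕ → ℕ} {P : Fin N → List (Fin M)}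

theorem trunc_le {D x : ℕ} : trunc lab dist D x ≤ D := by
  unfold trunc; split_ifs with h₁
  · exact h₁.2.le
  · exact le_rfl

theorem trunc_self (x : ℕ) : trunc lab dist (dist x) x = dist x := by
  unfold trunc; split_ifs <;> rfl

theorem DijResult.trunc_source (hP : DijResult src dst w u lab dist par P) (D : ℕ) :
    trunc lab dist D u = 0 := by
  unfold trunc
  rw [hP.dist_s]
  by_cases hD : 0 < D
  · rw [if_pos ⟨hP.lab_s, hD⟩]
  · rw [if_neg fun h => hD h.2]; omega

/-- Truncation at `D` turns the distances into a feasible potential on all nodes: nodes that were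
not reached get the value `D`, and a link can gain nothing beyond `D`. Source and destination keep
their distances. -/
theorem DijResult.trunc_relaxed (hP : DijResult src dst w u lab dist par P) (D : ℕ) (e : Fin M) :
    trunc lab dist D (dst e) ≤ trunc lab dist D (src e) + w e := by
  by_cases hl : lab (src e) ≠ 0 ∧ dist (src e) < D
  · obtain ⟨h₁, h₂⟩ := hP.relaxed e hl.1
    have : trunc lab dist D (src e) = dist (src e) := if_pos hl
    rw [this]
    unfold trunc
    split_ifs with h₃
    · exact h₂
    · have : ¬ dist (dst e) < D := fun h' => h₃ ⟨h₁, h'⟩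
      omega
  · have : trunc lab dist D (src e) = D := if_neg hl
    rw [this]
    have := trunc_le (lab := lab) (dist := dist) (D := D) (x := dst e)
    omega

/-- The links of a shortest path are tight. -/
theorem IsWalk.tight {π : List (Fin M)} (hπ : IsWalk src dst u v π)
    (hfeas : ∀ e, h (dst e) ≤ h (src e) + w e) (hsum : h u + (π.map w).sum ≤ h v) :
    ∀ e ∈ π, h (dst e) = h (src e) + w e := by
  have key : ∀ (π : List (Fin M)) (u : Fin N), IsWalk src dst u v π →
      h v ≤ h u + (π.map w).sum := by
    intro π
    induction π with
    | nil => rintro u hu; obtain rfl : u = v := hu; simp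
    | cons e π ih =>
      rintro u ⟨rfl, h₂⟩
      have := ih _ h₂
      have := hfeas e
      simp; omega
  induction π generalizing u with
  | nil => simp
  | cons e π ih =>
    obtain ⟨rfl, h₂⟩ := hπ
    have h₃ := key π _ h₂
    have h₄ := hfeas e
    simp only [List.map_cons, List.sum_cons] at hsum
    rintro e' (_ | ⟨_, he'⟩)
    · omega
    · exact ih h₂ (by omega) e' he'

variable {lab₂ dist₂ par₂ : ℕ → ℕ} {P₂ : Fin N → List (Fin M)}

/-- The destination is not reachable in the residual graph: no edge-disjoint pair. -/
theorem not_disjoint_of_residual (hπ : IsSimplePath src dst u v π)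
    (hP₂ : DijResult (resSrc src dst π) (resDst src dst π) (resW src dst w π h) u lab₂ dist₂ par₂ P₂)
    (hv : lab₂ v = 0) {Q₁ Q₂ : List (Fin M)} (h₁ : IsWalk src dst u v Q₁)
    (h₂ : IsWalk src dst u v Q₂) (hd : (Q₁ ++ Q₂).Nodup) : False := by
  have hr : ∀ e, lab₂ (resSrc src dst π e) ≠ 0 → lab₂ (resDst src dst π e) ≠ 0 :=
    fun e he => (hP₂.relaxed e he).1
  -- The cut as dual solution: zero weights and the indicator of the nodes not reachable in the
  -- residual graph. Weak duality then reads `0 + (1 - 0) ≤ 0`.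
  have := add_sub_le_sum_of_disjoint (w := fun _ => 0)
    (φ := fun x => if lab₂ x = 0 then 1 else 0) hπ.1 hπ.nodup h₁ h₂ hd
    (fun e he => by
      have := hr e
      simp only [resSrc, resDst, if_neg he] at this
      by_cases g₁ : lab₂ (src e) = 0 <;> by_cases g₂ : lab₂ (dst e) = 0 <;> simp [g₁, g₂]
      exact this g₁ g₂)
    (fun e he => by
      have := hr e
      simp only [resSrc, resDst, if_pos he] at this
      by_cases g₁ : lab₂ (src e) = 0 <;> by_cases g₂ : lab₂ (dst e) = 0 <;> simp [g₁, g₂]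
      exact this g₂ g₁)
  simp [hv, hP₂.lab_s] at this

theorem DijResult.tight (hP : DijResult src dst w u lab dist par P) (hv : lab v ≠ 0) :
    ∀ e ∈ P v, trunc lab dist (dist v) (dst e) = trunc lab dist (dist v) (src e) + w e := by
  obtain ⟨h₁, h₂⟩ := hP.path v hv
  refine h₁.1.tight (h := fun x => trunc lab dist (dist v) x) (hP.trunc_relaxed _) ?_
  show trunc lab dist (dist v) u + _ ≤ trunc lab dist (dist v) v
  rw [hP.trunc_source, trunc_self, h₂]
  omega

/-- A lower bound for the weight of edge-disjoint pairs. -/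
theorem two_mul_dist_add_le (hP : DijResult src dst w u lab dist par P) (hv : lab v ≠ 0)
    (hP₂ : DijResult (resSrc src dst (P v)) (resDst src dst (P v))
      (resW src dst w (P v) fun x => trunc lab dist (dist v) x) u lab₂ dist₂ par₂ P₂)
    {Q₁ Q₂ : List (Fin M)} (h₁ : IsWalk src dst u v Q₁)
    (h₂ : IsWalk src dst u v Q₂) (hd : (Q₁ ++ Q₂).Nodup) :
    2 * dist v + dist₂ v ≤ ((Q₁ ++ Q₂).map w).sum := by
  obtain ⟨g₁, g₂⟩ := hP.path v hv
  have tight := hP.tight hv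
  -- The dual solution is the sum of both truncated distances. The first makes the links of the path
  -- tight; the second is feasible in the residual graph, where these links are reversed with weight
  -- 0, so reduced costs become nonpositive on the path and stay nonnegative elsewhere.
  have key := add_sub_le_sum_of_disjoint (w := fun e => (w e : ℤ))
    (φ := fun x => (trunc lab dist (dist v) x : ℤ) + trunc lab₂ dist₂ (dist₂ v) x)
    g₁.1 g₁.nodup h₁ h₂ hd
    (fun e he => by
      have f₁ := hP.trunc_relaxed (dist v) e
      have f₂ := hP₂.trunc_relaxed (dist₂ v) e
      simp only [resSrc, resDst, resW, if_neg he] at f₂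
      omega)
    (fun e he => by
      have f₁ := tight e he
      have f₂ := hP₂.trunc_relaxed (dist₂ v) e
      simp only [resSrc, resDst, resW, if_pos he] at f₂
      omega)
  simp only [hP.trunc_source, hP₂.trunc_source, trunc_self] at key
  have e₁ : ∀ l : List (Fin M), (l.map fun e => (w e : ℤ)).sum = ((l.map w).sum : ℕ) := by
    intro l; induction l with
    | nil => simp
    | cons a l ih => simp [ih]
  rw [e₁, e₁, g₂] at key
  omega

/-- The links of the shortest pair. -/
def pairLinks (π ρ : List (Fin M)) : Finset (Fin M) := symmDiff π.toFinset ρ.toFinset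

/-- Flow conservation, tested against all functions `φ`: the links carry a flow of value two from
`u` to `v`. Links common to both paths cancel, since the second path traverses them backwards. -/
theorem sum_pairLinks (hP : DijResult src dst w u lab dist par P) (hv : lab v ≠ 0)
    (hP₂ : DijResult (resSrc src dst (P v)) (resDst src dst (P v))
      (resW src dst w (P v) fun x => trunc lab dist (dist v) x) u lab₂ dist₂ par₂ P₂)
    (hv₂ : lab₂ v ≠ 0) (φ : Fin N → ℤ) :
    ∑ e ∈ pairLinks (P v) (P₂ v), (φ (src e) - φ (dst e)) = (φ u - φ v) + (φ u - φ v) := by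
  have h₁ := (hP.path v hv).1
  have h₂ := (hP₂.path v hv₂).1
  rw [pairLinks, sum_symmDiff_toFinset h₁.nodup h₂.nodup, h₁.1.sum_sub, ← h₂.1.sum_sub]
  congr 2
  refine List.map_congr_left fun e _ => ?_
  simp only [resSrc, resDst]
  split_ifs <;> ring

/-- Along the residual path, the weight with its sign is the reduced weight plus a difference of
potentials. This telescopes to `dist₂ v + dist v`, to be added to the weight `dist v` of the first
path, and meets the lower bound `two_mul_dist_add_le`. -/
theorem sum_weight_pairLinks (hP : DijResult src dst w u lab dist par P) (hv : lab v ≠ 0)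
    (hP₂ : DijResult (resSrc src dst (P v)) (resDst src dst (P v))
      (resW src dst w (P v) fun x => trunc lab dist (dist v) x) u lab₂ dist₂ par₂ P₂)
    (hv₂ : lab₂ v ≠ 0) :
    ∑ e ∈ pairLinks (P v) (P₂ v), w e = 2 * dist v + dist₂ v := by
  obtain ⟨h₁, h₁'⟩ := hP.path v hv
  obtain ⟨h₂, h₂'⟩ := hP₂.path v hv₂
  have tight := hP.tight hv
  set φ : Fin N → ℤ := fun x => (trunc lab dist (dist v) x : ℤ) with hφ
  have e₁ : ∀ (f : Fin M → ℕ) (l : List (Fin M)),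
      ((l.map f).sum : ℤ) = (l.map fun e => (f e : ℤ)).sum := by
    intro f l; induction l with
    | nil => simp
    | cons a l ih => simp [ih]
  have key := sum_symmDiff_toFinset h₁.nodup h₂.nodup fun e => (w e : ℤ)
  rw [← e₁ w, h₁'] at key
  have e₂ : ((P₂ v).map fun e => if e ∈ P v then - (w e : ℤ) else (w e : ℤ)).sum =
      ((P₂ v).map fun e => (resW src dst w (P v) (fun x => trunc lab dist (dist v) x) e : ℤ) +
        ((fun x => - φ x) (resSrc src dst (P v) e) - (fun x => - φ x) (resDst src dst (P v) e))).sum := by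
    congr 1
    refine List.map_congr_left fun e _ => ?_
    simp only [resW, resSrc, resDst, hφ]
    have f₁ := hP.trunc_relaxed (dist v) e
    split_ifs with he
    · have := tight e he
      push_cast
      omega
    · omega
  rw [e₂, sum_map_add, h₂.1.sum_sub (fun x => - φ x), ← e₁, h₂'] at key
  simp only [hφ, hP.trunc_source, trunc_self] at key
  rw [pairLinks]
  have : ((∑ e ∈ symmDiff (P v).toFinset (P₂ v).toFinset, w e : ℕ) : ℤ) =
    ∑ e ∈ symmDiff (P v).toFinset (P₂ v).toFinset, (w e : ℤ) := by push_cast; rfl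
  omega

end Residual

/-- Two edge-disjoint walks in a set of links of minimum weight are a shortest pair of paths. -/
theorem isShortestDisjointPair_of_walks {G : Network} {u v : Fin G.N} {Q₁ Q₂ : List (Fin G.M)}
    {E : Finset (Fin G.M)} {L : ℕ} (h₁ : IsWalk G.src G.dst u v Q₁)
    (h₂ : IsWalk G.src G.dst u v Q₂) (hd : (Q₁ ++ Q₂).Nodup) (hE : ∀ e ∈ Q₁ ++ Q₂, e ∈ E)
    (hL : ∑ e ∈ E, G.w e ≤ L)
    (hmin : ∀ Q₁ Q₂, IsWalk G.src G.dst u v Q₁ → IsWalk G.src G.dst u v Q₂ → (Q₁ ++ Q₂).Nodup →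
      L ≤ ((Q₁ ++ Q₂).map G.w).sum) : G.IsShortestDisjointPair u v Q₁ Q₂ := by
  have hQ : ((Q₁ ++ Q₂).map G.w).sum ≤ L := by
    rw [← List.sum_toFinset _ hd]
    exact (Finset.sum_le_sum_of_subset fun e he => hE e (List.mem_toFinset.1 he)).trans hL
  obtain ⟨π₁, s₁, p₁⟩ := h₁.exists_isSimplePath
  obtain ⟨π₂, s₂, p₂⟩ := h₂.exists_isSimplePath
  have hs := s₁.append s₂
  have h₃ := hmin π₁ π₂ p₁.1 p₂.1 (hd.sublist hs)
  have l₁ := s₁.sum_map_add_length_le G.w_pos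
  have l₂ := s₂.sum_map_add_length_le G.w_pos
  have m₁ := s₁.length_le
  have m₂ := s₂.length_le
  simp only [List.map_append, List.sum_append] at h₃ hQ
  -- If a link were dropped on the way to a simple path, the pair would become lighter than the
  -- minimum `L`; so both walks are simple already.
  obtain rfl := s₁.eq_of_length (by omega)
  obtain rfl := s₂.eq_of_length (by omega)
  refine ⟨⟨p₁, p₂, (List.nodup_append'.1 hd).2.2⟩, fun π₁' π₂' h => ?_⟩
  have := hmin π₁' π₂' h.1.1 h.2.1.1 (List.nodup_append'.2 ⟨h.1.nodup, h.2.1.nodup, h.2.2⟩)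
  simp only [List.map_append, List.sum_append] at this
  simp only [Network.weight]
  omega

end CTQAMSC

namespace CTQAMSC

/-! ### Programs for the residual graph -/

/-- No link is marked. -/
def clearMarks : Cmd :=
  block [
    assign 140 (.const 0),
    .loop (.natLt (var 140) (var 111)) (block [.setNat 116 (var 140) (.const 0), incr 140])]

/-- Compute the potentials, with the end node `12`. -/
def truncDist : Cmd :=
  block [
    assign 118 (.get 126 (var 12)),
    assign 135 (.const 0),
    .loop (.natLt (var 135) (var 110)) (block [
      .ite (.and (.not (.natEq (.get 127 (var 135)) (.const 0)))
          (.natLt (.get 126 (var 135)) (var 118)))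
        (.setNat 117 (var 135) (.get 126 (var 135)))
        (.setNat 117 (var 135) (var 118)),
      incr 135])]

def resStep : Cmd :=
  block [
    .ite (.natEq (.get 116 (var 140)) (.const 1))
      (block [
        .setNat 112 (var 140) (.get 3 (var 140)),
        .setNat 113 (var 140) (.get 2 (var 140)),
        .setNat 114 (var 140) (.const 0)])
      (.setNat 114 (var 140) (.minus
        (.plus (.get 114 (var 140)) (.get 117 (.get 112 (var 140))))
        (.get 117 (.get 113 (var 140))))),
    incr 140]

/-- Replace the graph by the residual graph. -/
def residual : Cmd :=
  block [
    assign 140 (.const 0),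
    .loop (.natLt (var 140) (var 111)) resStep]

def greedyStep (len arr : ℕ) : Cmd :=
  block [
    assign 140 (.minus (.get 129 (var 141)) (.const 1)),
    .setNat 129 (var 141) (.get 130 (var 140)),
    .setNat arr (var len) (var 140),
    incr len,
    assign 141 (.get 113 (var 140))]

/-- Take links from the lists until the node `12` is reached. -/
def greedy (len arr : ℕ) : Cmd :=
  block [
    assign 141 (var 115),
    assign len (.const 0),
    .loop (.not (.natEq (var 141) (var 12))) (greedyStep len arr)]

/-- The links that are marked. -/
def MarkAt {M : ℕ} (S : Finset (Fin M)) (σ : State) : Prop :=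
  ∀ e : Fin M, σ.nat 116 e = if e ∈ S then 1 else 0

section

variable {N M : ℕ} {src dst : Fin M → Fin N} {w : Fin M → ℕ} {u v : Fin N} {σ : State}
  {P : Fin N → List (Fin M)} {k R : ℕ}

theorem MarkAt.congr {S : Finset (Fin M)} {τ : State} (h : MarkAt S σ) {l : List ℕ}
    (hl : SameBut l σ τ) (h116 : 116 ∉ l) : MarkAt S τ := by
  intro e; rw [hl 116 h116]; exact h e

theorem runs_clearMarks (hg : GraphAt src dst w u σ) (hk : 30 * (M + 1) + R ≤ k) :
    Runs clearMarks σ k (fun τ k' => MarkAt (∅ : Finset (Fin M)) τ ∧ R ≤ k') := by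
  refine Runs.seq (Runs.of_run 3 rfl (by decide) (by omega) ?_)
  refine Runs.seq (Runs.count M 20 (fun j τ => τ.nat 140 0 = j ∧ ∀ e < j, τ.nat 116 e = 0)
    ⟨by simp [Cmd.run], by simp⟩ (by simp only [BExp.cost, NExp.cost, var]; omega) ?_ ?_ ?_)
  · rintro j τ hj hτ ⟨h₁, -⟩
    have e := hτ.1 111 (by decide)
    simp [Cmd.run] at e
    simp [h₁, e, hg.M_eq]
  · rintro j τ hj hτ ⟨h₁, h₂⟩
    refine Runs.of_run 20 rfl (by decide) le_rfl ⟨by simp [Cmd.run, block, h₁], fun e he => ?_⟩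
    by_cases hej : e = j
    · simp [Cmd.run, block, h₁, hej]
    · simpa [Cmd.run, block, h₁, hej] using h₂ e (by omega)
  · rintro τ hτ ⟨-, h₂⟩
    simp only [BExp.cost, NExp.cost, var]
    exact Runs.skip (by omega) ⟨fun e => by simp [h₂ e e.2], by omega⟩

theorem runs_markPath (hg : GraphAt src dst w u σ)
    (hP : DijResult src dst w u (σ.nat 127) (σ.nat 126) (σ.nat 128) P) (hv : σ.nat 127 v ≠ 0)
    (h12 : σ.nat 12 0 = v) (hm : MarkAt (∅ : Finset (Fin M)) σ) (hk : 30 * (N + 1) + R ≤ k) :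
    Runs (walkBack 12 (.setNat 116 (var 140) (.const 1))) σ k
      (fun τ k' => MarkAt (P v).toFinset τ ∧ R ≤ k') := by
  have hlen : (P v).length < N := ((hP.path v hv).1).length_lt
  refine runs_walkBack (B := 10) (fun l τ => MarkAt l.toFinset τ) hg hP hv h12
    (fun τ h => hm.congr h (by decide)) (by decide) (fun τ τ' l h₁ h₂ => h₁.congr h₂ (by decide))
    (fun τ e l h₁ h₂ h₃ h₄ => ?_) (by omega)
  refine Runs.of_run 10 rfl (by decide) le_rfl fun e' => ?_
  by_cases he : e' = e
  · subst he; simp [Cmd.run, h₃]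
  · have he' : (e' : ℕ) ≠ e := fun h => he (Fin.ext h)
    simp [Cmd.run, h₃, he, he']
    simpa using h₂ e'

/-- A simple path visits every link at most once, so each of its marks is flipped exactly once and
the marks become the symmetric difference. -/
theorem runs_togglePath {π : List (Fin M)} (hg : GraphAt src dst w u σ)
    (hP : DijResult src dst w u (σ.nat 127) (σ.nat 126) (σ.nat 128) P) (hv : σ.nat 127 v ≠ 0)
    (h12 : σ.nat 12 0 = v) (hm : MarkAt π.toFinset σ) (hk : 40 * (N + 1) + R ≤ k) :
    Runs (walkBack 12 (.setNat 116 (var 140) (.minus (.const 1) (.get 116 (var 140))))) σ k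
      (fun τ k' => MarkAt (pairLinks π (P v)) τ ∧ R ≤ k') := by
  have hp := (hP.path v hv).1
  have hlen : (P v).length < N := hp.length_lt
  refine runs_walkBack (B := 12) (fun l τ => MarkAt (pairLinks π l) τ) hg hP hv h12
    (fun τ h => ?_) (by decide) (fun τ τ' l h₁ h₂ => h₁.congr h₂ (by decide))
    (fun τ e l h₁ h₂ h₃ h₄ => ?_) (by omega)
  · have : pairLinks π [] = π.toFinset := by simp [pairLinks]
    rw [this]
    exact hm.congr h (by decide)
  · have hel : e ∉ l := (List.nodup_cons.1 (hp.nodup.sublist h₄.sublist)).1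
    refine Runs.of_run 12 rfl (by decide) le_rfl fun e' => ?_
    have h₅ := h₂ e'
    simp only [pairLinks, Finset.mem_symmDiff, List.mem_toFinset, List.mem_cons] at h₅ ⊢
    by_cases he : e' = e
    · subst he
      by_cases hπ : e' ∈ π <;> simp [Cmd.run, h₃, hel, hπ] at h₅ ⊢ <;> simp [h₅]
    · have he' : (e' : ℕ) ≠ e := fun h => he (Fin.ext h)
      simp [Cmd.run, h₃, he, he']
      simpa using h₅

theorem runs_truncDist (hg : GraphAt src dst w u σ) (h12 : σ.nat 12 0 = v)
    (hk : 50 * (N + 1) + R ≤ k) :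
    Runs truncDist σ k (fun τ k' => (∀ x < N,
      τ.nat 117 x = trunc (σ.nat 127) (σ.nat 126) (σ.nat 126 v) x) ∧ R ≤ k') := by
  refine Runs.seq (Runs.of_run 6 rfl (by decide) (by omega) ?_)
  refine Runs.seq (Runs.of_run 3 rfl (by decide) (by omega) ?_)
  set σ₁ := (assign 135 (.const 0)).run ((assign 118 (.get 126 (var 12))).run σ) with hσ₁
  have hs₁ : SameBut [118, 135] σ σ₁ :=
    ((SameBut.refl _ σ).run rfl (by decide)).run rfl (by decide)
  have h118 : σ₁.nat 118 0 = σ.nat 126 v := by simp [hσ₁, Cmd.run, h12]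
  refine Runs.seq (Runs.count N 38 (fun j τ => τ.nat 135 0 = j ∧ ∀ x < j,
    τ.nat 117 x = trunc (σ.nat 127) (σ.nat 126) (σ.nat 126 v) x)
    ⟨by simp [hσ₁, Cmd.run], by simp⟩ (by simp only [BExp.cost, NExp.cost, var]; omega) ?_ ?_ ?_)
  · rintro j τ hj hτ ⟨h₁, -⟩
    simp [h₁, hτ.1 110 (by decide), hs₁ 110 (by decide), hg.N_eq]
  · rintro j τ hj hτ ⟨h₁, h₂⟩
    have e₁ : τ.nat 118 0 = σ.nat 126 v := by rw [hτ.1 118 (by decide), h118]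
    have e₂ : τ.nat 126 = σ.nat 126 := by rw [hτ.1 126 (by decide), hs₁ 126 (by decide)]
    have e₃ : τ.nat 127 = σ.nat 127 := by rw [hτ.1 127 (by decide), hs₁ 127 (by decide)]
    by_cases hc : σ.nat 127 j ≠ 0 ∧ σ.nat 126 j < σ.nat 126 v
    · refine Runs.of_run 38 rfl (by decide) le_rfl ⟨by simp [Cmd.run, block, h₁, e₁, e₂, e₃, hc.1, hc.2],
        fun x hx => ?_⟩
      by_cases hxj : x = j
      · subst hxj; simp [Cmd.run, block, h₁, e₁, e₂, e₃, hc.1, hc.2, trunc]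
      · simpa [Cmd.run, block, h₁, e₁, e₂, e₃, hc.1, hc.2, hxj] using h₂ x (by omega)
    · have hc' : ¬ (¬ σ.nat 127 j = 0 ∧ σ.nat 126 j < σ.nat 126 v) := hc
      refine Runs.of_run 38 rfl (by decide) le_rfl ⟨by simp [Cmd.run, block, h₁, e₁, e₂, e₃, hc'],
        fun x hx => ?_⟩
      by_cases hxj : x = j
      · subst hxj; simp [Cmd.run, block, h₁, e₁, e₂, e₃, hc', trunc]
      · simpa [Cmd.run, block, h₁, e₁, e₂, e₃, hc', hxj] using h₂ x (by omega)
  · rintro τ hτ ⟨-, h₂⟩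
    simp only [BExp.cost, NExp.cost, var]
    exact Runs.skip (by omega) ⟨h₂, by omega⟩

theorem runs_residual {G : Network} {u : Fin G.N} {π : List (Fin G.M)} {h : Fin G.N → ℕ}
    (hg : GraphAt G.src G.dst G.w u σ) (hl : LinksAt G σ) (hm : MarkAt π.toFinset σ)
    (hh : ∀ x : Fin G.N, σ.nat 117 x = h x) (hk : 70 * (G.M + 1) + R ≤ k) :
    Runs residual σ k (fun τ k' =>
      GraphAt (resSrc G.src G.dst π) (resDst G.src G.dst π) (resW G.src G.dst G.w π h) u τ ∧
        R ≤ k') := by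
  refine Runs.seq (Runs.of_run 3 rfl (by decide) (by omega) ?_)
  set σ₁ := (assign 140 (.const 0)).run σ with hσ₁
  have hs₁ : SameBut [140] σ σ₁ := (SameBut.refl _ σ).run rfl (by decide)
  refine Runs.seq (Runs.count G.M 54 (fun j τ => τ.nat 140 0 = j ∧
    (∀ e : Fin G.M, (e : ℕ) < j → τ.nat 112 e = resSrc G.src G.dst π e ∧
      τ.nat 113 e = resDst G.src G.dst π e ∧ τ.nat 114 e = resW G.src G.dst G.w π h e) ∧
    (∀ e : Fin G.M, j ≤ (e : ℕ) → τ.nat 112 e = G.src e ∧ τ.nat 113 e = G.dst e ∧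
      τ.nat 114 e = G.w e))
    ⟨by simp [hσ₁, Cmd.run], by simp, fun e _ => ?_⟩
    (by simp only [BExp.cost, NExp.cost, var]; omega) ?_ ?_ ?_)
  · rw [hs₁ 112 (by decide), hs₁ 113 (by decide), hs₁ 114 (by decide)]
    exact ⟨hg.src_eq e, hg.dst_eq e, hg.w_eq e⟩
  · rintro j τ hj hτ ⟨h₁, -⟩
    simp [h₁, hτ.1 111 (by decide), hs₁ 111 (by decide), hg.M_eq]
  · rintro j τ hj hτ ⟨h₁, h₂, h₃⟩
    have hs : SameBut [112, 113, 114, 140] σ τ :=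
      (hs₁.mono (by decide)).trans (hτ.sameBut (by decide))
    obtain ⟨g₁, g₂, g₃⟩ := h₃ ⟨j, hj⟩ le_rfl
    have e₁ := hm ⟨j, hj⟩
    have e₂ := hh (G.src ⟨j, hj⟩)
    have e₃ := hh (G.dst ⟨j, hj⟩)
    have e₄ := hl.src_eq ⟨j, hj⟩
    have e₅ := hl.dst_eq ⟨j, hj⟩
    rw [← hs 116 (by decide)] at e₁
    rw [← hs 117 (by decide)] at e₂ e₃
    rw [← hs 2 (by decide)] at e₄
    rw [← hs 3 (by decide)] at e₅
    simp only [List.mem_toFinset] at g₁ g₂ g₃ e₁ e₄ e₅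
    by_cases hc : (⟨j, hj⟩ : Fin G.M) ∈ π
    · rw [if_pos hc] at e₁
      refine Runs.of_run 54 rfl (by decide) le_rfl ⟨by simp [Cmd.run, resStep, block, h₁, e₁],
        fun e he => ?_, fun e he => ?_⟩
      · by_cases hej : e = ⟨j, hj⟩
        · subst hej
          simp [Cmd.run, resStep, block, h₁, e₁, e₄, e₅, resSrc, resDst, resW, hc]
        · have hej' : (e : ℕ) ≠ j := fun h => hej (Fin.ext h)
          simpa [Cmd.run, resStep, block, h₁, e₁, hej'] using h₂ e (by omega)
      · have hej' : (e : ℕ) ≠ j := by omega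
        simpa [Cmd.run, resStep, block, h₁, e₁, hej'] using h₃ e (by omega)
    · rw [if_neg hc] at e₁
      refine Runs.of_run 54 rfl (by decide) le_rfl ⟨by simp [Cmd.run, resStep, block, h₁, e₁],
        fun e he => ?_, fun e he => ?_⟩
      · by_cases hej : e = ⟨j, hj⟩
        · subst hej
          simp [Cmd.run, resStep, block, h₁, e₁, g₁, g₂, g₃, e₂, e₃, resSrc, resDst, resW, hc]
        · have hej' : (e : ℕ) ≠ j := fun h => hej (Fin.ext h)
          simpa [Cmd.run, resStep, block, h₁, e₁, hej'] using h₂ e (by omega)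
      · have hej' : (e : ℕ) ≠ j := by omega
        simpa [Cmd.run, resStep, block, h₁, e₁, hej'] using h₃ e (by omega)
  · rintro τ hτ ⟨-, h₂, -⟩
    simp only [BExp.cost, NExp.cost, var]
    refine Runs.skip (by omega) ⟨⟨?_, ?_, ?_, fun e => (h₂ e e.2).1, fun e => (h₂ e e.2).2.1,
      fun e => (h₂ e e.2).2.2⟩, by omega⟩
    · rw [hτ.1 110 (by decide), hs₁ 110 (by decide)]; exact hg.N_eq
    · rw [hτ.1 111 (by decide), hs₁ 111 (by decide)]; exact hg.M_eq
    · rw [hτ.1 115 (by decide), hs₁ 115 (by decide)]; exact hg.s_eq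

/-- By `hE` the set `E` is a flow of value `1 + m` from `u` to `v`. The unused links `E'` form a
flow of value `m` plus one unit from the current node `x` to `v`, so the walk can get stuck only at
`v`; as `E'` shrinks, it arrives there. Nodes may repeat on the walk. -/
theorem runs_greedy {len arr : ℕ} {E : Finset (Fin M)} {m : ℤ} (hg : GraphAt src dst w u σ)
    (h12 : σ.nat 12 0 = v) (hA : ∃ A, AdjAt src (· ∈ E) σ A) (hm : 0 ≤ m)
    (hE : ∀ φ : Fin N → ℤ, ∑ e ∈ E, (φ (src e) - φ (dst e)) = (φ u - φ v) + m * (φ u - φ v))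
    (hl : len < 100) (hr : arr < 100) (hla : len ≠ arr) (hl12 : len ≠ 12) (hr12 : arr ≠ 12)
    (hk : 60 * E.card + 50 + R ≤ k) :
    Runs (greedy len arr) σ k (fun τ k' => ∃ (Q : List (Fin M)) (E' : Finset (Fin M)),
      IsWalk src dst u v Q ∧ Q.Nodup ∧ (∀ e ∈ Q, e ∈ E ∧ e ∉ E') ∧ E' ⊆ E ∧ PathAt τ len arr Q ∧
      (∃ A, AdjAt src (· ∈ E') τ A) ∧
      (∀ φ : Fin N → ℤ, ∑ e ∈ E', (φ (src e) - φ (dst e)) = m * (φ u - φ v)) ∧ R ≤ k') := by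
  refine Runs.seq (Runs.of_run 4 rfl (by decide) (by omega) ?_)
  refine Runs.seq (Runs.of_run 3 rfl (by simp [Cmd.bound, NExp.cost]) (by omega) ?_)
  set σ₁ := (assign len (.const 0)).run ((assign 141 (var 115)).run σ) with hσ₁
  have hs₁ : SameBut [141, len] σ σ₁ :=
    ((SameBut.refl _ σ).run rfl (by simp [Cmd.writes])).run rfl (by simp [Cmd.writes])
  obtain ⟨A, hA⟩ := hA
  have hw : (greedyStep len arr).writes ⊆ [129, 140, 141, len, arr] := by
    intro b hb
    simp [greedyStep, block, Cmd.writes] at hb ⊢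
    tauto
  have hl141 : (141 : ℕ) ≠ len := by omega
  refine Runs.seq (Runs.loop (fun τ k' => ∃ (x : Fin N) (Q : List (Fin M)) (E' : Finset (Fin M)),
    τ.nat 141 0 = x ∧ IsWalk src dst u x Q ∧ Q.Nodup ∧ (∀ e ∈ Q, e ∈ E ∧ e ∉ E') ∧ E' ⊆ E ∧
    PathAt τ len arr Q ∧ (∃ A, AdjAt src (· ∈ E') τ A) ∧
    (∀ φ : Fin N → ℤ, ∑ e ∈ E', (φ (src e) - φ (dst e)) = (φ x - φ v) + m * (φ u - φ v)) ∧
    60 * E'.card + 20 + R ≤ k')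
    ⟨u, [], E, by simp [hσ₁, Cmd.run, hg.s_eq, hl141], rfl, by simp, by simp, subset_rfl,
      ⟨by simp [hσ₁, Cmd.run], by simp⟩, ⟨A, hA.congr hs₁ (by simp; omega)⟩, hE, by omega⟩ ?_ ?_)
  · rintro τ k' hτ ⟨x, Q, E', h₁, h₂, h₃, h₄, h₅, h₆, ⟨A', h₇⟩, h₈, h₉⟩ hb
    have hs : SameBut [129, 140, 141, len, arr] σ τ :=
      (hs₁.mono (by simp)).trans (hτ.sameBut hw)
    have e12 : τ.nat 12 0 = v := by rw [hs 12 (by simp; omega), h12]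
    have hxv : x ≠ v := by
      rintro rfl; exact hb (by simp [h₁, e12])
    obtain ⟨l₁, l₂, l₃⟩ := h₇ x
    obtain ⟨e, l, hel⟩ : ∃ e l, A' x = e :: l := by
      cases hl : A' x with
      | cons e l => exact ⟨e, l, rfl⟩
      | nil =>
        exfalso
        rw [hl] at l₃
        -- Tested at `x` alone, conservation gives a net outflow of at least 1 because `m ≥ 0`;
        -- without unused links leaving `x` it would be at most 0.
        have h₁₀ := h₈ (fun y => if y = x then 1 else 0)
        have h₁₁ : ∑ e ∈ E', ((if src e = x then (1 : ℤ) else 0) - if dst e = x then 1 else 0) ≤ 0 := by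
          refine Finset.sum_nonpos fun e he => ?_
          have : src e ≠ x := fun h => by simpa using (l₃ e).2 ⟨h, he⟩
          rw [if_neg this]
          split_ifs <;> simp
        rw [h₁₀, if_pos rfl, if_neg hxv.symm] at h₁₁
        by_cases hux : u = x
        · rw [if_pos hux] at h₁₁; linarith
        · rw [if_neg hux] at h₁₁; linarith
    rw [hel] at l₁ l₂ l₃
    obtain ⟨hse, heE⟩ := (l₃ e).1 (by simp)
    have hcard := Finset.card_erase_add_one heE
    have f₁ : τ.nat 129 x = e + 1 := l₁.1
    have f₂ : τ.nat 113 e = dst e := by rw [hs 113 (by simp; omega), hg.dst_eq]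
    have n₁ : len ≠ 129 := by omega
    have n₂ : len ≠ 140 := by omega
    have n₃ : arr ≠ 129 := by omega
    have n₄ : arr ≠ 140 := by omega
    have n₅ : arr ≠ 113 := by omega
    have n₆ : len ≠ 113 := by omega
    have n₇ : len ≠ 141 := by omega
    have n₈ : arr ≠ 141 := by omega
    have n₉ : len ≠ 130 := by omega
    have n₀ : arr ≠ 130 := by omega
    have hrun : (greedyStep len arr).run τ = (((((τ.setNat 140 0 e).setNat 129 x
        (τ.nat 130 e)).setNat arr Q.length e).setNat len 0 (Q.length + 1)).setNat 141 0 (dst e)) := by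
      simp [greedyStep, block, Cmd.run, h₁, f₁, f₂, h₆.1, n₁, n₂, n₃, n₄, n₅, n₆, n₇, n₈, hla,
        n₁.symm, n₂.symm, n₃.symm, n₄.symm, n₅.symm, n₆.symm, n₇.symm, n₈.symm]
    have heQ : e ∉ Q := fun h => (h₄ e h).2 heE
    refine ⟨k' - 7, by simp only [BExp.cost, NExp.cost, var]; omega, ?_⟩
    refine Runs.of_run 40 rfl (by simp [Cmd.bound, greedyStep, block, NExp.cost]) (by omega)
      ⟨dst e, Q ++ [e], E'.erase e, ?_, isWalk_concat.2 ⟨hse ▸ h₂, rfl⟩, ?_, ?_,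
        (Finset.erase_subset _ _).trans h₅, ?_, ?_, ?_, by omega⟩
    · rw [hrun]; simp
    · exact List.nodup_append'.2 ⟨h₃, by simp, by simpa using heQ⟩
    · intro e' he'
      rcases List.mem_append.1 he' with he' | he'
      · exact ⟨(h₄ e' he').1, fun h => (h₄ e' he').2 (Finset.mem_of_mem_erase h)⟩
      · obtain rfl : e' = e := by simpa using he'
        exact ⟨h₅ heE, by simp⟩
    · rw [hrun]
      refine ⟨by simp [n₇], fun i hi => ?_⟩
      simp only [List.length_append, List.length_singleton] at hi
      by_cases hiQ : i = Q.length
      · subst hiQ; simp [n₈, hla.symm]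
      · have hi' : i < Q.length := by omega
        rw [List.getElem_append_left hi']
        simpa [n₈, hla.symm, hiQ, n₃, n₄] using h₆.2 i hi'
    · refine ⟨Function.update A' x l, fun y => ?_⟩
      rw [hrun]
      by_cases hyx : y = x
      · subst hyx
        refine ⟨by simpa [n₁.symm, n₃.symm, n₉.symm, n₀.symm] using l₁.2,
          by simpa using (List.nodup_cons.1 l₂).2, fun e' => ?_⟩
        rw [Function.update_self]
        beta_reduce
        rw [Finset.mem_erase]
        have := l₃ e'
        simp only [List.mem_cons] at this
        constructor
        · intro he'
          obtain ⟨g₁, g₂⟩ := this.1 (Or.inr he')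
          exact ⟨g₁, fun h => (List.nodup_cons.1 l₂).1 (h ▸ he'), g₂⟩
        · rintro ⟨g₁, g₂, g₃⟩
          exact (this.2 ⟨g₁, g₃⟩).resolve_left g₂
      · have hyx' : (y : ℕ) ≠ x := fun h => hyx (Fin.ext h)
        obtain ⟨m₁, m₂, m₃⟩ := h₇ y
        rw [Function.update_of_ne hyx]
        refine ⟨by simpa [n₁.symm, n₃.symm, n₉.symm, n₀.symm, hyx'] using m₁, m₂, fun e' => ?_⟩
        rw [m₃]
        beta_reduce
        rw [Finset.mem_erase]
        refine ⟨fun ⟨g₁, g₂⟩ => ⟨g₁, fun h => hyx ?_, g₂⟩, fun ⟨g₁, _, g₂⟩ => ⟨g₁, g₂⟩⟩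
        rw [← g₁, h, hse]
    · intro φ
      have := Finset.add_sum_erase E' (fun e => φ (src e) - φ (dst e)) heE
      rw [h₈ φ] at this
      simp only [hse] at this
      linarith
  · rintro τ k' hτ ⟨x, Q, E', h₁, h₂, h₃, h₄, h₅, h₆, h₇, h₈, h₉⟩ hb
    have hs : SameBut [129, 140, 141, len, arr] σ τ :=
      (hs₁.mono (by simp)).trans (hτ.sameBut hw)
    have e12 : τ.nat 12 0 = v := by rw [hs 12 (by simp; omega), h12]
    obtain rfl : x = v := by
      have : τ.nat 141 0 = τ.nat 12 0 := by simpa using hb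
      rw [h₁, e12] at this
      exact Fin.ext this
    refine ⟨k' - 7, by simp only [BExp.cost, NExp.cost, var]; omega, Runs.skip (by omega)
      ⟨Q, E', h₂, h₃, h₄, h₅, h₆, h₇, fun φ => ?_, by omega⟩⟩
    rw [h₈ φ]; ring

end

end CTQAMSC

namespace CTQAMSC

/-! ### The EDSP subroutine -/

/-- Decompose the marked links into two paths. -/
def edPaths : Cmd :=
  block [
    walkBack 12 (.setNat 116 (var 140) (.minus (.const 1) (.get 116 (var 140)))),
    loadGraph 11,
    buildAdj (.natEq (.get 116 (var 140)) (.const 1)),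
    greedy 14 15,
    greedy 16 17,
    assign 13 (.const 1)]

/-- The search in the residual graph. -/
def edResidual : Cmd :=
  block [
    clearMarks,
    walkBack 12 (.setNat 116 (var 140) (.const 1)),
    truncDist,
    residual,
    dij,
    .ite (.natEq (.get 127 (var 12)) (.const 0)) (assign 13 (.const 0)) edPaths]

/-- The EDSP subroutine. -/
def edMain : Cmd :=
  block [
    loadGraph 11,
    dij,
    .ite (.natEq (.get 127 (var 12)) (.const 0)) (assign 13 (.const 0)) edResidual]

/-- A bound on the running time of the EDSP subroutine. -/
def edCost (N M : ℕ) : ℕ := 2 * dijCost N M + 1000 * (N + M + 1)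

section

variable {G : Network} {u v : Fin G.N} {σ : State} {k R : ℕ} {lab dist par : ℕ → ℕ}
  {P P₂ : Fin G.N → List (Fin G.M)}

/-- The first greedy walk takes one of the two units of flow (`m = 1`) and the second the other (`m
= 0`). Links that might remain need no attention: minimality uses only that both walks lie in `E`,
whose weight equals the dual bound. -/
theorem runs_edPaths (hl : LinksAt G σ) (h11 : σ.nat 11 0 = u) (h12 : σ.nat 12 0 = v)
    (hP : DijResult G.src G.dst G.w u lab dist par P) (hv : lab v ≠ 0)
    (hm : MarkAt (P v).toFinset σ)
    (hg : GraphAt (resSrc G.src G.dst (P v)) (resDst G.src G.dst (P v))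
      (resW G.src G.dst G.w (P v) fun x => trunc lab dist (dist v) x) u σ)
    (hP₂ : DijResult (resSrc G.src G.dst (P v)) (resDst G.src G.dst (P v))
      (resW G.src G.dst G.w (P v) fun x => trunc lab dist (dist v) x) u
      (σ.nat 127) (σ.nat 126) (σ.nat 128) P₂)
    (hv₂ : σ.nat 127 v ≠ 0) (hk : 500 * (G.N + G.M + 1) + R ≤ k) :
    Runs edPaths σ k (fun τ k' => τ.nat 13 0 = 1 ∧ (∃ π₁ π₂, G.IsShortestDisjointPair u v π₁ π₂ ∧
      PathAt τ 14 15 π₁ ∧ PathAt τ 16 17 π₂) ∧ R ≤ k') := by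
  refine Runs.seq (((runs_togglePath (R := k - 40 * (G.N + 1)) hg hP₂ hv₂ h12 hm
    (by omega)).frame).mono le_rfl ?_)
  rintro σ₁ k₁ ⟨⟨hm₁, hk₁⟩, ha₁⟩
  have hs₁ : SameBut [116, 140, 141] σ σ₁ := ha₁.sameBut (by decide)
  refine Runs.seq (((runs_loadGraph (a := 11) (R := k₁ - 50 * (G.M + 1)) (hl.congr hs₁ (by decide))
    (by rw [hs₁ 11 (by decide)]; exact h11) (by omega) (by omega)).frame).mono le_rfl ?_)
  rintro σ₂ k₂ ⟨⟨hg₂, hk₂⟩, ha₂⟩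
  have hs₂ : SameBut [110, 111, 112, 113, 114, 115, 140] σ₁ σ₂ := ha₂.sameBut (by decide)
  have hm₂ := hm₁.congr hs₂ (by decide)
  set E := pairLinks (P v) (P₂ v) with hE
  refine Runs.seq (((runs_buildAdj (p := (· ∈ E)) (R := k₂ - 60 * (G.N + G.M + 1)) hg₂
    (fun τ e h₁ h₂ => ?_) (by simp [BExp.cost, NExp.cost]) (by omega)).frame).mono le_rfl ?_)
  · have := hm₂.congr h₁ (by decide) e
    simp [h₂, this]
  rintro σ₃ k₃ ⟨⟨hA, hk₃⟩, ha₃⟩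
  have hs₃ : SameBut [129, 130, 135, 140] σ₂ σ₃ := ha₃.sameBut (by decide)
  have hg₃ := hg₂.congr hs₃ (by decide)
  have h12' : σ₃.nat 12 0 = v := by
    rw [hs₃ 12 (by decide), hs₂ 12 (by decide), hs₁ 12 (by decide)]; exact h12
  have hcard : E.card ≤ G.M := by simpa using Finset.card_le_univ E
  refine Runs.seq (((runs_greedy (len := 14) (arr := 15) (m := 1) (R := k₃ - (60 * G.M + 50)) hg₃
    h12' hA zero_le_one (fun φ => by rw [hE, sum_pairLinks hP hv hP₂ hv₂, one_mul]) (by omega)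
    (by omega) (by omega) (by omega) (by omega) (by omega)).frame).mono le_rfl ?_)
  rintro σ₄ k₄ ⟨⟨Q₁, E₁, a₁, a₂, a₃, a₄, a₅, a₆, a₇, hk₄⟩, ha₄⟩
  have hs₄ : SameBut [14, 15, 129, 140, 141] σ₃ σ₄ := ha₄.sameBut (by decide)
  have hcard₁ := Finset.card_le_card a₄
  refine Runs.seq (((runs_greedy (len := 16) (arr := 17) (m := 0) (R := k₄ - (60 * G.M + 50))
    (hg₃.congr hs₄ (by decide)) (by rw [hs₄ 12 (by decide)]; exact h12') a₆ le_rfl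
    (fun φ => by rw [a₇ φ]; ring) (by omega)
    (by omega) (by omega) (by omega) (by omega) (by omega)).frame).mono le_rfl ?_)
  rintro σ₅ k₅ ⟨⟨Q₂, E₂, b₁, b₂, b₃, b₄, b₅, -, -, hk₅⟩, ha₅⟩
  have hs₅ : SameBut [16, 17, 129, 140, 141] σ₄ σ₅ := ha₅.sameBut (by decide)
  refine Runs.seq (Runs.of_run 3 rfl (by decide) (by omega) (Runs.skip (by omega)
    ⟨by simp [Cmd.run], ⟨Q₁, Q₂, ?_, ?_, ?_⟩, by omega⟩))
  · refine isShortestDisjointPair_of_walks (E := E) a₁ b₁ (List.nodup_append'.2 ⟨a₂, b₂,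
      fun e h₁ h₂ => (a₃ e h₁).2 (b₃ e h₂).1⟩) (fun e he => ?_)
      (sum_weight_pairLinks hP hv hP₂ hv₂).le fun Q₁ Q₂ => two_mul_dist_add_le hP hv hP₂
    rcases List.mem_append.1 he with he | he
    · exact (a₃ e he).1
    · exact a₄ (b₃ e he).1
  · have e₁ := hs₅ 14 (by decide)
    have e₂ := hs₅ 15 (by decide)
    simpa [PathAt, Cmd.run, e₁, e₂] using a₅
  · simpa [PathAt, Cmd.run] using b₅

set_option maxRecDepth 20000 in
theorem runs_edResidual (hl : LinksAt G σ) (h11 : σ.nat 11 0 = u) (h12 : σ.nat 12 0 = v)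
    (hg : GraphAt G.src G.dst G.w u σ)
    (hP : DijResult G.src G.dst G.w u (σ.nat 127) (σ.nat 126) (σ.nat 128) P)
    (hv : σ.nat 127 v ≠ 0) (hk : dijCost G.N G.M + 800 * (G.N + G.M + 1) + R ≤ k) :
    Runs edResidual σ k (fun τ k' => ((τ.nat 13 0 = 1 ∧
      ∃ π₁ π₂, G.IsShortestDisjointPair u v π₁ π₂ ∧ PathAt τ 14 15 π₁ ∧ PathAt τ 16 17 π₂) ∨
      (τ.nat 13 0 = 0 ∧ ¬ ∃ π₁ π₂, G.IsDisjointPair u v π₁ π₂)) ∧ R ≤ k') := by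
  refine Runs.seq (((runs_clearMarks (R := k - 30 * (G.M + 1)) hg (by omega)).frame).mono le_rfl ?_)
  rintro σ₁ k₁ ⟨⟨hm₁, hk₁⟩, ha₁⟩
  have hs₁ : SameBut [116, 140] σ σ₁ := ha₁.sameBut (by decide)
  refine Runs.seq (((runs_markPath (R := k₁ - 30 * (G.N + 1)) (hg.congr hs₁ (by decide))
    (by rw [hs₁ 126 (by decide), hs₁ 127 (by decide), hs₁ 128 (by decide)]; exact hP)
    (by rw [hs₁ 127 (by decide)]; exact hv) (by rw [hs₁ 12 (by decide)]; exact h12) hm₁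
    (by omega)).frame).mono le_rfl ?_)
  rintro σ₂ k₂ ⟨⟨hm₂, hk₂⟩, ha₂⟩
  have hs₂ : SameBut [116, 140, 141] σ σ₂ :=
    (hs₁.mono (by decide)).trans (ha₂.sameBut (by decide))
  refine Runs.seq (((runs_truncDist (v := v) (R := k₂ - 50 * (G.N + 1)) (hg.congr hs₂ (by decide))
    (by rw [hs₂ 12 (by decide)]; exact h12) (by omega)).frame).mono le_rfl ?_)
  rintro σ₃ k₃ ⟨⟨ht, hk₃⟩, ha₃⟩
  have hs₃' : SameBut [117, 118, 135] σ₂ σ₃ := ha₃.sameBut (by decide)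
  have hs₃ : SameBut [116, 117, 118, 135, 140, 141] σ σ₃ :=
    (hs₂.mono (by decide)).trans (hs₃'.mono (by decide))
  rw [hs₂ 126 (by decide), hs₂ 127 (by decide)] at ht
  have hm₃ := hm₂.congr hs₃' (by decide)
  refine Runs.seq (((runs_residual (R := k₃ - 70 * (G.M + 1)) (hg.congr hs₃ (by decide))
    (hl.congr hs₃ (by decide)) hm₃ (fun x => ht x x.2) (by omega)).frame).mono le_rfl ?_)
  rintro σ₄ k₄ ⟨⟨hg₄, hk₄⟩, ha₄⟩
  have hs₄ : SameBut [112, 113, 114, 140] σ₃ σ₄ := ha₄.sameBut (by decide)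
  refine Runs.seq (((runs_dij (R := k₄ - dijCost G.N G.M) hg₄ (by omega)).frame).mono le_rfl ?_)
  rintro σ₅ k₅ ⟨⟨⟨P₂, hP₂⟩, hk₅⟩, ha₅⟩
  have hs₅ : SameBut dij.writes σ₄ σ₅ := ha₅.sameBut (List.Subset.refl _)
  have hs₆ : SameBut ([112, 113, 114, 116, 117, 118, 135, 140, 141] ++ dij.writes) σ σ₅ :=
    ((hs₃.mono (by simp)).trans (hs₄.mono (by simp))).trans
      (hs₅.mono (List.subset_append_right _ _))
  have h12' : σ₅.nat 12 0 = v := by rw [hs₆ 12 (by decide)]; exact h12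
  refine Runs.seq (Runs.ite (by simp only [BExp.cost, NExp.cost, var]; omega) (fun hb => ?_)
    (fun hb => ?_))
  · have hb : σ₅.nat 127 v = 0 := by simpa [h12'] using hb
    simp only [BExp.cost, NExp.cost, var]
    refine Runs.of_run 3 rfl (by decide) (by omega) (Runs.skip (by omega)
      ⟨Or.inr ⟨by simp [Cmd.run], ?_⟩, by omega⟩)
    rintro ⟨π₁, π₂, h₁, h₂, h₃⟩
    exact not_disjoint_of_residual (hP.path v hv).1 hP₂ hb h₁.1 h₂.1
      (List.nodup_append'.2 ⟨h₁.nodup, h₂.nodup, h₃⟩)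
  · have hb : σ₅.nat 127 v ≠ 0 := by simpa [h12'] using hb
    simp only [BExp.cost, NExp.cost, var]
    refine (runs_edPaths (R := R + 1) (hl.congr hs₆ (by decide))
      (by rw [hs₆ 11 (by decide)]; exact h11) h12' hP hv
      ((hm₃.congr hs₄ (by decide)).congr hs₅ (by decide)) (hg₄.congr hs₅ (by decide)) hP₂ hb
      (by omega)).mono le_rfl ?_
    rintro τ k' ⟨h₁, h₂, h₃⟩
    exact Runs.skip (by omega) ⟨Or.inl ⟨h₁, h₂⟩, by omega⟩

end

set_option maxRecDepth 20000 in
theorem isEDSPAlgorithm_edMain : IsEDSPAlgorithm edMain (fun N M => (edCost N M : ℝ)) := by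
  intro G s t u v σ huv hσ hu hv
  have hl := hσ.linksAt
  have h11 : σ.nat 11 0 = u := hu
  have h12 : σ.nat 12 0 = v := hv
  have hN : 0 < G.N := Fin.pos s
  have key : Runs edMain σ (edCost G.N G.M) (fun τ k' => ((τ.nat 13 0 = 1 ∧
      ∃ π₁ π₂, G.IsShortestDisjointPair u v π₁ π₂ ∧ PathAt τ 14 15 π₁ ∧ PathAt τ 16 17 π₂) ∨
      (τ.nat 13 0 = 0 ∧ ¬ ∃ π₁ π₂, G.IsDisjointPair u v π₁ π₂)) ∧ 2 * G.N ≤ k') := by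
    simp only [edCost]
    refine Runs.seq (((runs_loadGraph (R := 2 * dijCost G.N G.M + 900 * (G.N + G.M + 1)) hl h11
      (by omega) (by omega)).frame).mono le_rfl ?_)
    rintro σ₁ k₁ ⟨⟨hg, hk₁⟩, ha₁⟩
    refine Runs.seq (((runs_dij (R := dijCost G.N G.M + 900 * (G.N + G.M + 1)) hg
      (by omega)).frame).mono le_rfl ?_)
    rintro σ₂ k₂ ⟨⟨⟨P, hP⟩, hk₂⟩, ha₂⟩
    have hs₂ : SameBut ((loadGraph 11).writes ++ dij.writes) σ σ₂ :=
      (ha₁.sameBut (List.subset_append_left _ _)).trans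
        (ha₂.sameBut (List.subset_append_right _ _))
    have h12' : σ₂.nat 12 0 = v := by rw [hs₂ 12 (by decide)]; exact h12
    have hg₂ : GraphAt G.src G.dst G.w u σ₂ :=
      hg.congr (l := dij.writes) (ha₂.sameBut (List.Subset.refl _)) (by decide)
    refine Runs.seq (Runs.ite (by simp only [BExp.cost, NExp.cost, var]; omega) (fun hb => ?_)
      (fun hb => ?_))
    · have hb : σ₂.nat 127 v = 0 := by simpa [h12'] using hb
      simp only [BExp.cost, NExp.cost, var]
      refine Runs.of_run 3 rfl (by decide) (by omega) (Runs.skip (by omega)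
        ⟨Or.inr ⟨by simp [Cmd.run], ?_⟩, by omega⟩)
      rintro ⟨π, -, h₁, -⟩
      exact (hP.le_sum hP.lab_s h₁.1).1 hb
    · have hb : σ₂.nat 127 v ≠ 0 := by simpa [h12'] using hb
      simp only [BExp.cost, NExp.cost, var]
      refine (runs_edResidual (R := 2 * G.N + 1) (hl.congr hs₂ (by decide))
        (by rw [hs₂ 11 (by decide)]; exact h11) h12' hg₂ hP hb (by omega)).mono le_rfl ?_
      rintro τ k' ⟨h₁, h₂⟩
      exact Runs.skip (by omega) ⟨h₁, by omega⟩
  obtain ⟨τ, n, k', h₁, h₂, h₃, h₄⟩ := key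
  refine ⟨τ, n, h₁, h₁.agree.preserves _ (by decide) (by decide), ?_⟩
  rcases h₃ with ⟨h₃, π₁, π₂, h₅, h₆, h₇⟩ | ⟨h₃, h₅⟩
  · refine Or.inl ⟨h₃, π₁, π₂, h₅, h₆, h₇, ?_⟩
    have l₁ := h₅.1.1.length_lt
    have l₂ := h₅.1.2.1.length_lt
    show (n + π₁.length + π₂.length : ℝ) ≤ (edCost G.N G.M : ℝ)
    exact_mod_cast (by omega : n + π₁.length + π₂.length ≤ edCost G.N G.M)
  · refine Or.inr ⟨h₃, h₅, ?_⟩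
    show (n : ℝ) ≤ (edCost G.N G.M : ℝ)
    exact_mod_cast (by omega : n ≤ edCost G.N G.M)

end CTQAMSC

namespace CTQAMSC

/-! ### The running times of the subroutines -/

/-- Distinct end nodes force `N ≥ 2`, so the comparison is needed there only; `N log N` then
dominates the terms linear in `N`. -/
theorem IsSPAlgorithm.mono {c : Cmd} {SP SP' : ℕ → ℕ → ℝ} (h : IsSPAlgorithm c SP)
    (hle : ∀ N M, 2 ≤ N → SP N M ≤ SP' N M) : IsSPAlgorithm c SP' := by
  intro G s t σ hst hσ
  have hN : 2 ≤ G.N := by have := s.2; have := t.2; have := Fin.val_ne_of_ne hst; omega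
  obtain ⟨τ, n, h₁, h₂, h₃⟩ := h G s t σ hst hσ
  refine ⟨τ, n, h₁, h₂, h₃.imp ?_ ?_⟩
  · rintro ⟨h₄, π, h₅, h₆, h₇⟩; exact ⟨h₄, π, h₅, h₆, h₇.trans (hle _ _ hN)⟩
  · rintro ⟨h₄, h₅, h₆⟩; exact ⟨h₄, h₅, h₆.trans (hle _ _ hN)⟩

theorem IsEDSPAlgorithm.mono {c : Cmd} {D D' : ℕ → ℕ → ℝ} (h : IsEDSPAlgorithm c D)
    (hle : ∀ N M, 2 ≤ N → D N M ≤ D' N M) : IsEDSPAlgorithm c D' := by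
  intro G s t u v σ huv hσ hu hv
  have hN : 2 ≤ G.N := by have := u.2; have := v.2; have := Fin.val_ne_of_ne huv; omega
  obtain ⟨τ, n, h₁, h₂, h₃⟩ := h G s t u v σ huv hσ hu hv
  refine ⟨τ, n, h₁, h₂, h₃.imp ?_ ?_⟩
  · rintro ⟨h₄, π₁, π₂, h₅, h₆, h₇, h₈⟩
    exact ⟨h₄, π₁, π₂, h₅, h₆, h₇, h₈.trans (hle _ _ hN)⟩
  · rintro ⟨h₄, h₅, h₆⟩; exact ⟨h₄, h₅, h₆.trans (hle _ _ hN)⟩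

theorem IsRSPAlgorithm.mono {c : Cmd} {R R' : ℕ → ℕ → ℕ → ℝ} (h : IsRSPAlgorithm c R)
    (hle : ∀ N M T, R N M T ≤ R' N M T) : IsRSPAlgorithm c R' := by
  intro I N M σ hN hM hσ
  obtain ⟨τ, n, h₁, h₂, h₃⟩ := h I N M σ hN hM hσ
  refine ⟨τ, n, h₁, h₂, h₃.imp ?_ ?_⟩
  · rintro ⟨h₄, π, h₅, h₆, h₇⟩; exact ⟨h₄, π, h₅, h₆, h₇.trans (hle _ _ _)⟩
  · rintro ⟨h₄, h₅, h₆⟩; exact ⟨h₄, h₅, h₆.trans (hle _ _ _)⟩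

theorem size_mul_log_two_le (m : ℕ) :
    (Nat.size (m + 1) : ℝ) * Real.log 2 ≤ Real.log 2 + Real.log (m + 1) := by
  have hpos : 0 < Nat.size (m + 1) := Nat.size_pos.2 (Nat.succ_pos m)
  obtain ⟨j, hj⟩ := Nat.exists_eq_succ_of_ne_zero hpos.ne'
  have h₁ : 2 ^ j ≤ m + 1 := Nat.lt_size.1 (by omega)
  have h₂ : ((2 : ℝ) ^ j) ≤ (m : ℝ) + 1 := by exact_mod_cast h₁
  have h₃ := Real.log_le_log (by positivity) h₂
  rw [Real.log_pow] at h₃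
  rw [hj]
  push_cast
  linarith

theorem half_le_log_two : (1 : ℝ) / 2 ≤ Real.log 2 := by
  have := Real.log_two_gt_d9
  linarith

/-- The heap produces `N log M`, and parallel links leave `M` unbounded in terms of `N`. Applying
`log x ≤ x - 1` to `x = (M + 1) / N` gives `N log (M + 1) ≤ N log N + M + 1`, so the excess is
absorbed by `M`. -/
theorem size_bound {N M : ℕ} (hN : 2 ≤ N) :
    ((M + (N + 1) * (Nat.size (M + 1) + 1) : ℕ) : ℝ) ≤ 20 * (M + N * Real.log N) := by
  have hN' : (2 : ℝ) ≤ N := by exact_mod_cast hN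
  have hl2 := half_le_log_two
  have hM : (0 : ℝ) ≤ M := Nat.cast_nonneg M
  have hlogN : 1 / 2 ≤ Real.log N := hl2.trans (Real.log_le_log (by norm_num) hN')
  have hlogM : 0 ≤ Real.log ((M : ℝ) + 1) := Real.log_nonneg (by linarith)
  have hsize : (Nat.size (M + 1) : ℝ) ≤ 1 + 2 * Real.log (M + 1) := by
    have h₁ := size_mul_log_two_le M
    have h₂ : (0 : ℝ) ≤ Nat.size (M + 1) := Nat.cast_nonneg _
    by_contra h'
    push Not at h'
    nlinarith
  have h₁ : (N : ℝ) * Real.log (M + 1) ≤ N * Real.log N + (M + 1) := by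
    have h₂ := Real.log_le_sub_one_of_pos (x := ((M : ℝ) + 1) / N) (by positivity)
    rw [Real.log_div (by positivity) (by positivity)] at h₂
    have h₃ : (N : ℝ) * (((M : ℝ) + 1) / N) = M + 1 := by field_simp
    nlinarith
  have h₂ : (N : ℝ) ≤ 2 * (N * Real.log N) := by nlinarith
  have h₃ : ((N : ℝ) + 1) * (Nat.size (M + 1) + 1) ≤ (2 * N) * (2 + 2 * Real.log (M + 1)) :=
    mul_le_mul (by linarith) (by linarith) (by positivity) (by positivity)
  push_cast
  nlinarith

theorem spCost_le {N M : ℕ} (hN : 2 ≤ N) :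
    (spCost N M : ℝ) ≤ 140000 * (M + N * Real.log N) := by
  have h₁ : spCost N M ≤ 7000 * (M + (N + 1) * (Nat.size (M + 1) + 1)) := by
    have : (N + 1) * 1 ≤ (N + 1) * (Nat.size (M + 1) + 1) := Nat.mul_le_mul_left _ (by omega)
    simp only [spCost, dijCost]
    omega
  have h₂ := size_bound (M := M) hN
  have h₃ : (spCost N M : ℝ) ≤ 7000 * ((M + (N + 1) * (Nat.size (M + 1) + 1) : ℕ) : ℝ) := by
    exact_mod_cast h₁
  linarith

theorem edCost_le {N M : ℕ} (hN : 2 ≤ N) :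
    (edCost N M : ℝ) ≤ 140000 * (M + N * Real.log N) := by
  have h₁ : edCost N M ≤ 7000 * (M + (N + 1) * (Nat.size (M + 1) + 1)) := by
    have : (N + 1) * 1 ≤ (N + 1) * (Nat.size (M + 1) + 1) := Nat.mul_le_mul_left _ (by omega)
    simp only [edCost, dijCost]
    omega
  have h₂ := size_bound (M := M) hN
  have h₃ : (edCost N M : ℝ) ≤ 7000 * ((M + (N + 1) * (Nat.size (M + 1) + 1) : ℕ) : ℝ) := by
    exact_mod_cast h₁
  linarith

/-- The running time with the subroutines above. -/
theorem ctqamsc_standard {G : Network} {s t : Fin G.N} {B : ℕ} {σ : State} (hst : s ≠ t)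
    (hreach : ∃ π, G.IsPath s t π) (hB : 1 ≤ B) (hσ : InputAt G s t B σ) :
    ∃ (π : List (Fin G.M)) (τ : State) (n : ℕ),
      Exec (ctqamsc spMain edMain rspMain) σ τ n ∧ G.IsWeightShortest s t π ∧
      PathAt τ spLen spPath π ∧
      (n : ℝ) ≤ 4200000000 * ((π.length : ℝ) ^ 2 * (G.M + G.N * Real.log G.N) +
        (π.length : ℝ) ^ 3 * B) := by
  obtain ⟨π, τ, n, h₁, h₂, h₃, hk, hn, -⟩ := ctqamsc_bounds
    (isSPAlgorithm_spMain.mono (SP' := fun N M => 140000 * (M + N * Real.log N))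
      fun N M hN => spCost_le hN)
    (isEDSPAlgorithm_edMain.mono (D' := fun N M => 140000 * (M + N * Real.log N))
      fun N M hN => edCost_le hN)
    (isRSPAlgorithm_rspMain.mono (R' := fun N M T => 600 * (M * N * T)) fun N M T => le_rfl)
    hst hreach hB hσ
  refine ⟨π, τ, n, h₁, h₂, h₃, hn.trans ?_⟩
  have hk' : (1 : ℝ) ≤ π.length := by exact_mod_cast hk
  set x : ℝ := (π.length : ℝ) with hx
  have hN : 0 ≤ Real.log (G.N : ℝ) := Real.log_natCast_nonneg _
  set Y : ℝ := G.M + G.N * Real.log G.N with hY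
  have hY0 : 0 ≤ Y := by positivity
  have hB0 : (0 : ℝ) ≤ B := Nat.cast_nonneg B
  -- The single shortest-path call is absorbed by the `k²` EDSP calls, and `(k² + 2k)(k + 1) ≤ 6k³`
  -- bounds the product of links and nodes in the RSP call.
  have e₁ : Y ≤ x ^ 2 * Y := le_mul_of_one_le_left hY0 (one_le_pow₀ hk')
  have hx0 : 0 ≤ x * x := by positivity
  have e₂ : (x ^ 2 + 2 * x) * (x + 1) ≤ 6 * x ^ 3 := by
    nlinarith [mul_le_mul_of_nonneg_left hk' hx0]
  have e₃ := mul_le_mul_of_nonneg_right e₂ hB0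
  have e₄ : 0 ≤ x ^ 3 * B := by positivity
  push_cast
  rw [← hx]
  nlinarith

end CTQAMSC

theorem mainTheorem8 :
    -- time in terms of the running times of arbitrary correct subroutines
    (∃ C : ℝ, 0 < C ∧
      ∀ (sp edsp rsp : Cmd) (SP D : ℕ → ℕ → ℝ) (R : ℕ → ℕ → ℕ → ℝ),
        IsSPAlgorithm sp SP → IsEDSPAlgorithm edsp D → IsRSPAlgorithm rsp R →
        ∀ (G : Network) (s t : Fin G.N) (B : ℕ) (σ : State),
          s ≠ t → (∃ π, G.IsPath s t π) → 1 ≤ B → InputAt G s t B σ →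
          ∃ (π : List (Fin G.M)) (τ : State) (n : ℕ),
            Exec (ctqamsc sp edsp rsp) σ τ n ∧
            G.IsWeightShortest s t π ∧ PathAt τ spLen spPath π ∧
            (n : ℝ) ≤ C * (SP G.N G.M + (π.length : ℝ) ^ 2 * D G.N G.M +
              R (π.length + 1) (π.length ^ 2 + 2 * π.length) B) ∧
            ∀ L : ℝ,
              (∀ a b c : ℕ, 1 ≤ a → 1 ≤ b → 1 ≤ c → R (2 * a) (3 * b) c ≤ L * R a b c) →
              (n : ℝ) ≤ C * (SP G.N G.M + (π.length : ℝ) ^ 2 * D G.N G.M +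
                L * R π.length (π.length ^ 2) B)) ∧
    -- time with the standard subroutines
    (∃ (sp edsp rsp : Cmd) (C : ℝ), 0 < C ∧
      IsSPAlgorithm sp (fun N M => C * (M + N * Real.log N)) ∧
      IsEDSPAlgorithm edsp (fun N M => C * (M + N * Real.log N)) ∧
      IsRSPAlgorithm rsp (fun N M T => C * (M * N * T)) ∧
      ∀ (G : Network) (s t : Fin G.N) (B : ℕ) (σ : State),
        s ≠ t → (∃ π, G.IsPath s t π) → 1 ≤ B → InputAt G s t B σ →
        ∃ (π : List (Fin G.M)) (τ : State) (n : ℕ),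
          Exec (ctqamsc sp edsp rsp) σ τ n ∧
          G.IsWeightShortest s t π ∧ PathAt τ spLen spPath π ∧
          (n : ℝ) ≤ C * ((π.length : ℝ) ^ 2 * (G.M + G.N * Real.log G.N) +
            (π.length : ℝ) ^ 3 * B)) := by
  -- In the second part one constant has to serve the three subroutines and the total time, so the
  -- largest of them is taken for all.
  refine ⟨⟨5000, by norm_num, fun sp edsp rsp SP D R hsp hed hr G s t B σ hst hreach hB hσ => ?_⟩,
    spMain, edMain, rspMain, 4200000000, by norm_num, ?_, ?_, ?_,
    fun G s t B σ hst hreach hB hσ => ctqamsc_standard hst hreach hB hσ⟩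
  · obtain ⟨π, τ, n, h₁, h₂, h₃, -, h₄, h₅⟩ := ctqamsc_bounds hsp hed hr hst hreach hB hσ
    exact ⟨π, τ, n, h₁, h₂, h₃, h₄, h₅⟩
  · refine isSPAlgorithm_spMain.mono fun N M hN => (spCost_le hN).trans ?_
    have := Real.log_natCast_nonneg N
    exact mul_le_mul_of_nonneg_right (by norm_num) (by positivity)
  · refine isEDSPAlgorithm_edMain.mono fun N M hN => (edCost_le hN).trans ?_
    have := Real.log_natCast_nonneg N
    exact mul_le_mul_of_nonneg_right (by norm_num) (by positivity)
  · exact isRSPAlgorithm_rspMain.mono fun N M T =>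
      mul_le_mul_of_nonneg_right (by norm_num) (by positivity)
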